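/- **Setting.** Fix $d\ge 2$ and $\lambda>0$. For every $N$ let $G_N$ be a simple undirected graph on $[N]=\{1,\dots,N\}$ with adjacency indicators $\xi^N_{ij}$ and degrees $D^N_i$. For $x\in\mathbb N_0^d$ let $b(x)=\sum_{k=1}^d\frac1k\mathbf 1\{x_1=\min_i x_i,\ |\mathrm{argmin}_i\,x_i|=k\}$ (the probability that a job offered to servers with queue lengths $x_1,\dots,x_d$ joins the first one under join-the-shortest-queue with uniform tie-breaking). Let $(\mathcal N_i)_{i\ge1}$ be Poisson processes of rate $1$ and $(\bar{\mathcal N}_i)_{i\ge1}$ Poisson random measures on $[0,\infty)\times\mathbb R_+$ with intensity $\lambda\,ds\,dy$, all mutually independent. The queue lengths $X^N_i$, $i\in[N]$, are càdlàg $\mathbb N_0$-valued processes with $$X_i^N(t)=X_i^N(0)-\int_0^t\mathbf 1_{\{X_i^N(s-)>0\}}\,\mathcal N_i(ds)+\int_{[0,t]\times\mathbb R_+}\mathbf 1_{\{0\le y\le C_i^N(s-)\}}\,\bar{\mathcal N}_i(ds\,dy),$$ $$\begin{aligned}C_i^N(t)={}&\mathbf 1_{\{D_i^N<d-1\}}\bar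 b_i^N(X^N(t))+\mathbf 1_{\{D_i^N\ge d-1\}}\sum_{(j_2,\dots,j_d)\in\mathcal S_i^N}\alpha^N(i;j_2,\dots,j_d)\,b(X_i^N(t),X_{j_2}^N(t),\dots,X_{j_d}^N(t))\\&+(d-1)\sum_{(j_2,\dots,j_d)\in\mathcal S_i^N}\mathbf 1_{\{D_{j_2}^N\ge d-1\}}\alpha^N(j_2;i,j_3,\dots,j_d)\,b(X_i^N(t),X_{j_2}^N(t),\dots,X_{j_d}^N(t))+\sum_{j\ne i}\mathbf 1_{\{D_j^N<d-1\}}\xi_{ij}^N\bar b_{ij}^N(X^N(t)),\end{aligned}$$ where $\mathcal S_i^N$ is the set of $(j_2,\dots,j_d)\in[N]^{d-1}$ with $i,j_2,\dots,j_d$ distinct, $\alpha^N(i;j_2,\dots,j_d)=\frac{\xi^N_{ij_2}\cdots\xi^N_{ij_d}}{D_i^N(D_i^N-1)\cdots(D_i^N-d+2)}$, and $\bar b^N_i,\bar b^N_{ij}$ are arbitrary functions of the queue lengths with values in $[0,D_i^N+1]$. **Assumptions.** (a) $\min_{i\in[N]}D_i^N\to\infty$ and $\max_{i\in[N]}\bigl|\sum_{j\ne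 i}\xi_{ji}^N/D_j^N-1\bigr|\to0$ as $N\to\infty$. (b) For each $N$ the $X_i^N(0)$, $i\in[N]$, are i.i.d., independent of the driving noises, with $P(X_i^N(0)\ge j)=q^\infty_j$ for all $j\ge 0$, where $q^\infty_j\in[0,1]$, $q^\infty_0=1$, $q^\infty$ is nonincreasing and $\sum_jq^\infty_j<\infty$. **Theorem (Evolution of tagged servers).** Consider the McKean–Vlasov equation $$X_i(t)=X_i(0)-\int_0^t\mathbf 1_{\{X_i(s-)>0\}}\,\mathcal N_i(ds)+\int_{[0,t]\times\mathbb R_+}\mathbf 1_{\{0\le y\le C_i(s-)\}}\,\bar{\mathcal N}_i(ds\,dy),\qquad C_i(t)=d\int b(X_i(t),x_2,\dots,x_d)\,\mu_t(dx_2)\cdots\mu_t(dx_d),$$ where $\mu_t=\mathcal L(X_i(t))$, $\mu_0[j,\infty)=q^\infty_j$ for all $j\ge0$, and $X_i(0)$ is independent of $(\mathcal N_i,\bar{\mathcal N}_i)$. It has a solution for every such initial value, and all solutions have the same law $\mu$ on $\mathbb D([0,\infty),\mathbb N_0)$. Moreover, as $N\to\infty$: (i) For every $i$, $X_i^N$ converges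 in distribution to $\mu$ in $\mathbb D([0,\infty),\mathbb N_0)$ with the Skorokhod $J_1$ topology. If, moreover, $(X_i)_{i\ge1}$ are solutions driven by the same $(\mathcal N_i,\bar{\mathcal N}_i)$ with $X_i^N(0)=X_i(0)$ a.s. for all $i\in[N]$ and all $N$, then $\max_{i\in[N]}\mathbb E\bigl[\sup_{0\le t\le T}|X_i^N(t)-X_i(t)|^2\bigr]\to0$ for every $T<\infty$. (ii) For all distinct $i_1,\dots,i_m$, the law of $(X_{i_1}^N,\dots,X_{i_m}^N)$ converges weakly to $\mu^{\otimes m}$ as probability measures on $\mathbb D([0,\infty),\mathbb N_0^m)$. (iii) For every $i$, the neighborhood occupancy measure process $\mu^{i,N}_t=\frac1{D_i^N+1}\bigl(\sum_{j\ne i}\xi_{ij}^N\delta_{X_j^N(t)}+\delta_{X_i^N(t)}\bigr)$, with values in the probability measures on $\mathbb N_0$ with the weak topology, converges in distribution in the $J_1$ topology to the deterministic path $t\mapsto\mu_t$. -/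

import Mathlib

open MeasureTheory ProbabilityTheory Filter Set
open scoped ENNReal NNReal Topology

noncomputable section

namespace JSQ

/-! ### The Skorokhod space `𝔻([0, ∞), E)` with the `J₁` topology -/

/-- Right continuous functions with left limits from `[0, ∞)` to `E`. -/
structure CadlagPath (E : Type*) [TopologicalSpace E] where
  toFun : ℝ≥0 → E
  right_continuous : ∀ t, ContinuousWithinAt toFun (Ici t) t
  left_limit : ∀ t, ∃ l, Tendsto toFun (𝓝[<] t) (𝓝 l)

instance {E : Type*} [TopologicalSpace E] : CoeFun (CadlagPath E) (fun _ => ℝ≥0 → E) :=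
  ⟨CadlagPath.toFun⟩

namespace CadlagPath

/-- The path `t ↦ f (x t)` for a continuous `f`. -/
def map {E F : Type*} [TopologicalSpace E] [TopologicalSpace F] (f : E → F) (hf : Continuous f)
    (x : CadlagPath E) : CadlagPath F where
  toFun t := f (x t)
  right_continuous t := hf.continuousAt.comp_continuousWithinAt (x.right_continuous t)
  left_limit t := by
    obtain ⟨l, hl⟩ := x.left_limit t
    exact ⟨f l, (hf.tendsto l).comp hl⟩

/-- The path `t ↦ (x₁ t, …, xₘ t)`. -/
def tuple {E ι : Type*} [TopologicalSpace E] (x : ι → CadlagPath E) : CadlagPath (ι → E) where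
  toFun t k := x k t
  right_continuous t := tendsto_pi_nhds.2 fun k => (x k).right_continuous t
  left_limit t := by
    choose l hl using fun k => (x k).left_limit t
    exact ⟨l, tendsto_pi_nhds.2 hl⟩

variable {E : Type*} [PseudoMetricSpace E]

/-- `x` and `y` are `ε`-close on `[0, T]` up to a time change `τ` of `[0, ∞)` (an increasing
bijection) which is itself `ε`-close to the identity on `[0, T]`. -/
def close (T ε : ℝ≥0) : Set (CadlagPath E × CadlagPath E) :=
  {p | ∃ τ : ℝ≥0 ≃o ℝ≥0, ∀ t ≤ T, dist (τ t) t < ε ∧ dist (p.1 t) (p.2 (τ t)) < ε}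

theorem close_mono {T T' ε ε' : ℝ≥0} (hT : T' ≤ T) (hε : ε ≤ ε') :
    close (E := E) T ε ⊆ close T' ε' := by
  rintro p ⟨τ, h⟩
  have hε' : (ε : ℝ) ≤ ε' := hε
  exact ⟨τ, fun t ht => ⟨(h t (ht.trans hT)).1.trans_le hε', (h t (ht.trans hT)).2.trans_le hε'⟩⟩

theorem close_symm (T ε : ℝ≥0) :
    close (E := E) (T + ε) ε ⊆ Prod.swap ⁻¹' close T ε := by
  rintro p ⟨τ, h⟩
  refine ⟨τ.symm, fun s hs => ?_⟩
  have hle : τ.symm s ≤ T + ε := by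
    by_contra hlt
    push Not at hlt
    have h1 : τ (T + ε) < s := by simpa using τ.strictMono hlt
    have h2 := (h (T + ε) le_rfl).1
    rw [NNReal.dist_eq, abs_sub_lt_iff] at h2
    have h3 : (τ (T + ε) : ℝ) < s := h1
    have h4 : (s : ℝ) ≤ T := hs
    have h5 := h2.2
    push_cast at h5
    linarith
  have := h _ hle
  simp only [OrderIso.apply_symm_apply] at this
  exact ⟨by rw [dist_comm]; exact this.1, by rw [dist_comm]; exact this.2⟩

theorem close_comp (T ε : ℝ≥0) (p q r : CadlagPath E)
    (h₁ : (p, q) ∈ close T (ε / 2)) (h₂ : (q, r) ∈ close (T + ε) (ε / 2)) :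
    (p, r) ∈ close T ε := by
  obtain ⟨τ, h⟩ := h₁
  obtain ⟨σ, h'⟩ := h₂
  refine ⟨τ.trans σ, fun t ht => ?_⟩
  obtain ⟨a, b⟩ := h t ht
  have hle : τ t ≤ T + ε := by
    rw [NNReal.dist_eq, abs_sub_lt_iff] at a
    have a1 := a.1
    have ht' : (t : ℝ) ≤ T := ht
    have h0 : (0 : ℝ) ≤ ε := ε.2
    rw [← NNReal.coe_le_coe]
    push_cast at a1 ⊢
    linarith
  obtain ⟨a', b'⟩ := h' _ hle
  push_cast at a b a' b'
  constructor
  · have := dist_triangle (σ (τ t)) (τ t) t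
    simp only [OrderIso.trans_apply]
    linarith
  · have := dist_triangle (p t) (q (τ t)) (r (σ (τ t)))
    simp only [OrderIso.trans_apply]
    linarith

/-- The sets `close T ε`, `ε > 0`, form a basis of a uniform structure. -/
def closeBasis (E : Type*) [PseudoMetricSpace E] : FilterBasis (CadlagPath E × CadlagPath E) where
  sets := {s | ∃ T ε : ℝ≥0, 0 < ε ∧ s = close T ε}
  nonempty := ⟨_, 0, 1, one_pos, rfl⟩
  inter_sets := by
    rintro _ _ ⟨T, ε, hε, rfl⟩ ⟨T', ε', hε', rfl⟩
    exact ⟨_, ⟨max T T', min ε ε', lt_min hε hε', rfl⟩,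
      subset_inter (close_mono (le_max_left _ _) (min_le_left _ _))
        (close_mono (le_max_right _ _) (min_le_right _ _))⟩

/-- The `J₁` uniform structure: `xₙ → x` iff for every `T` there are time changes `τₙ` with
`sup_{t ≤ T} |τₙ t - t| → 0` and `sup_{t ≤ T} dist (xₙ t) (x (τₙ t)) → 0`. Its topology is the
(metrizable, for metric `E`) Skorokhod `J₁` topology on `𝔻([0, ∞), E)`. -/
instance : UniformSpace (CadlagPath E) :=
  .ofCore <| .mkOfBasis (closeBasis E)
    (by
      rintro _ ⟨T, ε, hε, rfl⟩ x
      exact ⟨OrderIso.refl _, fun t _ => by simpa using hε⟩)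
    (by
      rintro _ ⟨T, ε, hε, rfl⟩
      exact ⟨_, ⟨T + ε, ε, hε, rfl⟩, close_symm T ε⟩)
    (by
      rintro _ ⟨T, ε, hε, rfl⟩
      refine ⟨_, ⟨T + ε, ε / 2, half_pos hε, rfl⟩, ?_⟩
      rintro ⟨x, z⟩ ⟨y, h₁, h₂⟩
      exact close_comp T ε x y z (close_mono le_self_add le_rfl h₁) h₂)

instance : MeasurableSpace (CadlagPath E) := borel _

instance : BorelSpace (CadlagPath E) := ⟨rfl⟩

end CadlagPath

/-! ### Driving noise -/

/-- Lebesgue measure on `[0, ∞)`. -/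
def lebesgue : Measure ℝ≥0 := (volume : Measure ℝ).comap (fun t : ℝ≥0 => (t : ℝ))

/-- `η` is a Poisson random measure with intensity `ν`, under `P`. -/
structure IsPoissonRandomMeasure {Ω S : Type*} [MeasurableSpace Ω] [MeasurableSpace S]
    (P : Measure Ω) (ν : Measure S) (η : Ω → Measure S) : Prop where
  measurable : Measurable η
  poisson : ∀ s, MeasurableSet s → ν s ≠ ∞ →
    P.map (fun ω => η ω s) = (poissonMeasure (ν s).toNNReal).map (fun n : ℕ => (n : ℝ≥0∞))
  indep : ∀ (n : ℕ) (s : Fin n → Set S), (∀ k, MeasurableSet (s k)) →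
    Pairwise (fun k l => Disjoint (s k) (s l)) → iIndepFun (fun k ω => η ω (s k)) P

/-- Mutually independent driving noises of the servers `i = 0, 1, 2, …`: `Svc i` is the (random
counting measure of the) rate one Poisson process of service completions, and `Arr i` is a Poisson
random measure on `[0, ∞) × ℝ₊` with intensity `lam ds dy`. -/
structure IsDrivingNoise {Ω : Type*} [MeasurableSpace Ω] (P : Measure Ω) (lam : ℝ≥0)
    (Svc : ℕ → Ω → Measure ℝ≥0) (Arr : ℕ → Ω → Measure (ℝ≥0 × ℝ≥0)) : Prop where
  service : ∀ i, IsPoissonRandomMeasure P lebesgue (Svc i)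
  arrival : ∀ i, IsPoissonRandomMeasure P (lam • lebesgue.prod lebesgue) (Arr i)
  indep_pair : ∀ i, IndepFun (Svc i) (Arr i) P
  indep : iIndepFun (fun i ω => (Svc i ω, Arr i ω)) P

/-- The evolution equation of one queue with acceptance level `C` and noises `η`, `ζ`:
`x(t) = x(0) - ∫_[0,t] 1{x(s-) > 0} η(ds) + ∫_{[0,t] × ℝ₊} 1{0 ≤ y ≤ C(s-)} ζ(ds dy)`, `t ≥ 0`.
It is an identity in `[0, ∞]`, with the service term moved to the left. -/
def SolvesQueueEquation (x : CadlagPath ℕ) (C : ℝ≥0 → ℝ) (η : Measure ℝ≥0)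
    (ζ : Measure (ℝ≥0 × ℝ≥0)) : Prop :=
  ∀ t : ℝ≥0,
    (x t : ℝ≥0∞) + ∫⁻ s in Iic t, indicator {s | 0 < Function.leftLim x s} 1 s ∂η =
      (x 0 : ℝ≥0∞) + ∫⁻ p in Iic t ×ˢ univ,
        indicator {p : ℝ≥0 × ℝ≥0 | (p.2 : ℝ) ≤ Function.leftLim C p.1} 1 p ∂ζ

/-! ### The JSQ(`d`) dynamics on a graph -/

/-- The set of indices of shortest queues. -/
def argminSet {n : ℕ} (x : Fin (n + 1) → ℕ) : Finset (Fin (n + 1)) :=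
  Finset.univ.filter fun k => ∀ l, x k ≤ x l

/-- `b(x₁, …, x_d)` with `d = n + 1`: the probability that a job is sent to the first of `d`
servers with queue lengths `x`. -/
def jsqProb {n : ℕ} (x : Fin (n + 1) → ℕ) : ℝ :=
  ∑ k ∈ Finset.Icc 1 (n + 1), if 0 ∈ argminSet x ∧ (argminSet x).card = k then 1 / (k : ℝ) else 0

section Graph

variable {N : ℕ} (G : SimpleGraph (Fin N))

open Classical in
/-- `ξ_{ij}`. -/
def edge (i j : Fin N) : ℝ := if G.Adj i j then 1 else 0

open Classical in
/-- The number `D_i` of neighbors of `i`. -/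
def deg (i : Fin N) : ℕ := G.degree i

open Classical in
/-- `d_min(G)`. -/
def minDeg : ℕ := G.minDegree

/-- `α(i; j₂, …, j_d)` with `n = d - 1`; here
`D_i (D_i - 1) ⋯ (D_i - d + 2)` is the descending factorial. -/
def sampleWeight {n : ℕ} (i : Fin N) (j : Fin n → Fin N) : ℝ :=
  (∏ k, edge G i (j k)) / ((deg G i).descFactorial n : ℝ)

open Classical in
/-- The set of `(j₂, …, j_d)` such that `(i, j₂, …, j_d)` are distinct; `n = d - 1`. -/
def distinctTuples (N n : ℕ) (i : Fin N) : Finset (Fin n → Fin N) :=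
  Finset.univ.filter fun j => Function.Injective j ∧ ∀ k, j k ≠ i

open Classical in
/-- `C_i` as a function of the queue lengths `x`; `bself i` and `bnbr i j` are the
rules used at servers with less than `d - 1` neighbors. -/
def arrivalRate (d : ℕ) (hd : 2 ≤ d) (bself : Fin N → (Fin N → ℕ) → ℝ)
    (bnbr : Fin N → Fin N → (Fin N → ℕ) → ℝ) (i : Fin N) (x : Fin N → ℕ) : ℝ :=
  (if deg G i < d - 1 then bself i x else 0)
  + (if d - 1 ≤ deg G i then
      ∑ j ∈ distinctTuples N (d - 1) i,
        sampleWeight G i j * jsqProb (Matrix.vecCons (x i) fun k => x (j k))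
    else 0)
  + ((d : ℝ) - 1) * ∑ j ∈ distinctTuples N (d - 1) i,
      (let z : Fin (d - 1) := ⟨0, by omega⟩
       if d - 1 ≤ deg G (j z) then
        sampleWeight G (j z) (Function.update j z i)
          * jsqProb (Matrix.vecCons (x i) fun k => x (j k))
       else 0)
  + ∑ j ∈ Finset.univ.filter (fun j => j ≠ i),
      (if deg G j < d - 1 then edge G i j * bnbr i j x else 0)

/-- The occupancy measure of the neighborhood of `i`,
`(D_i + 1)⁻¹ (∑_{j ≠ i} ξ_{ij} δ_{x_j} + δ_{x_i})`. -/
def nbhdMeasure (i : Fin N) (x : Fin N → ℕ) : Measure ℕ :=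
  ((deg G i : ℝ≥0∞) + 1)⁻¹ •
    (∑ j ∈ Finset.univ.filter (fun j => j ≠ i),
        ENNReal.ofReal (edge G i j) • Measure.dirac (x j)
      + Measure.dirac (x i))

instance (i : Fin N) (x : Fin N → ℕ) : IsProbabilityMeasure (nbhdMeasure G i x) := by
  classical
  have h : ∑ j ∈ Finset.univ.filter (fun j => j ≠ i), ENNReal.ofReal (edge G i j)
      = (deg G i : ℝ≥0∞) := by
    have h1 : ∀ j, ENNReal.ofReal (edge G i j) = if G.Adj i j then 1 else 0 := by
      intro j; unfold edge; split_ifs <;> simp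
    simp only [h1, Finset.sum_ite, Finset.sum_const_zero, add_zero, Finset.sum_const, nsmul_one]
    unfold deg
    rw [← SimpleGraph.card_neighborFinset_eq_degree]
    congr 2
    ext j
    simp only [Finset.mem_filter, Finset.mem_univ, true_and, SimpleGraph.mem_neighborFinset]
    exact ⟨fun h => h.2, fun h => ⟨h.ne', h⟩⟩
  constructor
  simp only [nbhdMeasure, Measure.smul_apply, Measure.add_apply, Measure.finsetSum_apply,
    measure_univ, smul_eq_mul, mul_one, h]
  exact ENNReal.inv_mul_cancel (by simp) (by simp)

/-- The space of probability measures on the set of queue lengths, with the Lévy–Prokhorov metric,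
which metrizes weak convergence. -/
abbrev QueueLaws : Type := LevyProkhorov (ProbabilityMeasure ℕ)

/-- The neighborhood occupancy measure as a point of `QueueLaws`. -/
def nbhdOccupancy (i : Fin N) (x : Fin N → ℕ) : QueueLaws :=
  .ofMeasure ⟨nbhdMeasure G i x, inferInstance⟩

/-- The neighborhood occupancy measure process `t ↦ μ_t^{i,N}`. -/
def nbhdOccupancyPath (i : Fin N) (x : Fin N → CadlagPath ℕ) : CadlagPath QueueLaws :=
  (CadlagPath.tuple x).map (nbhdOccupancy G i) continuous_of_discreteTopology

end Graph

/-- Regularity of degrees: `d_min(G_N) → ∞` and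
`max_i |∑_{j ≠ i} ξ_{ji} / D_j - 1| → 0` as `N → ∞`. -/
structure DegreeRegular (G : ∀ N : ℕ, SimpleGraph (Fin N)) : Prop where
  minDeg_tendsto : Tendsto (fun N => minDeg (G N)) atTop atTop
  balanced : Tendsto
    (fun N => ⨆ i : Fin N,
      |∑ j ∈ Finset.univ.filter (fun j => j ≠ i), edge (G N) j i / (deg (G N) j : ℝ) - 1|)
    atTop (𝓝 0)

/-- The space `S` of tail sequences with finite sum. -/
structure IsTailSequence (q : ℕ → ℝ) : Prop where
  mem_Icc : ∀ j, q j ∈ Icc (0 : ℝ) 1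
  zero : q 0 = 1
  antitone : Antitone q
  summable : Summable q

/-- `ξ` has tail probabilities `P(ξ ≥ j) = q_j`. -/
def HasTail {Ω : Type*} [MeasurableSpace Ω] (P : Measure Ω) (q : ℕ → ℝ) (ξ : Ω → ℕ) : Prop :=
  ∀ j, P {ω | j ≤ ξ ω} = ENNReal.ofReal (q j)

/-- The queue length processes `X = (X_i)_i` on the graph `G` with `N` servers, started
from iid queue lengths with tail `q` which are independent of the driving noise. -/
structure IsQueueSystem {Ω : Type*} [MeasurableSpace Ω] (P : Measure Ω) (d : ℕ) (hd : 2 ≤ d)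
    (q : ℕ → ℝ) (Svc : ℕ → Ω → Measure ℝ≥0) (Arr : ℕ → Ω → Measure (ℝ≥0 × ℝ≥0))
    {N : ℕ} (G : SimpleGraph (Fin N)) (bself : Fin N → (Fin N → ℕ) → ℝ)
    (bnbr : Fin N → Fin N → (Fin N → ℕ) → ℝ) (X : Fin N → Ω → CadlagPath ℕ) : Prop where
  measurable : ∀ i t, Measurable fun ω => X i ω t
  initial_indep : iIndepFun (fun i ω => X i ω 0) P
  initial_law : ∀ i, HasTail P q fun ω => X i ω 0
  indep_noise : IndepFun (fun ω i => X i ω 0) (fun ω (i : ℕ) => (Svc i ω, Arr i ω)) P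
  evolution : ∀ᵐ ω ∂P, ∀ i : Fin N,
    SolvesQueueEquation (X i ω)
      (fun t => arrivalRate G d hd bself bnbr i fun k => X k ω t) (Svc i ω) (Arr i ω)

/-- `C(t) = d ∫ b(a, x₂, …, x_d) ν(dx₂) ⋯ ν(dx_d)`. -/
def limitRate (d : ℕ) (a : ℕ) (ν : Measure ℕ) : ℝ :=
  d * ∫ x : Fin (d - 1) → ℕ, jsqProb (Matrix.vecCons a x) ∂(Measure.pi fun _ => ν)

/-- `Y` is a McKean–Vlasov process driven by the noises `η`, `ζ`, whose initial value has tail `q`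
and is independent of the noises. The law of `Y(t)` enters its own arrival rate. -/
structure IsMcKeanVlasov {Ω : Type*} [MeasurableSpace Ω] (P : Measure Ω) (d : ℕ) (q : ℕ → ℝ)
    (η : Ω → Measure ℝ≥0) (ζ : Ω → Measure (ℝ≥0 × ℝ≥0)) (Y : Ω → CadlagPath ℕ) : Prop where
  measurable : ∀ t, Measurable fun ω => Y ω t
  initial_law : HasTail P q fun ω => Y ω 0
  indep_noise : IndepFun (fun ω => Y ω 0) (fun ω => (η ω, ζ ω)) P
  evolution : ∀ᵐ ω ∂P,
    SolvesQueueEquation (Y ω)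
      (fun t => limitRate d (Y ω t) (P.map fun ω' => Y ω' t)) (η ω) (ζ ω)

end JSQ

end

open JSQ

open MeasureTheory ProbabilityTheory Filter Set
open scoped ENNReal NNReal Topology

noncomputable section

namespace JSQ

namespace CadlagPath

/-! ### A countable basis of the Skorokhod uniformity -/

section Uniformity
variable {E : Type*} [PseudoMetricSpace E]

/-! The proof is a coupling. Server `i` of the graph system is compared with a McKean–Vlasov process
that has the same initial value and the same noise; over `i` these processes are independent copies
of one process. The quantity to control is the probability that the two paths of server `i` differ
somewhere on `[0, t]` (`decoupling`). Both queues see the same noise points, so in a short interval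
`(t, t + h]` two queues that still agree can separate only if an arrival point falls between their
two acceptance levels. The states at time `t` are independent of later arrivals, so this has
probability at most `lam * h` times the mean difference of the rates, up to `O(h ^ 2)`
(`decoupling_add_le`). The constant in `O(h ^ 2)` grows with the number of servers, but Gronwall's
argument lets `h → 0` with the graph fixed, and the constant disappears (`gronwall_exp`).

It remains to estimate the difference of the rates. Once all degrees are at least `d - 1`, the graph
rate is a weighted sum of `b` over tuples of servers. Replacing the true queues by the limiting ones
costs at most `2 * d ^ 2` times the largest decoupling probability. What is left is a weighted sum
over tuples of independent queues: tuples without a common server are uncorrelated, and no server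
carries more than a fraction of order `1 / d_min` of the weight (`integral_sq_sum_deviation_le`,
`sum_tupleWeight_apply_le`). The total weight is `1 + (d - 1) * inflow`, which tends to `d` by the
balance condition. Gronwall then makes the decoupling probabilities small uniformly over the servers
(`graph_decoupling_le`, `DegreeRegular.eventually_decoupling_le`).

No martingales, compensators or filtrations are used. Almost surely some mesh has at most one noise
point of the whole finite system in each of its cells up to a given horizon. In such a cell the
equations are explicit, and composing the cells (`euler`) gives existence, uniqueness and
measurability. It also shows that the state at time `t` ignores arrivals after `t`.

For the McKean–Vlasov equation the flow of one-dimensional laws is frozen. The same decoupling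
estimate makes the map from flows to solutions a contraction by `1 / 2` in the distance `sup_t
exp(-θ t) P(Z_t ≠ Z'_t)`, whence existence by Picard iteration and pathwise uniqueness. On the
canonical space of initial values and noises the solution is a measurable map; the law of a Poisson
random measure is determined by its intensity (`IsPoissonRandomMeasure.map_eq`), so the law of the
solution is unique and independent inputs give independent copies.

The limit statements follow from the coupling. Paths that agree on a long interval are close in
`J₁`, and the coupled processes have a fixed law, which gives convergence of one or several tagged
servers (`tendsto_map_of_uniformity`). Mean square convergence uses a third moment of the number of
noise points. For the occupancy measures, three fractions of a growing neighborhood are controlled: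
the decoupled servers (Markov), the servers with a noise point between grid times, and the servers
in a given state at a grid time (law of large numbers). -/

theorem hasBasis_uniformity :
    (uniformity (CadlagPath E)).HasBasis (fun p : ℝ≥0 × ℝ≥0 => 0 < p.2)
      (fun p => close p.1 p.2) := by
  have h : (uniformity (CadlagPath E)) = (closeBasis E).filter := rfl
  rw [h]
  refine ⟨fun t => ?_⟩
  rw [(closeBasis E).hasBasis.mem_iff]
  constructor
  · rintro ⟨_, ⟨T, ε, hε, rfl⟩, h⟩
    exact ⟨(T, ε), hε, h⟩
  · rintro ⟨⟨T, ε⟩, hε, h⟩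
    exact ⟨_, ⟨T, ε, hε, rfl⟩, h⟩

theorem close_mem_uniformity (T : ℝ≥0) {ε : ℝ≥0} (hε : 0 < ε) :
    close (E := E) T ε ∈ uniformity (CadlagPath E) :=
  hasBasis_uniformity.mem_of_mem (i := (T, ε)) hε

/-- This makes the path space pseudometrizable, so that pointwise limits of measurable random paths
are measurable, and it supplies the sequence of entourages used for convergence in distribution. -/
instance : (uniformity (CadlagPath E)).IsCountablyGenerated := by
  refine isCountablyGenerated_of_seq ⟨fun n : ℕ => close (n : ℝ≥0) ((n : ℝ≥0) + 1)⁻¹, ?_⟩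
  refine le_antisymm ?_ ?_
  · refine le_iInf fun n => ?_
    rw [le_principal_iff]
    exact close_mem_uniformity _ (by positivity)
  · intro s hs
    obtain ⟨⟨T, ε⟩, hε, h⟩ := hasBasis_uniformity.mem_iff.1 hs
    obtain ⟨n, hn⟩ := exists_nat_gt (max T ε⁻¹)
    refine mem_iInf_of_mem n ?_
    rw [mem_principal]
    refine subset_trans (close_mono ((le_max_left _ _).trans hn.le) ?_) h
    refine (inv_anti₀ (inv_pos.2 hε) ?_).trans_eq (inv_inv ε)
    exact (le_max_right T ε⁻¹).trans (hn.le.trans le_self_add)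

theorem mem_close_of_dist_lt {T ε : ℝ≥0} (hε : 0 < ε) {x y : CadlagPath E}
    (h : ∀ t ≤ T, dist (x t) (y t) < ε) : (x, y) ∈ close T ε :=
  ⟨OrderIso.refl _, fun t ht => ⟨by simpa using hε, by simpa using h t ht⟩⟩

end Uniformity

/-! ### Time changes -/

/-- A tent of half-width `δ` has slope at most `1 / δ`. Sums of small tents added to the identity
will be the time changes. -/
theorem abs_bump_sub_le (δ : ℝ) (hδ : 0 < δ) (s t u : ℝ) :
    |max 0 (1 - |t - s| / δ) - max 0 (1 - |u - s| / δ)| ≤ |t - u| / δ := by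
  refine (abs_max_sub_max_le_max _ _ _ _).trans ?_
  rw [sub_self, abs_zero, max_eq_right (abs_nonneg _)]
  have h : 1 - |t - s| / δ - (1 - |u - s| / δ) = (|u - s| - |t - s|) / δ := by ring
  rw [h, abs_div, abs_of_pos hδ]
  refine div_le_div_of_nonneg_right ?_ hδ.le
  have h1 := abs_abs_sub_abs_le (u - s) (t - s)
  rwa [show u - s - (t - s) = -(t - u) by ring, abs_neg] at h1

/-- Finitely many positive times can be moved to slightly later times by a time change which is
close to the identity. -/
theorem exists_timeChange (J : Finset ℝ≥0) (hJ : ∀ s ∈ J, 0 < s) :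
    ∃ η : ℝ≥0, 0 < η ∧ ∀ c : ℝ≥0 → ℝ≥0, (∀ s ∈ J, c s ≤ η) →
      ∃ τ : ℝ≥0 ≃o ℝ≥0, (∀ s ∈ J, τ s = s + c s) ∧ ∀ t, dist (τ t) t ≤ ∑ s ∈ J, (c s : ℝ) := by
  obtain ⟨δ, hδ, hsep, h0⟩ : ∃ δ : ℝ, 0 < δ ∧ (∀ s ∈ J, ∀ t ∈ J, s ≠ t → δ ≤ |(s : ℝ) - t|) ∧
      ∀ s ∈ J, δ ≤ s := by
    have h1 : ∀ᶠ δ in 𝓝[>] (0 : ℝ), ∀ s ∈ J, ∀ t ∈ J, s ≠ t → δ ≤ |(s : ℝ) - t| := by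
      rw [Finset.eventually_all]
      intro s _
      rw [Finset.eventually_all]
      intro t _
      by_cases h : s = t
      · simp [h]
      · have : 0 < |(s : ℝ) - t| := by
          rw [abs_pos, sub_ne_zero]; exact_mod_cast h
        filter_upwards [Ioo_mem_nhdsGT this] with δ hδ _ using hδ.2.le
    have h2 : ∀ᶠ δ in 𝓝[>] (0 : ℝ), ∀ s ∈ J, δ ≤ (s : ℝ) := by
      rw [Finset.eventually_all]
      intro s hs
      have : (0 : ℝ) < s := hJ s hs
      filter_upwards [Ioo_mem_nhdsGT this] with δ hδ using hδ.2.le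
    obtain ⟨δ, ⟨h1, h2⟩, h3⟩ := ((h1.and h2).and self_mem_nhdsWithin).exists
    exact ⟨δ, h3, h1, h2⟩
  -- With heights at most `δ / (card + 1)` the sum of `card` tents has slope at most `card / (card +
  -- 1) < 1`, so the identity plus this sum is still strictly increasing.
  have hη : 0 < δ / (J.card + 1) := by positivity
  refine ⟨⟨δ / (J.card + 1), hη.le⟩, hη, fun c hc => ?_⟩
  have hc' : ∀ s ∈ J, (c s : ℝ) ≤ δ / (J.card + 1) := fun s hs => hc s hs
  -- The tent at `s` equals one at `s` and vanishes at `0` and at the other points of `J`, which are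
  -- at distance at least `δ`.
  set β : ℝ → ℝ → ℝ := fun s t => max 0 (1 - |t - s| / δ) with hβ
  have hβ0 : ∀ s t, 0 ≤ β s t := fun s t => le_max_left _ _
  have hβ1 : ∀ s t, β s t ≤ 1 := fun s t => max_le zero_le_one (by
    have : 0 ≤ |t - s| / δ := by positivity
    linarith)
  set f : ℝ → ℝ := fun t => t + ∑ s ∈ J, (c s : ℝ) * β s t with hf
  have hfmono : StrictMono f := by
    intro t u htu
    have : ∑ s ∈ J, (c s : ℝ) * β s t - ∑ s ∈ J, (c s : ℝ) * β s u < u - t := by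
      rw [← Finset.sum_sub_distrib]
      calc ∑ s ∈ J, ((c s : ℝ) * β s t - c s * β s u)
          ≤ ∑ s ∈ J, δ / (J.card + 1) * ((u - t) / δ) := by
            refine Finset.sum_le_sum fun s hs => ?_
            rw [← mul_sub]
            have h1 : β s t - β s u ≤ (u - t) / δ := by
              have := abs_bump_sub_le δ hδ s t u
              rw [abs_sub_comm t u, abs_of_pos (sub_pos.2 htu)] at this
              exact (le_abs_self _).trans this
            have h2 : 0 ≤ (u - t) / δ := div_nonneg (sub_pos.2 htu).le hδ.le
            calc (c s : ℝ) * (β s t - β s u) ≤ c s * ((u - t) / δ) := by gcongr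
              _ ≤ _ := by gcongr; exact hc' s hs
        _ = (J.card : ℝ) / (J.card + 1) * (u - t) := by
            rw [Finset.sum_const, nsmul_eq_mul]; field_simp
        _ < 1 * (u - t) := by
            refine mul_lt_mul_of_pos_right ?_ (sub_pos.2 htu)
            rw [div_lt_one (by positivity)]; linarith
        _ = u - t := one_mul _
    simp only [hf]; linarith
  have hfcont : Continuous f := by
    simp only [hf, hβ]; fun_prop
  have hfge : ∀ t, t ≤ f t := fun t => by
    have : 0 ≤ ∑ s ∈ J, (c s : ℝ) * β s t :=
      Finset.sum_nonneg fun s _ => mul_nonneg (c s).2 (hβ0 _ _)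
    simp only [hf]; linarith
  have hf0 : f 0 = 0 := by
    simp only [hf, zero_add]
    refine Finset.sum_eq_zero fun s hs => ?_
    have : β s 0 = 0 := by
      simp only [hβ, zero_sub, abs_neg, NNReal.abs_eq]
      refine max_eq_left ?_
      have := (one_le_div hδ).2 (h0 s hs)
      linarith
    rw [this, mul_zero]
  set g : ℝ≥0 → ℝ≥0 := fun t => ⟨f t, t.2.trans (hfge t)⟩ with hg
  have hgmono : StrictMono g := fun t u h => hfmono (by exact_mod_cast h)
  have hgsurj : Function.Surjective g := by
    intro y
    have := intermediate_value_Icc (a := (0 : ℝ)) (b := y) y.2 hfcont.continuousOn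
    obtain ⟨t, ht, hty⟩ := this ⟨by rw [hf0]; exact y.2, hfge y⟩
    exact ⟨⟨t, ht.1⟩, NNReal.eq hty⟩
  refine ⟨hgmono.orderIsoOfSurjective g hgsurj, fun s hs => ?_, fun t => ?_⟩
  · apply NNReal.eq
    change f s = s + c s
    simp only [hf]
    congr 1
    rw [Finset.sum_eq_single_of_mem s hs]
    · simp [hβ]
    · intro t ht hne
      have : β t s = 0 := by
        refine max_eq_left ?_
        have := (one_le_div hδ).2 (hsep s hs t ht hne.symm)
        linarith
      rw [this, mul_zero]
  · rw [NNReal.dist_eq]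
    change |f t - t| ≤ _
    have h1 : 0 ≤ ∑ s ∈ J, (c s : ℝ) * β s t :=
      Finset.sum_nonneg fun s _ => mul_nonneg (c s).2 (hβ0 _ _)
    simp only [hf, add_sub_cancel_left]
    rw [abs_of_nonneg h1]
    exact Finset.sum_le_sum fun s _ => mul_le_of_le_one_right (c s).2 (hβ1 _ _)

/-! ### Paths in a countable discrete space -/

section Discrete
variable {E : Type*} [PseudoMetricSpace E]

theorem eventually_eq_of_tendsto (hE : ∀ a b : E, dist a b < 1 → a = b) {l : Filter ℝ≥0}
    {f : ℝ≥0 → E} {e : E} (h : Tendsto f l (𝓝 e)) : ∀ᶠ t in l, f t = e := by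
  filter_upwards [h (Metric.ball_mem_nhds e one_pos)] with t ht using hE _ _ ht

theorem exists_Ico_eq (hE : ∀ a b : E, dist a b < 1 → a = b) (x : CadlagPath E) (t : ℝ≥0) :
    ∃ u, t < u ∧ ∀ s ∈ Ico t u, x s = x t := by
  have h := eventually_eq_of_tendsto hE (x.right_continuous t)
  obtain ⟨u, hu, h⟩ := (mem_nhdsGE_iff_exists_Ico_subset).1 h
  exact ⟨u, hu, h⟩

theorem exists_Ioo_eq (hE : ∀ a b : E, dist a b < 1 → a = b) (x : CadlagPath E) {t : ℝ≥0}
    (ht : 0 < t) : ∃ u < t, ∃ e, ∀ s ∈ Ioo u t, x s = e := by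
  obtain ⟨e, he⟩ := x.left_limit t
  have h := eventually_eq_of_tendsto hE he
  obtain ⟨u, hu, h⟩ := (mem_nhdsLT_iff_exists_Ioo_subset' ht).1 h
  exact ⟨u, hu, e, h⟩

/-- A path in a discrete space has finitely many jumps on `[0, T]`. -/
theorem exists_finset_jumps (hE : ∀ a b : E, dist a b < 1 → a = b) (x : CadlagPath E) (T : ℝ≥0) :
    ∃ J : Finset ℝ≥0, ∀ a b, a ≤ b → b ≤ T → (∀ s ∈ J, ¬(a < s ∧ s ≤ b)) → x a = x b := by
  classical
  -- Induction along the half-line: the property holds at `0`, passes to limits from the left and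
  -- extends a little to the right, so the supremum of the good horizons cannot be finite.
  set Q : ℝ≥0 → Prop := fun T => ∃ J : Finset ℝ≥0, ∀ a b, a ≤ b → b ≤ T →
    (∀ s ∈ J, ¬(a < s ∧ s ≤ b)) → x a = x b with hQ
  have hdown : ∀ T T', T' ≤ T → Q T → Q T' := fun T T' h ⟨J, hJ⟩ =>
    ⟨J, fun a b hab hb => hJ a b hab (hb.trans h)⟩
  have hzero : Q 0 := ⟨∅, fun a b hab hb _ => by
    have : b = 0 := le_antisymm hb (zero_le)
    subst this
    rw [le_antisymm hab (zero_le)]⟩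
  have hleft : ∀ T, (∀ t < T, Q t) → Q T := by
    intro T hT
    rcases eq_or_lt_of_le (zero_le : 0 ≤ T) with h | h
    · rw [← h]; exact hzero
    obtain ⟨u, hu, e, he⟩ := exists_Ioo_eq hE x h
    obtain ⟨v, huv, hvT⟩ := exists_between hu
    obtain ⟨J, hJ⟩ := hT v hvT
    -- On a left neighborhood of `T` the path is constant, so the only new jump time can be `T`
    -- itself.
    refine ⟨insert T J, fun a b hab hb hs => ?_⟩
    have hsJ : ∀ s ∈ J, ¬(a < s ∧ s ≤ b) := fun s h => hs s (Finset.mem_insert_of_mem h)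
    have hsT := hs T (Finset.mem_insert_self _ _)
    rcases eq_or_lt_of_le hb with rfl | hb
    · have : a = b := le_antisymm hab (not_lt.1 fun h => hsT ⟨h, le_rfl⟩)
      rw [this]
    rcases le_total b v with hbv | hvb
    · exact hJ a b hab hbv hsJ
    rw [he b ⟨huv.trans_le hvb, hb⟩]
    rcases le_total a v with hav | hva
    · rw [hJ a v hav le_rfl fun s h h' => hsJ s h ⟨h'.1, h'.2.trans hvb⟩, he v ⟨huv, hvT⟩]
    · exact he a ⟨huv.trans_le hva, hab.trans_lt hb⟩
  have hright : ∀ T, Q T → ∃ T' > T, Q T' := by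
    rintro T ⟨J, hJ⟩
    obtain ⟨u, hu, hc⟩ := exists_Ico_eq hE x T
    obtain ⟨v, hTv, hvu⟩ := exists_between hu
    refine ⟨v, hTv, J, fun a b hab hb hs => ?_⟩
    rcases le_total b T with hbT | hTb
    · exact hJ a b hab hbT hs
    rw [hc b ⟨hTb, hb.trans_lt hvu⟩]
    rcases le_total a T with haT | hTa
    · exact hJ a T haT le_rfl fun s h h' => hs s h ⟨h'.1, h'.2.trans hTb⟩
    · exact hc a ⟨hTa, (hab.trans hb).trans_lt hvu⟩
  by_contra hT
  have hbdd : BddAbove {t | Q t} := ⟨T, fun t ht => by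
    by_contra h
    exact hT (hdown t T (not_le.1 h).le ht)⟩
  have hs : Q (sSup {t | Q t}) := hleft _ fun t ht => by
    obtain ⟨u, hu, htu⟩ := exists_lt_of_lt_csSup ⟨0, hzero⟩ ht
    exact hdown u t htu.le hu
  obtain ⟨T', hT', hQ'⟩ := hright _ hs
  exact absurd (le_csSup hbdd hQ') (not_le.2 hT')

/-- The step path with values `v k` on `[k / n, (k + 1) / n)`, constant after `m / n`. -/
def stepPath (n m : ℕ) (v : Fin (m + 1) → E) : CadlagPath E where
  toFun t := v ⟨min ⌊n * t⌋₊ m, by omega⟩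
  right_continuous t := by
    have h : ∀ᶠ s in 𝓝[≥] t, ⌊(n : ℝ≥0) * s⌋₊ = ⌊(n : ℝ≥0) * t⌋₊ := by
      have hc : Tendsto (fun s : ℝ≥0 => (n : ℝ≥0) * s) (𝓝[≥] t) (𝓝 (n * t)) :=
        ((continuous_const.mul continuous_id).tendsto t).mono_left nhdsWithin_le_nhds
      filter_upwards [hc (Iio_mem_nhds (Nat.lt_floor_add_one ((n : ℝ≥0) * t))),
        self_mem_nhdsWithin] with s hs hts
      refine (Nat.floor_eq_iff (zero_le)).2 ⟨?_, hs⟩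
      exact (Nat.floor_le zero_le).trans (by gcongr; exact hts)
    refine tendsto_nhds_of_eventually_eq ?_
    filter_upwards [h] with s hs
    simp only [hs]
  left_limit t := by
    have h : ∃ k, ∀ᶠ s in 𝓝[<] t, ⌊(n : ℝ≥0) * s⌋₊ = k := by
      -- Just to the left of `t` the floor of `n * s` is `⌈n * t⌉ - 1`, also when `n * t` is an
      -- integer. For `n = 0` the floor is constant and for `t = 0` the filter is trivial.
      refine ⟨⌈(n : ℝ≥0) * t⌉₊ - 1, ?_⟩
      rcases Nat.eq_zero_or_pos n with rfl | hn
      · simp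
      have hn' : (0 : ℝ≥0) < n := by exact_mod_cast hn
      rcases eq_or_lt_of_le (zero_le : 0 ≤ t) with h0 | h0
      · simp [← h0]
      have hk : 0 < ⌈(n : ℝ≥0) * t⌉₊ := Nat.ceil_pos.2 (by positivity)
      have hlt : ((⌈(n : ℝ≥0) * t⌉₊ - 1 : ℕ) : ℝ≥0) < n * t := Nat.lt_ceil.1 (by omega)
      have hc : Tendsto (fun s : ℝ≥0 => (n : ℝ≥0) * s) (𝓝[<] t) (𝓝 (n * t)) :=
        ((continuous_const.mul continuous_id).tendsto t).mono_left nhdsWithin_le_nhds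
      filter_upwards [hc (Ioi_mem_nhds hlt), self_mem_nhdsWithin] with s hs hts
      refine (Nat.floor_eq_iff (zero_le)).2 ⟨le_of_lt hs, ?_⟩
      have h1 : (n : ℝ≥0) * s < n * t := by gcongr; exact hts
      have h2 := h1.trans_le (Nat.le_ceil ((n : ℝ≥0) * t))
      refine h2.trans_le ?_
      have : ⌈(n : ℝ≥0) * t⌉₊ ≤ (⌈(n : ℝ≥0) * t⌉₊ - 1) + 1 := by omega
      exact_mod_cast this
    obtain ⟨k, hk⟩ := h
    refine ⟨v ⟨min k m, by omega⟩, tendsto_nhds_of_eventually_eq ?_⟩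
    filter_upwards [hk] with s hs
    simp only [hs]

/-- The path sampled on a grid sees a jump at `s` at the first grid time not before `s`. A time
change carrying each jump time to that grid time matches the two paths exactly, and it is close to
the identity because there are finitely many jumps. Sampling up to `n + 1` exhausts the half-line.
-/
theorem tendsto_stepPath (hE : ∀ a b : E, dist a b < 1 → a = b) (x : CadlagPath E) :
    Tendsto (fun n : ℕ => stepPath (n + 1) ((n + 1) * (n + 1))
      fun k => x ((k : ℕ) / ((n : ℝ≥0) + 1))) atTop (𝓝 x) := by
  classical
  rw [nhds_eq_comap_uniformity, tendsto_comap_iff, hasBasis_uniformity.tendsto_right_iff]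
  rintro ⟨T, ε⟩ hε
  obtain ⟨J', hJ'⟩ := exists_finset_jumps hE x (T + 1)
  set J := J'.filter fun s => 0 < s with hJdef
  have hJpos : ∀ s ∈ J, 0 < s := fun s hs => (Finset.mem_filter.1 hs).2
  have hJ : ∀ a b, a ≤ b → b ≤ T + 1 → (∀ s ∈ J, ¬(a < s ∧ s ≤ b)) → x a = x b :=
    fun a b hab hb h => hJ' a b hab hb fun s hs h' =>
      h s (Finset.mem_filter.2 ⟨hs, (zero_le).trans_lt h'.1⟩) h'
  obtain ⟨η, hη, H⟩ := exists_timeChange J hJpos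
  have hlim : Tendsto (fun n : ℕ => ((n : ℝ≥0) + 1)⁻¹) atTop (𝓝 0) := by
    rw [← NNReal.tendsto_coe]
    simpa using tendsto_one_div_add_atTop_nhds_zero_nat (𝕜 := ℝ)
  have hlim' : Tendsto (fun n : ℕ => (J.card : ℝ≥0) * ((n : ℝ≥0) + 1)⁻¹) atTop (𝓝 0) := by
    simpa using hlim.const_mul (J.card : ℝ≥0)
  -- The bound by `1` keeps the changed times below `T + 1`, where `J` still lists all jumps.
  have hε' : (0 : ℝ≥0) < min ε 1 := lt_min hε one_pos
  filter_upwards [hlim.eventually (Iic_mem_nhds hη), hlim'.eventually (Iio_mem_nhds hε'),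
    eventually_ge_atTop ⌈T + 1⌉₊] with n hn1 hn2 hn3
  set m : ℝ≥0 := (n : ℝ≥0) + 1 with hm
  have hmpos : 0 < m := by positivity
  set c : ℝ≥0 → ℝ≥0 := fun s => (⌈m * s⌉₊ : ℝ≥0) / m - s with hcdef
  have hsc : ∀ s, s + c s = (⌈m * s⌉₊ : ℝ≥0) / m := fun s => by
    refine add_tsub_cancel_of_le ?_
    rw [le_div_iff₀ hmpos, mul_comm]
    exact Nat.le_ceil _
  have hc1 : ∀ s, c s ≤ m⁻¹ := fun s => by
    rw [hcdef, tsub_le_iff_right, div_le_iff₀ hmpos]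
    have : (m⁻¹ + s) * m = m * s + 1 := by field_simp; ring
    rw [this]
    exact (Nat.ceil_lt_add_one zero_le).le
  obtain ⟨τ, hτJ, hτ⟩ := H c fun s _ => (hc1 s).trans hn1
  have hτ' : ∀ t, dist (τ t) t < min ε 1 := by
    intro t
    refine (hτ t).trans_lt ?_
    have h1 : ∑ s ∈ J, (c s : ℝ) ≤ ((J.card : ℝ≥0) * m⁻¹ : ℝ≥0) := by
      rw [← NNReal.coe_sum, NNReal.coe_le_coe]
      refine (Finset.sum_le_card_nsmul J c m⁻¹ fun s _ => hc1 s).trans_eq ?_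
      rw [nsmul_eq_mul]
    exact h1.trans_lt (by exact_mod_cast hn2)
  refine ⟨τ, fun t ht => ⟨(hτ' t).trans_le (by exact_mod_cast min_le_left _ _), ?_⟩⟩
  have hτle : τ t ≤ T + 1 := by
    have h1 := (hτ' t).trans_le (min_le_right (ε : ℝ) 1)
    rw [NNReal.dist_eq, abs_sub_lt_iff] at h1
    have ht' : (t : ℝ) ≤ T := ht
    rw [← NNReal.coe_le_coe]; push_cast; linarith [h1.1]
  have hfloor : ⌊m * τ t⌋₊ ≤ (n + 1) * (n + 1) := by
    have h1 : T + 1 ≤ m := (Nat.le_ceil _).trans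
      ((Nat.cast_le.2 hn3).trans (by rw [hm]; exact le_self_add))
    refine Nat.floor_le_of_le ?_
    calc m * τ t ≤ m * m := by gcongr; exact hτle.trans h1
      _ = _ := by rw [hm]; push_cast; ring
  have hval : (stepPath (n + 1) ((n + 1) * (n + 1)) fun k => x ((k : ℕ) / m)) (τ t) =
      x ((⌊m * τ t⌋₊ : ℝ≥0) / m) := by
    change x (((min ⌊((n + 1 : ℕ) : ℝ≥0) * τ t⌋₊ ((n + 1) * (n + 1)) : ℕ) : ℝ≥0) / m) = _
    have : ((n + 1 : ℕ) : ℝ≥0) = m := by rw [hm]; push_cast; ring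
    rw [this, min_eq_left hfloor]
  -- The time change preserves order and sends `s` to the grid time `⌈m s⌉ / m`, so a jump precedes
  -- `t` exactly when it precedes the sampling time `⌊m τ(t)⌋ / m`. Hence `x` has no jump between
  -- the two times.
  have key : ∀ s ∈ J, s ≤ t ↔ s ≤ (⌊m * τ t⌋₊ : ℝ≥0) / m := by
    intro s hs
    rw [le_div_iff₀ hmpos, mul_comm, ← Nat.ceil_le, Nat.le_floor_iff zero_le,
      ← div_le_iff₀' hmpos, ← hsc, ← hτJ s hs, τ.le_iff_le]
  have hle : (⌊m * τ t⌋₊ : ℝ≥0) / m ≤ T + 1 := by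
    refine le_trans ?_ hτle
    rw [div_le_iff₀' hmpos]
    exact Nat.floor_le zero_le
  change dist (x t) ((stepPath (n + 1) ((n + 1) * (n + 1)) fun k => x ((k : ℕ) / m)) (τ t)) < ε
  rw [hval]
  have heq : x t = x ((⌊m * τ t⌋₊ : ℝ≥0) / m) := by
    rcases le_total t ((⌊m * τ t⌋₊ : ℝ≥0) / m) with h | h
    · refine hJ _ _ h hle fun s hs h' => ?_
      exact absurd ((key s hs).2 h'.2) (not_le.2 h'.1)
    · refine (hJ _ _ h (ht.trans le_self_add) fun s hs h' => ?_).symm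
      exact absurd ((key s hs).1 h'.2) (not_le.2 h'.1)
  rw [heq, dist_self]
  exact_mod_cast hε

/-- A random path in a countable discrete space is Borel measurable if its values are. -/
theorem measurable_of_eval [Countable E] [MeasurableSpace E] [MeasurableSingletonClass E]
    (hE : ∀ a b : E, dist a b < 1 → a = b) {Ω : Type*} [MeasurableSpace Ω]
    {X : Ω → CadlagPath E} (hX : ∀ t, Measurable fun ω => X ω t) : Measurable X := by
  refine measurable_of_tendsto_metrizable (f := fun (n : ℕ) ω =>
    stepPath (n + 1) ((n + 1) * (n + 1)) fun k => X ω ((k : ℕ) / ((n : ℝ≥0) + 1))) (fun n => ?_) ?_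
  · exact (Measurable.of_discrete (f := stepPath (E := E) (n + 1) ((n + 1) * (n + 1)))).comp
      (measurable_pi_lambda _ fun k => hX _)
  · rw [tendsto_pi_nhds]
    exact fun ω => tendsto_stepPath hE (X ω)

/-- Evaluation at `t` is not continuous in `J₁`. However, by right continuity `x t = e` means that
`x = e` on some `[t, t + 1 / (n + 1))`, and each of these conditions is closed: at an interior time
a limit path takes a value of a nearby path at a nearby time, and the endpoint `t` follows by right
continuity. -/
theorem measurable_eval [Countable E] [MeasurableSpace E]
    (hE : ∀ a b : E, dist a b < 1 → a = b) (t : ℝ≥0) :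
    Measurable fun x : CadlagPath E => x t := by
  have hset : ∀ e : E, MeasurableSet {x : CadlagPath E | x t = e} := by
    intro e
    set B : ℕ → Set (CadlagPath E) := fun n =>
      {x | ∀ s ∈ Ico t (t + ((n : ℝ≥0) + 1)⁻¹), x s = e} with hB
    have hUnion : {x : CadlagPath E | x t = e} = ⋃ n, B n := by
      ext x
      simp only [mem_ofPred_eq, mem_iUnion, hB]
      constructor
      · intro h
        obtain ⟨u, hu, hc⟩ := exists_Ico_eq hE x t
        obtain ⟨n, hn⟩ := exists_nat_gt (u - t)⁻¹
        refine ⟨n, fun s hs => (hc s ⟨hs.1, hs.2.trans_le ?_⟩).trans h⟩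
        have h1 : ((n : ℝ≥0) + 1)⁻¹ ≤ u - t := by
          refine (inv_anti₀ (inv_pos.2 (tsub_pos_of_lt hu)) ?_).trans_eq (inv_inv _)
          exact hn.le.trans le_self_add
        calc t + ((n : ℝ≥0) + 1)⁻¹ ≤ t + (u - t) := by gcongr
          _ = u := add_tsub_cancel_of_le hu.le
      · rintro ⟨n, h⟩
        exact h t ⟨le_rfl, lt_add_of_pos_right _ (by positivity)⟩
    rw [hUnion]
    refine MeasurableSet.iUnion fun n => IsClosed.measurableSet ?_
    refine isClosed_of_closure_subset fun x hx => ?_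
    set v := t + ((n : ℝ≥0) + 1)⁻¹ with hv
    have htv : t < v := lt_add_of_pos_right _ (by positivity)
    have hIoo : ∀ u ∈ Ioo t v, x u = e := by
      intro u hu
      obtain ⟨ε, hε, hε1, hεt, hεv⟩ :
          ∃ ε : ℝ≥0, 0 < ε ∧ ε ≤ 1 ∧ (ε : ℝ) ≤ u - t ∧ (ε : ℝ) ≤ v - u := by
        have h1 : (0 : ℝ) < u - t := sub_pos.2 (by exact_mod_cast hu.1)
        have h2 : (0 : ℝ) < v - u := sub_pos.2 (by exact_mod_cast hu.2)
        refine ⟨min 1 (min ⟨u - t, h1.le⟩ ⟨v - u, h2.le⟩), ?_, min_le_left _ _, ?_, ?_⟩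
        · exact lt_min one_pos (lt_min h1 h2)
        · exact_mod_cast (min_le_right _ _).trans
            (min_le_left (⟨u - t, h1.le⟩ : ℝ≥0) ⟨v - u, h2.le⟩)
        · exact_mod_cast (min_le_right _ _).trans
            (min_le_right (⟨u - t, h1.le⟩ : ℝ≥0) ⟨v - u, h2.le⟩)
      obtain ⟨y, hxy, hy⟩ := UniformSpace.mem_closure_iff_ball.1 hx (close_mem_uniformity u hε)
      obtain ⟨τ, hτ⟩ := hxy
      obtain ⟨h1, h2⟩ := hτ u le_rfl
      rw [NNReal.dist_eq, abs_sub_lt_iff] at h1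
      have h3 : x u = y (τ u) := hE _ _ (h2.trans_le (by exact_mod_cast hε1))
      rw [h3]
      refine hy _ ⟨?_, ?_⟩
      · rw [← NNReal.coe_le_coe]; linarith
      · change τ u < v
        rw [← NNReal.coe_lt_coe]; linarith
    intro s hs
    rcases eq_or_lt_of_le hs.1 with rfl | h
    · obtain ⟨u, hu, hc⟩ := exists_Ico_eq hE x t
      obtain ⟨r, hr1, hr2⟩ := exists_between (lt_min hu htv)
      rw [← hc r ⟨hr1.le, hr2.trans_le (min_le_left _ _)⟩]
      exact hIoo r ⟨hr1, hr2.trans_le (min_le_right _ _)⟩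
    · exact hIoo s ⟨h, hs.2⟩
  exact measurable_to_countable' hset

end Discrete

theorem nat_eq_of_dist_lt_one (a b : ℕ) (h : dist a b < 1) : a = b := by
  rw [Nat.dist_eq, abs_sub_lt_iff] at h
  have h1 : (a : ℝ) < b + 1 := by linarith
  have h2 : (b : ℝ) < a + 1 := by linarith
  norm_cast at h1 h2
  omega

theorem pi_nat_eq_of_dist_lt_one {ι : Type*} [Fintype ι] (a b : ι → ℕ) (h : dist a b < 1) :
    a = b :=
  funext fun i => nat_eq_of_dist_lt_one _ _ ((dist_le_pi_dist a b i).trans_lt h)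

end CadlagPath

/-! ### Convergence in distribution from a coupling -/

/-- If the law of `Y i` does not depend on `i` and `X i` and `Y i` are uniformly close with
probability tending to one, then `X i` converges in distribution. -/
theorem tendsto_map_of_uniformity {Ω E F : Type*} [MeasurableSpace Ω] (P : Measure Ω)
    [IsProbabilityMeasure P] [UniformSpace E] [(uniformity E).IsCountablyGenerated]
    [MeasurableSpace E] [BorelSpace E] (X Y : ℕ → Ω → E) (hX : ∀ n, AEMeasurable (X n) P)
    [MeasurableSpace F] {μ : Measure F} [IsProbabilityMeasure μ] {Z : F → E}
    (hZ : AEMeasurable Z μ)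
    (hY : ∀ᶠ n in atTop, AEMeasurable (Y n) P ∧ P.map (Y n) = μ.map Z)
    (h : ∀ V ∈ uniformity E, Tendsto (fun n => P {ω | (X n ω, Y n ω) ∉ V}) atTop (𝓝 0)) :
    TendstoInDistribution X atTop Z (fun _ => P) μ where
  forall_aemeasurable := hX
  aemeasurable_limit := hZ
  tendsto := by
    obtain ⟨V, hV⟩ := (uniformity E).exists_antitone_basis
    refine tendsto_of_forall_isOpen_le_liminf' fun G hG => ?_
    simp only [ProbabilityMeasure.coe_mk]
    -- Portmanteau for an open set `G`: the points whose `V k`-ball stays in `G` increase to `G`. If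
    -- `Y` is such a point and `X` is `V k`-close to it, then `X` lies in `G`. Interiors are taken
    -- to have open, hence measurable, sets.
    set U : ℕ → Set E := fun k => interior {x | UniformSpace.ball x (V k) ⊆ G} with hU
    have hUmono : Monotone U := fun k l hkl => interior_mono fun x hx =>
      (UniformSpace.ball_mono (hV.antitone hkl) x).trans hx
    have hUG : ⋃ k, U k = G := by
      refine subset_antisymm (iUnion_subset fun k x hx => ?_) fun x hx => ?_
      · exact interior_subset hx (UniformSpace.mem_ball_self x (hV.toHasBasis.mem_of_mem trivial))
      · obtain ⟨W, hW, hWG⟩ := isOpen_iff_ball_subset.1 hG x hx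
        obtain ⟨W', hW', hcomp⟩ := comp_mem_uniformity_sets hW
        obtain ⟨k, hk⟩ := hV.mem_iff.1 hW'
        refine mem_iUnion.2 ⟨k, mem_interior_iff_mem_nhds.2 ?_⟩
        filter_upwards [UniformSpace.ball_mem_nhds x hW'] with y hy z hz
        exact hWG (hcomp ⟨y, hy, hk hz⟩)
    have hsup : (μ.map Z) G = ⨆ k, (μ.map Z) (U k) := by
      rw [← hUG]
      exact hUmono.measure_iUnion
    rw [hsup]
    refine iSup_le fun k => ?_
    have hle : ∀ᶠ n in atTop, (μ.map Z) (U k) - P {ω | (X n ω, Y n ω) ∉ Prod.swap ⁻¹' (V k)} ≤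
        (P.map (X n)) G := by
      filter_upwards [hY] with n hn
      rw [tsub_le_iff_right, ← hn.2, Measure.map_apply_of_aemeasurable hn.1
        isOpen_interior.measurableSet, Measure.map_apply_of_aemeasurable (hX n) hG.measurableSet]
      refine (measure_mono fun ω hω => ?_).trans (measure_union_le _ _)
      by_cases hc : (X n ω, Y n ω) ∈ Prod.swap ⁻¹' (V k)
      · exact Or.inl (interior_subset hω hc)
      · exact Or.inr hc
    have hV' := h _ (UniformSpace.symm (hV.toHasBasis.mem_of_mem (i := k) trivial))
    have hlim := ENNReal.Tendsto.sub (tendsto_const_nhds (x := (μ.map Z) (U k))) hV'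
      (Or.inr ENNReal.zero_ne_top)
    rw [tsub_zero] at hlim
    rw [← hlim.liminf_eq]
    exact liminf_le_liminf hle


/-! ### Lebesgue measure on `[0, ∞)` -/

theorem measurableEmbedding_coe : MeasurableEmbedding (fun t : ℝ≥0 => (t : ℝ)) :=
  MeasurableEmbedding.subtype_coe (measurableSet_Ici (a := (0 : ℝ)))

theorem lebesgue_apply (s : Set ℝ≥0) :
    lebesgue s = volume ((fun t : ℝ≥0 => (t : ℝ)) '' s) :=
  measurableEmbedding_coe.comap_apply _ _

theorem lebesgue_le {s : Set ℝ≥0} {a b : ℝ} (h : ∀ t ∈ s, (t : ℝ) ∈ Icc a b) :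
    lebesgue s ≤ ENNReal.ofReal (b - a) := by
  rw [lebesgue_apply, ← Real.volume_Icc]
  refine measure_mono ?_
  rintro _ ⟨t, ht, rfl⟩
  exact h t ht

theorem lebesgue_Ioc_le (a b : ℝ≥0) : lebesgue (Ioc a b) ≤ ENNReal.ofReal (b - a) :=
  lebesgue_le fun _ ht => ⟨ht.1.le, ht.2⟩

theorem lebesgue_Iic_le (b : ℝ≥0) : lebesgue (Iic b) ≤ b := by
  refine (lebesgue_le (a := 0) (b := b) fun t ht => ⟨t.2, ht⟩).trans_eq ?_
  simp

theorem lebesgue_singleton (t : ℝ≥0) : lebesgue {t} = 0 := by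
  rw [lebesgue_apply, image_singleton, Real.volume_singleton]

instance : SigmaFinite lebesgue :=
  ⟨⟨⟨fun n => Iic (n : ℝ≥0), fun _ => trivial,
    fun n => (lebesgue_Iic_le _).trans_lt ENNReal.coe_lt_top, by
      refine eq_univ_of_forall fun t => ?_
      obtain ⟨n, hn⟩ := exists_nat_ge t
      exact mem_iUnion.2 ⟨n, hn⟩⟩⟩⟩

/-! ### The Poisson distribution -/

theorem poissonMeasure_compl_zero_le (r : ℝ≥0) : poissonMeasure r {0}ᶜ ≤ r := by
  rw [prob_compl_eq_one_sub (by simp), poissonMeasure_singleton, tsub_le_iff_right]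
  have h : (1 : ℝ) ≤ r + Real.exp (-r) * r ^ 0 / (Nat.factorial 0) := by
    have := Real.add_one_le_exp (-(r : ℝ))
    simp; linarith
  calc (1 : ℝ≥0∞) = ENNReal.ofReal 1 := by simp
    _ ≤ ENNReal.ofReal (r + Real.exp (-r) * r ^ 0 / (Nat.factorial 0)) :=
      ENNReal.ofReal_le_ofReal h
    _ ≤ _ := by
      refine ENNReal.ofReal_add_le.trans ?_
      rw [ENNReal.ofReal_coe_nnreal]

/-- Since `exp(-r) ≥ 1 - r`, the mass of `{0, 1}` is at least `(1 - r) * (1 + r) = 1 - r ^ 2`. This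
quadratic bound is the reason why small cells rarely contain two points. -/
theorem poissonMeasure_compl_zero_one_le (r : ℝ≥0) : poissonMeasure r {0, 1}ᶜ ≤ (r : ℝ≥0∞) ^ 2 := by
  rw [prob_compl_eq_one_sub (by simp), show ({0, 1} : Set ℕ) = {0} ∪ {1} from rfl,
    measure_union (by simp) (by simp), poissonMeasure_singleton, poissonMeasure_singleton,
    tsub_le_iff_right]
  have h : (1 : ℝ) ≤ r ^ 2 + (Real.exp (-r) * r ^ 0 / (Nat.factorial 0) +
      Real.exp (-r) * r ^ 1 / (Nat.factorial 1)) := by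
    have := Real.add_one_le_exp (-(r : ℝ))
    have h0 : (0 : ℝ) ≤ r := r.2
    simp
    nlinarith
  calc (1 : ℝ≥0∞) = ENNReal.ofReal 1 := by simp
    _ ≤ _ := ENNReal.ofReal_le_ofReal h
    _ ≤ _ := by
      refine ENNReal.ofReal_add_le.trans (add_le_add (le_of_eq ?_) ENNReal.ofReal_add_le)
      rw [ENNReal.ofReal_pow (NNReal.coe_nonneg r), ENNReal.ofReal_coe_nnreal]

/-! ### Poisson random measures -/

theorem exists_tsum_eq_natCast (k : ℕ → ℕ) (h : ∑' i, (k i : ℝ≥0∞) ≠ ∞) :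
    ∃ n : ℕ, ∑' i, (k i : ℝ≥0∞) = n := by
  have h2 : ∀ᶠ i in cofinite, k i = 0 := by
    have h1 := ENNReal.tendsto_cofinite_zero_of_tsum_ne_top h
    filter_upwards [h1 (Iio_mem_nhds (zero_lt_one : (0 : ℝ≥0∞) < 1))] with i hi
    have : (k i : ℝ≥0∞) < 1 := hi
    exact Nat.lt_one_iff.1 (by exact_mod_cast this)
  have h3 : {i | k i ≠ 0}.Finite := h2
  refine ⟨∑ i ∈ h3.toFinset, k i, ?_⟩
  rw [tsum_eq_sum (s := h3.toFinset)]
  · push_cast; rfl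
  · intro i hi
    simpa using hi

namespace IsPoissonRandomMeasure

variable {Ω S : Type*} [MeasurableSpace Ω] [MeasurableSpace S] {P : Measure Ω}
  {ν : Measure S} {η : Ω → Measure S}

theorem measurable_apply (h : IsPoissonRandomMeasure P ν η) {s : Set S} (hs : MeasurableSet s) :
    Measurable fun ω => η ω s :=
  (Measure.measurable_coe hs).comp h.measurable

theorem measure_apply_mem (h : IsPoissonRandomMeasure P ν η) {s : Set S} (hs : MeasurableSet s)
    (hν : ν s ≠ ∞) {B : Set ℝ≥0∞} (hB : MeasurableSet B) :
    P {ω | η ω s ∈ B} = poissonMeasure (ν s).toNNReal {n | (n : ℝ≥0∞) ∈ B} := by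
  have := congrArg (fun m => m B) (h.poisson s hs hν)
  rwa [Measure.map_apply (h.measurable_apply hs) hB, Measure.map_apply (by fun_prop) hB] at this

theorem ae_natCast (h : IsPoissonRandomMeasure P ν η) {s : Set S} (hs : MeasurableSet s)
    (hν : ν s ≠ ∞) : ∀ᵐ ω ∂P, ∃ n : ℕ, η ω s = n := by
  have hr : MeasurableSet (range (fun n : ℕ => (n : ℝ≥0∞)))ᶜ := (countable_range _).measurableSet.compl
  have := h.measure_apply_mem hs hν hr
  rw [ae_iff]
  have h2 : {ω | ¬∃ n : ℕ, η ω s = n} = {ω | η ω s ∈ (range (fun n : ℕ => (n : ℝ≥0∞)))ᶜ} := by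
    ext ω; simp [eq_comm]
  rw [h2, this]
  simp

theorem measure_ne_zero_le (h : IsPoissonRandomMeasure P ν η) {s : Set S} (hs : MeasurableSet s) :
    P {ω | η ω s ≠ 0} ≤ ν s * P univ := by
  by_cases hν : ν s = ∞
  · by_cases hP : P = 0
    · simp [hP]
    · rw [hν, ENNReal.top_mul (by simpa using hP)]; exact le_top
  · by_cases hP : P = 0
    · simp [hP]
    have h1 : P univ = 1 := by
      have := h.measure_apply_mem hs hν MeasurableSet.univ
      simpa using this
    have := h.measure_apply_mem hs hν (measurableSet_singleton (0 : ℝ≥0∞)).compl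
    rw [h1, mul_one]
    refine this.trans_le ?_
    refine (le_of_eq ?_).trans ((poissonMeasure_compl_zero_le _).trans_eq
      (ENNReal.coe_toNNReal hν))
    congr 1; ext n; simp

theorem measure_apply_ne_zero_le [IsProbabilityMeasure P] (h : IsPoissonRandomMeasure P ν η)
    {s : Set S} (hs : MeasurableSet s) : P {ω | η ω s ≠ 0} ≤ ν s := by
  simpa using h.measure_ne_zero_le hs

theorem measure_two_le_le [IsProbabilityMeasure P] (h : IsPoissonRandomMeasure P ν η)
    {s : Set S} (hs : MeasurableSet s) : P {ω | ¬ η ω s ≤ 1} ≤ ν s ^ 2 := by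
  by_cases hν : ν s = ∞
  · rw [hν]; simp
  have := h.measure_apply_mem hs hν (measurableSet_Iic (a := (1 : ℝ≥0∞))).compl
  refine this.trans_le ?_
  refine (measure_mono ?_).trans ((poissonMeasure_compl_zero_one_le _).trans_eq
    (by rw [ENNReal.coe_toNNReal hν]))
  intro n hn
  simp only [mem_compl_iff, mem_Iic, mem_ofPred_eq, not_le] at hn
  have : 1 < n := by exact_mod_cast hn
  simp; omega

theorem ae_apply_eq_zero (h : IsPoissonRandomMeasure P ν η) {s : Set S} (hs : MeasurableSet s)
    (hν : ν s = 0) : ∀ᵐ ω ∂P, η ω s = 0 := by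
  have := h.measure_ne_zero_le hs
  rw [hν, zero_mul] at this
  exact ae_iff.2 (nonpos_iff_eq_zero.1 this)

/-- A Poisson random measure is almost surely integer valued on a set of finite intensity. -/
theorem ae_forall_natCast [MeasurableSpace.CountablyGenerated S]
    (h : IsPoissonRandomMeasure P ν η) {B : Set S} (hB : MeasurableSet B) (hν : ν B ≠ ∞) :
    ∀ᵐ ω ∂P, ∀ A, MeasurableSet A → ∃ n : ℕ, η ω (A ∩ B) = n := by
  set C := MeasurableSpace.countableGeneratingSet S with hC
  have hCm : ∀ s ∈ C, MeasurableSet s := fun s hs =>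
    MeasurableSpace.measurableSet_countableGeneratingSet hs
  -- Finite intersections of a countable generating family form a countable π-system. Integrality
  -- holds almost surely on all of them at once and then spreads to every measurable set, because
  -- complements within `B` and disjoint unions preserve it.
  set 𝒜 : Set (Set S) := (fun F : Set (Set S) => ⋂₀ F) '' {F | F.Finite ∧ F ⊆ C} with h𝒜
  have hcount : 𝒜.Countable := (countable_ofPred_finite_subset
    (MeasurableSpace.countable_countableGeneratingSet (α := S))).image _
  have hmeas : ∀ A ∈ 𝒜, MeasurableSet A := by
    rintro _ ⟨F, ⟨hF, hFC⟩, rfl⟩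
    exact MeasurableSet.sInter hF.countable fun s hs => hCm s (hFC hs)
  have hpi : IsPiSystem 𝒜 := by
    rintro _ ⟨F, ⟨hF, hFC⟩, rfl⟩ _ ⟨F', ⟨hF', hFC'⟩, rfl⟩ _
    exact ⟨F ∪ F', ⟨hF.union hF', union_subset hFC hFC'⟩, sInter_union _ _⟩
  have hgen : ‹MeasurableSpace S› = MeasurableSpace.generateFrom 𝒜 := by
    refine le_antisymm ?_ (MeasurableSpace.generateFrom_le hmeas)
    conv_lhs => rw [← MeasurableSpace.generateFrom_countableGeneratingSet (α := S)]
    refine MeasurableSpace.generateFrom_mono fun s hs => ⟨{s}, ⟨finite_singleton s, ?_⟩, ?_⟩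
    · simpa using hs
    · simp
  have h1 : ∀ᵐ ω ∂P, ∀ A ∈ 𝒜, ∃ n : ℕ, η ω (A ∩ B) = n := by
    rw [ae_ball_iff hcount]
    intro A hA
    exact h.ae_natCast ((hmeas A hA).inter hB)
      ((measure_mono inter_subset_right).trans_lt (lt_top_iff_ne_top.2 hν)).ne
  filter_upwards [h1, h.ae_natCast hB hν] with ω hω hωB A hA
  obtain ⟨N, hN⟩ := hωB
  have hfin : ∀ A, η ω (A ∩ B) ≠ ∞ := fun A =>
    ((measure_mono inter_subset_right).trans_lt (by rw [hN]; exact ENNReal.natCast_lt_top N)).ne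
  induction A, hA using MeasurableSpace.induction_on_inter hgen hpi with
  | empty => exact ⟨0, by simp⟩
  | basic A hA => exact hω A hA
  | compl A hA ih =>
    obtain ⟨n, hn⟩ := ih
    refine ⟨N - n, ?_⟩
    have h2 : Aᶜ ∩ B = B \ (A ∩ B) := by ext x; simp; tauto
    rw [h2, measure_sdiff inter_subset_right (hA.inter hB).nullMeasurableSet (hfin A), hN, hn]
    push_cast; rfl
  | iUnion f hd hf ih =>
    choose k hk using ih
    have h2 : η ω ((⋃ i, f i) ∩ B) = ∑' i, (k i : ℝ≥0∞) := by
      rw [iUnion_inter, measure_iUnion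
        (fun i j hij => (hd hij).mono inter_subset_left inter_subset_left)
        (fun i => (hf i).inter hB)]
      exact tsum_congr hk
    obtain ⟨n, hn⟩ := exists_tsum_eq_natCast k (by rw [← h2]; exact hfin _)
    exact ⟨n, h2.trans hn⟩

theorem indep_fintype {ι : Type*} [Fintype ι] (h : IsPoissonRandomMeasure P ν η) (s : ι → Set S)
    (hs : ∀ k, MeasurableSet (s k)) (hd : Pairwise fun k l => Disjoint (s k) (s l)) :
    iIndepFun (fun k ω => η ω (s k)) P := by
  have := h.indep (Fintype.card ι) (fun k => s ((Fintype.equivFin ι).symm k)) (fun k => hs _)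
    (fun k l hkl => hd ((Fintype.equivFin ι).symm.injective.ne hkl))
  have h2 := this.precomp (Fintype.equivFin ι).injective
  simpa using h2

end IsPoissonRandomMeasure

/-! #### Atoms of finitely many sets -/

section Atoms
variable {S : Type*} [MeasurableSpace S] {J : Type*} [Fintype J]

/-- The atom of `(A j)_j` inside `U` on which exactly the `A j` with `j ∈ σ` hold. -/
def atom {S J : Type*} (U : Set S) (A : J → Set S) (σ : Finset J) : Set S := {x ∈ U | ∀ j, x ∈ A j ↔ j ∈ σ}

theorem measurableSet_atom {U : Set S} {A : J → Set S} (hU : MeasurableSet U)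
    (hA : ∀ j, MeasurableSet (A j)) (σ : Finset J) : MeasurableSet (atom U A σ) := by
  have : atom U A σ = U ∩ ⋂ j, {x | x ∈ A j ↔ j ∈ σ} := by ext; simp [atom]
  rw [this]
  refine hU.inter (MeasurableSet.iInter fun j => ?_)
  by_cases h : j ∈ σ
  · simpa [h] using hA j
  · have : {x | x ∈ A j ↔ j ∈ σ} = (A j)ᶜ := by ext; simp [h]
    rw [this]; exact (hA j).compl

theorem disjoint_atom {S J : Type*} (U : Set S) (A : J → Set S) :
    Pairwise fun σ τ => Disjoint (atom U A σ) (atom U A τ) := by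
  intro σ τ hne
  rw [Set.disjoint_left]
  rintro x ⟨_, h1⟩ ⟨_, h2⟩
  exact hne (Finset.ext fun j => (h1 j).symm.trans (h2 j))

-- Only disjoint sets have independent masses. This writes the masses of overlapping sets as sums
-- over disjoint atoms.
open Classical in
theorem measure_inter_eq_sum_atom (m : Measure S) {U : Set S} {A : J → Set S}
    (hU : MeasurableSet U) (hA : ∀ j, MeasurableSet (A j)) (j : J) :
    m (A j ∩ U) = ∑ σ : Finset J, if j ∈ σ then m (atom U A σ) else 0 := by
  have h1 : A j ∩ U = ⋃ σ ∈ Finset.univ.filter (fun σ : Finset J => j ∈ σ), atom U A σ := by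
    ext x
    simp only [mem_inter_iff, mem_iUnion, Finset.mem_filter, Finset.mem_univ, true_and, atom,
      mem_ofPred_eq, exists_prop]
    constructor
    · rintro ⟨h1, h2⟩
      exact ⟨Finset.univ.filter fun j => x ∈ A j, by simpa using h1, h2, by simp⟩
    · rintro ⟨σ, hσ, h2, h3⟩
      exact ⟨(h3 j).2 hσ, h2⟩
  rw [h1, measure_biUnion_finset (fun σ _ τ _ h => disjoint_atom U A h)
    (fun σ _ => measurableSet_atom hU hA σ), Finset.sum_filter]

end Atoms

namespace IsPoissonRandomMeasure

variable {Ω Ω' S : Type*} [MeasurableSpace Ω] [MeasurableSpace Ω'] [MeasurableSpace S]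
  {P : Measure Ω} {P' : Measure Ω'}
  {ν : Measure S} {η : Ω → Measure S} {η' : Ω' → Measure S}

/-- The vector of masses is one fixed measurable function of the masses of the atoms, and these are
independent Poisson variables with parameters read off from `ν`. -/
theorem map_pi_eq {J : Type*} [Fintype J] (h : IsPoissonRandomMeasure P ν η)
    (h' : IsPoissonRandomMeasure P' ν η') (A : J → Set S) (hA : ∀ j, MeasurableSet (A j))
    (hν : ∀ j, ν (A j) ≠ ∞) :
    P.map (fun ω j => η ω (A j)) = P'.map (fun ω j => η' ω (A j)) := by
  classical
  set U := ⋃ j, A j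
  have hU : MeasurableSet U := MeasurableSet.iUnion hA
  have hνU : ν U ≠ ∞ := ((measure_iUnion_fintype_le ν A).trans_lt
    (ENNReal.sum_lt_top.2 fun j _ => lt_top_iff_ne_top.2 (hν j))).ne
  have hνa : ∀ σ, ν (atom U A σ) ≠ ∞ := fun σ =>
    ((measure_mono (sep_subset _ _)).trans_lt (lt_top_iff_ne_top.2 hνU)).ne
  have hma := measurableSet_atom hU hA
  set g : (Finset J → ℝ≥0∞) → J → ℝ≥0∞ := fun v j => ∑ σ : Finset J, if j ∈ σ then v σ else 0
  have hg : Measurable g := by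
    refine measurable_pi_lambda _ fun j => Finset.measurable_sum _ fun σ _ => ?_
    split_ifs <;> fun_prop
  have hrep : ∀ m : Measure S, (fun j => m (A j)) = g fun σ => m (atom U A σ) := by
    intro m
    funext j
    rw [← inter_eq_left.2 (subset_iUnion A j)]
    exact measure_inter_eq_sum_atom m hU hA j
  have hlaw : P.map (fun ω σ => η ω (atom U A σ)) = P'.map (fun ω σ => η' ω (atom U A σ)) := by
    rw [(h.indep_fintype _ hma (disjoint_atom U A)).map_fun_eq_pi_map
        fun σ => (h.measurable_apply (hma σ)).aemeasurable,
      (h'.indep_fintype _ hma (disjoint_atom U A)).map_fun_eq_pi_map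
        fun σ => (h'.measurable_apply (hma σ)).aemeasurable]
    congr 1
    funext σ
    rw [h.poisson _ (hma σ) (hνa σ), h'.poisson _ (hma σ) (hνa σ)]
  have e1 : (fun ω j => η ω (A j)) = g ∘ fun ω σ => η ω (atom U A σ) := funext fun ω => hrep (η ω)
  have e2 : (fun ω j => η' ω (A j)) = g ∘ fun ω σ => η' ω (atom U A σ) :=
    funext fun ω => hrep (η' ω)
  rw [e1, e2, ← Measure.map_map hg (measurable_pi_lambda _ fun σ => h.measurable_apply (hma σ)),
    ← Measure.map_map hg (measurable_pi_lambda _ fun σ => h'.measurable_apply (hma σ)), hlaw]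

/-- The law of a Poisson random measure is determined by its intensity. -/
theorem map_eq [IsProbabilityMeasure P] [IsProbabilityMeasure P'] [SigmaFinite ν] (h : IsPoissonRandomMeasure P ν η)
    (h' : IsPoissonRandomMeasure P' ν η') : P.map η = P'.map η' := by
  classical
  -- Laws are prescribed on sets of finite intensity only. By σ-finiteness every mass is an
  -- increasing limit of such masses, so they generate the σ-algebra, and their joint law is
  -- determined by its finite-dimensional marginals.
  set I := {A : Set S // MeasurableSet A ∧ ν A ≠ ∞}
  set Φ : Measure S → I → ℝ≥0∞ := fun m A => m A.1
  have hΦ : Measurable Φ := measurable_pi_lambda _ fun A => Measure.measurable_coe A.2.1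
  have hgen : (Measure.instMeasurableSpace : MeasurableSpace (Measure S)) ≤
      MeasurableSpace.comap Φ MeasurableSpace.pi := by
    refine iSup₂_le fun A hA => ?_
    rw [← measurable_iff_comap_le]
    have h1 : (fun m : Measure S => m A) =
        fun m => ⨆ n, m (A ∩ spanningSets ν n) := by
      funext m
      rw [← Monotone.measure_iUnion
        (fun i j hij => inter_subset_inter_right _ (monotone_spanningSets ν hij)),
        ← inter_iUnion, iUnion_spanningSets, inter_univ]
    rw [h1]
    let _ : MeasurableSpace (Measure S) := MeasurableSpace.comap Φ MeasurableSpace.pi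
    refine Measurable.iSup fun n => ?_
    have hn : MeasurableSet (A ∩ spanningSets ν n) ∧ ν (A ∩ spanningSets ν n) ≠ ∞ :=
      ⟨hA.inter (measurableSet_spanningSets ν n),
        ((measure_mono inter_subset_right).trans_lt (measure_spanningSets_lt_top ν n)).ne⟩
    exact (measurable_pi_apply (⟨_, hn⟩ : I)).comp (comap_measurable Φ)
  have hmap : (P.map η).map Φ = (P'.map η').map Φ := by
    have : IsProbabilityMeasure (P.map η) :=
      Measure.isProbabilityMeasure_map h.measurable.aemeasurable
    have : IsProbabilityMeasure (P'.map η') :=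
      Measure.isProbabilityMeasure_map h'.measurable.aemeasurable
    refine IsProjectiveLimit.unique
      (P := fun K : Finset I => ((P.map η).map Φ).map K.restrict) (fun K => rfl) fun K => ?_
    simp only
    have hr : Measurable (K.restrict : (I → ℝ≥0∞) → K → ℝ≥0∞) := by fun_prop
    rw [Measure.map_map hr hΦ, Measure.map_map (hr.comp hΦ) h'.measurable,
      Measure.map_map hr hΦ, Measure.map_map (hr.comp hΦ) h.measurable]
    exact (h.map_pi_eq h' (fun A : K => A.1.1) (fun A => A.1.2.1) fun A => A.1.2.2).symm
  ext B hB
  obtain ⟨C, hC, rfl⟩ := hgen B hB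
  rw [← Measure.map_apply hΦ hC, ← Measure.map_apply hΦ hC, hmap]

/-- The restriction of a Poisson random measure to `A` is independent of its mass of a set which is
disjoint from `A`. -/
theorem indepFun_restrict [IsProbabilityMeasure P] (h : IsPoissonRandomMeasure P ν η) {A B : Set S} (hA : MeasurableSet A)
    (hB : MeasurableSet B) (hAB : Disjoint A B) :
    IndepFun (fun ω => (η ω).restrict A) (fun ω => η ω B) P := by
  classical
  rw [IndepFun_iff_Indep]
  set I := {C : Set S // MeasurableSet C}
  set f : (K : Finset I) → Ω → K → ℝ≥0∞ := fun K ω C => η ω (C.1.1 ∩ A)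
  have hf : ∀ K, Measurable (f K) := fun K =>
    measurable_pi_lambda _ fun C => h.measurable_apply (C.1.2.inter hA)
  -- The σ-algebra of the restriction is generated by a directed family of σ-algebras of finitely
  -- many masses, so independence may be checked on each of these.
  have hle : MeasurableSpace.comap (fun ω => (η ω).restrict A) Measure.instMeasurableSpace ≤
      ⨆ K : Finset I, MeasurableSpace.comap (f K) MeasurableSpace.pi := by
    rw [← measurable_iff_comap_le]
    refine @Measure.measurable_of_measurable_coe _ _ _ (_) _ fun C hC => ?_
    have h1 : (fun ω => (η ω).restrict A C) = fun ω => f {⟨C, hC⟩} ω ⟨⟨C, hC⟩, by simp⟩ := by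
      funext ω
      rw [Measure.restrict_apply hC]
    rw [h1]
    refine Measurable.mono ?_ (le_iSup (fun K : Finset I =>
      MeasurableSpace.comap (f K) MeasurableSpace.pi) {⟨C, hC⟩}) le_rfl
    exact (measurable_pi_apply (⟨⟨C, hC⟩, by simp⟩ : ({⟨C, hC⟩} : Finset I))).comp
      (comap_measurable (f {⟨C, hC⟩}))
  refine indep_of_indep_of_le_left (indep_iSup_of_directed_le (fun K => ?_)
    (fun K => (hf K).comap_le) (h.measurable_apply hB).comap_le ?_) hle
  · have hma := measurableSet_atom hA fun C : K => C.1.2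
    -- The index `none` carries `B`, the other indices carry the atoms inside `A`; all these sets
    -- are pairwise disjoint.
    set s : Option (Finset K) → Set S := fun o => o.elim B fun σ => atom A (fun C : K => C.1.1) σ
    have hs : ∀ o, MeasurableSet (s o) := by
      rintro (_ | σ)
      · exact hB
      · exact hma σ
    have hsub : ∀ σ, atom A (fun C : K => C.1.1) σ ⊆ A := fun σ => sep_subset _ _
    have hd : Pairwise fun k l => Disjoint (s k) (s l) := by
      rintro (_ | σ) (_ | τ) hne
      · exact absurd rfl hne
      · exact (hAB.mono_left (hsub τ)).symm
      · exact hAB.mono_left (hsub σ)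
      · exact disjoint_atom _ _ fun h => hne (congrArg some h)
    have hind := (h.indep_fintype s hs hd).indepFun_finset (Finset.univ.erase none) {none}
      (by simp) (fun o => h.measurable_apply (hs o))
    set g : (↥((Finset.univ : Finset (Option (Finset K))).erase none) → ℝ≥0∞) → K → ℝ≥0∞ :=
      fun v C => ∑ σ : Finset K, if C ∈ σ then v ⟨some σ, by simp⟩ else 0
    have hg : Measurable g := by
      refine measurable_pi_lambda _ fun j => Finset.measurable_sum _ fun σ _ => ?_
      split_ifs <;> fun_prop
    have hcomp := hind.comp hg
      (measurable_pi_apply (⟨none, by simp⟩ : ({none} : Finset (Option (Finset K)))))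
    have e1 : (g ∘ fun ω (i : ↥((Finset.univ : Finset (Option (Finset K))).erase none)) =>
        η ω (s i)) = f K := by
      funext ω C
      refine Eq.trans ?_ (measure_inter_eq_sum_atom (η ω) hA (fun C : K => C.1.2) C).symm
      refine Finset.sum_congr rfl fun σ _ => ?_
      congr
    rw [e1] at hcomp
    exact hcomp
  · refine directed_of_isDirected_le fun K L hKL => ?_
    rw [← measurable_iff_comap_le]
    refine @measurable_pi_lambda _ _ _ (_) _ _ fun C => ?_
    exact (measurable_pi_apply (⟨C.1, hKL C.2⟩ : L)).comp (comap_measurable (f L))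

end IsPoissonRandomMeasure


/-! ### Left limits -/

theorem nhdsLT_neBot_of_pos {s : ℝ≥0} (hs : 0 < s) : (𝓝[<] s).NeBot :=
  nhdsLT_neBot_of_exists_lt ⟨0, hs⟩

/-- `Function.leftLim` returns the value at the point when the left neighborhood is trivial, as at
time zero, or when there is no limit. Agreement at `s` itself is needed for these default cases. -/
theorem leftLim_eq_of_eventuallyEq {β : Type*} [TopologicalSpace β] [T2Space β] {f g : ℝ≥0 → β}
    {s : ℝ≥0} (h : f =ᶠ[𝓝[<] s] g) (hs : f s = g s) :
    Function.leftLim f s = Function.leftLim g s := by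
  rcases eq_or_neBot (𝓝[<] s) with hb | hb
  · rw [leftLim_eq_of_eq_bot f hb, leftLim_eq_of_eq_bot g hb, hs]
  by_cases hex : ∃ y, Tendsto f (𝓝[<] s) (𝓝 y)
  · obtain ⟨y, hy⟩ := hex
    rw [leftLim_eq_of_tendsto hy, leftLim_eq_of_tendsto ((tendsto_congr' h).1 hy)]
  · have hex' : ¬∃ y, Tendsto g (𝓝[<] s) (𝓝 y) := fun ⟨y, hy⟩ => hex ⟨y, (tendsto_congr' h).2 hy⟩
    rw [leftLim_eq_of_not_tendsto f hex, leftLim_eq_of_not_tendsto g hex', hs]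

theorem leftLim_congr {β : Type*} [TopologicalSpace β] [T2Space β] {f g : ℝ≥0 → β} {s : ℝ≥0}
    (h : ∀ r ≤ s, f r = g r) : Function.leftLim f s = Function.leftLim g s :=
  leftLim_eq_of_eventuallyEq (by filter_upwards [self_mem_nhdsWithin] with r hr using h r hr.le)
    (h s le_rfl)

theorem leftLim_eq_of_Ico_eq {β : Type*} [TopologicalSpace β] [T2Space β] {f g : ℝ≥0 → β}
    {a s : ℝ≥0} (has : a < s) (h : ∀ r ∈ Ico a s, f r = g r) (hg : ContinuousAt g s) :
    Function.leftLim f s = g s := by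
  have := nhdsLT_neBot_of_pos ((zero_le).trans_lt has)
  refine leftLim_eq_of_tendsto ((tendsto_congr' ?_).2 (hg.tendsto.mono_left nhdsWithin_le_nhds))
  filter_upwards [Ioo_mem_nhdsLT has] with r hr using h r ⟨hr.1.le, hr.2⟩

theorem leftLim_le {C : ℝ≥0 → ℝ} {K : ℝ} (h : ∀ t, C t ≤ K) (s : ℝ≥0) :
    Function.leftLim C s ≤ K := by
  rcases eq_or_neBot (𝓝[<] s) with hb | hb
  · rw [leftLim_eq_of_eq_bot _ hb]; exact h s
  by_cases hex : ∃ y, Tendsto C (𝓝[<] s) (𝓝 y)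
  · obtain ⟨y, hy⟩ := hex
    rw [leftLim_eq_of_tendsto hy]
    exact le_of_tendsto' hy h
  · rw [leftLim_eq_of_not_tendsto _ hex]; exact h s

/-! ### The queue equation between two times -/

/-- The number of departures in `(a, t]`. -/
def departures (x : ℝ≥0 → ℕ) (η : Measure ℝ≥0) (a t : ℝ≥0) : ℝ≥0∞ :=
  ∫⁻ s in Ioc a t, indicator {s | 0 < Function.leftLim x s} 1 s ∂η

/-- The number of accepted arrivals in `(a, t]`. -/
def arrivals (C : ℝ≥0 → ℝ) (ζ : Measure (ℝ≥0 × ℝ≥0)) (a t : ℝ≥0) : ℝ≥0∞ :=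
  ∫⁻ p in Ioc a t ×ˢ univ, indicator {p : ℝ≥0 × ℝ≥0 | (p.2 : ℝ) ≤ Function.leftLim C p.1} 1 p ∂ζ

/-- The queue equation on `(a, t]`. -/
def QueueIncrement (x : ℝ≥0 → ℕ) (C : ℝ≥0 → ℝ) (η : Measure ℝ≥0) (ζ : Measure (ℝ≥0 × ℝ≥0))
    (a t : ℝ≥0) : Prop :=
  (x t : ℝ≥0∞) + departures x η a t = (x a : ℝ≥0∞) + arrivals C ζ a t

/-- Finitely many noise points in bounded time, none at time zero. -/
structure IsLocallyFiniteNoise (η : Measure ℝ≥0) (ζ : Measure (ℝ≥0 × ℝ≥0)) (K : ℝ≥0) : Prop where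
  service_ne_top : ∀ T, η (Iic T) ≠ ∞
  arrival_ne_top : ∀ T, ζ (Iic T ×ˢ Iic K) ≠ ∞
  service_zero : η {0} = 0
  arrival_zero : ζ ({0} ×ˢ Iic K) = 0

theorem departures_le (x : ℝ≥0 → ℕ) (η : Measure ℝ≥0) (a t : ℝ≥0) :
    departures x η a t ≤ η (Ioc a t) := by
  refine (lintegral_mono (g := fun _ => 1) fun s => ?_).trans_eq (by simp)
  exact indicator_le_self' (fun _ _ => zero_le) s

/-- Points above the bound `K` of the acceptance level are never accepted, so only the strip `[0,
K]` matters, where the noise is locally finite. -/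
theorem setLIntegral_accept_eq {C : ℝ≥0 → ℝ} {K : ℝ≥0} (hC : ∀ t, C t ≤ K)
    (ζ : Measure (ℝ≥0 × ℝ≥0)) {A : Set ℝ≥0} (hA : MeasurableSet A) :
    ∫⁻ p in A ×ˢ univ, indicator {p : ℝ≥0 × ℝ≥0 | (p.2 : ℝ) ≤ Function.leftLim C p.1} 1 p ∂ζ =
    ∫⁻ p in A ×ˢ Iic K, indicator {p : ℝ≥0 × ℝ≥0 | (p.2 : ℝ) ≤ Function.leftLim C p.1} 1 p ∂ζ := by
  have h1 : A ×ˢ (univ : Set ℝ≥0) = A ×ˢ Iic K ∪ A ×ˢ Ioi K := by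
    rw [← prod_union, Iic_union_Ioi]
  have hm : MeasurableSet (A ×ˢ Ioi K) := hA.prod measurableSet_Ioi
  rw [h1, lintegral_union hm, setLIntegral_congr_fun (g := fun _ => 0) hm, lintegral_zero, add_zero]
  · rintro p ⟨_, hp⟩
    refine indicator_of_notMem ?_ _
    simp only [mem_ofPred_eq, not_le]
    exact (leftLim_le hC p.1).trans_lt (by exact_mod_cast hp)
  · exact Disjoint.set_prod_right (Iic_disjoint_Ioi le_rfl) _ _

theorem arrivals_le {C : ℝ≥0 → ℝ} {K : ℝ≥0} (hC : ∀ t, C t ≤ K) (ζ : Measure (ℝ≥0 × ℝ≥0))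
    (a t : ℝ≥0) : arrivals C ζ a t ≤ ζ (Ioc a t ×ˢ Iic K) := by
  rw [arrivals, setLIntegral_accept_eq hC ζ measurableSet_Ioc]
  refine (lintegral_mono (g := fun _ => 1) fun s => ?_).trans_eq (by simp)
  exact indicator_le_self' (fun _ _ => zero_le) s

theorem departures_add (x : ℝ≥0 → ℕ) (η : Measure ℝ≥0) {a b t : ℝ≥0} (hab : a ≤ b) (hbt : b ≤ t) :
    departures x η a t = departures x η a b + departures x η b t := by
  rw [departures, ← Ioc_union_Ioc_eq_Ioc hab hbt, lintegral_union measurableSet_Ioc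
    (Ioc_disjoint_Ioc_of_le le_rfl)]
  rfl

theorem arrivals_add (C : ℝ≥0 → ℝ) (ζ : Measure (ℝ≥0 × ℝ≥0)) {a b t : ℝ≥0} (hab : a ≤ b)
    (hbt : b ≤ t) : arrivals C ζ a t = arrivals C ζ a b + arrivals C ζ b t := by
  rw [arrivals, ← Ioc_union_Ioc_eq_Ioc hab hbt, union_prod, lintegral_union
    (measurableSet_Ioc.prod MeasurableSet.univ)
    (Disjoint.set_prod_left (Ioc_disjoint_Ioc_of_le le_rfl) _ _)]
  rfl

theorem departures_congr {x y : ℝ≥0 → ℕ} (η : Measure ℝ≥0) {a t : ℝ≥0} (h : ∀ r ≤ t, x r = y r) :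
    departures x η a t = departures y η a t := by
  refine setLIntegral_congr_fun measurableSet_Ioc fun s hs => ?_
  have h1 : Function.leftLim x s = Function.leftLim y s :=
    leftLim_congr fun r hr => h r (hr.trans hs.2)
  simp only [indicator, mem_ofPred_eq, h1]
  congr

theorem arrivals_congr {C D : ℝ≥0 → ℝ} (ζ : Measure (ℝ≥0 × ℝ≥0)) {a t : ℝ≥0}
    (h : ∀ r ≤ t, C r = D r) : arrivals C ζ a t = arrivals D ζ a t := by
  refine setLIntegral_congr_fun (measurableSet_Ioc.prod MeasurableSet.univ) fun p hp => ?_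
  have h1 : Function.leftLim C p.1 = Function.leftLim D p.1 :=
    leftLim_congr fun r hr => h r (hr.trans hp.1.2)
  simp only [indicator, mem_ofPred_eq, h1]

theorem queueIncrement_congr {x y : ℝ≥0 → ℕ} {C D : ℝ≥0 → ℝ} {η : Measure ℝ≥0}
    {ζ : Measure (ℝ≥0 × ℝ≥0)} {a t : ℝ≥0} (hat : a ≤ t) (h : ∀ r ≤ t, x r = y r)
    (h' : ∀ r ≤ t, C r = D r) : QueueIncrement x C η ζ a t ↔ QueueIncrement y D η ζ a t := by
  rw [QueueIncrement, QueueIncrement, departures_congr η h, arrivals_congr ζ h', h t le_rfl,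
    h a hat]

/-- The restart property: the counts on `(a, b]` are finite and can be cancelled from both sides of
the equation in `[0, ∞]`. -/
theorem queueIncrement_iff_of_le {x : ℝ≥0 → ℕ} {C : ℝ≥0 → ℝ} {η : Measure ℝ≥0}
    {ζ : Measure (ℝ≥0 × ℝ≥0)} {K : ℝ≥0} (hC : ∀ t, C t ≤ K) (hn : IsLocallyFiniteNoise η ζ K)
    {a b t : ℝ≥0} (hab : a ≤ b) (hbt : b ≤ t) (h : QueueIncrement x C η ζ a b) :
    QueueIncrement x C η ζ a t ↔ QueueIncrement x C η ζ b t := by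
  have hd : departures x η a b ≠ ∞ := ((departures_le x η a b).trans_lt
    ((measure_mono fun s hs => hs.2).trans_lt (lt_top_iff_ne_top.2 (hn.service_ne_top b)))).ne
  have ha : arrivals C ζ a b ≠ ∞ := ((arrivals_le hC ζ a b).trans_lt
    ((measure_mono (prod_mono_left fun s hs => hs.2)).trans_lt
      (lt_top_iff_ne_top.2 (hn.arrival_ne_top b)))).ne
  unfold QueueIncrement at h ⊢
  rw [departures_add x η hab hbt, arrivals_add C ζ hab hbt]
  constructor
  · intro h2
    have h3 : (departures x η a b + arrivals C ζ a b) + (x t + departures x η b t) =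
        (departures x η a b + arrivals C ζ a b) + (x b + arrivals C ζ b t) := by
      calc _ = (x t + (departures x η a b + departures x η b t)) + arrivals C ζ a b := by ring
        _ = (x a + arrivals C ζ a b) + (arrivals C ζ a b + arrivals C ζ b t) := by rw [h2]; ring
        _ = _ := by rw [← h]; ring
    exact (ENNReal.add_right_inj (ENNReal.add_ne_top.2 ⟨hd, ha⟩)).1 h3
  · intro h2
    have h3 : x b + (x t + (departures x η a b + departures x η b t)) =
        x b + (x a + (arrivals C ζ a b + arrivals C ζ b t)) := by
      calc _ = (x b + departures x η a b) + (x t + departures x η b t) := by ring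
        _ = _ := by rw [h, h2]; ring
    exact (ENNReal.add_right_inj (ENNReal.natCast_ne_top _)).1 h3

/-- There is no noise point at time zero, so integrals over `[0, t]` and `(0, t]` agree and the
default left limit at zero plays no role. -/
theorem solvesQueueEquation_iff {x : CadlagPath ℕ} {C : ℝ≥0 → ℝ} {η : Measure ℝ≥0}
    {ζ : Measure (ℝ≥0 × ℝ≥0)} {K : ℝ≥0} (hC : ∀ t, C t ≤ K) (hn : IsLocallyFiniteNoise η ζ K) :
    SolvesQueueEquation x C η ζ ↔ ∀ t, QueueIncrement x C η ζ 0 t := by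
  have hI : ∀ t : ℝ≥0, Iic t = {0} ∪ Ioc 0 t := fun t => by
    ext s
    simp only [mem_Iic, mem_union, mem_singleton_iff, mem_Ioc]
    constructor
    · intro h
      rcases eq_or_lt_of_le (zero_le : 0 ≤ s) with h0 | h0
      · exact Or.inl h0.symm
      · exact Or.inr ⟨h0, h⟩
    · rintro (rfl | h)
      · exact zero_le
      · exact h.2
  have hdisj : ∀ t : ℝ≥0, Disjoint {0} (Ioc 0 t) := fun t => by simp
  refine forall_congr' fun t => ?_
  have h1 : ∫⁻ s in Iic t, indicator {s | 0 < Function.leftLim x s} 1 s ∂η =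
      departures x η 0 t := by
    rw [hI, lintegral_union measurableSet_Ioc (hdisj t), setLIntegral_measure_zero _ _
      hn.service_zero, zero_add]
    rfl
  have h2 : ∫⁻ p in Iic t ×ˢ univ,
        indicator {p : ℝ≥0 × ℝ≥0 | (p.2 : ℝ) ≤ Function.leftLim C p.1} 1 p ∂ζ =
      arrivals C ζ 0 t := by
    rw [hI, union_prod, lintegral_union (measurableSet_Ioc.prod MeasurableSet.univ)
      (Disjoint.set_prod_left (hdisj t) _ _),
      setLIntegral_accept_eq hC ζ (measurableSet_singleton 0), setLIntegral_measure_zero _ _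
      hn.arrival_zero, zero_add]
    rfl
  rw [h1, h2]
  rfl

/-! ### Cells with at most one noise point -/

/-- The natural number given by an extended real. -/
def count (z : ℝ≥0∞) : ℕ := ⌊z.toReal⌋₊

@[simp] theorem count_zero : count 0 = 0 := by simp [count]

@[simp] theorem count_one : count 1 = 1 := by simp [count]

theorem measurable_count : Measurable count := Nat.measurable_floor.comp ENNReal.measurable_toReal

/-- The queue length at time `t` when the queue has length `u` at time `a` and there is at most one
noise point in `(a, t]`. -/
def stepQueue (η : Measure ℝ≥0) (ζ : Measure (ℝ≥0 × ℝ≥0)) (c : ℝ≥0 → ℝ) (u : ℕ) (a t : ℝ≥0) : ℕ :=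
  u + count (ζ {p | p.1 ∈ Ioc a t ∧ (p.2 : ℝ) ≤ c p.1}) - if 0 < u then count (η (Ioc a t)) else 0

/-- No noise points in `(a, t]`. -/
def IsQuiet (η : Measure ℝ≥0) (ζ : Measure (ℝ≥0 × ℝ≥0)) (K a b : ℝ≥0) : Prop :=
  η (Ioc a b) = 0 ∧ ζ (Ioc a b ×ˢ Iic K) = 0

/-- Exactly one noise point in `(a, b]`, at time `s`. -/
def HasOnePoint (η : Measure ℝ≥0) (ζ : Measure (ℝ≥0 × ℝ≥0)) (K a b s : ℝ≥0) : Prop :=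
  (η.restrict (Ioc a b) = Measure.dirac s ∧ ζ (Ioc a b ×ˢ Iic K) = 0) ∨
  ∃ y, η (Ioc a b) = 0 ∧ ζ.restrict (Ioc a b ×ˢ Iic K) = Measure.dirac (s, y)

theorem IsQuiet.mono {η : Measure ℝ≥0} {ζ : Measure (ℝ≥0 × ℝ≥0)} {K a b t : ℝ≥0}
    (h : IsQuiet η ζ K a b) (htb : t ≤ b) : IsQuiet η ζ K a t :=
  ⟨measure_mono_null (Ioc_subset_Ioc_right htb) h.1,
    measure_mono_null (prod_mono_left (Ioc_subset_Ioc_right htb)) h.2⟩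

theorem HasOnePoint.isQuiet {η : Measure ℝ≥0} {ζ : Measure (ℝ≥0 × ℝ≥0)} {K a b s t : ℝ≥0}
    (h : HasOnePoint η ζ K a b s) (hts : t < s) (htb : t ≤ b) : IsQuiet η ζ K a t := by
  have hsub : Ioc a t ⊆ Ioc a b := Ioc_subset_Ioc_right htb
  rcases h with ⟨h1, h2⟩ | ⟨y, h1, h2⟩
  · refine ⟨?_, measure_mono_null (prod_mono_left hsub) h2⟩
    rw [← Measure.restrict_eq_self η hsub, h1, Measure.dirac_apply' _ measurableSet_Ioc]
    simp [hts]
  · refine ⟨measure_mono_null hsub h1, ?_⟩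
    rw [← Measure.restrict_eq_self ζ (prod_mono_left hsub), h2,
      Measure.dirac_apply' _ (measurableSet_Ioc.prod measurableSet_Iic)]
    simp [hts]

section Cell
variable {η : Measure ℝ≥0} {ζ : Measure (ℝ≥0 × ℝ≥0)} {K a b t s : ℝ≥0} {x : ℝ≥0 → ℕ}
  {C c : ℝ≥0 → ℝ}

theorem IsQuiet.queueIncrement_iff (h : IsQuiet η ζ K a t) (hC : ∀ t, C t ≤ K) :
    QueueIncrement x C η ζ a t ↔ x t = x a := by
  have h1 : departures x η a t = 0 := le_antisymm ((departures_le x η a t).trans_eq h.1) zero_le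
  have h2 : arrivals C ζ a t = 0 := le_antisymm ((arrivals_le hC ζ a t).trans_eq h.2) zero_le
  rw [QueueIncrement, h1, h2, add_zero, add_zero, Nat.cast_inj]

theorem acceptSet_subset (hc : ∀ t, c t ≤ K) :
    {p : ℝ≥0 × ℝ≥0 | p.1 ∈ Ioc a t ∧ (p.2 : ℝ) ≤ c p.1} ⊆ Ioc a t ×ˢ Iic K :=
  fun p hp => ⟨hp.1, by exact_mod_cast hp.2.trans (hc p.1)⟩

theorem measurableSet_acceptSet (hc : Continuous c) (a t : ℝ≥0) :
    MeasurableSet {p : ℝ≥0 × ℝ≥0 | p.1 ∈ Ioc a t ∧ (p.2 : ℝ) ≤ c p.1} := by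
  refine MeasurableSet.inter (measurable_fst measurableSet_Ioc) ?_
  exact measurableSet_le (f := fun p : ℝ≥0 × ℝ≥0 => (p.2 : ℝ)) (g := fun p => c p.1) (by fun_prop)
    (by fun_prop)

theorem IsQuiet.stepQueue_eq (h : IsQuiet η ζ K a t) (hc : ∀ t, c t ≤ K) (u : ℕ) :
    stepQueue η ζ c u a t = u := by
  rw [stepQueue, h.1, measure_mono_null (acceptSet_subset hc) h.2]
  simp

/-- Up to the point at time `s` the queue keeps the value `x a` and the level coincides with the
continuous function `c`. The left limits at `s` are therefore `x a` and `c s`, and they alone decide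
on the departure or the acceptance. -/
theorem HasOnePoint.queueIncrement_iff (h : HasOnePoint η ζ K a b s) (hs : s ∈ Ioc a b)
    (hst : s ≤ t) (htb : t ≤ b) (hC : ∀ t, C t ≤ K) (hc : ∀ t, c t ≤ K) (hcc : Continuous c)
    (hx : ∀ r ∈ Ico a s, x r = x a) (hCc : ∀ r ∈ Ico a s, C r = c r) :
    QueueIncrement x C η ζ a t ↔ x t = stepQueue η ζ c (x a) a t := by
  have hsub : Ioc a t ⊆ Ioc a b := Ioc_subset_Ioc_right htb
  have hst' : s ∈ Ioc a t := ⟨hs.1, hst⟩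
  have hlx : Function.leftLim x s = x a :=
    leftLim_eq_of_Ico_eq (g := fun _ => x a) hs.1 hx continuousAt_const
  have hlC : Function.leftLim C s = c s := leftLim_eq_of_Ico_eq hs.1 hCc hcc.continuousAt
  rcases h with ⟨h1, h2⟩ | ⟨y, h1, h2⟩
  · have hζ : ζ (Ioc a t ×ˢ Iic K) = 0 := measure_mono_null (prod_mono_left hsub) h2
    have hA : arrivals C ζ a t = 0 := le_antisymm ((arrivals_le hC ζ a t).trans_eq hζ) zero_le
    have hr : η.restrict (Ioc a t) = Measure.dirac s := by
      rw [← inter_eq_left.2 hsub, ← Measure.restrict_restrict measurableSet_Ioc, h1,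
        restrict_dirac' measurableSet_Ioc, if_pos hst']
    have hD : departures x η a t = if 0 < x a then 1 else 0 := by
      rw [departures, hr, lintegral_dirac]
      simp only [indicator, mem_ofPred_eq, hlx, Pi.one_apply]
    have hη : η (Ioc a t) = 1 := by
      rw [← Measure.restrict_apply_self, hr, Measure.dirac_apply' _ measurableSet_Ioc]
      simp [hs.1, hst]
    rw [QueueIncrement, hA, hD, stepQueue, hη, measure_mono_null (acceptSet_subset hc) hζ]
    simp only [count_zero, count_one, add_zero]
    split_ifs with h0
    · rw [← Nat.cast_one, ← Nat.cast_add, Nat.cast_inj]; omega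
    · simp
  · have hη : η (Ioc a t) = 0 := measure_mono_null hsub h1
    have hD : departures x η a t = 0 := le_antisymm ((departures_le x η a t).trans_eq hη) zero_le
    have hm : MeasurableSet (Ioc a t ×ˢ Iic K) := measurableSet_Ioc.prod measurableSet_Iic
    have hy : y ≤ K := by
      have h3 : ζ.restrict (Ioc a b ×ˢ Iic K) (Ioc a b ×ˢ Iic K)ᶜ = 0 := by
        rw [Measure.restrict_apply (measurableSet_Ioc.prod measurableSet_Iic).compl]; simp
      rw [h2, Measure.dirac_apply' _ (measurableSet_Ioc.prod measurableSet_Iic).compl] at h3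
      by_contra hcon
      simp [hcon] at h3
    have hr : ζ.restrict (Ioc a t ×ˢ Iic K) = Measure.dirac (s, y) := by
      rw [← inter_eq_left.2 (prod_mono_left hsub : Ioc a t ×ˢ Iic K ⊆ Ioc a b ×ˢ Iic K),
        ← Measure.restrict_restrict hm, h2, restrict_dirac' hm, if_pos ⟨hst', hy⟩]
    have hA : arrivals C ζ a t = if (y : ℝ) ≤ c s then 1 else 0 := by
      rw [arrivals, setLIntegral_accept_eq hC ζ measurableSet_Ioc, hr, lintegral_dirac]
      simp only [indicator, mem_ofPred_eq, hlC, Pi.one_apply]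
    have hζ : ζ {p : ℝ≥0 × ℝ≥0 | p.1 ∈ Ioc a t ∧ (p.2 : ℝ) ≤ c p.1} =
        if (y : ℝ) ≤ c s then 1 else 0 := by
      rw [← Measure.restrict_eq_self ζ (acceptSet_subset hc), hr,
        Measure.dirac_apply' _ (measurableSet_acceptSet hcc a t)]
      simp [indicator, hs.1, hst]
    rw [QueueIncrement, hA, hD, stepQueue, hη, hζ]
    simp only [count_zero, add_zero, ite_self, tsub_zero]
    split_ifs with h0
    · rw [count_one, ← Nat.cast_one, ← Nat.cast_add, Nat.cast_inj]
    · simp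

theorem HasOnePoint.stepQueue_eq (h : HasOnePoint η ζ K a b s) (hs : s ∈ Ioc a b)
    (hst : s ≤ t) (htb : t ≤ b) (hc : ∀ t, c t ≤ K) (hcc : Continuous c) (u : ℕ) :
    stepQueue η ζ c u a t = stepQueue η ζ c u a s := by
  -- The explicit formula is tested on the path that equals `u` before `s` and `v` from `s` on.
  -- Since there are no points in `(s, t]`, the value which solves the equation at `s` also solves
  -- it at `t`.
  have hx : ∀ r, s ≤ r → r ≤ b → ∀ v : ℕ,
      QueueIncrement (fun w => if w < s then u else v) c η ζ a r ↔ v = stepQueue η ζ c u a r := by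
    intro r hsr hrb v
    have := h.queueIncrement_iff (C := c) (c := c) (x := fun w => if w < s then u else v) hs hsr
      hrb hc hc hcc (fun w hw => by simp [hw.2, hs.1]) (fun _ _ => rfl)
    simpa [hs.1, not_lt.2 hsr] using this
  have hdep : ∀ v : ℕ, departures (fun r => if r < s then u else v) η a t =
      departures (fun r => if r < s then u else v) η a s := by
    intro v
    rw [departures_add _ η hs.1.le hst]
    have : η (Ioc s t) = 0 := by
      rcases h with ⟨h1, _⟩ | ⟨y, h1, _⟩
      · have hsub : Ioc s t ⊆ Ioc a b := Ioc_subset_Ioc hs.1.le htb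
        rw [← Measure.restrict_eq_self η hsub, h1, Measure.dirac_apply' _ measurableSet_Ioc]
        simp
      · exact measure_mono_null (Ioc_subset_Ioc hs.1.le htb) h1
    rw [le_antisymm ((departures_le _ η s t).trans_eq this) zero_le, add_zero]
  have harr : arrivals c ζ a t = arrivals c ζ a s := by
    rw [arrivals_add _ ζ hs.1.le hst]
    have : ζ (Ioc s t ×ˢ Iic K) = 0 := by
      have hsub : Ioc s t ⊆ Ioc a b := Ioc_subset_Ioc hs.1.le htb
      rcases h with ⟨_, h1⟩ | ⟨y, _, h1⟩
      · exact measure_mono_null (prod_mono_left hsub) h1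
      · rw [← Measure.restrict_eq_self ζ (prod_mono_left hsub), h1,
          Measure.dirac_apply' _ (measurableSet_Ioc.prod measurableSet_Iic)]
        simp
    rw [le_antisymm ((arrivals_le hc ζ s t).trans_eq this) zero_le, add_zero]
  have key := (hx s le_rfl (hst.trans htb) (stepQueue η ζ c u a s)).2 rfl
  refine ((hx t hst htb (stepQueue η ζ c u a s)).1 ?_).symm
  rw [QueueIncrement, hdep, harr]
  simpa [QueueIncrement, not_lt.2 hst] using key

end Cell


/-! ### Systems of queues -/

/-- The service and arrival noise of one server. -/
abbrev Noise : Type := Measure ℝ≥0 × Measure (ℝ≥0 × ℝ≥0)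

section System
variable {ι : Type*}

/-- Arrival rates of a system of queues, as functions of time and of all queue lengths. -/
structure IsRate (c : ℝ≥0 → ι → (ι → ℕ) → ℝ) (K : ℝ≥0) : Prop where
  continuous : ∀ i u, Continuous fun t => c t i u
  le : ∀ t i u, c t i u ≤ K

/-- The system of queue equations on `(a, t]`. -/
def SystemIncrement (N : ι → Noise) (c : ℝ≥0 → ι → (ι → ℕ) → ℝ) (x : ι → ℝ≥0 → ℕ) (a t : ℝ≥0) :
    Prop :=
  ∀ i, QueueIncrement (x i) (fun r => c r i fun k => x k r) (N i).1 (N i).2 a t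

/-- At most one point of all noises in `(a, b]`. -/
def AtMostOne (N : ι → Noise) (K a b : ℝ≥0) : Prop :=
  (∀ i, IsQuiet (N i).1 (N i).2 K a b) ∨
  ∃ i, ∃ s ∈ Ioc a b, HasOnePoint (N i).1 (N i).2 K a b s ∧
    ∀ j ≠ i, IsQuiet (N j).1 (N j).2 K a b

/-- The queue lengths at time `t` if they are `u` at time `a` and there is at most one noise point
in `(a, t]`. -/
def stepSystem (N : ι → Noise) (c : ℝ≥0 → ι → (ι → ℕ) → ℝ) (u : ι → ℕ) (a t : ℝ≥0) : ι → ℕ :=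
  fun i => stepQueue (N i).1 (N i).2 (fun r => c r i u) (u i) a t

variable {N : ι → Noise} {c : ℝ≥0 → ι → (ι → ℕ) → ℝ} {x : ι → ℝ≥0 → ℕ} {K a b t : ℝ≥0}

theorem isQuiet_of_le {η : Measure ℝ≥0} {ζ : Measure (ℝ≥0 × ℝ≥0)} (h : b ≤ a) :
    IsQuiet η ζ K a b := by
  simp [IsQuiet, Ioc_eq_empty (not_lt.2 h)]

theorem HasOnePoint.mono {η : Measure ℝ≥0} {ζ : Measure (ℝ≥0 × ℝ≥0)} {s : ℝ≥0}
    (h : HasOnePoint η ζ K a b s) (hs : s ∈ Ioc a b) (hst : s ≤ t) (htb : t ≤ b) :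
    HasOnePoint η ζ K a t s := by
  have hsub : Ioc a t ⊆ Ioc a b := Ioc_subset_Ioc_right htb
  rcases h with ⟨h1, h2⟩ | ⟨y, h1, h2⟩
  · refine Or.inl ⟨?_, measure_mono_null (prod_mono_left hsub) h2⟩
    rw [← inter_eq_left.2 hsub, ← Measure.restrict_restrict measurableSet_Ioc, h1,
      restrict_dirac' measurableSet_Ioc, if_pos ⟨hs.1, hst⟩]
  · refine Or.inr ⟨y, measure_mono_null hsub h1, ?_⟩
    have hm : ∀ v, MeasurableSet (Ioc a v ×ˢ Iic K) := fun v =>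
      measurableSet_Ioc.prod measurableSet_Iic
    have hy : y ≤ K := by
      have h3 : ζ.restrict (Ioc a b ×ˢ Iic K) (Ioc a b ×ˢ Iic K)ᶜ = 0 := by
        rw [Measure.restrict_apply (hm b).compl]; simp
      rw [h2, Measure.dirac_apply' _ (hm b).compl] at h3
      by_contra hcon
      simp [hcon] at h3
    rw [← inter_eq_left.2 (prod_mono_left hsub : Ioc a t ×ˢ Iic K ⊆ Ioc a b ×ˢ Iic K),
      ← Measure.restrict_restrict (hm t), h2, restrict_dirac' (hm t), if_pos ⟨⟨hs.1, hst⟩, hy⟩]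

theorem AtMostOne.mono (h : AtMostOne N K a b) (htb : t ≤ b) : AtMostOne N K a t := by
  rcases h with h | ⟨i, s, hs, h1, h2⟩
  · exact Or.inl fun i => (h i).mono htb
  rcases le_or_gt s t with hst | hts
  · exact Or.inr ⟨i, s, ⟨hs.1, hst⟩, h1.mono hs hst htb, fun j hj => (h2 j hj).mono htb⟩
  · refine Or.inl fun j => ?_
    by_cases hj : j = i
    · rw [hj]; exact h1.isQuiet hts htb
    · exact (h2 j hj).mono htb

/-- The jump time in a cell with at most one noise point. -/
theorem AtMostOne.exists_jump (h : AtMostOne N K a b) (hab : a < b) :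
    ∃ s ∈ Ioc a b, (∀ t < s, ∀ i, IsQuiet (N i).1 (N i).2 K a t) ∧
      ∀ i, IsQuiet (N i).1 (N i).2 K a b ∨ HasOnePoint (N i).1 (N i).2 K a b s := by
  rcases h with h | ⟨i, s, hs, h1, h2⟩
  · exact ⟨b, ⟨hab, le_rfl⟩, fun _ ht i => (h i).mono ht.le, fun i => Or.inl (h i)⟩
  · refine ⟨s, hs, fun t ht j => ?_, fun j => ?_⟩
    · by_cases hj : j = i
      · rw [hj]; exact h1.isQuiet ht (ht.le.trans hs.2)
      · exact (h2 j hj).mono (ht.le.trans hs.2)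
    · by_cases hj : j = i
      · rw [hj]; exact Or.inr h1
      · exact Or.inl (h2 j hj)

theorem stepSystem_self (hc : IsRate c K) (u : ι → ℕ) : stepSystem N c u a a = u :=
  funext fun _ => (isQuiet_of_le le_rfl).stepQueue_eq (fun _ => hc.le _ _ _) _

theorem stepSystem_eq_of_quiet (hc : IsRate c K) (u : ι → ℕ)
    (h : ∀ i, IsQuiet (N i).1 (N i).2 K a t) : stepSystem N c u a t = u :=
  funext fun i => (h i).stepQueue_eq (fun _ => hc.le _ _ _) _

theorem AtMostOne.exists_jump_stepSystem (h : AtMostOne N K a b) (hc : IsRate c K) (hab : a < b)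
    (u : ι → ℕ) : ∃ s ∈ Ioc a b, (∀ t < s, stepSystem N c u a t = u) ∧
      ∀ t ∈ Icc s b, stepSystem N c u a t = stepSystem N c u a s := by
  obtain ⟨s, hs, h1, h2⟩ := h.exists_jump hab
  refine ⟨s, hs, fun t ht => stepSystem_eq_of_quiet hc u (h1 t ht), fun t ht => funext fun i => ?_⟩
  rcases h2 i with hq | hp
  · exact ((hq.mono ht.2).stepQueue_eq (fun _ => hc.le _ _ _) _).trans
      ((hq.mono hs.2).stepQueue_eq (fun _ => hc.le _ _ _) _).symm
  · exact hp.stepQueue_eq hs ht.1 ht.2 (fun _ => hc.le _ _ _) (hc.continuous _ _) _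

/-- Before the only noise point all queues are frozen, so every rate at the jump is evaluated at the
state at time `a` and the feedback between servers disappears. The equation is needed at all times
of the cell, since the freezing before the jump is itself deduced from it. -/
theorem AtMostOne.systemIncrement_iff (h : AtMostOne N K a b) (hc : IsRate c K) :
    (∀ t ∈ Icc a b, SystemIncrement N c x a t) ↔
      ∀ t ∈ Icc a b, (fun i => x i t) = stepSystem N c (fun i => x i a) a t := by
  have hC : ∀ i, ∀ r, (fun r => c r i fun k => x k r) r ≤ K := fun i r => hc.le _ _ _
  rcases lt_or_ge a b with hab | hba
  · obtain ⟨s, hs, h1, h2⟩ := h.exists_jump hab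
    have hq : ∀ t < s, SystemIncrement N c x a t ↔
        (fun i => x i t) = stepSystem N c (fun i => x i a) a t := fun t ht => by
      rw [stepSystem_eq_of_quiet hc _ (h1 t ht), funext_iff]
      exact forall_congr' fun i => (h1 t ht i).queueIncrement_iff (hC i)
    have hp : (∀ t ∈ Ico a s, (fun i => x i t) = fun i => x i a) → ∀ t ∈ Icc s b,
        (SystemIncrement N c x a t ↔
          (fun i => x i t) = stepSystem N c (fun i => x i a) a t) := fun hx t ht => by
      rw [funext_iff]
      refine forall_congr' fun i => ?_
      rcases h2 i with hqi | hpi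
      · rw [(hqi.mono ht.2).queueIncrement_iff (hC i), stepSystem,
          (hqi.mono ht.2).stepQueue_eq (fun _ => hc.le _ _ _) _]
      · exact hpi.queueIncrement_iff hs ht.1 ht.2 (hC i) (fun _ => hc.le _ _ _)
          (hc.continuous _ _) (fun r hr => congrFun (hx r hr) i)
          (fun r hr => by rw [hx r hr])
    have hcase : ∀ t ∈ Icc a b, t ∈ Ico a s ∨ t ∈ Icc s b := fun t ht =>
      (lt_or_ge t s).imp (fun h => ⟨ht.1, h⟩) fun h => ⟨h, ht.2⟩
    have hIco : ∀ t ∈ Ico a s, t ∈ Icc a b := fun t ht => ⟨ht.1, ht.2.le.trans hs.2⟩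
    constructor
    · intro H t ht
      rcases hcase t ht with ht' | ht'
      · exact (hq t ht'.2).1 (H t ht)
      · refine (hp (fun r hr => ?_) t ht').1 (H t ht)
        rw [(hq r hr.2).1 (H r (hIco r hr)), stepSystem_eq_of_quiet hc _ (h1 r hr.2)]
    · intro H t ht
      rcases hcase t ht with ht' | ht'
      · exact (hq t ht'.2).2 (H t ht)
      · refine (hp (fun r hr => ?_) t ht').2 (H t ht)
        rw [H r (hIco r hr), stepSystem_eq_of_quiet hc _ (h1 r hr.2)]
  · refine forall₂_congr fun t ht => ?_
    have hta : t = a := le_antisymm (ht.2.trans hba) ht.1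
    subst hta
    rw [stepSystem_self hc]
    refine iff_of_true (fun i => ?_) rfl
    exact ((isQuiet_of_le le_rfl).queueIncrement_iff (hC i)).2 rfl

/-- Two systems which agree at server `i` before a cell with at most one noise point also agree in
the cell if there is no noise point at a level between the two rates. -/
theorem AtMostOne.eq_of_band {c' : ℝ≥0 → ι → (ι → ℕ) → ℝ} {x' : ι → ℝ≥0 → ℕ} {δ : ℝ}
    (h : AtMostOne N K a b) (hc : IsRate c K) (hc' : IsRate c' K)
    (hx : ∀ t ∈ Icc a b, SystemIncrement N c x a t)
    (hx' : ∀ t ∈ Icc a b, SystemIncrement N c' x' a t) {i : ι} (hi : x i a = x' i a)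
    (hδ : ∀ r ∈ Ioc a b, ∀ u, |c r i u - c a i u| ≤ δ)
    (hδ' : ∀ r ∈ Ioc a b, ∀ u, |c' r i u - c' a i u| ≤ δ)
    (hband : (N i).2 (Ioc a b ×ˢ {y : ℝ≥0 | (y : ℝ) ∈
      Icc (min (c a i fun k => x k a) (c' a i fun k => x' k a) - δ)
        (max (c a i fun k => x k a) (c' a i fun k => x' k a) + δ)}) = 0) :
    ∀ t ∈ Icc a b, x i t = x' i t := by
  intro t ht
  have h1 := congrFun ((h.systemIncrement_iff hc).1 hx t ht) i
  have h2 := congrFun ((h.systemIncrement_iff hc').1 hx' t ht) i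
  rw [h1, h2]
  simp only [stepSystem]
  set u := fun k => x k a
  set u' := fun k => x' k a
  have hμ : (N i).2 {p | p.1 ∈ Ioc a t ∧ (p.2 : ℝ) ≤ c p.1 i u} =
      (N i).2 {p | p.1 ∈ Ioc a t ∧ (p.2 : ℝ) ≤ c' p.1 i u'} := by
    -- The two acceptance regions differ only inside the band: within the cell each level moves by
    -- at most `δ` from its value at `a`.
    have key : ∀ A B : Set (ℝ≥0 × ℝ≥0), A ⊆ B ∪ (Ioc a b ×ˢ {y : ℝ≥0 | (y : ℝ) ∈
        Icc (min (c a i u) (c' a i u') - δ) (max (c a i u) (c' a i u') + δ)}) →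
        (N i).2 A ≤ (N i).2 B := fun A B hAB => by
      refine (measure_mono hAB).trans ((measure_union_le _ _).trans_eq ?_)
      rw [hband, add_zero]
    refine le_antisymm (key _ _ fun p hp => ?_) (key _ _ fun p hp => ?_)
    all_goals
      have hpb : p.1 ∈ Ioc a b := ⟨hp.1.1, hp.1.2.trans ht.2⟩
      have e1 := abs_le.1 (hδ p.1 hpb u)
      have e2 := abs_le.1 (hδ' p.1 hpb u')
      have hp2 := hp.2
      have m1 := min_le_left (c a i u) (c' a i u')
      have m2 := min_le_right (c a i u) (c' a i u')
      have m3 := le_max_left (c a i u) (c' a i u')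
      have m4 := le_max_right (c a i u) (c' a i u')
    · by_cases hle : (p.2 : ℝ) ≤ c' p.1 i u'
      · exact Or.inl ⟨hp.1, hle⟩
      · refine Or.inr ⟨hpb, ?_, ?_⟩ <;> linarith [not_le.1 hle]
    · by_cases hle : (p.2 : ℝ) ≤ c p.1 i u
      · exact Or.inl ⟨hp.1, hle⟩
      · refine Or.inr ⟨hpb, ?_, ?_⟩ <;> linarith [not_le.1 hle]
  simp only [stepQueue]
  rw [hμ, hi]

/-! ### Uniqueness -/

/-- The queue lengths along the grid `τ`, computed as if there was at most one noise point in each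
cell of the grid. -/
def euler (N : ι → Noise) (c : ℝ≥0 → ι → (ι → ℕ) → ℝ) (u : ι → ℕ) (τ : ℕ → ℝ≥0) : ℕ → ι → ℕ
  | 0 => u
  | k + 1 => stepSystem N c (euler N c u τ k) (τ k) (τ (k + 1))

theorem systemIncrement_of_le (hc : IsRate c K)
    (hN : ∀ i, IsLocallyFiniteNoise (N i).1 (N i).2 K) (hab : a ≤ b) (hbt : b ≤ t)
    (hb : SystemIncrement N c x a b) (ht : SystemIncrement N c x a t) :
    SystemIncrement N c x b t := fun i =>
  (queueIncrement_iff_of_le (fun _ => hc.le _ _ _) (hN i) hab hbt (hb i)).1 (ht i)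

/-- By restarting at each grid time, the explicit formula for one cell is iterated. Uniqueness
follows because the result involves only the initial state and the noise. -/
theorem eq_euler (hc : IsRate c K) (hN : ∀ i, IsLocallyFiniteNoise (N i).1 (N i).2 K)
    {τ : ℕ → ℝ≥0} (hτ : Monotone τ) (h0 : τ 0 = 0) (M : ℕ)
    (hone : ∀ k < M, AtMostOne N K (τ k) (τ (k + 1)))
    (hx : ∀ t ≤ τ M, SystemIncrement N c x 0 t) :
    (fun i => x i (τ M)) = euler N c (fun i => x i 0) τ M := by
  induction M with
  | zero => rw [h0]; rfl
  | succ M ih =>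
    have hle : τ M ≤ τ (M + 1) := hτ (Nat.le_succ M)
    have h1 := ih (fun k hk => hone k (hk.trans (Nat.lt_succ_self M))) fun t ht =>
      hx t (ht.trans hle)
    have h2 := ((hone M (Nat.lt_succ_self M)).systemIncrement_iff hc (x := x)).1
      (fun t ht => systemIncrement_of_le hc hN zero_le ht.1 (hx _ hle) (hx t ht.2))
      (τ (M + 1)) ⟨hle, le_rfl⟩
    rw [h2, h1]
    rfl

/-- The grid of mesh `1 / (n + 1)`, stopped at `t`. -/
def grid (n : ℕ) (t : ℝ≥0) (k : ℕ) : ℝ≥0 := min ((k : ℝ≥0) / ((n : ℝ≥0) + 1)) t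

theorem monotone_grid (n : ℕ) (t : ℝ≥0) : Monotone (grid n t) := fun k l hkl =>
  min_le_min_right _ (by gcongr)

theorem grid_zero (n : ℕ) (t : ℝ≥0) : grid n t 0 = 0 := by simp [grid]

theorem grid_eq {n T : ℕ} (ht : t ≤ T) : grid n t (T * (n + 1)) = t := by
  have h : ((T * (n + 1) : ℕ) : ℝ≥0) / ((n : ℝ≥0) + 1) = T := by
    push_cast
    field_simp
  rw [grid, h, min_eq_right ht]

/-- All cells of mesh `1 / (n + 1)` in `[0, T]` contain at most one noise point. -/
def IsGoodMesh (N : ι → Noise) (K : ℝ≥0) (n T : ℕ) : Prop :=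
  ∀ k < T * (n + 1), AtMostOne N K ((k : ℝ≥0) / ((n : ℝ≥0) + 1)) (((k + 1 : ℕ) : ℝ≥0) / ((n : ℝ≥0) + 1))

theorem IsGoodMesh.atMostOne_grid {n T : ℕ} (h : IsGoodMesh N K n T) (t : ℝ≥0) {k : ℕ}
    (hk : k < T * (n + 1)) : AtMostOne N K (grid n t k) (grid n t (k + 1)) := by
  rcases le_total t ((k : ℝ≥0) / ((n : ℝ≥0) + 1)) with h1 | h1
  · refine Or.inl fun i => isQuiet_of_le ?_
    rw [grid, grid, min_eq_right h1]
    exact min_le_right _ _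
  · rw [grid, min_eq_left h1]
    exact (h k hk).mono (min_le_left _ _)

theorem IsGoodMesh.eq_euler {n T : ℕ} (h : IsGoodMesh N K n T) (hc : IsRate c K)
    (hN : ∀ i, IsLocallyFiniteNoise (N i).1 (N i).2 K) (ht : t ≤ T)
    (hx : ∀ s ≤ t, SystemIncrement N c x 0 s) :
    (fun i => x i t) = euler N c (fun i => x i 0) (grid n t) (T * (n + 1)) := by
  have := JSQ.eq_euler hc hN (monotone_grid n t) (grid_zero n t) (T * (n + 1))
    (fun k hk => h.atMostOne_grid t hk) (x := x) (by rwa [grid_eq ht])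
  rwa [grid_eq ht] at this

theorem IsGoodMesh.unique {n T : ℕ} (h : IsGoodMesh N K n T) (hc : IsRate c K)
    (hN : ∀ i, IsLocallyFiniteNoise (N i).1 (N i).2 K) (ht : t ≤ T) {y : ι → ℝ≥0 → ℕ}
    (h0 : ∀ i, x i 0 = y i 0)
    (hx : ∀ s ≤ t, SystemIncrement N c x 0 s) (hy : ∀ s ≤ t, SystemIncrement N c y 0 s) (i : ι) :
    x i t = y i t := by
  have h1 := h.eq_euler hc hN ht hx
  have h2 := h.eq_euler hc hN ht hy
  rw [← funext h0, ← h1] at h2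
  exact (congrFun h2 i).symm

/-! ### Existence -/

/-- `x` is locally constant to the right of each time before `T` and to the left of each time up
to `T`. -/
structure IsStepOn (x : ι → ℝ≥0 → ℕ) (T : ℝ≥0) : Prop where
  right : ∀ t < T, ∃ u > t, ∀ s ∈ Ico t u, ∀ i, x i s = x i t
  left : ∀ t ≤ T, 0 < t → ∃ u < t, ∃ e : ι → ℕ, ∀ s ∈ Ioo u t, ∀ i, x i s = e i

theorem systemIncrement_congr {y : ι → ℝ≥0 → ℕ} (hat : a ≤ t) (h : ∀ r ≤ t, ∀ i, x i r = y i r) :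
    SystemIncrement N c x a t ↔ SystemIncrement N c y a t := by
  refine forall_congr' fun i => queueIncrement_congr hat (fun r hr => h r hr i) fun r hr => ?_
  rw [show (fun k => x k r) = fun k => y k r from funext (h r hr)]

/-- The explicit formula for one cell continues the solution. The step structure is carried along
because it gives the càdlàg property at the end. -/
theorem exists_extension (hc : IsRate c K) (hN : ∀ i, IsLocallyFiniteNoise (N i).1 (N i).2 K)
    (hone : AtMostOne N K a b) (hab : a < b) (hx : ∀ t ≤ a, SystemIncrement N c x 0 t)
    (hstep : IsStepOn x a) :
    ∃ y : ι → ℝ≥0 → ℕ, (∀ i, y i 0 = x i 0) ∧ (∀ t ≤ b, SystemIncrement N c y 0 t) ∧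
      IsStepOn y b := by
  set u : ι → ℕ := fun i => x i a
  set y : ι → ℝ≥0 → ℕ := fun i t => if t ≤ a then x i t else stepSystem N c u a t i with hy
  have hya : ∀ t ≤ a, ∀ i, y i t = x i t := fun t ht i => by simp [hy, ht]
  have hyb : ∀ t, a ≤ t → ∀ i, y i t = stepSystem N c u a t i := fun t ht i => by
    rcases eq_or_lt_of_le ht with rfl | ht
    · rw [hya a le_rfl, stepSystem_self hc]
    · simp [hy, not_le.2 ht]
  obtain ⟨s, hs, hs1, hs2⟩ := hone.exists_jump_stepSystem hc hab u
  refine ⟨y, fun i => hya 0 zero_le i, fun t ht => ?_, ?_, ?_⟩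
  · rcases le_total t a with hta | hat
    · exact (systemIncrement_congr zero_le fun r hr => hya r (hr.trans hta)).2 (hx t hta)
    · have h1 : SystemIncrement N c y 0 a :=
        (systemIncrement_congr zero_le fun r hr => hya r hr).2 (hx a le_rfl)
      have h2 := (hone.systemIncrement_iff hc (x := y)).2 (fun t ht => by
        rw [show (fun i => y i a) = u from funext (hya a le_rfl)]
        exact funext (hyb t ht.1)) t ⟨hat, ht⟩
      exact fun i => (queueIncrement_iff_of_le (fun _ => hc.le _ _ _) (hN i) zero_le hat
        (h1 i)).2 (h2 i)
  · intro t ht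
    rcases lt_or_ge t a with hta | hat
    · obtain ⟨v, hv, h⟩ := hstep.right t hta
      refine ⟨min v a, lt_min hv hta, fun r hr i => ?_⟩
      have hra : r < a := hr.2.trans_le (min_le_right _ _)
      rw [hya r hra.le, hya t hta.le]
      exact h r ⟨hr.1, hr.2.trans_le (min_le_left _ _)⟩ i
    rcases lt_or_ge t s with hts | hst
    · refine ⟨s, hts, fun r hr i => ?_⟩
      rw [hyb r (hat.trans hr.1), hyb t hat, hs1 r hr.2, hs1 t hts]
    · refine ⟨b, ht, fun r hr i => ?_⟩
      rw [hyb r (hat.trans hr.1), hyb t hat, hs2 r ⟨hst.trans hr.1, hr.2.le⟩, hs2 t ⟨hst, ht.le⟩]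
  · intro t ht h0
    rcases le_or_gt t a with hta | hat
    · obtain ⟨v, hv, e, h⟩ := hstep.left t hta h0
      exact ⟨v, hv, e, fun r hr i => by rw [hya r (hr.2.le.trans hta)]; exact h r hr i⟩
    rcases le_or_gt t s with hts | hst
    · refine ⟨a, hat, u, fun r hr i => ?_⟩
      rw [hyb r hr.1.le, hs1 r (hr.2.trans_le hts)]
    · refine ⟨s, hst, stepSystem N c u a s, fun r hr i => ?_⟩
      rw [hyb r (hs.1.trans hr.1).le, hs2 r ⟨hr.1.le, hr.2.le.trans ht⟩]

theorem IsGoodMesh.exists_solution {n T : ℕ} (h : IsGoodMesh N K n T) (hc : IsRate c K)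
    (hN : ∀ i, IsLocallyFiniteNoise (N i).1 (N i).2 K) (u : ι → ℕ) :
    ∃ x : ι → ℝ≥0 → ℕ, (∀ i, x i 0 = u i) ∧ (∀ t ≤ (T : ℝ≥0), SystemIncrement N c x 0 t) ∧
      IsStepOn x T := by
  have key : ∀ k ≤ T * (n + 1), ∃ x : ι → ℝ≥0 → ℕ, (∀ i, x i 0 = u i) ∧
      (∀ t ≤ (k : ℝ≥0) / ((n : ℝ≥0) + 1), SystemIncrement N c x 0 t) ∧
      IsStepOn x ((k : ℝ≥0) / ((n : ℝ≥0) + 1)) := by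
    intro k
    induction k with
    | zero =>
      intro _
      refine ⟨fun i _ => u i, fun _ => rfl, fun t ht i => ?_, ⟨fun t ht => ?_, fun t ht h0 => ?_⟩⟩
      · have ht0 : t = 0 := by simpa using ht
        rw [ht0]
        exact ((isQuiet_of_le le_rfl).queueIncrement_iff (fun _ => hc.le _ _ _)).2 rfl
      · simp at ht
      · have ht0 : t = 0 := by simpa using ht
        exact absurd ht0 h0.ne'
    | succ k ih =>
      intro hk
      obtain ⟨x, h0, hx, hstep⟩ := ih (by omega)
      obtain ⟨y, hy0, hy, hystep⟩ := exists_extension hc hN (h k (by omega)) (by gcongr; simp)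
        hx hstep
      exact ⟨y, fun i => (hy0 i).trans (h0 i), hy, hystep⟩
  have h1 : ((T * (n + 1) : ℕ) : ℝ≥0) / ((n : ℝ≥0) + 1) = T := by
    push_cast
    field_simp
  have := key _ le_rfl
  rwa [h1] at this

/-- Solutions on `[0, T]` for different `T` agree where both are defined, by uniqueness, and are
glued together. -/
theorem exists_system_solution (hc : IsRate c K)
    (hN : ∀ i, IsLocallyFiniteNoise (N i).1 (N i).2 K) (hgood : ∀ T, ∃ n, IsGoodMesh N K n T)
    (u : ι → ℕ) : ∃ y : ι → CadlagPath ℕ, (∀ i, y i 0 = u i) ∧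
      ∀ i, SolvesQueueEquation (y i) (fun t => c t i fun k => y k t) (N i).1 (N i).2 := by
  choose n hn using hgood
  choose x h0 hx hstep using fun T => (hn T).exists_solution hc hN u
  have hagree : ∀ (S T : ℕ) (t : ℝ≥0), t ≤ S → t ≤ T → ∀ i, x S i t = x T i t :=
    fun S T t hS hT i => (hn S).unique hc hN hS (fun i => (h0 S i).trans (h0 T i).symm)
      (fun s hs => hx S s (hs.trans hS)) (fun s hs => hx T s (hs.trans hT)) i
  set y : ι → ℝ≥0 → ℕ := fun i t => x ⌈t⌉₊ i t
  have hy : ∀ (T : ℕ) (t : ℝ≥0), t ≤ T → ∀ i, y i t = x T i t := fun T t ht i =>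
    hagree _ _ t (Nat.le_ceil t) ht i
  have hright : ∀ i t, ∃ u > t, ∀ s ∈ Ico t u, y i s = y i t := by
    intro i t
    -- Right continuity at `t` needs room to the right, hence the solution with horizon `⌈t⌉ + 1`
    -- instead of `⌈t⌉`.
    have htT : t < (⌈t⌉₊ + 1 : ℕ) := (Nat.le_ceil t).trans_lt (by exact_mod_cast Nat.lt_succ_self _)
    obtain ⟨v, hv, h⟩ := (hstep (⌈t⌉₊ + 1)).right t htT
    refine ⟨min v (⌈t⌉₊ + 1 : ℕ), lt_min hv htT, fun s hs => ?_⟩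
    rw [hy _ s (hs.2.le.trans (min_le_right _ _)), hy _ t htT.le]
    exact h s ⟨hs.1, hs.2.trans_le (min_le_left _ _)⟩ i
  refine ⟨fun i => ⟨y i, fun t => ?_, fun t => ?_⟩, fun i => h0 _ i, fun i => ?_⟩
  · obtain ⟨v, hv, h⟩ := hright i t
    refine tendsto_nhds_of_eventually_eq ?_
    filter_upwards [Ico_mem_nhdsGE hv] with s hs using h s hs
  · rcases eq_or_lt_of_le (zero_le : 0 ≤ t) with ht | ht
    · refine ⟨0, ?_⟩
      rw [← ht]
      simp
    obtain ⟨v, hv, e, h⟩ := (hstep ⌈t⌉₊).left t (Nat.le_ceil t) ht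
    refine ⟨e i, tendsto_nhds_of_eventually_eq ?_⟩
    filter_upwards [Ioo_mem_nhdsLT hv] with s hs
    rw [hy ⌈t⌉₊ s (hs.2.le.trans (Nat.le_ceil t))]
    exact h s hs i
  · refine (solvesQueueEquation_iff (fun _ => hc.le _ _ _) (hN i)).2 fun t => ?_
    exact (systemIncrement_congr zero_le fun r hr j =>
      hy ⌈t⌉₊ r (hr.trans (Nat.le_ceil t)) j).2 (hx ⌈t⌉₊ t (Nat.le_ceil t)) i

end System


/-! ### Independence -/

section Independence
variable {Ω α β γ : Type*} [MeasurableSpace Ω] [MeasurableSpace α] [MeasurableSpace β]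
  [MeasurableSpace γ] {P : Measure Ω} [IsProbabilityMeasure P] {A : Ω → α} {B : Ω → β} {C : Ω → γ}

/-- The two hypotheses say that the law of `(A, B, C)` is the product of the three laws; regrouping
the factors gives the claim. -/
theorem indepFun_prodMk_left (hA : Measurable A) (hB : Measurable B) (hC : Measurable C)
    (h : IndepFun A (fun ω => (B ω, C ω)) P) (h' : IndepFun B C P) :
    IndepFun (fun ω => (A ω, B ω)) C P := by
  have hAB : IndepFun A B P := h.comp measurable_id measurable_fst
  have e1 := (indepFun_iff_map_prod_eq_prod_map_map hA.aemeasurable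
    (hB.prodMk hC).aemeasurable).1 h
  have e2 := (indepFun_iff_map_prod_eq_prod_map_map hB.aemeasurable hC.aemeasurable).1 h'
  have e3 := (indepFun_iff_map_prod_eq_prod_map_map hA.aemeasurable hB.aemeasurable).1 hAB
  refine (indepFun_iff_map_prod_eq_prod_map_map (hA.prodMk hB).aemeasurable hC.aemeasurable).2 ?_
  have : IsProbabilityMeasure (P.map A) := Measure.isProbabilityMeasure_map hA.aemeasurable
  have : IsProbabilityMeasure (P.map B) := Measure.isProbabilityMeasure_map hB.aemeasurable
  have : IsProbabilityMeasure (P.map C) := Measure.isProbabilityMeasure_map hC.aemeasurable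
  refine MeasurableEquiv.prodAssoc.map_measurableEquiv_injective ?_
  rw [e3, Measure.prodAssoc_prod, ← e2, ← e1,
    Measure.map_map MeasurableEquiv.prodAssoc.measurable ((hA.prodMk hB).prodMk hC)]
  rfl

end Independence

/-! ### Families of noises -/

/-- The intensity of the arrival noise. -/
def arrivalIntensity (lam : ℝ≥0) : Measure (ℝ≥0 × ℝ≥0) := lam • lebesgue.prod lebesgue

instance (lam : ℝ≥0) : SigmaFinite (arrivalIntensity lam) := by
  unfold arrivalIntensity; infer_instance

theorem arrivalIntensity_prod (lam : ℝ≥0) (A B : Set ℝ≥0) :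
    arrivalIntensity lam (A ×ˢ B) = lam * (lebesgue A * lebesgue B) := by
  rw [arrivalIntensity, Measure.smul_apply, Measure.prod_prod, ENNReal.smul_def, smul_eq_mul]

/-- Mutually independent noises of the servers `i : ι`. -/
structure IsNoiseFamily {Ω ι : Type*} [MeasurableSpace Ω] (P : Measure Ω) (lam : ℝ≥0)
    (N : Ω → ι → Noise) : Prop where
  service : ∀ i, IsPoissonRandomMeasure P lebesgue fun ω => (N ω i).1
  arrival : ∀ i, IsPoissonRandomMeasure P (arrivalIntensity lam) fun ω => (N ω i).2
  indep_pair : ∀ i, IndepFun (fun ω => (N ω i).1) (fun ω => (N ω i).2) P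
  indep : iIndepFun (fun i ω => N ω i) P

theorem IsDrivingNoise.isNoiseFamily {Ω ι : Type*} [MeasurableSpace Ω] {P : Measure Ω} {lam : ℝ≥0}
    {Svc : ℕ → Ω → Measure ℝ≥0} {Arr : ℕ → Ω → Measure (ℝ≥0 × ℝ≥0)}
    (h : IsDrivingNoise P lam Svc Arr) {e : ι → ℕ} (he : Function.Injective e) :
    IsNoiseFamily P lam fun ω i => (Svc (e i) ω, Arr (e i) ω) where
  service i := h.service (e i)
  arrival i := h.arrival (e i)
  indep_pair i := h.indep_pair (e i)
  indep := h.indep.precomp he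

/-- Noises which are integer valued and locally finite. -/
structure IsRegularNoise (N : Noise) (K : ℝ≥0) : Prop extends
    IsLocallyFiniteNoise N.1 N.2 K where
  service_nat : ∀ T : ℕ, ∀ A, MeasurableSet A → ∃ n : ℕ, N.1 (A ∩ Iic (T : ℝ≥0)) = n
  arrival_nat : ∀ T : ℕ, ∀ A, MeasurableSet A → ∃ n : ℕ, N.2 (A ∩ Iic (T : ℝ≥0) ×ˢ Iic K) = n

/-- An integer valued measure of total mass one takes only the values zero and one, and on a
standard Borel space such a measure is a point mass. -/
theorem exists_restrict_eq_dirac {S : Type*} [MeasurableSpace S] [StandardBorelSpace S]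
    {m : Measure S} {B : Set S} (hB : MeasurableSet B) (hm : m B = 1)
    (h : ∀ A, MeasurableSet A → ∃ n : ℕ, m (A ∩ B) = n) :
    ∃ s ∈ B, m.restrict B = Measure.dirac s := by
  have h1 : IsZeroOneMeasure (m.restrict B) := by
    refine ⟨fun A hA => ?_⟩
    rw [Measure.restrict_apply hA]
    obtain ⟨n, hn⟩ := h A hA
    have hle : m (A ∩ B) ≤ 1 := (measure_mono inter_subset_right).trans_eq hm
    rw [hn] at hle ⊢
    have : n ≤ 1 := by exact_mod_cast hle
    interval_cases n <;> simp
  have h2 : NeZero (m.restrict B) := ⟨fun h0 => by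
    have : m.restrict B B = 0 := by rw [h0]; rfl
    rw [Measure.restrict_apply_self, hm] at this
    exact one_ne_zero this⟩
  obtain ⟨s, hs⟩ := IsZeroOneMeasure.exists_eq_dirac (μ := m.restrict B)
  refine ⟨s, ?_, hs⟩
  by_contra hcon
  have : m.restrict B B = 0 := by
    rw [hs, Measure.dirac_apply' _ hB]; simp [hcon]
  rw [Measure.restrict_apply_self, hm] at this
  exact one_ne_zero this

section Family
variable {Ω ι : Type*} [MeasurableSpace Ω] [Fintype ι]

/-- The number of noise points in `(a, b]`. -/
def cellCount (N : ι → Noise) (K a b : ℝ≥0) : ℝ≥0∞ :=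
  ∑ i, ((N i).1 (Ioc a b) + (N i).2 (Ioc a b ×ˢ Iic K))

omit [Fintype ι] in
theorem measurable_service {A : Set ℝ≥0} (hA : MeasurableSet A) (i : ι) :
    Measurable fun N : ι → Noise => (N i).1 A :=
  (Measure.measurable_coe hA).comp (measurable_fst.comp (measurable_pi_apply i))

omit [Fintype ι] in
theorem measurable_arrival {A : Set (ℝ≥0 × ℝ≥0)} (hA : MeasurableSet A) (i : ι) :
    Measurable fun N : ι → Noise => (N i).2 A :=
  (Measure.measurable_coe hA).comp (measurable_snd.comp (measurable_pi_apply i))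

theorem measurable_cellCount (K a b : ℝ≥0) :
    Measurable fun N : ι → Noise => cellCount N K a b :=
  Finset.measurable_sum _ fun i _ => (measurable_service measurableSet_Ioc i).add
    (measurable_arrival (measurableSet_Ioc.prod measurableSet_Iic) i)

/-- The masses are integers with sum at most one, so either all vanish or exactly one equals one,
and in the latter case that noise is a point mass on the cell. -/
theorem atMostOne_of_cellCount_le {N : ι → Noise} {K a b : ℝ≥0}
    (hN : ∀ i, IsRegularNoise (N i) K) (h : cellCount N K a b ≤ 1) : AtMostOne N K a b := by
  classical
  have hone : ∀ i, (N i).1 (Ioc a b) + (N i).2 (Ioc a b ×ˢ Iic K) +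
      ∑ j ∈ Finset.univ.erase i, ((N j).1 (Ioc a b) + (N j).2 (Ioc a b ×ˢ Iic K)) ≤ 1 := fun i => by
    rwa [cellCount, ← Finset.add_sum_erase _ _ (Finset.mem_univ i)] at h
  obtain ⟨T, hT⟩ := exists_nat_ge b
  have hsub : Ioc a b ⊆ Iic (T : ℝ≥0) := fun s hs => hs.2.trans hT
  have hs1 : ∀ i A, MeasurableSet A → ∃ n : ℕ, (N i).1 (A ∩ Ioc a b) = n := fun i A hA => by
    obtain ⟨n, hn⟩ := (hN i).service_nat T (A ∩ Ioc a b) (hA.inter measurableSet_Ioc)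
    rw [inter_assoc, inter_eq_left.2 hsub] at hn
    exact ⟨n, hn⟩
  have hs2 : ∀ i A, MeasurableSet A → ∃ n : ℕ, (N i).2 (A ∩ Ioc a b ×ˢ Iic K) = n :=
    fun i A hA => by
    obtain ⟨n, hn⟩ := (hN i).arrival_nat T (A ∩ Ioc a b ×ˢ Iic K)
      (hA.inter (measurableSet_Ioc.prod measurableSet_Iic))
    rw [inter_assoc, inter_eq_left.2 (prod_mono_left hsub)] at hn
    exact ⟨n, hn⟩
  have hge : ∀ z : ℝ≥0∞, (∃ n : ℕ, z = n) → z ≠ 0 → 1 ≤ z := by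
    rintro _ ⟨n, rfl⟩ h0
    have : n ≠ 0 := by rintro rfl; simp at h0
    exact_mod_cast Nat.one_le_iff_ne_zero.2 this
  have hzero : ∀ x y z : ℝ≥0∞, x + y + z ≤ 1 → 1 ≤ x → x = 1 ∧ y = 0 ∧ z = 0 := by
    intro x y z hxyz hx
    have hx1 : x = 1 := le_antisymm ((le_self_add.trans le_self_add).trans hxyz) hx
    subst hx1
    have : (1 : ℝ≥0∞) + (y + z) ≤ 1 + 0 := by rwa [add_zero, ← add_assoc]
    have := (ENNReal.add_le_add_iff_left ENNReal.one_ne_top).1 this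
    have := add_eq_zero.1 (nonpos_iff_eq_zero.1 this)
    exact ⟨rfl, this⟩
  have hrest : ∀ i, ∑ j ∈ Finset.univ.erase i,
      ((N j).1 (Ioc a b) + (N j).2 (Ioc a b ×ˢ Iic K)) = 0 →
      ∀ j ≠ i, IsQuiet (N j).1 (N j).2 K a b := by
    intro i hi j hj
    have := (Finset.sum_eq_zero_iff.1 hi) j (Finset.mem_erase.2 ⟨hj, Finset.mem_univ j⟩)
    exact add_eq_zero.1 this
  by_cases hall : ∀ i, IsQuiet (N i).1 (N i).2 K a b
  · exact Or.inl hall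
  obtain ⟨i, hi⟩ := not_forall.1 hall
  by_cases h1 : (N i).1 (Ioc a b) = 0
  · have h2 : (N i).2 (Ioc a b ×ˢ Iic K) ≠ 0 := fun h2 => hi ⟨h1, h2⟩
    obtain ⟨n, hn⟩ := hs2 i univ MeasurableSet.univ
    rw [univ_inter] at hn
    have h3 := hone i
    rw [add_comm ((N i).1 (Ioc a b))] at h3
    obtain ⟨e1, _, e3⟩ := hzero _ _ _ h3 (hge _ ⟨n, hn⟩ h2)
    obtain ⟨⟨s, y⟩, hsB, hs⟩ := exists_restrict_eq_dirac
      (measurableSet_Ioc.prod measurableSet_Iic) e1 (hs2 i)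
    exact Or.inr ⟨i, s, hsB.1, Or.inr ⟨y, h1, hs⟩, hrest i e3⟩
  · obtain ⟨n, hn⟩ := hs1 i univ MeasurableSet.univ
    rw [univ_inter] at hn
    obtain ⟨e1, e2, e3⟩ := hzero _ _ _ (hone i) (hge _ ⟨n, hn⟩ h1)
    obtain ⟨s, hsB, hs⟩ := exists_restrict_eq_dirac measurableSet_Ioc e1 (hs1 i)
    exact Or.inr ⟨i, s, hsB, Or.inl ⟨hs, e2⟩, hrest i e3⟩

/-- All cells of mesh `1 / (n + 1)` in `[0, T]` have total count at most one. -/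
def IsCountedMesh (N : ι → Noise) (K : ℝ≥0) (n T : ℕ) : Prop :=
  ∀ k < T * (n + 1),
    cellCount N K ((k : ℝ≥0) / ((n : ℝ≥0) + 1)) (((k + 1 : ℕ) : ℝ≥0) / ((n : ℝ≥0) + 1)) ≤ 1

theorem measurableSet_isCountedMesh (K : ℝ≥0) (n T : ℕ) :
    MeasurableSet {N : ι → Noise | IsCountedMesh N K n T} := by
  have : {N : ι → Noise | IsCountedMesh N K n T} = ⋂ k, ⋂ (_ : k < T * (n + 1)),
      {N | cellCount N K ((k : ℝ≥0) / ((n : ℝ≥0) + 1)) (((k + 1 : ℕ) : ℝ≥0) / ((n : ℝ≥0) + 1)) ≤ 1} := by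
    ext; simp [IsCountedMesh]
  rw [this]
  exact MeasurableSet.iInter fun k => MeasurableSet.iInter fun _ =>
    measurableSet_le (measurable_cellCount _ _ _) measurable_const

theorem IsCountedMesh.isGoodMesh {N : ι → Noise} {K : ℝ≥0} {n T : ℕ}
    (h : IsCountedMesh N K n T) (hN : ∀ i, IsRegularNoise (N i) K) : IsGoodMesh N K n T :=
  fun k hk => atMostOne_of_cellCount_le hN (h k hk)

theorem sum_le_one_of_forall {J : Type*} [Fintype J] (f : J → ℝ≥0∞) (h1 : ∀ j, f j ≤ 1)
    (h2 : ∀ j k, j ≠ k → f j = 0 ∨ f k = 0) : ∑ j, f j ≤ 1 := by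
  classical
  by_cases h : ∃ j, f j ≠ 0
  · obtain ⟨j, hj⟩ := h
    rw [Finset.sum_eq_single j (fun k _ hk => (h2 j k hk.symm).resolve_left hj) (by simp)]
    exact h1 j
  · push Not at h
    simp [h]

/-- A sum above one needs a single term above one or two distinct nonzero terms. There are `card ^
2` such events, indexed by pairs with the diagonal for the first kind, and each has probability at
most `r ^ 2`. -/
theorem measure_sum_gt_one_le {J : Type*} [Fintype J] {P : Measure Ω}
    (f : J → Ω → ℝ≥0∞) (r : ℝ≥0∞)
    (h0 : ∀ j, P {ω | f j ω ≠ 0} ≤ r) (h1 : ∀ j, P {ω | ¬ f j ω ≤ 1} ≤ r ^ 2)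
    (hind : ∀ j k, j ≠ k → IndepFun (f j) (f k) P) :
    P {ω | ¬ ∑ j, f j ω ≤ 1} ≤ (Fintype.card J : ℝ≥0∞) ^ 2 * r ^ 2 := by
  classical
  set E : J × J → Set Ω := fun q => if q.1 = q.2 then {ω | ¬ f q.1 ω ≤ 1} else
    {ω | f q.1 ω ≠ 0} ∩ {ω | f q.2 ω ≠ 0}
  have hE : ∀ q, P (E q) ≤ r ^ 2 := by
    rintro ⟨j, k⟩
    by_cases hjk : j = k
    · simp only [E, hjk, if_true]; exact h1 k
    · simp only [E, hjk, if_false]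
      have := (hind j k hjk).measure_inter_preimage_eq_mul {0}ᶜ {0}ᶜ
        (measurableSet_singleton 0).compl (measurableSet_singleton 0).compl
      calc P ({ω | f j ω ≠ 0} ∩ {ω | f k ω ≠ 0}) = P {ω | f j ω ≠ 0} * P {ω | f k ω ≠ 0} := this
        _ ≤ r * r := mul_le_mul' (h0 j) (h0 k)
        _ = r ^ 2 := (sq r).symm
  have hsub : {ω | ¬ ∑ j, f j ω ≤ 1} ⊆ ⋃ q, E q := by
    intro ω hω
    by_contra hcon
    simp only [mem_iUnion, not_exists] at hcon
    refine hω (sum_le_one_of_forall _ (fun j => ?_) fun j k hjk => ?_)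
    · have := hcon (j, j)
      simpa [E] using this
    · have := hcon (j, k)
      simp only [E, hjk, if_false, mem_inter_iff, mem_ofPred_eq, not_and_or, not_not] at this
      exact this
  refine (measure_mono hsub).trans ((measure_iUnion_fintype_le P E).trans ?_)
  refine (Finset.sum_le_card_nsmul _ _ _ fun q _ => hE q).trans_eq ?_
  rw [Finset.card_univ, Fintype.card_prod, nsmul_eq_mul]
  push_cast
  ring

/-! ### Regularity and sparsity of a finite family of noises -/

namespace IsNoiseFamily

variable {P : Measure Ω} [IsProbabilityMeasure P] {lam : ℝ≥0} {N : Ω → ι → Noise}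

omit [Fintype ι] [IsProbabilityMeasure P] in
theorem measurable_apply (h : IsNoiseFamily P lam N) (i : ι) : Measurable fun ω => N ω i :=
  (h.service i).measurable.prodMk (h.arrival i).measurable

omit [Fintype ι] [IsProbabilityMeasure P] in
theorem measurable (h : IsNoiseFamily P lam N) : Measurable N :=
  measurable_pi_lambda _ h.measurable_apply

theorem arrivalIntensity_cell_le (lam K a b : ℝ≥0) :
    arrivalIntensity lam (Ioc a b ×ˢ Iic K) ≤ lam * K * ENNReal.ofReal (b - a) := by
  rw [arrivalIntensity_prod, mul_assoc, mul_comm (K : ℝ≥0∞)]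
  gcongr
  · exact lebesgue_Ioc_le a b
  · exact lebesgue_Iic_le K

omit [IsProbabilityMeasure P] in
theorem ae_isRegularNoise (h : IsNoiseFamily P lam N) (K : ℝ≥0) :
    ∀ᵐ ω ∂P, ∀ i, IsRegularNoise (N ω i) K := by
  rw [ae_all_iff]
  intro i
  have h1 : ∀ T : ℕ, lebesgue (Iic (T : ℝ≥0)) ≠ ∞ := fun T =>
    ((lebesgue_Iic_le _).trans_lt ENNReal.coe_lt_top).ne
  have h2 : ∀ T : ℕ, arrivalIntensity lam (Iic (T : ℝ≥0) ×ˢ Iic K) ≠ ∞ := fun T => by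
    rw [arrivalIntensity_prod]
    exact ENNReal.mul_ne_top ENNReal.coe_ne_top (ENNReal.mul_ne_top (h1 T)
      ((lebesgue_Iic_le _).trans_lt ENNReal.coe_lt_top).ne)
  have h3 : arrivalIntensity lam ({0} ×ˢ Iic K) = 0 := by
    rw [arrivalIntensity_prod, lebesgue_singleton]; simp
  filter_upwards [ae_all_iff.2 fun T : ℕ => (h.service i).ae_forall_natCast measurableSet_Iic (h1 T),
    ae_all_iff.2 fun T : ℕ => (h.arrival i).ae_forall_natCast
      (measurableSet_Iic.prod measurableSet_Iic) (h2 T),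
    (h.service i).ae_apply_eq_zero (measurableSet_singleton 0) (lebesgue_singleton 0),
    (h.arrival i).ae_apply_eq_zero ((measurableSet_singleton 0).prod measurableSet_Iic) h3]
    with ω e1 e2 e3 e4
  refine { service_ne_top := fun T => ?_, arrival_ne_top := fun T => ?_, service_zero := e3,
           arrival_zero := e4, service_nat := e1, arrival_nat := e2 }
  · obtain ⟨n, hn⟩ := exists_nat_ge T
    obtain ⟨m, hm⟩ := e1 n (Iic T) measurableSet_Iic
    rw [inter_eq_left.2 (Iic_subset_Iic.2 hn)] at hm
    rw [hm]; exact ENNReal.natCast_ne_top m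
  · obtain ⟨n, hn⟩ := exists_nat_ge T
    obtain ⟨m, hm⟩ := e2 n (Iic T ×ˢ Iic K) (measurableSet_Iic.prod measurableSet_Iic)
    rw [inter_eq_left.2 (prod_mono_left (Iic_subset_Iic.2 hn))] at hm
    rw [hm]; exact ENNReal.natCast_ne_top m

/-- The bound on the expected number of points of one noise in a cell, per unit of time. -/
theorem measure_cellCount_gt_one_le (h : IsNoiseFamily P lam N) (K a b : ℝ≥0) :
    P {ω | ¬ cellCount (N ω) K a b ≤ 1} ≤
      (2 * Fintype.card ι : ℝ≥0∞) ^ 2 * ((1 + lam * K) * ENNReal.ofReal (b - a)) ^ 2 := by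
  set f : ι ⊕ ι → Ω → ℝ≥0∞ := Sum.elim (fun i ω => (N ω i).1 (Ioc a b))
    fun i ω => (N ω i).2 (Ioc a b ×ˢ Iic K)
  have hsum : ∀ ω, cellCount (N ω) K a b = ∑ j, f j ω := fun ω => by
    simp [cellCount, f, Finset.sum_add_distrib]
  have hm2 : MeasurableSet (Ioc a b ×ˢ Iic K) := measurableSet_Ioc.prod measurableSet_Iic
  have i1 : lebesgue (Ioc a b) ≤ (1 + lam * K) * ENNReal.ofReal (b - a) :=
    (lebesgue_Ioc_le a b).trans (le_mul_of_one_le_left' le_self_add)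
  have i2 : arrivalIntensity lam (Ioc a b ×ˢ Iic K) ≤ (1 + lam * K) * ENNReal.ofReal (b - a) :=
    (arrivalIntensity_cell_le lam K a b).trans (by gcongr; exact le_add_self)
  have key := measure_sum_gt_one_le (P := P) f ((1 + lam * K) * ENNReal.ofReal (b - a)) ?_ ?_ ?_
  · simp only [hsum]
    refine key.trans_eq ?_
    rw [Fintype.card_sum]; push_cast; ring
  · rintro (i | i)
    · exact ((h.service i).measure_apply_ne_zero_le measurableSet_Ioc).trans i1
    · exact ((h.arrival i).measure_apply_ne_zero_le hm2).trans i2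
  · rintro (i | i)
    · exact ((h.service i).measure_two_le_le measurableSet_Ioc).trans (by gcongr)
    · exact ((h.arrival i).measure_two_le_le hm2).trans (by gcongr)
  · have m1 : Measurable fun m : Noise => m.1 (Ioc a b) :=
      (Measure.measurable_coe measurableSet_Ioc).comp measurable_fst
    have m2 : Measurable fun m : Noise => m.2 (Ioc a b ×ˢ Iic K) :=
      (Measure.measurable_coe hm2).comp measurable_snd
    have hsame : ∀ i, IndepFun (f (Sum.inl i)) (f (Sum.inr i)) P := fun i =>
      (h.indep_pair i).comp (Measure.measurable_coe measurableSet_Ioc)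
        (Measure.measurable_coe hm2)
    rintro (i | i) (j | j) hij
    · exact (h.indep.indepFun fun e => hij (congrArg _ e)).comp m1 m1
    · rcases eq_or_ne i j with rfl | hne
      · exact hsame i
      · exact (h.indep.indepFun hne).comp m1 m2
    · rcases eq_or_ne i j with rfl | hne
      · exact (hsame i).symm
      · exact (h.indep.indepFun hne).comp m2 m1
    · exact (h.indep.indepFun fun e => hij (congrArg _ e)).comp m2 m2

/-- There are `T * (n + 1)` cells, each with two or more points with probability of order `(n + 1) ^
(-2)`, so the mesh fails with probability of order `1 / (n + 1)`. -/
theorem tendsto_measure_not_isCountedMesh (h : IsNoiseFamily P lam N) (K : ℝ≥0) (T : ℕ) :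
    Tendsto (fun n => P {ω | ¬ IsCountedMesh (N ω) K n T}) atTop (𝓝 0) := by
  set A : ℝ≥0∞ := (2 * Fintype.card ι : ℝ≥0∞) ^ 2 * (1 + lam * K) ^ 2 * T with hA
  have hAtop : A ≠ ∞ := by
    refine ENNReal.mul_ne_top (ENNReal.mul_ne_top ?_ ?_) (ENNReal.natCast_ne_top T)
    · exact ENNReal.pow_ne_top (ENNReal.mul_ne_top (by simp) (by simp))
    · refine ENNReal.pow_ne_top (ENNReal.add_ne_top.2 ⟨by simp, ?_⟩)
      exact ENNReal.mul_ne_top ENNReal.coe_ne_top ENNReal.coe_ne_top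
  have hbound : ∀ n : ℕ, P {ω | ¬ IsCountedMesh (N ω) K n T} ≤
      A * ENNReal.ofReal (1 / ((n : ℝ) + 1)) := by
    intro n
    have hsub : {ω | ¬ IsCountedMesh (N ω) K n T} ⊆ ⋃ k ∈ Finset.range (T * (n + 1)),
        {ω | ¬ cellCount (N ω) K ((k : ℝ≥0) / ((n : ℝ≥0) + 1))
          (((k + 1 : ℕ) : ℝ≥0) / ((n : ℝ≥0) + 1)) ≤ 1} := by
      intro ω hω
      simp only [IsCountedMesh, mem_ofPred_eq] at hω
      push Not at hω
      obtain ⟨k, hk, hc⟩ := hω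
      exact mem_biUnion (Finset.mem_coe.2 (Finset.mem_range.2 hk)) (not_le.2 hc)
    refine (measure_mono hsub).trans ((measure_biUnion_finset_le _ _).trans ?_)
    refine (Finset.sum_le_card_nsmul _ _ ((2 * Fintype.card ι : ℝ≥0∞) ^ 2 *
      ((1 + lam * K) * ENNReal.ofReal (1 / ((n : ℝ) + 1))) ^ 2) fun k _ => ?_).trans_eq ?_
    · refine (h.measure_cellCount_gt_one_le K _ _).trans_eq ?_
      congr 4
      push_cast
      ring
    · rw [Finset.card_range, nsmul_eq_mul]
      have h1 : ENNReal.ofReal (1 / ((n : ℝ) + 1)) * ((n : ℝ≥0∞) + 1) = 1 := by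
        have : ((n : ℝ≥0∞) + 1) = ENNReal.ofReal ((n : ℝ) + 1) := by
          rw [ENNReal.ofReal_add (by positivity) zero_le_one]; simp
        rw [this, ← ENNReal.ofReal_mul (by positivity), one_div_mul_cancel (by positivity)]
        simp
      rw [hA]
      push_cast
      calc (T : ℝ≥0∞) * ((n : ℝ≥0∞) + 1) * ((2 * Fintype.card ι : ℝ≥0∞) ^ 2 *
            ((1 + lam * K) * ENNReal.ofReal (1 / ((n : ℝ) + 1))) ^ 2)
          = (2 * Fintype.card ι : ℝ≥0∞) ^ 2 * (1 + lam * K) ^ 2 * T *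
            (ENNReal.ofReal (1 / ((n : ℝ) + 1)) * ((n : ℝ≥0∞) + 1)) *
              ENNReal.ofReal (1 / ((n : ℝ) + 1)) := by ring
        _ = _ := by rw [h1, mul_one]
  have hlim : Tendsto (fun n : ℕ => A * ENNReal.ofReal (1 / ((n : ℝ) + 1))) atTop (𝓝 0) := by
    have h1 : Tendsto (fun n : ℕ => ENNReal.ofReal (1 / ((n : ℝ) + 1))) atTop (𝓝 0) := by
      have := ENNReal.tendsto_ofReal (tendsto_one_div_add_atTop_nhds_zero_nat (𝕜 := ℝ))
      rwa [ENNReal.ofReal_zero] at this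
    have := ENNReal.Tendsto.const_mul h1 (Or.inr hAtop)
    rwa [mul_zero] at this
  exact tendsto_of_tendsto_of_tendsto_of_le_of_le tendsto_const_nhds hlim (fun _ => zero_le) hbound

/-- Failure of every mesh is contained in the failure of each single mesh, whose probability tends
to zero. -/
theorem ae_exists_isCountedMesh (h : IsNoiseFamily P lam N) (K : ℝ≥0) :
    ∀ᵐ ω ∂P, ∀ T, ∃ n, IsCountedMesh (N ω) K n T := by
  rw [ae_all_iff]
  intro T
  rw [ae_iff]
  refine le_antisymm (ge_of_tendsto' (h.tendsto_measure_not_isCountedMesh K T) fun n =>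
    measure_mono fun ω hω => ?_) zero_le
  simp only [mem_ofPred_eq, not_exists] at hω
  exact hω n

end IsNoiseFamily

/-! ### Non-anticipation -/

/-- The set of states is countable, so only measurability in the noise for a fixed state has to be
checked. -/
theorem measurable_stepSystem {c : ℝ≥0 → ι → (ι → ℕ) → ℝ} {K : ℝ≥0} (hc : IsRate c K) (a t : ℝ≥0) :
    Measurable fun p : (ι → ℕ) × (ι → Noise) => stepSystem p.2 c p.1 a t := by
  refine measurable_from_prod_countable_right fun u => measurable_pi_lambda _ fun i => ?_
  simp only [stepSystem, stepQueue]
  have h1 : Measurable fun N : ι → Noise =>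
      count ((N i).2 {p | p.1 ∈ Ioc a t ∧ (p.2 : ℝ) ≤ c p.1 i u}) :=
    measurable_count.comp (measurable_arrival (measurableSet_acceptSet (hc.continuous i u) a t) i)
  have h2 : Measurable fun N : ι → Noise => count ((N i).1 (Ioc a t)) :=
    measurable_count.comp (measurable_service measurableSet_Ioc i)
  split_ifs
  · exact (measurable_const.add h1).sub h2
  · exact (measurable_const.add h1).sub measurable_const

theorem measurable_euler {c : ℝ≥0 → ι → (ι → ℕ) → ℝ} {K : ℝ≥0} (hc : IsRate c K) (τ : ℕ → ℝ≥0)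
    (k : ℕ) : Measurable fun p : (ι → ℕ) × (ι → Noise) => euler p.2 c p.1 τ k := by
  induction k with
  | zero => exact measurable_fst
  | succ k ih => exact (measurable_stepSystem hc _ _).comp (ih.prodMk measurable_snd)

open Classical in
/-- The noise of server `i` restricted to `[0, t]`; the other noises are not changed. -/
def restrictNoise (N : ι → Noise) (i : ι) (t : ℝ≥0) : ι → Noise := fun j =>
  if j = i then ((N i).1, (N i).2.restrict (Iic t ×ˢ univ)) else N j

-- The explicit scheme on a grid in `[0, t]` reads the arrivals of server `i` on `(0, t]` only; this
-- is how non-anticipation enters.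
omit [Fintype ι] in
theorem euler_restrictNoise (N : ι → Noise) {c : ℝ≥0 → ι → (ι → ℕ) → ℝ} {K : ℝ≥0}
    (hc : IsRate c K) (u : ι → ℕ) (i : ι) {t : ℝ≥0} {τ : ℕ → ℝ≥0} (hτ : ∀ k, τ k ≤ t) (k : ℕ) :
    euler (restrictNoise N i t) c u τ k = euler N c u τ k := by
  induction k with
  | zero => rfl
  | succ k ih =>
    simp only [euler, ih]
    funext j
    by_cases hj : j = i
    · subst hj
      simp only [stepSystem, restrictNoise, if_true, stepQueue]
      rw [Measure.restrict_apply (measurableSet_acceptSet (hc.continuous _ _) _ _),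
        inter_eq_left.2]
      intro p hp
      exact ⟨hp.1.2.trans (hτ _), mem_univ _⟩
    · simp [stepSystem, restrictNoise, hj]

/-- The initial state and the noise up to time `t` are independent of the arrival noise of server
`i` after time `t`. -/
theorem IsNoiseFamily.indepFun_restrictNoise {P : Measure Ω} [IsProbabilityMeasure P] {lam : ℝ≥0}
    {N : Ω → ι → Noise} (h : IsNoiseFamily P lam N) {U : Ω → ι → ℕ} (hU : Measurable U)
    (hUN : IndepFun U N P) (i : ι) (t : ℝ≥0) {B : Set (ℝ≥0 × ℝ≥0)} (hB : MeasurableSet B)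
    (hBt : B ⊆ Ioi t ×ˢ univ) :
    IndepFun (fun ω => (U ω, restrictNoise (N ω) i t)) (fun ω => (N ω i).2 B) P := by
  classical
  have hA : MeasurableSet (Iic t ×ˢ (univ : Set ℝ≥0)) := measurableSet_Iic.prod MeasurableSet.univ
  have hdisj : Disjoint (Iic t ×ˢ (univ : Set ℝ≥0)) B :=
    (Disjoint.set_prod_left (Iic_disjoint_Ioi le_rfl) _ _).mono_right hBt
  have mC : Measurable fun ω => (N ω i).2 B := (h.arrival i).measurable_apply hB
  have mres : Measurable fun m : Measure (ℝ≥0 × ℝ≥0) => m.restrict (Iic t ×ˢ univ) :=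
    Measure.measurable_of_measurable_coe _ fun s hs => by
      simp_rw [Measure.restrict_apply hs]; exact Measure.measurable_coe (hs.inter hA)
  have mB1 : Measurable fun ω => (N ω i).2.restrict (Iic t ×ˢ univ) :=
    mres.comp (h.arrival i).measurable
  have mcoe : Measurable fun m : Measure (ℝ≥0 × ℝ≥0) => m B := Measure.measurable_coe hB
  -- Independent blocks are adjoined one at a time to the past arrivals of `i`: its service noise,
  -- the noises of the other servers, and the initial state. None of these blocks has to be cut at
  -- time `t`, since each is independent of the arrivals of `i`.
  have s1 : IndepFun (fun ω => ((N ω i).1, (N ω i).2.restrict (Iic t ×ˢ univ)))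
      (fun ω => (N ω i).2 B) P :=
    indepFun_prodMk_left (h.service i).measurable mB1 mC
      ((h.indep_pair i).comp measurable_id (mres.prodMk mcoe))
      ((h.arrival i).indepFun_restrict hA hB hdisj)
  set R : Ω → ({j // j ∈ Finset.univ.erase i} → Noise) := fun ω j => N ω j
  have mR : Measurable R := measurable_pi_lambda _ fun j => h.measurable_apply j
  have m1 : Measurable fun m : Noise => ((m.1, m.2.restrict (Iic t ×ˢ univ)), m.2 B) :=
    (measurable_fst.prodMk (mres.comp measurable_snd)).prodMk (mcoe.comp measurable_snd)
  have s2 : IndepFun (fun ω => (R ω, ((N ω i).1, (N ω i).2.restrict (Iic t ×ˢ univ))))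
      (fun ω => (N ω i).2 B) P := by
    refine indepFun_prodMk_left mR ((h.service i).measurable.prodMk mB1) mC ?_ s1
    have h3 := h.indep.indepFun_finset (Finset.univ.erase i) {i} (by simp) h.measurable_apply
    exact h3.comp measurable_id
      (m1.comp (measurable_pi_apply (⟨i, by simp⟩ : ({i} : Finset ι))))
  have m2 : Measurable fun M : ι → Noise =>
      (((fun j : {j // j ∈ Finset.univ.erase i} => M j),
        ((M i).1, (M i).2.restrict (Iic t ×ˢ univ))), (M i).2 B) :=
    ((measurable_pi_lambda _ fun j => measurable_pi_apply _).prodMk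
      ((measurable_fst.comp (measurable_pi_apply i)).prodMk
        (mres.comp (measurable_snd.comp (measurable_pi_apply i))))).prodMk
      (measurable_arrival hB i)
  have s3 := indepFun_prodMk_left hU (mR.prodMk ((h.service i).measurable.prodMk mB1)) mC
    (hUN.comp measurable_id m2) s2
  set g : (ι → ℕ) × ({j // j ∈ Finset.univ.erase i} → Noise) × Noise → (ι → ℕ) × (ι → Noise) :=
    fun q => (q.1, fun j => if hj : j = i then q.2.2 else q.2.1 ⟨j, by simp [hj]⟩)
  have hg : Measurable g := by
    refine measurable_fst.prodMk (measurable_pi_lambda _ fun j => ?_)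
    by_cases hj : j = i
    · simp only [hj, dite_true]
      exact measurable_snd.comp measurable_snd
    · simp only [hj, dite_false]
      exact (measurable_pi_apply _).comp (measurable_fst.comp measurable_snd)
  have s4 := s3.comp hg measurable_id
  have e : (g ∘ fun ω => (U ω, R ω, ((N ω i).1, (N ω i).2.restrict (Iic t ×ˢ univ)))) =
      fun ω => (U ω, restrictNoise (N ω) i t) := by
    funext ω
    refine Prod.ext rfl (funext fun j => ?_)
    by_cases hj : j = i <;> simp [g, R, restrictNoise, hj]
  rw [e] at s4
  exact s4

end Family


/-! ### A discrete Gronwall inequality -/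

/-- The function `M / (θ - L) * exp (θ t)` is a supersolution of the recursion with step `s`,
because one step multiplies its coefficient by `1 + θ s ≤ exp (θ s)`. With `k` steps of length `t /
k` the quadratic errors add up to at most `C * t ^ 2 / k * exp (L t)`, which vanishes as `k → ∞`.
The bound thus does not depend on `C`, and no regularity of `p` is required. -/
theorem gronwall_exp {p : ℝ≥0 → ℝ} {L M θ C : ℝ} (hL : 0 ≤ L) (hM : 0 ≤ M) (hθ : L < θ)
    (hC : 0 ≤ C) (h0 : p 0 ≤ 0)
    (h : ∀ t s : ℝ≥0, p (t + s) ≤ (1 + L * s) * p t + s * (M * Real.exp (θ * t)) + C * s ^ 2)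
    (t : ℝ≥0) : p t ≤ M / (θ - L) * Real.exp (θ * t) := by
  have hd : 0 < θ - L := sub_pos.2 hθ
  have hA : 0 ≤ M / (θ - L) := div_nonneg hM hd.le
  have key : ∀ (s : ℝ≥0) (k : ℕ), p (k * s) ≤ M / (θ - L) * Real.exp (θ * (k * s)) +
      C * k * (s : ℝ) ^ 2 * Real.exp (L * (k * s)) := by
    intro s k
    have hs : (0 : ℝ) ≤ s := s.2
    induction k with
    | zero => simpa using h0.trans hA
    | succ k ih =>
      have h1 := h (k * s) s
      have e : ((k + 1 : ℕ) : ℝ≥0) * s = k * s + s := by push_cast; ring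
      rw [e]
      refine h1.trans ?_
      push_cast
      have x1 : Real.exp (θ * ((k + 1) * s)) = Real.exp (θ * (k * s)) * Real.exp (θ * s) := by
        rw [← Real.exp_add]; ring_nf
      have x2 : Real.exp (L * ((k + 1) * s)) = Real.exp (L * (k * s)) * Real.exp (L * s) := by
        rw [← Real.exp_add]; ring_nf
      have y1 : 1 + θ * s ≤ Real.exp (θ * s) := by linarith [Real.add_one_le_exp (θ * (s : ℝ))]
      have y2 : 1 + L * s ≤ Real.exp (L * s) := by linarith [Real.add_one_le_exp (L * (s : ℝ))]
      have y3 : 1 ≤ Real.exp (L * (k * s)) * Real.exp (L * s) := by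
        rw [← x2]; exact Real.one_le_exp (by positivity)
      have z1 : (1 + L * s) * (M / (θ - L) * Real.exp (θ * (k * s))) +
          s * (M * Real.exp (θ * (k * s))) =
          M / (θ - L) * Real.exp (θ * (k * s)) * (1 + θ * s) := by
        field_simp; ring
      have z2 : M / (θ - L) * Real.exp (θ * (k * s)) * (1 + θ * s) ≤
          M / (θ - L) * Real.exp (θ * (k * s)) * Real.exp (θ * s) := by gcongr
      have z3 : (1 + L * s) * (C * k * (s : ℝ) ^ 2 * Real.exp (L * (k * s))) ≤
          C * k * (s : ℝ) ^ 2 * (Real.exp (L * (k * s)) * Real.exp (L * s)) := by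
        have : 0 ≤ C * k * (s : ℝ) ^ 2 * Real.exp (L * (k * s)) := by positivity
        nlinarith
      have z4 : C * (s : ℝ) ^ 2 ≤ C * (s : ℝ) ^ 2 * (Real.exp (L * (k * s)) * Real.exp (L * s)) :=
        le_mul_of_one_le_right (by positivity) y3
      have z5 : (1 + L * s) * p (k * s) ≤ (1 + L * s) * (M / (θ - L) * Real.exp (θ * (k * s)) +
          C * k * (s : ℝ) ^ 2 * Real.exp (L * (k * s))) := by gcongr
      rw [x1, x2]
      nlinarith
  have hlim : Tendsto (fun n : ℕ => M / (θ - L) * Real.exp (θ * t) +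
      C * (t : ℝ) ^ 2 * Real.exp (L * t) * (1 / ((n : ℝ) + 1))) atTop
      (𝓝 (M / (θ - L) * Real.exp (θ * t) + C * (t : ℝ) ^ 2 * Real.exp (L * t) * 0)) :=
    tendsto_const_nhds.add (tendsto_const_nhds.mul tendsto_one_div_add_atTop_nhds_zero_nat)
  rw [mul_zero, add_zero] at hlim
  refine ge_of_tendsto' hlim fun n => ?_
  have h1 := key (t / (n + 1)) (n + 1)
  have hn : ((n : ℝ) + 1) ≠ 0 := by positivity
  have hn' : ((n : ℝ≥0) + 1) ≠ 0 := by positivity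
  have e1 : ((n + 1 : ℕ) : ℝ≥0) * (t / (n + 1)) = t := by push_cast; field_simp
  have e2 : ((n + 1 : ℕ) : ℝ) * ((t / (n + 1) : ℝ≥0) : ℝ) = t := by push_cast; field_simp
  rw [e1, e2] at h1
  refine h1.trans_eq ?_
  push_cast
  field_simp

/-! ### Solutions driven by random noise -/

section Coupling
variable {Ω ι : Type*} [MeasurableSpace Ω] [Fintype ι]

/-- `x` solves the system with rates `c` and initial state `U`, driven by `N`. -/
structure IsSystemSolution (P : Measure Ω) (N : Ω → ι → Noise) (c : ℝ≥0 → ι → (ι → ℕ) → ℝ)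
    (U : Ω → ι → ℕ) (x : Ω → ι → ℝ≥0 → ℕ) : Prop where
  measurable : ∀ i t, Measurable fun ω => x ω i t
  initial : ∀ᵐ ω ∂P, ∀ i, x ω i 0 = U ω i
  evolution : ∀ᵐ ω ∂P, ∀ t, SystemIncrement (N ω) c (x ω) 0 t

variable {P : Measure Ω} [IsProbabilityMeasure P] {lam K : ℝ≥0} {N : Ω → ι → Noise}
  {c c' : ℝ≥0 → ι → (ι → ℕ) → ℝ} {U : Ω → ι → ℕ} {x x' : Ω → ι → ℝ≥0 → ℕ}

omit [IsProbabilityMeasure P] in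
theorem IsSystemSolution.ae_eq_euler (h : IsSystemSolution P N c U x)
    (hN : IsNoiseFamily P lam N) (hc : IsRate c K) :
    ∀ᵐ ω ∂P, ∀ (n T : ℕ) (t : ℝ≥0), t ≤ T → IsCountedMesh (N ω) K n T →
      (fun i => x ω i t) = euler (N ω) c (U ω) (grid n t) (T * (n + 1)) := by
  filter_upwards [h.initial, h.evolution, hN.ae_isRegularNoise K] with ω h0 h1 h2 n T t ht hm
  rw [← funext h0]
  exact (hm.isGoodMesh h2).eq_euler hc (fun i => (h2 i).toIsLocallyFiniteNoise) ht fun s _ => h1 s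

/-- The states of two systems at time `t` do not depend on the arrivals after time `t`. -/
theorem measure_state_inter_le (hN : IsNoiseFamily P lam N) (hU : Measurable U)
    (hUN : IndepFun U N P) (hc : IsRate c K) (hc' : IsRate c' K)
    (hx : IsSystemSolution P N c U x) (hx' : IsSystemSolution P N c' U x') (i : ι) (t : ℝ≥0)
    {B : Set (ℝ≥0 × ℝ≥0)} (hB : MeasurableSet B) (hBt : B ⊆ Ioi t ×ˢ univ)
    (v : (ι → ℕ) × (ι → ℕ)) :
    P {ω | ((fun j => x ω j t, fun j => x' ω j t) : (ι → ℕ) × (ι → ℕ)) = v ∧ (N ω i).2 B ≠ 0} ≤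
      P {ω | ((fun j => x ω j t, fun j => x' ω j t) : (ι → ℕ) × (ι → ℕ)) = v} *
        P {ω | (N ω i).2 B ≠ 0} := by
  obtain ⟨T, hT⟩ := exists_nat_ge t
  set V : Ω → (ι → ℕ) × (ι → ℕ) := fun ω => (fun j => x ω j t, fun j => x' ω j t)
  set β : Set Ω := {ω | (N ω i).2 B ≠ 0}
  -- Unless mesh `n` fails, both states at `t` are the explicit function `F n` of the initial state
  -- and the truncated noise, hence independent of the mass of `B`. Replacing the states by `F n`
  -- and going back costs the failure probability `e n` twice, and `e n → 0`.
  set F : ℕ → (ι → ℕ) × (ι → Noise) → (ι → ℕ) × (ι → ℕ) := fun n p =>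
    (euler p.2 c p.1 (grid n t) (T * (n + 1)), euler p.2 c' p.1 (grid n t) (T * (n + 1)))
  have hF : ∀ n, Measurable (F n) := fun n => (measurable_euler hc _ _).prodMk
    (measurable_euler hc' _ _)
  set D : Ω → (ι → ℕ) × (ι → Noise) := fun ω => (U ω, restrictNoise (N ω) i t)
  have hgrid : ∀ n k, grid n t k ≤ t := fun n k => min_le_right _ _
  have hFD : ∀ n, ∀ᵐ ω ∂P, IsCountedMesh (N ω) K n T → V ω = F n (D ω) := by
    intro n
    filter_upwards [hx.ae_eq_euler hN hc, hx'.ae_eq_euler hN hc'] with ω h1 h2 hm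
    simp only [V, F, D]
    rw [h1 n T t hT hm, h2 n T t hT hm, euler_restrictNoise _ hc _ _ (hgrid n),
      euler_restrictNoise _ hc' _ _ (hgrid n)]
  set e : ℕ → ℝ≥0∞ := fun n => P {ω | ¬ IsCountedMesh (N ω) K n T}
  have hbound : ∀ n, P ({ω | V ω = v} ∩ β) ≤ P {ω | V ω = v} * P β + 2 * e n := by
    intro n
    have hind : P ({ω | F n (D ω) = v} ∩ β) = P {ω | F n (D ω) = v} * P β :=
      ((hN.indepFun_restrictNoise hU hUN i t hB hBt).comp (hF n)
        measurable_id).measure_inter_preimage_eq_mul {v} {0}ᶜ (measurableSet_singleton v)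
        (measurableSet_singleton 0).compl
    have h1 : P ({ω | V ω = v} ∩ β) ≤ P ({ω | F n (D ω) = v} ∩ β) + e n := by
      refine (measure_mono_ae ?_).trans (measure_union_le _ _)
      filter_upwards [hFD n] with ω hω hω2
      by_cases hm : IsCountedMesh (N ω) K n T
      · exact Or.inl ⟨(hω hm).symm.trans hω2.1, hω2.2⟩
      · exact Or.inr hm
    have h2 : P {ω | F n (D ω) = v} ≤ P {ω | V ω = v} + e n := by
      refine (measure_mono_ae ?_).trans (measure_union_le _ _)
      filter_upwards [hFD n] with ω hω hω2
      by_cases hm : IsCountedMesh (N ω) K n T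
      · exact Or.inl ((hω hm).trans hω2)
      · exact Or.inr hm
    calc P ({ω | V ω = v} ∩ β) ≤ P {ω | F n (D ω) = v} * P β + e n := hind ▸ h1
      _ ≤ (P {ω | V ω = v} + e n) * P β + e n := by gcongr
      _ ≤ P {ω | V ω = v} * P β + 2 * e n := by
        rw [add_mul, two_mul, add_assoc]
        gcongr
        exact mul_le_of_le_one_right' prob_le_one
  have hlim : Tendsto (fun n => P {ω | V ω = v} * P β + 2 * e n) atTop
      (𝓝 (P {ω | V ω = v} * P β + 2 * 0)) :=
    tendsto_const_nhds.add (ENNReal.Tendsto.const_mul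
      (hN.tendsto_measure_not_isCountedMesh K T) (Or.inr (by simp)))
  rw [mul_zero, add_zero] at hlim
  exact ge_of_tendsto' hlim hbound

/-- The probability that server `i` differs in the two systems up to time `t`. -/
def decoupling (P : Measure Ω) (x x' : Ω → ι → ℝ≥0 → ℕ) (i : ι) (t : ℝ≥0) : ℝ :=
  P.real {ω | ∃ s ≤ t, x ω i s ≠ x' ω i s}

theorem lebesgue_band_le (p q : ℝ) : lebesgue {y : ℝ≥0 | (y : ℝ) ∈ Icc p q} ≤
    ENNReal.ofReal (q - p) := lebesgue_le fun _ h => h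

/-- The band is random but is determined by the two states at time `t`, which take countably many
values. For each value the arrivals in the band are independent of the states, and they are present
with probability at most the intensity of the band, `lam * h` times its width. -/
theorem measure_band_le (hN : IsNoiseFamily P lam N) (hU : Measurable U)
    (hUN : IndepFun U N P) (hc : IsRate c K) (hc' : IsRate c' K)
    (hx : IsSystemSolution P N c U x) (hx' : IsSystemSolution P N c' U x') (i : ι) (t h : ℝ≥0)
    {δ : ℝ} (hδ : 0 ≤ δ) :
    P {ω | (N ω i).2 (Ioc t (t + h) ×ˢ {y : ℝ≥0 | (y : ℝ) ∈
      Icc (min (c t i fun k => x ω k t) (c' t i fun k => x' ω k t) - δ)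
        (max (c t i fun k => x ω k t) (c' t i fun k => x' ω k t) + δ)}) ≠ 0} ≤
      lam * h * (∫⁻ ω, ENNReal.ofReal |(c t i fun k => x ω k t) - c' t i fun k => x' ω k t| ∂P +
        ENNReal.ofReal (2 * δ)) := by
  set V : Ω → (ι → ℕ) × (ι → ℕ) := fun ω => (fun j => x ω j t, fun j => x' ω j t)
  have hV : Measurable V := (measurable_pi_lambda _ fun j => hx.measurable j t).prodMk
    (measurable_pi_lambda _ fun j => hx'.measurable j t)
  set B : (ι → ℕ) × (ι → ℕ) → Set (ℝ≥0 × ℝ≥0) := fun v => Ioc t (t + h) ×ˢ {y : ℝ≥0 | (y : ℝ) ∈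
      Icc (min (c t i v.1) (c' t i v.2) - δ) (max (c t i v.1) (c' t i v.2) + δ)}
  have hBm : ∀ v, MeasurableSet (B v) := fun v =>
    measurableSet_Ioc.prod (measurable_subtype_coe measurableSet_Icc)
  have hBt : ∀ v, B v ⊆ Ioi t ×ˢ univ := fun v p hp => ⟨hp.1.1, mem_univ _⟩
  set f : (ι → ℕ) × (ι → ℕ) → ℝ≥0∞ := fun v => ENNReal.ofReal |c t i v.1 - c' t i v.2|
  have hPB : ∀ v, P {ω | (N ω i).2 (B v) ≠ 0} ≤ lam * h * (f v + ENNReal.ofReal (2 * δ)) := by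
    intro v
    refine ((hN.arrival i).measure_apply_ne_zero_le (hBm v)).trans ?_
    rw [arrivalIntensity_prod, mul_assoc]
    gcongr
    · refine (lebesgue_Ioc_le _ _).trans_eq ?_
      push_cast
      simp
    · refine (lebesgue_band_le _ _).trans_eq ?_
      rw [← ENNReal.ofReal_add (abs_nonneg _) (by positivity), ← max_sub_min_eq_abs]
      congr 1
      rw [max_comm, min_comm]
      ring
  have hsub : {ω | (N ω i).2 (B (V ω)) ≠ 0} ⊆ ⋃ v, {ω | V ω = v ∧ (N ω i).2 (B v) ≠ 0} :=
    fun ω hω => mem_iUnion.2 ⟨V ω, rfl, hω⟩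
  refine (measure_mono hsub).trans ((measure_iUnion_le _).trans ?_)
  have h1 : ∀ v, P {ω | V ω = v ∧ (N ω i).2 (B v) ≠ 0} ≤
      lam * h * ((f v + ENNReal.ofReal (2 * δ)) * P.map V {v}) := fun v => by
    refine (measure_state_inter_le hN hU hUN hc hc' hx hx' i t (hBm v) (hBt v) v).trans ?_
    rw [Measure.map_apply hV (measurableSet_singleton v), mul_comm, ← mul_assoc]
    gcongr
    · exact hPB v
    · exact fun ω hω => hω
  refine (ENNReal.tsum_le_tsum h1).trans_eq ?_
  rw [ENNReal.tsum_mul_left, ← lintegral_countable', lintegral_map (measurable_of_countable _) hV,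
    lintegral_add_right _ measurable_const, lintegral_const, measure_univ, mul_one]

/-- Two copies of server `i` differ by time `t + h` only if they differed by time `t`, or the whole
system has two noise points in `(t, t + h]`, or an arrival of `i` falls in the band between the two
levels. The second event and the widening of the band are of order `h ^ 2`. -/
theorem decoupling_add_le (hN : IsNoiseFamily P lam N) (hU : Measurable U)
    (hUN : IndepFun U N P) (hc : IsRate c K) (hc' : IsRate c' K) {κ : ℝ} (hκ : 0 ≤ κ)
    (hcκ : ∀ i u s t, |c s i u - c t i u| ≤ κ * dist s t)
    (hcκ' : ∀ i u s t, |c' s i u - c' t i u| ≤ κ * dist s t)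
    (hx : IsSystemSolution P N c U x) (hx' : IsSystemSolution P N c' U x') (i : ι) (t h : ℝ≥0)
    {r : ℝ} (hr0 : 0 ≤ r)
    (hr : ∫⁻ ω, ENNReal.ofReal |(c t i fun k => x ω k t) - c' t i fun k => x' ω k t| ∂P ≤
      ENNReal.ofReal r) :
    decoupling P x x' i (t + h) ≤ decoupling P x x' i t + lam * h * r +
      (2 * lam * κ + (2 * Fintype.card ι) ^ 2 * (1 + lam * K) ^ 2) * h ^ 2 := by
  -- The rates are `κ`-Lipschitz in time, so over the cell each level drifts by at most `κ * h`.
  set δ : ℝ := κ * h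
  have hδ0 : 0 ≤ δ := by positivity
  set E1 := {ω | ∃ s ≤ t, x ω i s ≠ x' ω i s}
  set E2 := {ω | ¬ cellCount (N ω) K t (t + h) ≤ 1}
  set E3 := {ω | (N ω i).2 (Ioc t (t + h) ×ˢ {y : ℝ≥0 | (y : ℝ) ∈
      Icc (min (c t i fun k => x ω k t) (c' t i fun k => x' ω k t) - δ)
        (max (c t i fun k => x ω k t) (c' t i fun k => x' ω k t) + δ)}) ≠ 0}
  have hsub : {ω | ∃ s ≤ t + h, x ω i s ≠ x' ω i s} ≤ᵐ[P] (E1 ∪ E3 ∪ E2 : Set Ω) := by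
    filter_upwards [hx.evolution, hx'.evolution, hN.ae_isRegularNoise K] with ω h1 h1' h2
    intro hω
    by_contra hcon
    have hE1 : ω ∉ E1 := fun h => hcon (Or.inl (Or.inl h))
    have hE3 : ω ∉ E3 := fun h => hcon (Or.inl (Or.inr h))
    have hE2 : ω ∉ E2 := fun h => hcon (Or.inr h)
    obtain ⟨s, hs, hne⟩ := hω
    have hst : t ≤ s := le_of_not_ge fun hst => hE1 ⟨s, hst, hne⟩
    have hloc := fun j => (h2 j).toIsLocallyFiniteNoise
    have hdist : ∀ r ∈ Ioc t (t + h), κ * dist r t ≤ δ := fun r hr => by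
      refine mul_le_mul_of_nonneg_left ?_ hκ
      have h3 : (r : ℝ) ≤ t + h := hr.2
      have h4 : (t : ℝ) < r := hr.1
      rw [NNReal.dist_eq, abs_of_pos (sub_pos.2 h4)]
      linarith
    refine hne ((atMostOne_of_cellCount_le h2 (not_not.1 hE2)).eq_of_band (δ := δ) hc hc'
      (fun r hr => systemIncrement_of_le hc hloc zero_le hr.1 (h1 t) (h1 r))
      (fun r hr => systemIncrement_of_le hc' hloc zero_le hr.1 (h1' t) (h1' r))
      (by_contra fun h => hE1 ⟨t, le_rfl, h⟩)
      (fun r hr u => (hcκ i u r t).trans (hdist r hr))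
      (fun r hr u => (hcκ' i u r t).trans (hdist r hr)) (not_not.1 hE3) s ⟨hst, hs⟩)
  have e2 := hN.measure_cellCount_gt_one_le K t (t + h)
  have e3 := (measure_band_le hN hU hUN hc hc' hx hx' i t h hδ0).trans
    (mul_le_mul_right (add_le_add_left hr _) _)
  have key : P {ω | ∃ s ≤ t + h, x ω i s ≠ x' ω i s} ≤ P E1 + ENNReal.ofReal
      (lam * h * (r + 2 * δ)) +
      ENNReal.ofReal ((2 * Fintype.card ι) ^ 2 * ((1 + lam * K) * h) ^ 2) := by
    refine (measure_mono_ae hsub).trans ((measure_union_le _ _).trans (add_le_add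
      ((measure_union_le _ _).trans (add_le_add le_rfl (e3.trans_eq ?_))) (e2.trans_eq ?_)))
    · rw [ENNReal.ofReal_mul (q := r + 2 * δ) (by positivity), ENNReal.ofReal_mul (p := (lam : ℝ))
        (by positivity), ENNReal.ofReal_add hr0 (by positivity), ENNReal.ofReal_coe_nnreal,
        ENNReal.ofReal_coe_nnreal]
    · have : ((t + h : ℝ≥0) : ℝ) - t = h := by push_cast; ring
      rw [this, ENNReal.ofReal_mul (by positivity), ENNReal.ofReal_pow (by positivity),
        ENNReal.ofReal_pow (by positivity), ENNReal.ofReal_mul (by positivity),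
        ENNReal.ofReal_mul (by positivity), ENNReal.ofReal_add (by positivity) (by positivity),
        ENNReal.ofReal_mul (by positivity)]
      simp
  have hE : P E1 = ENNReal.ofReal (decoupling P x x' i t) := (ofReal_measureReal).symm
  have hdec : 0 ≤ decoupling P x x' i t := measureReal_nonneg
  rw [hE, ← ENNReal.ofReal_add hdec (by positivity),
    ← ENNReal.ofReal_add (by positivity) (by positivity)] at key
  refine (ENNReal.toReal_le_of_le_ofReal (by positivity) key).trans_eq ?_
  simp only [δ]
  ring

end Coupling

/-! ### The limiting arrival rate -/

theorem jsqProb_eq {n : ℕ} (x : Fin (n + 1) → ℕ) :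
    jsqProb x = if 0 ∈ argminSet x then 1 / ((argminSet x).card : ℝ) else 0 := by
  unfold jsqProb
  by_cases h : 0 ∈ argminSet x
  · simp only [h, true_and, if_true]
    have hc : (argminSet x).card ∈ Finset.Icc 1 (n + 1) := Finset.mem_Icc.2
      ⟨Finset.card_pos.2 ⟨0, h⟩, (Finset.card_le_univ _).trans (by simp)⟩
    rw [Finset.sum_ite_eq (Finset.Icc 1 (n + 1)) (argminSet x).card fun k => 1 / (k : ℝ), if_pos hc]
  · simp [h]

theorem jsqProb_nonneg {n : ℕ} (x : Fin (n + 1) → ℕ) : 0 ≤ jsqProb x := by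
  rw [jsqProb_eq]; split_ifs <;> positivity

theorem jsqProb_le_one {n : ℕ} (x : Fin (n + 1) → ℕ) : jsqProb x ≤ 1 := by
  rw [jsqProb_eq]
  split_ifs with h
  · have : 1 ≤ (argminSet x).card := Finset.card_pos.2 ⟨0, h⟩
    rw [div_le_one (by exact_mod_cast this)]
    exact_mod_cast this
  · exact zero_le_one

theorem abs_jsqProb_sub_le {n : ℕ} (x y : Fin (n + 1) → ℕ) : |jsqProb x - jsqProb y| ≤ 1 := by
  rw [abs_le]
  constructor <;> linarith [jsqProb_nonneg x, jsqProb_nonneg y, jsqProb_le_one x, jsqProb_le_one y]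

/-- The probability `∫ b(a, x₂, …, x_{n+1}) ν(dx₂) ⋯ ν(dx_{n+1})`. -/
def meanProb (n a : ℕ) (ν : Measure ℕ) : ℝ :=
  ∫ x : Fin n → ℕ, jsqProb (Matrix.vecCons a x) ∂(Measure.pi fun _ => ν)

theorem limitRate_eq (d a : ℕ) (ν : Measure ℕ) : limitRate d a ν = d * meanProb (d - 1) a ν := rfl

section Mean
variable {n a : ℕ} {ν : Measure ℕ} [IsProbabilityMeasure ν]

theorem integrable_jsqProb {α : Type*} [MeasurableSpace α] {μ : Measure α} [IsFiniteMeasure μ]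
    {f : α → Fin n → ℕ} (hf : Measurable f) (a : ℕ) :
    Integrable (fun x => jsqProb (Matrix.vecCons a (f x))) μ :=
  Integrable.of_bound ((measurable_of_countable
    fun x : Fin n → ℕ => jsqProb (Matrix.vecCons a x)).comp hf).aestronglyMeasurable 1
    (ae_of_all _ fun x => by
      rw [Real.norm_of_nonneg (jsqProb_nonneg _)]; exact jsqProb_le_one _)

theorem meanProb_nonneg (n a : ℕ) (ν : Measure ℕ) : 0 ≤ meanProb n a ν :=
  integral_nonneg fun _ => jsqProb_nonneg _

theorem meanProb_le_one : meanProb n a ν ≤ 1 := by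
  have := integral_mono (integrable_jsqProb (μ := Measure.pi fun _ : Fin n => ν) measurable_id a)
    (integrable_const 1) fun x => jsqProb_le_one _
  rw [integral_const, probReal_univ, one_smul] at this
  exact this

theorem limitRate_nonneg (d a : ℕ) (ν : Measure ℕ) : 0 ≤ limitRate d a ν :=
  mul_nonneg (Nat.cast_nonneg d) (meanProb_nonneg _ _ _)

theorem limitRate_le (d : ℕ) : limitRate d a ν ≤ d :=
  mul_le_of_le_one_right (Nat.cast_nonneg d) meanProb_le_one

theorem meanProb_map {S : Type*} [MeasurableSpace S] {Q : Measure S} [IsProbabilityMeasure Q]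
    {U : S → ℕ} (hU : Measurable U) (n a : ℕ) : meanProb n a (Q.map U) =
      ∫ s : Fin n → S, jsqProb (Matrix.vecCons a fun k => U (s k)) ∂(Measure.pi fun _ => Q) := by
  have : IsProbabilityMeasure (Q.map U) := Measure.isProbabilityMeasure_map hU.aemeasurable
  rw [meanProb, ← Measure.pi_map_pi (fun _ => hU.aemeasurable), integral_map]
  · exact (measurable_pi_lambda _ fun k => hU.comp (measurable_pi_apply k)).aemeasurable
  · exact (measurable_of_countable _).aestronglyMeasurable

/-- The two product laws are coupled by `n` independent copies of the pair `(U, U')`. The integrands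
differ by at most one, and only if some copy has `U ≠ U'`. -/
theorem abs_meanProb_map_sub_le {S : Type*} [MeasurableSpace S] {Q : Measure S}
    [IsProbabilityMeasure Q] {U U' : S → ℕ} (hU : Measurable U) (hU' : Measurable U') (n a : ℕ) :
    |meanProb n a (Q.map U) - meanProb n a (Q.map U')| ≤ n * Q.real {s | U s ≠ U' s} := by
  have hm : ∀ {V : S → ℕ}, Measurable V → Measurable fun (s : Fin n → S) k => V (s k) :=
    fun hV => measurable_pi_lambda _ fun k => hV.comp (measurable_pi_apply k)
  have hE : MeasurableSet {s | U s ≠ U' s} := (measurableSet_eq_fun hU hU').compl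
  rw [meanProb_map hU, meanProb_map hU', ← integral_sub (integrable_jsqProb (hm hU) a)
    (integrable_jsqProb (hm hU') a)]
  refine (abs_integral_le_integral_abs).trans ?_
  have hi : ∀ k : Fin n, Integrable (fun s : Fin n → S => {s | U s ≠ U' s}.indicator
      (fun _ => (1 : ℝ)) (s k)) (Measure.pi fun _ => Q) := fun k =>
    Integrable.of_bound ((measurable_const.indicator hE).comp
      (measurable_pi_apply k)).aestronglyMeasurable 1 (ae_of_all _ fun s => by
        simp only [indicator]; split_ifs <;> simp)
  calc ∫ s : Fin n → S, |jsqProb (Matrix.vecCons a fun k => U (s k)) -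
        jsqProb (Matrix.vecCons a fun k => U' (s k))| ∂(Measure.pi fun _ => Q)
      ≤ ∫ s : Fin n → S, ∑ k, {s | U s ≠ U' s}.indicator (fun _ => (1 : ℝ)) (s k)
          ∂(Measure.pi fun _ => Q) := by
        refine integral_mono (((integrable_jsqProb (hm hU) a).sub
          (integrable_jsqProb (hm hU') a)).abs) (integrable_finsetSum _ fun k _ => hi k) fun s => ?_
        by_cases h : ∀ k, U (s k) = U' (s k)
        · simp only [funext h, sub_self, abs_zero]
          exact Finset.sum_nonneg fun k _ => indicator_nonneg (fun _ _ => zero_le_one) _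
        · push Not at h
          obtain ⟨k, hk⟩ := h
          refine (abs_jsqProb_sub_le _ _).trans ?_
          refine le_trans ?_ (Finset.single_le_sum (f := fun k =>
            {s | U s ≠ U' s}.indicator (fun _ => (1 : ℝ)) (s k))
            (fun k _ => indicator_nonneg (fun _ _ => zero_le_one) _) (Finset.mem_univ k))
          simp [hk]
    _ = n * Q.real {s | U s ≠ U' s} := by
        rw [integral_finsetSum _ fun k _ => hi k]
        have : ∀ k : Fin n, ∫ s : Fin n → S, {s | U s ≠ U' s}.indicator (fun _ => (1 : ℝ)) (s k)
            ∂(Measure.pi fun _ => Q) = Q.real {s | U s ≠ U' s} := fun k => by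
          refine (integral_comp_eval (μ := fun _ : Fin n => Q) (i := k)
            (f := {s | U s ≠ U' s}.indicator (fun _ => (1 : ℝ)))
            (measurable_const.indicator hE).aestronglyMeasurable).trans ?_
          exact integral_indicator_one hE
        simp [this]

theorem abs_limitRate_sub_le {S : Type*} [MeasurableSpace S] {Q : Measure S}
    [IsProbabilityMeasure Q] {U U' : S → ℕ} (hU : Measurable U) (hU' : Measurable U') (d a : ℕ) :
    |limitRate d a (Q.map U) - limitRate d a (Q.map U')| ≤
      (d : ℝ) ^ 2 * Q.real {s | U s ≠ U' s} := by
  rw [limitRate_eq, limitRate_eq, ← mul_sub, abs_mul, abs_of_nonneg (Nat.cast_nonneg d), sq,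
    mul_assoc]
  refine mul_le_mul_of_nonneg_left ((abs_meanProb_map_sub_le hU hU' _ a).trans ?_)
    (Nat.cast_nonneg d)
  gcongr
  exact Nat.sub_le d 1

end Mean

/-! ### Measurable solutions -/

section Solution
variable {Ω ι : Type*} [MeasurableSpace Ω] [Fintype ι] {P : Measure Ω} [IsProbabilityMeasure P]
  {lam K : ℝ≥0} {N : Ω → ι → Noise} {c : ℝ≥0 → ι → (ι → ℕ) → ℝ} {U : Ω → ι → ℕ}

omit [IsProbabilityMeasure P] in
theorem IsNoiseFamily.isSystemSolution (hN : IsNoiseFamily P lam N) (hc : IsRate c K)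
    {y : Ω → ι → CadlagPath ℕ} (hm : ∀ i t, Measurable fun ω => y ω i t)
    (h0 : ∀ᵐ ω ∂P, ∀ i, y ω i 0 = U ω i)
    (h : ∀ᵐ ω ∂P, ∀ i, SolvesQueueEquation (y ω i) (fun t => c t i fun k => y ω k t)
      (N ω i).1 (N ω i).2) : IsSystemSolution P N c U fun ω i t => y ω i t where
  measurable := hm
  initial := h0
  evolution := by
    filter_upwards [h, hN.ae_isRegularNoise K] with ω h1 h2 t i
    exact (solvesQueueEquation_iff (fun _ => hc.le _ _ _)
      (h2 i).toIsLocallyFiniteNoise).1 (h1 i) t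

/-- Constant paths. -/
def CadlagPath.const {E : Type*} [TopologicalSpace E] (e : E) : CadlagPath E where
  toFun _ := e
  right_continuous _ := continuousWithinAt_const
  left_limit _ := ⟨e, tendsto_const_nhds⟩

/-- Solutions are chosen separately for each `ω`. Measurability is not lost, because on the event
that mesh `n` is good the value at time `t` is the measurable explicit scheme. -/
theorem IsNoiseFamily.exists_solution (hN : IsNoiseFamily P lam N) (hc : IsRate c K)
    (hU : Measurable U) : ∃ y : Ω → ι → CadlagPath ℕ, (∀ i t, Measurable fun ω => y ω i t) ∧
      (∀ᵐ ω ∂P, ∀ i, y ω i 0 = U ω i) ∧ ∀ᵐ ω ∂P, ∀ i, SolvesQueueEquation (y ω i)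
        (fun t => c t i fun k => y ω k t) (N ω i).1 (N ω i).2 := by
  classical
  set B : Set Ω := {ω | ¬ ((∀ i, IsRegularNoise (N ω i) K) ∧ ∀ T, ∃ n, IsCountedMesh (N ω) K n T)}
  have hB : P B = 0 := by
    have : ∀ᵐ ω ∂P, (∀ i, IsRegularNoise (N ω i) K) ∧ ∀ T, ∃ n, IsCountedMesh (N ω) K n T := by
      filter_upwards [hN.ae_isRegularNoise K, hN.ae_exists_isCountedMesh K] with ω h1 h2
      exact ⟨h1, h2⟩
    exact this
  -- The exceptional set need not be measurable; its measurable hull is still null, and a constant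
  -- path is used there.
  set G : Set Ω := (toMeasurable P B)ᶜ
  have hG : MeasurableSet G := (measurableSet_toMeasurable P B).compl
  have hGm : ∀ ω ∈ G, (∀ i, IsRegularNoise (N ω i) K) ∧ ∀ T, ∃ n, IsCountedMesh (N ω) K n T :=
    fun ω hω => by_contra fun h => hω (subset_toMeasurable P B h)
  have hGae : ∀ᵐ ω ∂P, ω ∈ G := by
    have : P (toMeasurable P B) = 0 := by rw [measure_toMeasurable, hB]
    exact (measure_eq_zero_iff_ae_notMem.1 this)
  have hex : ∀ ω, ω ∈ G → ∃ y : ι → CadlagPath ℕ, (∀ i, y i 0 = U ω i) ∧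
      ∀ i, SolvesQueueEquation (y i) (fun t => c t i fun k => y k t) (N ω i).1 (N ω i).2 :=
    fun ω hω => exists_system_solution hc (fun i => ((hGm ω hω).1 i).toIsLocallyFiniteNoise)
      (fun T => ((hGm ω hω).2 T).imp fun n hn => hn.isGoodMesh (hGm ω hω).1) (U ω)
  choose y hy0 hy using hex
  refine ⟨fun ω => if h : ω ∈ G then y ω h else fun _ => CadlagPath.const 0, fun i t => ?_, ?_, ?_⟩
  · obtain ⟨T, hT⟩ := exists_nat_ge t
    refine measurable_to_countable' fun v => ?_
    have heq : (fun ω => (if h : ω ∈ G then y ω h else fun _ => CadlagPath.const 0) i t) ⁻¹' {v} =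
        (G ∩ ⋃ n, ({ω | IsCountedMesh (N ω) K n T} ∩
          {ω | euler (N ω) c (U ω) (grid n t) (T * (n + 1)) i = v})) ∪ (Gᶜ ∩ {_ω | 0 = v}) := by
      ext ω
      by_cases hω : ω ∈ G
      · have hsol : ∀ n, IsCountedMesh (N ω) K n T →
            y ω hω i t = euler (N ω) c (U ω) (grid n t) (T * (n + 1)) i := fun n hn => by
          have := (hn.isGoodMesh (hGm ω hω).1).eq_euler (x := fun i t => y ω hω i t) hc
            (fun i => ((hGm ω hω).1 i).toIsLocallyFiniteNoise) hT fun s _ j =>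
              (solvesQueueEquation_iff (fun _ => hc.le _ _ _)
                ((hGm ω hω).1 j).toIsLocallyFiniteNoise).1 (hy ω hω j) s
          rw [← funext (hy0 ω hω)]
          exact congrFun this i
        simp only [mem_preimage, hω, dite_true, mem_singleton_iff, mem_union, mem_inter_iff,
          true_and, mem_compl_iff, not_true, false_and, or_false, mem_iUnion, mem_ofPred_eq]
        constructor
        · intro h
          obtain ⟨n, hn⟩ := (hGm ω hω).2 T
          exact ⟨n, hn, (hsol n hn).symm.trans h⟩
        · rintro ⟨n, hn, h⟩
          exact (hsol n hn).trans h
      · simp [hω, CadlagPath.const]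
    rw [heq]
    refine (hG.inter (MeasurableSet.iUnion fun n => ?_)).union
      (hG.compl.inter (MeasurableSet.const _))
    refine (hN.measurable (measurableSet_isCountedMesh K n T)).inter ?_
    exact ((measurable_pi_apply i).comp ((measurable_euler hc _ _).comp
      (hU.prodMk hN.measurable))) (measurableSet_singleton v)
  · filter_upwards [hGae] with ω hω
    simpa [hω] using hy0 ω hω
  · filter_upwards [hGae] with ω hω
    simpa [hω] using hy ω hω

omit [IsProbabilityMeasure P] in
theorem IsNoiseFamily.ae_eq_of_isQuiet (hN : IsNoiseFamily P lam N) (i : ι) {x : Ω → ℝ≥0 → ℕ}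
    {C : Ω → ℝ≥0 → ℝ} (hC : ∀ ω t, C ω t ≤ K)
    (h : ∀ᵐ ω ∂P, ∀ t, QueueIncrement (x ω) (C ω) (N ω i).1 (N ω i).2 0 t) :
    ∀ᵐ ω ∂P, ∀ s t, s ≤ t → IsQuiet (N ω i).1 (N ω i).2 K s t → x ω t = x ω s := by
  filter_upwards [h, hN.ae_isRegularNoise K] with ω hω hr s t hst hq
  exact (hq.queueIncrement_iff (hC ω)).1 ((queueIncrement_iff_of_le (hC ω)
    (hr i).toIsLocallyFiniteNoise zero_le hst (hω s)).1 (hω t))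

omit [Fintype ι] in
theorem IsNoiseFamily.measure_not_isQuiet_le (hN : IsNoiseFamily P lam N) (i : ι) (K : ℝ≥0)
    {s t : ℝ≥0} (hst : s ≤ t) :
    P.real {ω | ¬IsQuiet (N ω i).1 (N ω i).2 K s t} ≤ (1 + lam * K) * dist s t := by
  have h1 : {ω | ¬IsQuiet (N ω i).1 (N ω i).2 K s t} ⊆ {ω | (N ω i).1 (Ioc s t) ≠ 0} ∪
      {ω | (N ω i).2 (Ioc s t ×ˢ Iic K) ≠ 0} := fun ω hω => not_and_or.1 hω
  refine ENNReal.toReal_le_of_le_ofReal (by positivity) ((measure_mono h1).trans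
    ((measure_union_le _ _).trans
    ((add_le_add (((hN.service i).measure_apply_ne_zero_le measurableSet_Ioc).trans
    (lebesgue_Ioc_le _ _)) (((hN.arrival i).measure_apply_ne_zero_le
    (measurableSet_Ioc.prod measurableSet_Iic)).trans
      (arrivalIntensity_cell_le lam K s t))).trans_eq ?_)))
  have hst' : (s : ℝ) ≤ t := hst
  rw [dist_comm, NNReal.dist_eq, abs_of_nonneg (sub_nonneg.2 hst'),
    ENNReal.ofReal_mul (by positivity), ENNReal.ofReal_add zero_le_one (by positivity),
    ENNReal.ofReal_mul (by positivity)]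
  simp [add_mul]

/-- A queue changes in a short time with small probability. -/
theorem IsNoiseFamily.measure_ne_le (hN : IsNoiseFamily P lam N) (i : ι) {x : Ω → ℝ≥0 → ℕ}
    {C : Ω → ℝ≥0 → ℝ} (hC : ∀ ω t, C ω t ≤ K)
    (h : ∀ᵐ ω ∂P, ∀ t, QueueIncrement (x ω) (C ω) (N ω i).1 (N ω i).2 0 t) (s t : ℝ≥0) :
    P.real {ω | x ω s ≠ x ω t} ≤ (1 + lam * K) * dist s t := by
  wlog hst : s ≤ t generalizing s t
  · rw [dist_comm]
    simpa only [ne_comm] using this t s (le_of_not_ge hst)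
  refine le_trans (ENNReal.toReal_mono (measure_ne_top _ _) (measure_mono_ae ?_))
    (hN.measure_not_isQuiet_le i K hst)
  filter_upwards [hN.ae_eq_of_isQuiet i hC h] with ω hω hne hq
  exact hne (hω s t hst hq).symm

end Solution

/-! ### Flows of laws -/

section Flow
variable {Ω : Type*} [MeasurableSpace Ω] {P : Measure Ω} [IsProbabilityMeasure P] {lam : ℝ≥0}
  {d : ℕ}

/-- The arrival rates of queues whose competitors have law `ν t` at time `t`. -/
def flowRate {ι : Type*} (d : ℕ) (ν : ℝ≥0 → Measure ℕ) (t : ℝ≥0) (i : ι) (u : ι → ℕ) : ℝ :=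
  limitRate d (u i) (ν t)

/-- A measurable process which changes in a short time with small probability. -/
structure IsFlow (P : Measure Ω) (A : ℝ) (Z : Ω → ℝ≥0 → ℕ) : Prop where
  measurable : ∀ t, Measurable fun ω => Z ω t
  lipschitz : ∀ s t, P.real {ω | Z ω s ≠ Z ω t} ≤ A * dist s t

/-- The laws of a process. -/
def flow (P : Measure Ω) (Z : Ω → ℝ≥0 → ℕ) (t : ℝ≥0) : Measure ℕ := P.map fun ω => Z ω t

theorem IsFlow.abs_flowRate_sub_le {ι : Type*} {A : ℝ} {Z : Ω → ℝ≥0 → ℕ} (h : IsFlow P A Z)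
    (d : ℕ) (i : ι) (u : ι → ℕ) (s t : ℝ≥0) :
    |flowRate d (flow P Z) s i u - flowRate d (flow P Z) t i u| ≤ (d : ℝ) ^ 2 * A * dist s t := by
  rw [mul_assoc]
  exact (abs_limitRate_sub_le (h.measurable s) (h.measurable t) d _).trans
    (mul_le_mul_of_nonneg_left (h.lipschitz s t) (by positivity))

theorem IsFlow.isRate {ι : Type*} {A : ℝ} {Z : Ω → ℝ≥0 → ℕ} (h : IsFlow P A Z) (d : ℕ) :
    IsRate (flowRate (ι := ι) d (flow P Z)) d where
  continuous i u := by
    refine continuous_iff_continuousAt.2 fun t => tendsto_iff_dist_tendsto_zero.2 ?_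
    refine squeeze_zero (fun _ => dist_nonneg) (fun s => h.abs_flowRate_sub_le d i u s t) ?_
    have : Tendsto (fun s : ℝ≥0 => dist s t) (𝓝 t) (𝓝 0) :=
      tendsto_iff_dist_tendsto_zero.1 tendsto_id
    simpa using this.const_mul ((d : ℝ) ^ 2 * A)
  le t i u := by
    have : IsProbabilityMeasure (flow P Z t) :=
      Measure.isProbabilityMeasure_map (h.measurable t).aemeasurable
    rw [NNReal.coe_natCast]
    exact limitRate_le d

/-- If the own queue lengths agree, only the laws of the competitors matter. Otherwise the rates,
which lie in `[0, d]`, differ by at most `d ≤ d ^ 2`. -/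
theorem lintegral_limitRate_sub_le {V V' x x' : Ω → ℕ} (hV : Measurable V) (hV' : Measurable V')
    (hx : Measurable x) (hx' : Measurable x') (d : ℕ) :
    ∫⁻ ω, ENNReal.ofReal |limitRate d (x ω) (P.map V) - limitRate d (x' ω) (P.map V')| ∂P ≤
      ENNReal.ofReal ((d : ℝ) ^ 2 * (P.real {ω | x ω ≠ x' ω} + P.real {ω | V ω ≠ V' ω})) := by
  have hE : MeasurableSet {ω | x ω ≠ x' ω} := (measurableSet_eq_fun hx hx').compl
  have : IsProbabilityMeasure (P.map V) := Measure.isProbabilityMeasure_map hV.aemeasurable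
  have : IsProbabilityMeasure (P.map V') := Measure.isProbabilityMeasure_map hV'.aemeasurable
  have hd : (d : ℝ) ≤ (d : ℝ) ^ 2 := by
    rcases Nat.eq_zero_or_pos d with rfl | h
    · simp
    · have : (1 : ℝ) ≤ d := by exact_mod_cast h
      nlinarith
  calc _ ≤ ∫⁻ ω, (ENNReal.ofReal ((d : ℝ) ^ 2) * {ω | x ω ≠ x' ω}.indicator 1 ω +
        ENNReal.ofReal ((d : ℝ) ^ 2 * P.real {ω | V ω ≠ V' ω})) ∂P := by
        refine lintegral_mono fun ω => ?_
        by_cases hω : x ω = x' ω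
        · rw [hω]
          exact (ENNReal.ofReal_le_ofReal (abs_limitRate_sub_le hV hV' d _)).trans le_add_self
        · have h1 : |limitRate d (x ω) (P.map V) - limitRate d (x' ω) (P.map V')| ≤ (d : ℝ) ^ 2 := by
            rw [abs_le]
            constructor <;> linarith [limitRate_nonneg d (x ω) (P.map V),
              limitRate_nonneg d (x' ω) (P.map V'), limitRate_le d (a := x ω) (ν := P.map V),
              limitRate_le d (a := x' ω) (ν := P.map V')]
          refine (ENNReal.ofReal_le_ofReal h1).trans ?_
          simp [hω]
    _ = _ := by
        rw [lintegral_add_right _ measurable_const, lintegral_const_mul _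
          (measurable_one.indicator hE), lintegral_indicator_one hE, lintegral_const, measure_univ,
          mul_one, mul_add, ENNReal.ofReal_add (by positivity) (by positivity),
          ENNReal.ofReal_mul (p := (d : ℝ) ^ 2) (q := P.real {ω | x ω ≠ x' ω}) (by positivity),
          ofReal_measureReal]

/-- The noise of a single server as a family. -/
def single (N : Ω → Noise) : Ω → Unit → Noise := fun ω _ => N ω

/-- `x` is a queue driven by `N` whose competitors have law `ν t` at time `t`. -/
def IsFlowSolution (P : Measure Ω) (N : Ω → Noise) (d : ℕ) (ν : ℝ≥0 → Measure ℕ) (U : Ω → ℕ)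
    (x : Ω → ℝ≥0 → ℕ) : Prop :=
  IsSystemSolution P (single N) (flowRate d ν) (fun ω _ => U ω) fun ω _ => x ω

variable {N : Ω → Noise} {U : Ω → ℕ}

/-- A queue changes at rate at most one by services and `lam * d` by arrivals. The Lipschitz
constant does not depend on the driving flow, so the class of flows with this constant is preserved
by the Picard iteration. -/
theorem IsFlowSolution.isFlow {A : ℝ} {Z x : Ω → ℝ≥0 → ℕ} (hN : IsNoiseFamily P lam (single N))
    (hZ : IsFlow P A Z) (h : IsFlowSolution P N d (flow P Z) U x) :
    IsFlow P (1 + lam * d) x where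
  measurable t := IsSystemSolution.measurable h () t
  lipschitz s t := by
    have := hN.measure_ne_le () (K := d) (x := x)
      (C := fun ω t => flowRate d (flow P Z) t () fun _ : Unit => x ω t)
      (fun ω t => (hZ.isRate d).le _ _ _) (by
        filter_upwards [IsSystemSolution.evolution h] with ω hω t using hω t ()) s t
    simpa using this

/-- The rate of the contraction estimate. -/
def contractionRate (lam : ℝ≥0) (d : ℕ) : ℝ := 3 * (lam * (d : ℝ) ^ 2 + 1)

/-- Gronwall with `L = lam * d ^ 2 + 1`, `M = L * δ` and `θ = 3 * L` gives `M / (θ - L) = δ / 2`: a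
contraction by `1 / 2` in the weighted distance. The left side concerns the whole path up to `t`,
the hypothesis only single times. -/
theorem IsFlowSolution.measure_ne_le {A : ℝ} {Z Z' x x' : Ω → ℝ≥0 → ℕ}
    (hN : IsNoiseFamily P lam (single N)) (hU : Measurable U) (hUN : IndepFun U N P)
    (hA : 0 ≤ A) (hZ : IsFlow P A Z) (hZ' : IsFlow P A Z')
    (h : IsFlowSolution P N d (flow P Z) U x) (h' : IsFlowSolution P N d (flow P Z') U x')
    {δ : ℝ} (hδ : 0 ≤ δ) (hne : ∀ t, P.real {ω | Z ω t ≠ Z' ω t} ≤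
      δ * Real.exp (contractionRate lam d * t)) (t : ℝ≥0) :
    P.real {ω | ∃ s ≤ t, x ω s ≠ x' ω s} ≤ δ / 2 * Real.exp (contractionRate lam d * t) := by
  set L : ℝ := lam * (d : ℝ) ^ 2 + 1 with hLdef
  have hL : 0 < L := by positivity
  have hUm : Measurable fun ω (_ : Unit) => U ω := measurable_pi_lambda _ fun _ => hU
  have hUN' : IndepFun (fun ω (_ : Unit) => U ω) (single N) P :=
    hUN.comp (φ := fun u (_ : Unit) => u) (ψ := fun n (_ : Unit) => n)
      (measurable_pi_lambda _ fun _ => measurable_id) (measurable_pi_lambda _ fun _ => measurable_id)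
  set C : ℝ := 2 * lam * ((d : ℝ) ^ 2 * A) + (2 * Fintype.card Unit) ^ 2 * (1 + lam * (d : ℝ≥0)) ^ 2
  have hC : 0 ≤ C := by positivity
  have hx0 : decoupling P (fun ω (_ : Unit) => x ω) (fun ω _ => x' ω) () 0 ≤ 0 := by
    refine le_of_eq ?_
    rw [decoupling, measureReal_eq_zero_iff]
    refine measure_mono_null (t := {ω | ¬ (x ω 0 = U ω ∧ x' ω 0 = U ω)}) ?_ ?_
    · rintro ω ⟨s, hs, hne⟩ ⟨h1, h2⟩
      have : s = 0 := le_antisymm hs zero_le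
      subst this
      exact hne (h1.trans h2.symm)
    · have : ∀ᵐ ω ∂P, x ω 0 = U ω ∧ x' ω 0 = U ω := by
        filter_upwards [IsSystemSolution.initial h, IsSystemSolution.initial h'] with ω h1 h2
        exact ⟨h1 (), h2 ()⟩
      exact this
  have key := gronwall_exp (p := decoupling P (fun ω (_ : Unit) => x ω) (fun ω _ => x' ω) ())
    (L := L) (M := L * δ) (θ := contractionRate lam d) (C := C) hL.le (by positivity)
    (by rw [contractionRate]; linarith) hC hx0 (fun t s => ?_) t
  · refine key.trans_eq ?_
    rw [contractionRate, ← hLdef]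
    field_simp
    ring
  · set p := decoupling P (fun ω (_ : Unit) => x ω) (fun ω _ => x' ω) () t
    have hp : P.real {ω | x ω t ≠ x' ω t} ≤ p := measureReal_mono fun ω hω => ⟨t, le_rfl, hω⟩
    have hp0 : 0 ≤ p := measureReal_nonneg
    set e : ℝ := δ * Real.exp (contractionRate lam d * t)
    have he : 0 ≤ e := by positivity
    have hstep := decoupling_add_le hN hUm hUN' (hZ.isRate d) (hZ'.isRate d)
      (κ := (d : ℝ) ^ 2 * A) (by positivity) (hZ.abs_flowRate_sub_le d) (hZ'.abs_flowRate_sub_le d)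
      h h' () t s (r := (d : ℝ) ^ 2 * (p + e)) (by positivity)
      ((lintegral_limitRate_sub_le (hZ.measurable t) (hZ'.measurable t)
        (IsSystemSolution.measurable h () t) (IsSystemSolution.measurable h' () t) d).trans
        (ENNReal.ofReal_le_ofReal (mul_le_mul_of_nonneg_left (add_le_add hp (hne t))
          (by positivity))))
    refine hstep.trans ?_
    have hs : (0 : ℝ) ≤ s := s.2
    have : (lam : ℝ) * s * ((d : ℝ) ^ 2 * (p + e)) ≤ L * s * p + s * (L * e) := by
      have h1 : 0 ≤ s * (p + e) := by positivity
      calc (lam : ℝ) * s * ((d : ℝ) ^ 2 * (p + e)) = lam * (d : ℝ) ^ 2 * (s * (p + e)) := by ring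
        _ ≤ L * (s * (p + e)) := by gcongr; simp [L]
        _ = _ := by ring
    have e1 : s * (L * δ * Real.exp (contractionRate lam d * t)) = s * (L * e) := by
      simp only [e]; ring
    rw [e1]
    linarith

end Flow

/-! ### The McKean–Vlasov equation -/

section McKeanVlasov
variable {Ω : Type*} [MeasurableSpace Ω] {P : Measure Ω} [IsProbabilityMeasure P] {lam : ℝ≥0}
  {d : ℕ} {N : Ω → Noise} {U : Ω → ℕ}

omit [IsProbabilityMeasure P] in
theorem measurable_single (hN : IsNoiseFamily P lam (single N)) : Measurable N :=
  (measurable_pi_apply ()).comp hN.measurable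

theorem measureReal_ne_le (x x' : Ω → ℝ≥0 → ℕ) (t : ℝ≥0) :
    P.real {ω | x ω t ≠ x' ω t} ≤ P.real {ω | ∃ s ≤ t, x ω s ≠ x' ω s} :=
  measureReal_mono fun _ hω => ⟨t, le_rfl, hω⟩

/-- A queue driven by the flow of laws of `Z`, as a càdlàg process. -/
theorem IsFlow.exists_solution {A : ℝ} {Z : Ω → ℝ≥0 → ℕ} (hN : IsNoiseFamily P lam (single N))
    (hU : Measurable U) (hZ : IsFlow P A Z) : ∃ Y : Ω → CadlagPath ℕ,
      IsFlowSolution P N d (flow P Z) U (fun ω => Y ω) ∧ (∀ᵐ ω ∂P, Y ω 0 = U ω) ∧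
      ∀ᵐ ω ∂P, SolvesQueueEquation (Y ω) (fun t => limitRate d (Y ω t) (flow P Z t))
        (N ω).1 (N ω).2 := by
  obtain ⟨y, hm, h0, hy⟩ := hN.exists_solution (hZ.isRate d)
    (measurable_pi_lambda (fun ω (_ : Unit) => U ω) fun _ => hU)
  refine ⟨fun ω => y ω (), ?_, h0.mono fun ω h => h (), hy.mono fun ω h => h ()⟩
  exact hN.isSystemSolution (hZ.isRate d) (y := fun ω _ => y ω ()) (fun i t => hm i t) h0 hy

theorem tsum_geometric_tail (n : ℕ) (b : ℝ) (hb : 0 ≤ b) :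
    ∑' k, ENNReal.ofReal ((1 / 2) ^ (n + k) * b) = ENNReal.ofReal (2 * (1 / 2) ^ n * b) := by
  have h1 : ∀ k : ℕ, ((1 / 2 : ℝ)) ^ (n + k) * b = (1 / 2) ^ n * b * (1 / 2) ^ k := fun k => by
    rw [pow_add]; ring
  simp only [h1]
  rw [← ENNReal.ofReal_tsum_of_nonneg (fun k => by positivity)
    (summable_geometric_two.mul_left _), tsum_mul_left, tsum_geometric_two]
  congr 1
  ring

/-- Borel–Cantelli at each fixed time: the disagreement probabilities are summable, so the integer
values are eventually constant. The bound is the tail of a geometric series. Path regularity of the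
limit is neither obtained nor needed. -/
theorem exists_limit_process {z : ℕ → Ω → ℝ≥0 → ℕ} (hz : ∀ n t, Measurable fun ω => z n ω t)
    {θ : ℝ} (h : ∀ n t, P.real {ω | z n ω t ≠ z (n + 1) ω t} ≤ (1 / 2) ^ n * Real.exp (θ * t)) :
    ∃ Z : Ω → ℝ≥0 → ℕ, (∀ t, Measurable fun ω => Z ω t) ∧
      ∀ n t, P.real {ω | Z ω t ≠ z n ω t} ≤ 2 * (1 / 2) ^ n * Real.exp (θ * t) := by
  have hP : ∀ n t, P {ω | z n ω t ≠ z (n + 1) ω t} ≤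
      ENNReal.ofReal ((1 / 2) ^ n * Real.exp (θ * t)) := fun n t => by
    rw [← ofReal_measureReal]
    exact ENNReal.ofReal_le_ofReal (h n t)
  have hlim : ∀ t, ∃ Zt : Ω → ℕ, Measurable Zt ∧
      ∀ᵐ ω ∂P, Tendsto (fun n => z n ω t) atTop (𝓝 (Zt ω)) := fun t => by
    refine measurable_limit_of_tendsto_metrizable_ae (fun n => (hz n t).aemeasurable) ?_
    have hsum : ∑' n, P {ω | z n ω t ≠ z (n + 1) ω t} ≠ ∞ := by
      refine ((ENNReal.tsum_le_tsum fun n => hP n t).trans_lt ?_).ne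
      have := tsum_geometric_tail 0 (Real.exp (θ * t)) (by positivity)
      simp only [zero_add] at this
      rw [this]
      exact ENNReal.ofReal_lt_top
    filter_upwards [ae_eventually_notMem hsum] with ω hω
    obtain ⟨n0, hn0⟩ := eventually_atTop.1 hω
    refine ⟨z n0 ω t, tendsto_const_nhds.congr' ?_⟩
    filter_upwards [eventually_ge_atTop n0] with n hn
    induction n, hn using Nat.le_induction with
    | base => rfl
    | succ n hn ih => exact ih.trans (not_not.1 (hn0 n hn))
  choose Z hZm hZ using hlim
  refine ⟨fun ω t => Z t ω, hZm, fun n t => ?_⟩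
  have hsub : {ω | Z t ω ≠ z n ω t} ≤ᵐ[P] (⋃ k, {ω | z (n + k) ω t ≠ z (n + k + 1) ω t} : Set Ω) := by
    filter_upwards [hZ t] with ω hω hne
    by_contra hcon
    have hcon' : ∀ k, z (n + k) ω t = z (n + k + 1) ω t := fun k =>
      by_contra fun h => hcon (mem_iUnion.2 ⟨k, h⟩)
    have heq : ∀ k, z (n + k) ω t = z n ω t := fun k => by
      induction k with
      | zero => rfl
      | succ k ih => exact (hcon' k).symm.trans ih
    refine hne (tendsto_nhds_unique hω (tendsto_const_nhds.congr' ?_))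
    filter_upwards [eventually_ge_atTop n] with m hm
    obtain ⟨k, rfl⟩ := Nat.exists_eq_add_of_le hm
    exact (heq k).symm
  refine ENNReal.toReal_le_of_le_ofReal (by positivity) ((measure_mono_ae hsub).trans
    ((measure_iUnion_le _).trans ((ENNReal.tsum_le_tsum fun k => hP (n + k) t).trans_eq
      (tsum_geometric_tail n _ (by positivity)))))

theorem flow_congr {Z Z' : Ω → ℝ≥0 → ℕ} (h : ∀ t, P.real {ω | Z ω t ≠ Z' ω t} = 0) :
    flow P Z = flow P Z' := by
  funext t
  refine Measure.map_congr ?_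
  have := (measureReal_eq_zero_iff (μ := P)).1 (h t)
  exact this

/-- Picard iteration on flows of laws. The timewise limit `Z` supplies only a flow; a queue solved
along this flow is a càdlàg process, and the contraction shows that it has the same one-dimensional
laws as `Z`. -/
theorem exists_mcKeanVlasov_process (hN : IsNoiseFamily P lam (single N)) (hU : Measurable U)
    (hUN : IndepFun U N P) : ∃ Y : Ω → CadlagPath ℕ, (∀ t, Measurable fun ω => Y ω t) ∧
      (∀ᵐ ω ∂P, Y ω 0 = U ω) ∧ ∀ᵐ ω ∂P, SolvesQueueEquation (Y ω)
        (fun t => limitRate d (Y ω t) (P.map fun ω' => Y ω' t)) (N ω).1 (N ω).2 := by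
  set A : ℝ := 1 + lam * d
  have hA : 0 ≤ A := by positivity
  set θ := contractionRate lam d
  set F := {Z : Ω → ℝ≥0 → ℕ // IsFlow P A Z}
  have hnext : ∀ Z : F, ∃ Z' : F, IsFlowSolution P N d (flow P Z.1) U Z'.1 := fun Z => by
    obtain ⟨Y, hY, -⟩ := Z.2.exists_solution hN hU (d := d)
    exact ⟨⟨_, hY.isFlow hN Z.2⟩, hY⟩
  choose next hnext using hnext
  set z : ℕ → F := fun n => next^[n] ⟨fun _ _ => 0, ⟨fun _ => measurable_const, fun s t => by
    simpa using mul_nonneg hA dist_nonneg⟩⟩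
  have hz : ∀ n, IsFlowSolution P N d (flow P (z n).1) U (z (n + 1)).1 := fun n => by
    simp only [z, Function.iterate_succ_apply']
    exact hnext _
  have hle : ∀ n t, P.real {ω | (z n).1 ω t ≠ (z (n + 1)).1 ω t} ≤
      (1 / 2) ^ n * Real.exp (θ * t) := by
    intro n
    induction n with
    | zero =>
      intro t
      rw [pow_zero, one_mul]
      exact measureReal_le_one.trans (Real.one_le_exp (by
        simp only [θ, contractionRate]; positivity))
    | succ n ih =>
      intro t
      refine le_trans (measureReal_ne_le _ _ t)
        (((hz n).measure_ne_le hN hU hUN hA (z n).2 (z (n + 1)).2 (hz (n + 1))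
          (δ := (1 / 2) ^ n) (by positivity) ih t).trans_eq ?_)
      rw [pow_succ]
      ring
  obtain ⟨Z, hZm, hZ⟩ := exists_limit_process (fun n => (z n).2.measurable) hle
  have hlim : ∀ t : ℝ≥0, Tendsto (fun n : ℕ => 2 * (1 / 2) ^ n * Real.exp (θ * t)) atTop (𝓝 0) :=
    fun t => by
    have := ((tendsto_pow_atTop_nhds_zero_of_lt_one (r := (1 / 2 : ℝ)) (by norm_num)
      (by norm_num)).const_mul 2).mul_const (Real.exp (θ * t))
    simpa using this
  -- The Lipschitz bound with the common constant `A` passes to the limit, because the iterates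
  -- approximate `Z` in probability at both times.
  have hZF : IsFlow P A Z := by
    refine ⟨hZm, fun s t => ?_⟩
    have hl := ((hlim s).add_const (A * dist s t)).add (hlim t)
    rw [zero_add, add_zero] at hl
    refine ge_of_tendsto' hl fun n => ?_
    have hsub : {ω | Z ω s ≠ Z ω t} ⊆ {ω | Z ω s ≠ (z n).1 ω s} ∪
        {ω | (z n).1 ω s ≠ (z n).1 ω t} ∪ {ω | Z ω t ≠ (z n).1 ω t} := fun ω hω => by
      by_contra hcon
      simp only [mem_union, mem_ofPred_eq, not_or, not_not] at hcon
      exact hω (hcon.1.1.trans (hcon.1.2.trans hcon.2.symm))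
    exact (measureReal_mono hsub).trans ((measureReal_union_le _ _).trans (add_le_add
      ((measureReal_union_le _ _).trans (add_le_add (hZ n s) ((z n).2.lipschitz s t))) (hZ n t)))
  obtain ⟨Y, hY, hY0, hYe⟩ := hZF.exists_solution hN hU (d := d)
  -- Iterate `n + 1` is driven by iterate `n` as `Y` is driven by `Z`. The contraction therefore
  -- places it close to `Y`, and it is close to `Z` by construction.
  have hYZ : ∀ t, P.real {ω | Y ω t ≠ Z ω t} = 0 := fun t => by
    refine le_antisymm ?_ measureReal_nonneg
    have hl := (hlim t).add ((hlim t).comp (tendsto_add_atTop_nat 1))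
    rw [zero_add] at hl
    refine ge_of_tendsto' hl fun n => ?_
    have h1 := hY.measure_ne_le hN hU hUN hA hZF (z n).2 (hz n) (δ := 2 * (1 / 2) ^ n)
      (by positivity) (hZ n) t
    have hsub : {ω | Y ω t ≠ Z ω t} ⊆ {ω | ∃ s ≤ t, Y ω s ≠ (z (n + 1)).1 ω s} ∪
        {ω | Z ω t ≠ (z (n + 1)).1 ω t} := fun ω hω => by
      by_contra hcon
      simp only [mem_union, mem_ofPred_eq, not_or, not_not, not_exists, not_and] at hcon
      exact hω ((hcon.1 t le_rfl).trans hcon.2.symm)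
    refine (measureReal_mono hsub).trans ((measureReal_union_le _ _).trans (add_le_add
      (h1.trans ?_) (hZ (n + 1) t)))
    gcongr
    have : (0 : ℝ) ≤ 2 * (1 / 2) ^ n := by positivity
    linarith
  refine ⟨Y, fun t => IsSystemSolution.measurable hY () t, hY0, ?_⟩
  have hflow : ∀ t, flow P Z t = P.map fun ω => Y ω t := fun t =>
    congrFun (flow_congr hYZ).symm t
  simpa only [hflow] using hYe

theorem IsMcKeanVlasov.isFlow {q : ℕ → ℝ} {Y : Ω → CadlagPath ℕ}
    (hN : IsNoiseFamily P lam (single N))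
    (h : IsMcKeanVlasov P d q (fun ω => (N ω).1) (fun ω => (N ω).2) Y) :
    IsFlow P (1 + lam * d) fun ω => Y ω where
  measurable := h.measurable
  lipschitz s t := by
    have hC : ∀ ω t, limitRate d (Y ω t) (P.map fun ω' => Y ω' t) ≤ (d : ℝ≥0) := fun ω t => by
      have := Measure.isProbabilityMeasure_map (μ := P) (h.measurable t).aemeasurable
      rw [NNReal.coe_natCast]
      exact limitRate_le d
    have := hN.measure_ne_le () (K := d) (x := fun ω => Y ω) hC (by
      filter_upwards [h.evolution, hN.ae_isRegularNoise d] with ω hω hr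
      exact (solvesQueueEquation_iff (hC ω) (hr ()).toIsLocallyFiniteNoise).1 hω) s t
    simpa using this

theorem IsMcKeanVlasov.isFlowSolution {q : ℕ → ℝ} {Y : Ω → CadlagPath ℕ}
    (hN : IsNoiseFamily P lam (single N))
    (h : IsMcKeanVlasov P d q (fun ω => (N ω).1) (fun ω => (N ω).2) Y)
    (h0 : ∀ᵐ ω ∂P, Y ω 0 = U ω) :
    IsFlowSolution P N d (flow P fun ω => Y ω) U fun ω => Y ω :=
  hN.isSystemSolution ((h.isFlow hN).isRate d) (y := fun ω _ => Y ω) (fun _ t => h.measurable t)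
    (h0.mono fun _ h _ => h) (h.evolution.mono fun _ h _ => h)

theorem CadlagPath.ext {E : Type*} [TopologicalSpace E] {x y : CadlagPath E} (h : ∀ t, x t = y t) :
    x = y := by
  cases x; cases y; congr; exact funext h

/-- Two solutions are driven by their own flows, so the contraction applies to the pair itself.
Starting from the trivial bound one, it yields `2 ^ (-n) * exp (θ t)` for every `n`, for
disagreement anywhere on `[0, t]`. -/
theorem IsMcKeanVlasov.ae_eq {q q' : ℕ → ℝ} {Y Y' : Ω → CadlagPath ℕ}
    (hN : IsNoiseFamily P lam (single N))
    (h : IsMcKeanVlasov P d q (fun ω => (N ω).1) (fun ω => (N ω).2) Y)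
    (h' : IsMcKeanVlasov P d q' (fun ω => (N ω).1) (fun ω => (N ω).2) Y')
    (h0 : ∀ᵐ ω ∂P, Y ω 0 = Y' ω 0) : ∀ᵐ ω ∂P, Y ω = Y' ω := by
  have hA : (0 : ℝ) ≤ 1 + lam * d := by positivity
  set U : Ω → ℕ := fun ω => Y ω 0
  have hU : Measurable U := h.measurable 0
  have s1 := h.isFlowSolution hN (U := U) (ae_of_all _ fun _ => rfl)
  have s2 := h'.isFlowSolution hN (U := U) (h0.mono fun _ h => h.symm)
  have hbound : ∀ (n : ℕ) (t : ℝ≥0), P.real {ω | ∃ s ≤ t, Y ω s ≠ Y' ω s} ≤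
      (1 / 2) ^ n * Real.exp (contractionRate lam d * t) := by
    intro n
    induction n with
    | zero =>
      intro t
      rw [pow_zero, one_mul]
      exact measureReal_le_one.trans (Real.one_le_exp (by
        simp only [contractionRate]; positivity))
    | succ n ih =>
      intro t
      refine (s1.measure_ne_le hN hU h.indep_noise hA (h.isFlow hN) (h'.isFlow hN) s2
        (δ := (1 / 2) ^ n) (by positivity) (fun t => (measureReal_ne_le _ _ t).trans (ih t)) t).trans_eq ?_
      rw [pow_succ]
      ring
  have hzero : ∀ t : ℝ≥0, P {ω | ∃ s ≤ t, Y ω s ≠ Y' ω s} = 0 := fun t => by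
    refine (measureReal_eq_zero_iff (μ := P)).1 (le_antisymm ?_ measureReal_nonneg)
    have := (tendsto_pow_atTop_nhds_zero_of_lt_one (r := (1 / 2 : ℝ)) (by norm_num)
      (by norm_num)).mul_const (Real.exp (contractionRate lam d * t))
    rw [zero_mul] at this
    exact ge_of_tendsto' this fun n => hbound n t
  have : ∀ᵐ ω ∂P, ∀ n : ℕ, ¬ ∃ s ≤ (n : ℝ≥0), Y ω s ≠ Y' ω s :=
    ae_all_iff.2 fun n => measure_eq_zero_iff_ae_notMem.1 (hzero n)
  filter_upwards [this] with ω hω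
  refine CadlagPath.ext fun t => ?_
  obtain ⟨n, hn⟩ := exists_nat_ge t
  exact by_contra fun hne => hω n ⟨t, hn, hne⟩

/-! ### Uniqueness in law -/

theorem HasTail.map_eq {Ω' : Type*} [MeasurableSpace Ω'] {P' : Measure Ω'} [IsProbabilityMeasure P']
    {q : ℕ → ℝ} {U' : Ω' → ℕ} (hU : Measurable U) (hU' : Measurable U') (h : HasTail P q U)
    (h' : HasTail P' q U') : P.map U = P'.map U' := by
  have : IsProbabilityMeasure (P.map U) := Measure.isProbabilityMeasure_map hU.aemeasurable
  refine Measure.ext_of_Ici _ _ fun j => ?_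
  rw [Measure.map_apply hU measurableSet_Ici, Measure.map_apply hU' measurableSet_Ici]
  exact (h j).trans (h' j).symm

/-- The joint law is the product of the laws of the initial value, the service noise and the arrival
noise; these are fixed by the tail and the intensities. -/
theorem map_noise_eq {Ω' : Type*} [MeasurableSpace Ω'] {P' : Measure Ω'} [IsProbabilityMeasure P']
    {q : ℕ → ℝ} {U' : Ω' → ℕ} {N' : Ω' → Noise} (hN : IsNoiseFamily P lam (single N))
    (hN' : IsNoiseFamily P' lam (single N')) (hU : Measurable U) (hU' : Measurable U')
    (h : HasTail P q U) (h' : HasTail P' q U') (hUN : IndepFun U N P)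
    (hUN' : IndepFun U' N' P') :
    P.map (fun ω => (U ω, N ω)) = P'.map (fun ω => (U' ω, N' ω)) := by
  have m1 := measurable_single hN
  have m2 := measurable_single hN'
  rw [(indepFun_iff_map_prod_eq_prod_map_map hU.aemeasurable m1.aemeasurable).1 hUN,
    (indepFun_iff_map_prod_eq_prod_map_map hU'.aemeasurable m2.aemeasurable).1 hUN',
    h.map_eq hU hU' h']
  congr 1
  have e1 := (indepFun_iff_map_prod_eq_prod_map_map (hN.service ()).measurable.aemeasurable
    (hN.arrival ()).measurable.aemeasurable).1 (hN.indep_pair ())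
  have e2 := (indepFun_iff_map_prod_eq_prod_map_map (hN'.service ()).measurable.aemeasurable
    (hN'.arrival ()).measurable.aemeasurable).1 (hN'.indep_pair ())
  rw [(hN.service ()).map_eq (hN'.service ()), (hN.arrival ()).map_eq (hN'.arrival ()), ← e2] at e1
  exact e1

theorem iIndepFun_unit {β : Type*} [MeasurableSpace β] (f : Unit → Ω → β) : iIndepFun f P := by
  rw [iIndepFun_iff_measure_inter_preimage_eq_mul]
  intro S sets _
  have : S = ∅ ∨ S = {()} := by
    rcases S.eq_empty_or_nonempty with h | ⟨x, hx⟩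
    · exact Or.inl h
    · refine Or.inr (Finset.eq_singleton_iff_unique_mem.2 ⟨hx, fun _ _ => rfl⟩)
  rcases this with rfl | rfl
  · simp
  · rw [Finset.prod_singleton]
    congr 1
    ext ω
    simp only [Finset.mem_singleton, mem_iInter, mem_preimage]
    exact ⟨fun h => h () trivial, fun h i _ => h⟩

omit [IsProbabilityMeasure P] in
theorem IsPoissonRandomMeasure.of_map {S T : Type*} [MeasurableSpace S] [MeasurableSpace T]
    {ν : Measure S} {g : Ω → T} (hg : Measurable g) {η : T → Measure S}
    (hη : Measurable η) (h : IsPoissonRandomMeasure P ν fun ω => η (g ω)) :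
    IsPoissonRandomMeasure (P.map g) ν η where
  measurable := hη
  poisson s hs hν := by
    rw [Measure.map_map (g := fun t => η t s) ((Measure.measurable_coe hs).comp hη) hg]
    exact h.poisson s hs hν
  indep n s hs hd := by
    have hm : ∀ k, Measurable fun t => η t (s k) := fun k =>
      (Measure.measurable_coe (hs k)).comp hη
    have := h.indep n s hs hd
    rw [iIndepFun_iff_measure_inter_preimage_eq_mul] at this ⊢
    intro F sets hsets
    rw [Measure.map_apply hg (F.measurableSet_biInter fun k hk => hm k (hsets k hk))]
    refine Eq.trans ?_ ((this F hsets).trans (Finset.prod_congr rfl fun k hk => ?_))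
    · simp only [preimage_iInter]; rfl
    · rw [Measure.map_apply hg (hm k (hsets k hk))]; rfl

/-- The solution map of the McKean–Vlasov equation. -/
theorem exists_solutionMap {q : ℕ → ℝ} (hN : IsNoiseFamily P lam (single N)) (hU : Measurable U)
    (hUq : HasTail P q U) (hUN : IndepFun U N P) :
    ∃ Φ : ℕ × Noise → CadlagPath ℕ, Measurable Φ ∧
      ∀ {Ω' : Type*} [MeasurableSpace Ω'] (P' : Measure Ω') [IsProbabilityMeasure P']
        (N' : Ω' → Noise) (U' : Ω' → ℕ), IsNoiseFamily P' lam (single N') → Measurable U' →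
        HasTail P' q U' → IndepFun U' N' P' →
        IsMcKeanVlasov P' d q (fun ω => (N' ω).1) (fun ω => (N' ω).2) (fun ω => Φ (U' ω, N' ω)) ∧
        ∀ᵐ ω ∂P', Φ (U' ω, N' ω) 0 = U' ω := by
  have hNm := measurable_single hN
  -- The equation is solved on the canonical space with the joint law `Q` of initial value and
  -- noise. The solution is then a function of these data and can be composed with any other data of
  -- law `Q`.
  set g : Ω → ℕ × Noise := fun ω => (U ω, N ω)
  have hg : Measurable g := hU.prodMk hNm
  set Q := P.map g with hQ
  have : IsProbabilityMeasure Q := Measure.isProbabilityMeasure_map hg.aemeasurable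
  have hQN : IsNoiseFamily Q lam (single fun s : ℕ × Noise => s.2) := by
    refine ⟨fun i => ?_, fun i => ?_, fun i => ?_, iIndepFun_unit _⟩
    · exact (hN.service ()).of_map hg (η := fun s : ℕ × Noise => s.2.1)
        (measurable_fst.comp measurable_snd)
    · exact (hN.arrival ()).of_map hg (η := fun s : ℕ × Noise => s.2.2)
        (measurable_snd.comp measurable_snd)
    · have := hN.indep_pair ()
      rw [indepFun_iff_measure_inter_preimage_eq_mul] at this ⊢
      intro s t hs ht
      have m1 : MeasurableSet ((fun s : ℕ × Noise => s.2.1) ⁻¹' s) :=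
        (measurable_fst.comp measurable_snd) hs
      have m2 : MeasurableSet ((fun s : ℕ × Noise => s.2.2) ⁻¹' t) :=
        (measurable_snd.comp measurable_snd) ht
      have := this s t hs ht
      simp only [single]
      rw [hQ, Measure.map_apply hg (m1.inter m2), Measure.map_apply hg m1, Measure.map_apply hg m2]
      exact this
  have hQU : IndepFun (fun s : ℕ × Noise => s.1) (fun s : ℕ × Noise => s.2) Q := by
    rw [indepFun_iff_measure_inter_preimage_eq_mul] at hUN ⊢
    intro s t hs ht
    have m1 : MeasurableSet ((fun s : ℕ × Noise => s.1) ⁻¹' s) := measurable_fst hs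
    have m2 : MeasurableSet ((fun s : ℕ × Noise => s.2) ⁻¹' t) := measurable_snd ht
    rw [hQ, Measure.map_apply hg (m1.inter m2), Measure.map_apply hg m1, Measure.map_apply hg m2]
    exact hUN s t hs ht
  obtain ⟨Φ, hΦm, hΦ0, hΦ⟩ := exists_mcKeanVlasov_process (d := d) hQN measurable_fst hQU
  refine ⟨Φ, CadlagPath.measurable_of_eval CadlagPath.nat_eq_of_dist_lt_one hΦm, ?_⟩
  intro Ω' _ P' _ N' U' hN' hU' hUq' hUN'
  have hg' : Measurable fun ω => (U' ω, N' ω) := hU'.prodMk (measurable_single hN')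
  have hQ' : Q = P'.map fun ω => (U' ω, N' ω) := map_noise_eq hN hN' hU hU' hUq hUq' hUN hUN'
  have h0 : ∀ᵐ ω ∂P', Φ (U' ω, N' ω) 0 = U' ω := by
    rw [hQ'] at hΦ0
    exact ae_of_ae_map hg'.aemeasurable hΦ0
  refine ⟨⟨fun t => (hΦm t).comp hg', fun j => ?_, ?_, ?_⟩, h0⟩
  · rw [← hUq' j]
    refine measure_congr ?_
    filter_upwards [h0] with ω hω
    exact propext (by change j ≤ Φ (U' ω, N' ω) 0 ↔ j ≤ U' ω; rw [hω])
  · exact hUN'.congr (h0.mono fun _ h => h.symm) (ae_of_all _ fun _ => rfl)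
  -- Composition preserves the one-dimensional laws, so the law inside the arrival rate is again
  -- that of the process itself.
  · have hlaw : ∀ t, (P'.map fun ω => Φ (U' ω, N' ω) t) = Q.map fun s => Φ s t := fun t => by
      rw [hQ', Measure.map_map (hΦm t) hg']
      rfl
    simp only [hlaw]
    have h2 := hΦ
    rw [hQ'] at h2 ⊢
    exact ae_of_ae_map hg'.aemeasurable h2

end McKeanVlasov

/-! ### Counting injective tuples -/

section Count
variable {V : Type*} [Fintype V] [DecidableEq V] {n : ℕ}

-- Swapping the values `v` and `v'` is a bijection between the fibres of `f ↦ f k` over `v` and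
-- `v'`, so all fibres over `B` have the same size.
omit [Fintype V] in
theorem card_filter_apply_mul_card (F : Finset (Fin n → V)) (B : Finset V) (k : Fin n)
    (hB : ∀ f ∈ F, f k ∈ B)
    (hF : ∀ f ∈ F, ∀ v ∈ B, ∀ v' ∈ B, (fun l => Equiv.swap v v' (f l)) ∈ F) {v : V} (hv : v ∈ B) :
    (F.filter fun f => f k = v).card * B.card = F.card := by
  have hsame : ∀ v' ∈ B, (F.filter fun f => f k = v').card = (F.filter fun f => f k = v).card := by
    intro v' hv'
    refine Finset.card_nbij' (fun f l => Equiv.swap v v' (f l)) (fun f l => Equiv.swap v v' (f l))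
      ?_ ?_ ?_ ?_
    · intro f hf
      simp only [Finset.coe_filter, mem_ofPred_eq] at hf ⊢
      exact ⟨hF f hf.1 v hv v' hv', by rw [hf.2, Equiv.swap_apply_right]⟩
    · intro f hf
      simp only [Finset.coe_filter, mem_ofPred_eq] at hf ⊢
      exact ⟨hF f hf.1 v hv v' hv', by rw [hf.2, Equiv.swap_apply_left]⟩
    · intro f _; simp
    · intro f _; simp
  rw [Finset.card_eq_sum_card_fiberwise (f := fun f => f k) (t := B)
    (fun f hf => hB f hf), Finset.sum_congr rfl hsame,
    Finset.sum_const, smul_eq_mul, mul_comm]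

/-- The injective `n`-tuples with entries in `A`. -/
def injTuples (n : ℕ) (A : Finset V) : Finset (Fin n → V) :=
  open Classical in Finset.univ.filter fun f => Function.Injective f ∧ ∀ k, f k ∈ A

theorem mem_injTuples {A : Finset V} {f : Fin n → V} :
    f ∈ injTuples n A ↔ Function.Injective f ∧ ∀ k, f k ∈ A := by
  simp [injTuples]

theorem card_injTuples (A : Finset V) : (injTuples n A).card = A.card.descFactorial n := by
  classical
  have h := Fintype.card_embedding_eq (α := Fin n) (β := A)
  rw [Fintype.card_coe, Fintype.card_fin] at h
  rw [← h, ← Finset.card_univ]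
  symm
  refine Finset.card_bij (fun e _ k => (e k : V)) (fun e _ => ?_) (fun e _ e' _ h => ?_)
    fun f hf => ?_
  · exact mem_injTuples.2 ⟨Subtype.val_injective.comp e.injective, fun k => (e k).2⟩
  · exact DFunLike.ext _ _ fun k => Subtype.ext (congrFun h k)
  · obtain ⟨h1, h2⟩ := mem_injTuples.1 hf
    exact ⟨⟨fun k => ⟨f k, h2 k⟩, fun a b hab => h1 (congrArg Subtype.val hab)⟩,
      Finset.mem_univ _, rfl⟩

theorem swap_mem_injTuples {A : Finset V} {f : Fin n → V} (hf : f ∈ injTuples n A) {v v' : V}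
    (hv : v ∈ A) (hv' : v' ∈ A) : (fun l => Equiv.swap v v' (f l)) ∈ injTuples n A := by
  obtain ⟨h1, h2⟩ := mem_injTuples.1 hf
  refine mem_injTuples.2 ⟨(Equiv.injective _).comp h1, fun k => ?_⟩
  rw [Equiv.swap_apply_def]
  split_ifs
  exacts [hv', hv, h2 k]

theorem card_filter_injTuples {A : Finset V} (k : Fin n) {v : V} (hv : v ∈ A) :
    ((injTuples n A).filter fun f => f k = v).card * A.card = A.card.descFactorial n := by
  rw [← card_injTuples]
  exact card_filter_apply_mul_card _ _ k (fun f hf => (mem_injTuples.1 hf).2 k)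
    (fun f hf v hv v' hv' => swap_mem_injTuples hf hv hv') hv

/-- Once `f z = i` is fixed, the swaps of elements of `A` other than `i` still act on the remaining
tuples, and position `k` is equidistributed over `A` without `i`. -/
theorem card_filter_filter_injTuples {A : Finset V} {k z : Fin n} (hkz : k ≠ z) {v i : V}
    (hv : v ∈ A) (hi : i ∈ A) (hvi : v ≠ i) :
    ((injTuples n A).filter fun f => f z = i ∧ f k = v).card * ((A.card - 1) * A.card) =
      A.card.descFactorial n := by
  rw [← card_filter_injTuples z hi, ← mul_assoc]
  congr 1
  rw [← Finset.filter_filter, ← Finset.card_erase_of_mem hi]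
  refine card_filter_apply_mul_card _ _ k (fun f hf => ?_) (fun f hf v hv v' hv' => ?_)
    (Finset.mem_erase.2 ⟨hvi, hv⟩)
  · obtain ⟨h1, h2⟩ := Finset.mem_filter.1 hf
    obtain ⟨h3, h4⟩ := mem_injTuples.1 h1
    exact Finset.mem_erase.2 ⟨fun h => hkz (h3 (h.trans h2.symm)), h4 k⟩
  · obtain ⟨h1, h2⟩ := Finset.mem_filter.1 hf
    obtain ⟨h3, h4⟩ := Finset.mem_erase.1 hv
    obtain ⟨h5, h6⟩ := Finset.mem_erase.1 hv'
    refine Finset.mem_filter.2 ⟨swap_mem_injTuples h1 h4 h6, ?_⟩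
    simp only [h2]
    exact Equiv.swap_apply_of_ne_of_ne h3.symm h5.symm

end Count

/-! ### Sampling weights -/

section Weights
variable {N : ℕ} (G : SimpleGraph (Fin N)) {n : ℕ}

open Classical in
/-- The set of neighbors of `u`. -/
def nbrs (u : Fin N) : Finset (Fin N) := G.neighborFinset u

theorem mem_nbrs {u v : Fin N} : v ∈ nbrs G u ↔ G.Adj u v := by simp [nbrs]

theorem card_nbrs (u : Fin N) : (nbrs G u).card = deg G u := by
  classical
  rw [nbrs, deg, SimpleGraph.card_neighborFinset_eq_degree]

theorem edge_nonneg (u v : Fin N) : 0 ≤ edge G u v := by unfold edge; split_ifs <;> simp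

theorem sampleWeight_nonneg (u : Fin N) (f : Fin n → Fin N) : 0 ≤ sampleWeight G u f :=
  div_nonneg (Finset.prod_nonneg fun _ _ => edge_nonneg G u _) (Nat.cast_nonneg _)

open Classical in
theorem sampleWeight_eq (u : Fin N) (f : Fin n → Fin N) : sampleWeight G u f =
    if ∀ k, f k ∈ nbrs G u then 1 / ((deg G u).descFactorial n : ℝ) else 0 := by
  unfold sampleWeight
  split_ifs with h
  · congr 1
    refine Finset.prod_eq_one fun k _ => ?_
    simp [edge, (mem_nbrs G).1 (h k)]
  · push Not at h
    obtain ⟨k, hk⟩ := h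
    rw [Finset.prod_eq_zero (Finset.mem_univ k), zero_div]
    simp [edge, mt (mem_nbrs G).2 hk]

/-- The sampling weight is the uniform distribution on injective tuples of neighbors, so weights of
events become counts. -/
theorem sum_sampleWeight (u : Fin N) (p : (Fin n → Fin N) → Prop) [DecidablePred p] :
    ∑ f ∈ (distinctTuples N n u).filter p, sampleWeight G u f =
      (((injTuples n (nbrs G u)).filter p).card : ℝ) / ((deg G u).descFactorial n : ℝ) := by
  classical
  simp only [sampleWeight_eq]
  rw [← Finset.sum_filter, Finset.sum_const, nsmul_eq_mul, mul_one_div]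
  congr 3
  ext f
  simp only [distinctTuples, Finset.mem_filter, Finset.mem_univ, true_and, mem_injTuples]
  constructor
  · rintro ⟨⟨⟨h1, -⟩, h2⟩, h3⟩
    exact ⟨⟨h1, h3⟩, h2⟩
  · rintro ⟨⟨h1, h3⟩, h2⟩
    exact ⟨⟨⟨h1, fun k h => (G.ne_of_adj ((mem_nbrs G).1 (h3 k))) h.symm⟩, h2⟩, h3⟩

theorem descFactorial_pos_of_le {D : ℕ} (h : n ≤ D) : (0 : ℝ) < (D.descFactorial n : ℝ) := by
  exact_mod_cast Nat.descFactorial_pos.2 h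

theorem sum_sampleWeight_eq_one {u : Fin N} (h : n ≤ deg G u) :
    ∑ f ∈ distinctTuples N n u, sampleWeight G u f = 1 := by
  classical
  have := sum_sampleWeight G u fun _ : Fin n → Fin N => True
  rw [Finset.filter_true, Finset.filter_true, card_injTuples, card_nbrs] at this
  rw [this, div_self (descFactorial_pos_of_le h).ne']

theorem sum_sampleWeight_apply {u : Fin N} (h : n ≤ deg G u) (k : Fin n) (v : Fin N) :
    ∑ f ∈ (distinctTuples N n u).filter (fun f => f k = v), sampleWeight G u f =
      edge G u v / deg G u := by
  classical
  rw [sum_sampleWeight]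
  have hpos := descFactorial_pos_of_le h
  by_cases hv : v ∈ nbrs G u
  · have hD : 0 < deg G u := by rw [← card_nbrs]; exact Finset.card_pos.2 ⟨v, hv⟩
    have := card_filter_injTuples (n := n) k hv
    rw [card_nbrs] at this
    have h2 : (((injTuples n (nbrs G u)).filter fun f => f k = v).card : ℝ) * deg G u =
      (deg G u).descFactorial n := by exact_mod_cast this
    have : (0 : ℝ) < deg G u := by exact_mod_cast hD
    rw [edge, if_pos ((mem_nbrs G).1 hv), div_eq_div_iff hpos.ne' this.ne', one_mul, h2]
  · rw [edge, if_neg (mt (mem_nbrs G).2 hv), zero_div, Finset.card_eq_zero.2, Nat.cast_zero,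
      zero_div]
    refine Finset.filter_eq_empty_iff.2 fun f hf hfk => hv ?_
    rw [← hfk]
    exact (mem_injTuples.1 hf).2 k

/-- A given ordered pair of distinct neighbors occupies two given positions with probability `1 / (D
* (D - 1))`; in all other cases with `v` not a neighbor or equal to `i` the sum is empty. -/
theorem sum_sampleWeight_apply_apply_le {u : Fin N} (h : n ≤ deg G u) (h2 : 2 ≤ deg G u)
    {k z : Fin n} (hkz : k ≠ z) (v i : Fin N) :
    ∑ f ∈ (distinctTuples N n u).filter (fun f => f z = i ∧ f k = v), sampleWeight G u f ≤
      edge G u i / deg G u * (1 / ((deg G u : ℝ) - 1)) := by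
  classical
  rw [sum_sampleWeight]
  have hpos := descFactorial_pos_of_le h
  have hD : (2 : ℝ) ≤ deg G u := by exact_mod_cast h2
  have hD1 : (0 : ℝ) < (deg G u : ℝ) - 1 := by linarith
  have hrhs : 0 ≤ edge G u i / deg G u * (1 / ((deg G u : ℝ) - 1)) :=
    mul_nonneg (div_nonneg (edge_nonneg _ _ _) (Nat.cast_nonneg _)) (by positivity)
  by_cases hv : v ∈ nbrs G u ∧ i ∈ nbrs G u ∧ v ≠ i
  · have := card_filter_filter_injTuples (n := n) hkz hv.1 hv.2.1 hv.2.2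
    rw [card_nbrs] at this
    have h3 : (((injTuples n (nbrs G u)).filter fun f => f z = i ∧ f k = v).card : ℝ) *
        (((deg G u : ℝ) - 1) * deg G u) = (deg G u).descFactorial n := by
      rw [← this]
      push_cast [Nat.cast_sub (show 1 ≤ deg G u by omega)]
      ring
    rw [edge, if_pos ((mem_nbrs G).1 hv.2.1), ← h3]
    have h4 : (((injTuples n (nbrs G u)).filter fun f => f z = i ∧ f k = v).card : ℝ) ≠ 0 := by
      intro h0
      rw [h0, zero_mul] at h3
      exact hpos.ne h3
    refine le_of_eq ?_
    field_simp
  · rw [Finset.card_eq_zero.2, Nat.cast_zero, zero_div]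
    · exact hrhs
    · refine Finset.filter_eq_empty_iff.2 fun f hf hfk => hv ⟨?_, ?_, ?_⟩
      · rw [← hfk.2]; exact (mem_injTuples.1 hf).2 k
      · rw [← hfk.1]; exact (mem_injTuples.1 hf).2 z
      · rw [← hfk.1, ← hfk.2]; exact fun h => hkz ((mem_injTuples.1 hf).1 h)

/-- Exchanging the roles of the server `i` and of the first sampled server. -/
theorem sum_exchange (i : Fin N) (z : Fin n) (p : (Fin n → Fin N) → Prop) [DecidablePred p] :
    ∑ j ∈ (distinctTuples N n i).filter p, sampleWeight G (j z) (Function.update j z i) =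
      ∑ u, ∑ f ∈ (distinctTuples N n u).filter (fun f => f z = i ∧ p (Function.update f z u)),
        sampleWeight G u f := by
  classical
  rw [← Finset.sum_fiberwise _ (fun j => j z)]
  refine Finset.sum_congr rfl fun u _ => ?_
  -- Exchanging the center of a tuple with its entry at `z` keeps all servers distinct. Two
  -- exchanges give the identity, which yields the bijection below.
  have hmem : ∀ (a b : Fin N) (f : Fin n → Fin N), f ∈ distinctTuples N n a → f z = b →
      Function.update f z a ∈ distinctTuples N n b := by
    intro a b f hf hfz
    simp only [distinctTuples, Finset.mem_filter, Finset.mem_univ, true_and] at hf ⊢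
    refine ⟨fun k l hkl => ?_, fun k => ?_⟩
    · by_cases hk : k = z <;> by_cases hl : l = z
      · rw [hk, hl]
      · rw [hk, Function.update_self, Function.update_of_ne hl] at hkl
        exact absurd hkl.symm (hf.2 l)
      · rw [hl, Function.update_self, Function.update_of_ne hk] at hkl
        exact absurd hkl (hf.2 k)
      · rw [Function.update_of_ne hk, Function.update_of_ne hl] at hkl
        exact hf.1 hkl
    · by_cases hk : k = z
      · rw [hk, Function.update_self, ← hfz]
        exact (hf.2 z).symm
      · rw [Function.update_of_ne hk, ← hfz]
        exact fun h => hk (hf.1 h)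
  refine Finset.sum_nbij' (fun j => Function.update j z i) (fun f => Function.update f z u)
    ?_ ?_ ?_ ?_ ?_
  · intro j hj
    obtain ⟨h1, h2⟩ := Finset.mem_filter.1 hj
    obtain ⟨h3, h4⟩ := Finset.mem_filter.1 h1
    refine Finset.mem_filter.2 ⟨hmem i u j h3 h2, Function.update_self _ _ _, ?_⟩
    rw [Function.update_idem, ← h2, Function.update_eq_self]
    exact h4
  · intro f hf
    obtain ⟨h1, h2, h3⟩ := Finset.mem_filter.1 hf
    exact Finset.mem_filter.2 ⟨Finset.mem_filter.2 ⟨hmem u i f h1 h2, h3⟩,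
      Function.update_self _ _ _⟩
  · intro j hj
    obtain ⟨h1, h2⟩ := Finset.mem_filter.1 hj
    rw [Function.update_idem, ← h2, Function.update_eq_self]
  · intro f hf
    obtain ⟨h1, h2, h3⟩ := Finset.mem_filter.1 hf
    rw [Function.update_idem, ← h2, Function.update_eq_self]
  · intro j hj
    obtain ⟨h1, h2⟩ := Finset.mem_filter.1 hj
    rw [h2]

/-- The rate at which server `i` is compared with the tuple `j`. -/
def tupleWeight (i : Fin N) (z : Fin n) (j : Fin n → Fin N) : ℝ :=
  sampleWeight G i j + n * sampleWeight G (j z) (Function.update j z i)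

theorem tupleWeight_nonneg (i : Fin N) (z : Fin n) (j : Fin n → Fin N) :
    0 ≤ tupleWeight G i z j :=
  add_nonneg (sampleWeight_nonneg _ _ _)
    (mul_nonneg (Nat.cast_nonneg _) (sampleWeight_nonneg _ _ _))

/-- `∑_{j ≠ i} ξ_{ji} / D_j`. -/
def inflow (i : Fin N) : ℝ :=
  ∑ j ∈ Finset.univ.filter (fun j => j ≠ i), edge G j i / (deg G j : ℝ)

theorem sum_edge_div_eq_inflow (i : Fin N) : ∑ u, edge G u i / (deg G u : ℝ) = inflow G i := by
  rw [inflow]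
  refine (Finset.sum_subset (Finset.filter_subset _ _) fun j _ hj => ?_).symm
  have : j = i := by simpa using hj
  rw [this, edge, if_neg (G.loopless.irrefl i), zero_div]

/-- The jobs of server `i` itself contribute one and those of its neighbors contribute `n` times the
inflow. With `n = d - 1` the balance condition makes this close to `d`. -/
theorem sum_tupleWeight (hdeg : ∀ u, n ≤ deg G u) (i : Fin N) (z : Fin n) :
    ∑ j ∈ distinctTuples N n i, tupleWeight G i z j = 1 + n * inflow G i := by
  classical
  simp only [tupleWeight]
  rw [Finset.sum_add_distrib, sum_sampleWeight_eq_one G (hdeg i), ← Finset.mul_sum]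
  have := sum_exchange G i z fun _ => True
  simp only [Finset.filter_true, and_true] at this
  rw [this, Finset.sum_congr rfl fun u _ => sum_sampleWeight_apply G (hdeg u) z i,
    sum_edge_div_eq_inflow]

/-- No server `v` may dominate. As a sample of `i` it has weight at most `1 / D_i`, as the server
which samples `i` at most `1 / D_v`. As a second sample beside `i` at a third server `u` the weight
is `1 / (D_u * (D_u - 1))`, summed over neighbors `u` of `i` by means of the inflow bound. -/
theorem sum_tupleWeight_apply_le (hdeg : ∀ u, n ≤ deg G u) {m : ℕ} (hm : 2 ≤ m)
    (hmdeg : ∀ u, m ≤ deg G u) {i : Fin N} (hin : inflow G i ≤ 2) (z k : Fin n) (v : Fin N) :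
    ∑ j ∈ (distinctTuples N n i).filter (fun j => j k = v), tupleWeight G i z j ≤
      2 * (n + 1) / ((m : ℝ) - 1) := by
  classical
  have hm' : (2 : ℝ) ≤ m := by exact_mod_cast hm
  have hm1 : (0 : ℝ) < (m : ℝ) - 1 := by linarith
  have hmd : ∀ u, (m : ℝ) ≤ deg G u := fun u => by exact_mod_cast hmdeg u
  have hedge : ∀ u v, edge G u v / deg G u ≤ 1 / ((m : ℝ) - 1) := fun u v => by
    have : edge G u v ≤ 1 := by unfold edge; split_ifs <;> simp
    have := hmd u
    exact div_le_div₀ zero_le_one ‹_› hm1 (by linarith)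
  simp only [tupleWeight]
  rw [Finset.sum_add_distrib, ← Finset.mul_sum]
  have h1 := (sum_sampleWeight_apply G (hdeg i) k v).trans_le (hedge i v)
  have h2 : ∑ j ∈ (distinctTuples N n i).filter (fun j => j k = v),
      sampleWeight G (j z) (Function.update j z i) ≤ 2 / ((m : ℝ) - 1) := by
    rw [sum_exchange]
    by_cases hkz : k = z
    · subst hkz
      simp only [Function.update_self]
      rw [Finset.sum_eq_single v]
      · simp only [and_true]
        rw [sum_sampleWeight_apply G (hdeg v)]
        refine (hedge v i).trans ?_
        gcongr
        norm_num
      · intro u _ huv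
        simp [huv]
      · simp
    · simp only [Function.update_of_ne hkz]
      calc _ ≤ ∑ u, edge G u i / deg G u * (1 / ((m : ℝ) - 1)) := by
            refine Finset.sum_le_sum fun u _ => (sum_sampleWeight_apply_apply_le G (hdeg u)
              (hm.trans (hmdeg u)) hkz v i).trans ?_
            have := hmd u
            have := edge_nonneg G u i
            gcongr
        _ ≤ 2 / ((m : ℝ) - 1) := by
            rw [← Finset.sum_mul, sum_edge_div_eq_inflow, mul_one_div]
            gcongr
  calc _ ≤ 1 / ((m : ℝ) - 1) + n * (2 / ((m : ℝ) - 1)) := by gcongr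
    _ ≤ 2 / ((m : ℝ) - 1) + n * (2 / ((m : ℝ) - 1)) := by gcongr; norm_num
    _ = _ := by ring

/-- With all degrees at least `d - 1` the arbitrary rules drop out and both sampling terms merge
into one weight per tuple. -/
theorem arrivalRate_eq {d : ℕ} (hd : 2 ≤ d) (hdeg : ∀ u, d - 1 ≤ deg G u)
    (bself : Fin N → (Fin N → ℕ) → ℝ) (bnbr : Fin N → Fin N → (Fin N → ℕ) → ℝ) (i : Fin N)
    (x : Fin N → ℕ) : arrivalRate G d hd bself bnbr i x =
      ∑ j ∈ distinctTuples N (d - 1) i, tupleWeight G i ⟨0, by omega⟩ j *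
        jsqProb (Matrix.vecCons (x i) fun k => x (j k)) := by
  have hnot : ∀ u, ¬ deg G u < d - 1 := fun u => not_lt.2 (hdeg u)
  have hd1 : ((d - 1 : ℕ) : ℝ) = (d : ℝ) - 1 := by
    rw [Nat.cast_sub (by omega)]; simp
  simp only [arrivalRate, hnot, hdeg, if_true, if_false, Finset.sum_const_zero, add_zero, zero_add,
    tupleWeight, add_mul, Finset.sum_add_distrib, Finset.mul_sum, hd1, mul_assoc]

end Weights


/-! ### A law of large numbers for sampled tuples -/

section LLN
variable {Ω : Type*} [MeasurableSpace Ω] {P : Measure Ω} [IsProbabilityMeasure P] {N n : ℕ}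
  {Y : Fin N → Ω → ℕ} {ν : Measure ℕ}

theorem mem_distinctTuples {i : Fin N} {j : Fin n → Fin N} :
    j ∈ distinctTuples N n i ↔ Function.Injective j ∧ ∀ k, j k ≠ i := by
  simp [distinctTuples]

theorem measurable_comp_tuple (hY : ∀ v, Measurable (Y v)) (j : Fin n → Fin N) :
    Measurable fun ω k => Y (j k) ω :=
  measurable_pi_lambda _ fun k => hY (j k)

/-- The deviation of the sampled probability from its mean. -/
def deviation (ν : Measure ℕ) (Y : Fin N → Ω → ℕ) (a : ℕ) (j : Fin n → Fin N) (ω : Ω) : ℝ :=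
  jsqProb (Matrix.vecCons a fun k => Y (j k) ω) - meanProb n a ν

theorem measurable_deviation (hY : ∀ v, Measurable (Y v)) (a : ℕ) (j : Fin n → Fin N) :
    Measurable (deviation ν Y a j) :=
  ((measurable_of_countable fun x : Fin n → ℕ => jsqProb (Matrix.vecCons a x)).comp
    (measurable_comp_tuple hY j)).sub measurable_const

omit [MeasurableSpace Ω] in
theorem abs_deviation_le [IsProbabilityMeasure ν] (a : ℕ) (j : Fin n → Fin N) (ω : Ω) :
    |deviation ν Y a j ω| ≤ 1 := by
  rw [deviation, abs_le]
  constructor <;> linarith [jsqProb_nonneg (Matrix.vecCons a fun k => Y (j k) ω),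
    jsqProb_le_one (Matrix.vecCons a fun k => Y (j k) ω), meanProb_nonneg n a ν,
    meanProb_le_one (n := n) (a := a) (ν := ν)]

theorem integrable_deviation [IsProbabilityMeasure ν] (hY : ∀ v, Measurable (Y v)) (a : ℕ)
    (j : Fin n → Fin N) : Integrable (deviation ν Y a j) P :=
  Integrable.of_bound (measurable_deviation hY a j).aestronglyMeasurable 1
    (ae_of_all _ fun ω => abs_deviation_le a j ω)

theorem integrable_deviation_mul [IsProbabilityMeasure ν] (hY : ∀ v, Measurable (Y v)) (a : ℕ)
    (j l : Fin n → Fin N) : Integrable (fun ω => deviation ν Y a j ω * deviation ν Y a l ω) P :=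
  Integrable.of_bound ((measurable_deviation hY a j).mul
    (measurable_deviation hY a l)).aestronglyMeasurable 1 (ae_of_all _ fun ω => by
      rw [Real.norm_eq_abs, abs_mul]
      exact mul_le_one₀ (abs_deviation_le a j ω) (abs_nonneg _) (abs_deviation_le a l ω))

theorem integral_deviation_eq_zero [IsProbabilityMeasure ν] (hY : ∀ v, Measurable (Y v))
    (hind : iIndepFun Y P) (hν : ∀ v, P.map (Y v) = ν) (a : ℕ) {j : Fin n → Fin N}
    (hj : Function.Injective j) : ∫ ω, deviation ν Y a j ω ∂P = 0 := by
  have h1 : P.map (fun ω k => Y (j k) ω) = Measure.pi fun _ : Fin n => ν := by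
    have := (hind.precomp hj).map_fun_eq_pi_map (fun k => (hY (j k)).aemeasurable)
    simpa only [hν] using this
  have h2 : ∫ ω, jsqProb (Matrix.vecCons a fun k => Y (j k) ω) ∂P = meanProb n a ν := by
    rw [meanProb, ← h1, integral_map (measurable_comp_tuple hY j).aemeasurable
      (measurable_of_countable _).aestronglyMeasurable]
  simp only [deviation]
  rw [integral_sub (integrable_jsqProb (measurable_comp_tuple hY j) a) (integrable_const _), h2]
  simp

/-- Tuples without a common server depend on disjoint groups of independent queues, and each
deviation is centered. -/
theorem integral_deviation_mul_eq_zero [IsProbabilityMeasure ν] (hY : ∀ v, Measurable (Y v))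
    (hind : iIndepFun Y P) (hν : ∀ v, P.map (Y v) = ν) (a : ℕ) {j l : Fin n → Fin N}
    (hj : Function.Injective j) (hdisj : ∀ k k', l k' ≠ j k) :
    ∫ ω, deviation ν Y a j ω * deviation ν Y a l ω ∂P = 0 := by
  classical
  have hd : Disjoint (Finset.univ.image j) (Finset.univ.image l) := by
    rw [Finset.disjoint_left]
    intro v h1 h2
    obtain ⟨k, -, hk⟩ := Finset.mem_image.1 h1
    obtain ⟨k', -, hk'⟩ := Finset.mem_image.1 h2
    exact hdisj k k' (hk'.trans hk.symm)
  have h1 := hind.indepFun_finset _ _ hd hY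
  have hmem : ∀ (f : Fin n → Fin N) k, f k ∈ Finset.univ.image f := fun f k =>
    Finset.mem_image_of_mem f (Finset.mem_univ k)
  set φ : (f : Fin n → Fin N) → ({v // v ∈ Finset.univ.image f} → ℕ) → ℝ := fun f r =>
    jsqProb (Matrix.vecCons a fun k => r ⟨f k, hmem f k⟩) - meanProb n a ν with hφ
  have hφm : ∀ f, Measurable (φ f) := fun f => measurable_of_countable _
  have h2 : IndepFun (deviation ν Y a j) (deviation ν Y a l) P := by
    have := h1.comp (hφm j) (hφm l)
    simp only [Function.comp_def, hφ] at this
    exact this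
  have h3 := h2.integral_mul_eq_mul_integral (integrable_deviation hY a j).aestronglyMeasurable
    (integrable_deviation hY a l).aestronglyMeasurable
  rw [integral_deviation_eq_zero hY hind hν a hj, zero_mul] at h3
  exact h3

/-- The second moment of a weighted average of sampled probabilities. -/
theorem integral_sq_sum_deviation_le [IsProbabilityMeasure ν] (hY : ∀ v, Measurable (Y v))
    (hind : iIndepFun Y P) (hν : ∀ v, P.map (Y v) = ν) (a : ℕ) {i : Fin N}
    {w : (Fin n → Fin N) → ℝ} (hw : ∀ j, 0 ≤ w j) {W ε : ℝ} (hε0 : 0 ≤ ε)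
    (hW : ∑ j ∈ distinctTuples N n i, w j ≤ W)
    (hε : ∀ k v, ∑ j ∈ (distinctTuples N n i).filter (fun j => j k = v), w j ≤ ε) :
    ∫ ω, (∑ j ∈ distinctTuples N n i, w j * deviation ν Y a j ω) ^ 2 ∂P ≤ W * (n ^ 2 * ε) := by
  classical
  set D := distinctTuples N n i
  have hint : ∀ j l, Integrable (fun ω => w j * w l *
      (deviation ν Y a j ω * deviation ν Y a l ω)) P := fun j l =>
    (integrable_deviation_mul hY a j l).const_mul _
  have hsq : ∀ ω, (∑ j ∈ D, w j * deviation ν Y a j ω) ^ 2 =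
      ∑ j ∈ D, ∑ l ∈ D, w j * w l * (deviation ν Y a j ω * deviation ν Y a l ω) := fun ω => by
    rw [sq, Finset.sum_mul_sum]
    exact Finset.sum_congr rfl fun j _ => Finset.sum_congr rfl fun l _ => by ring
  simp only [hsq]
  rw [integral_finsetSum _ fun j _ => integrable_finsetSum _ fun l _ => hint j l]
  have hj : ∀ j ∈ D, ∫ ω, ∑ l ∈ D, w j * w l * (deviation ν Y a j ω * deviation ν Y a l ω) ∂P ≤
      w j * (n ^ 2 * ε) := by
    intro j hjD
    rw [integral_finsetSum _ fun l _ => hint j l]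
    -- Only tuples `l` sharing a server with `j` contribute. There are `n ^ 2` choices of the two
    -- positions of the shared server, and each choice has total weight at most `ε` after summation
    -- over `l`.
    have hl : ∀ l ∈ D, ∫ ω, w j * w l * (deviation ν Y a j ω * deviation ν Y a l ω) ∂P ≤
        ∑ k, ∑ k', w j * if l k' = j k then w l else 0 := by
      intro l _
      rw [integral_const_mul]
      have hnn : ∀ k k', 0 ≤ w j * if l k' = j k then w l else 0 := fun k k' =>
        mul_nonneg (hw j) (by split_ifs; exacts [hw l, le_rfl])
      by_cases hdisj : ∀ k k', l k' ≠ j k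
      · rw [integral_deviation_mul_eq_zero hY hind hν a (mem_distinctTuples.1 hjD).1 hdisj, mul_zero]
        exact Finset.sum_nonneg fun k _ => Finset.sum_nonneg fun k' _ => hnn k k'
      · push Not at hdisj
        obtain ⟨k, k', hkk⟩ := hdisj
        have h1 : ∫ ω, deviation ν Y a j ω * deviation ν Y a l ω ∂P ≤ 1 := by
          have := integral_mono (integrable_deviation_mul (P := P) (ν := ν) hY a j l)
            (integrable_const 1) fun ω => (le_abs_self _).trans (by
              rw [abs_mul]
              exact mul_le_one₀ (abs_deviation_le a j ω) (abs_nonneg _) (abs_deviation_le a l ω))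
          rwa [integral_const, probReal_univ, one_smul] at this
        calc w j * w l * ∫ ω, deviation ν Y a j ω * deviation ν Y a l ω ∂P
            ≤ w j * w l := mul_le_of_le_one_right (mul_nonneg (hw j) (hw l)) h1
          _ = w j * if l k' = j k then w l else 0 := by rw [if_pos hkk]
          _ ≤ ∑ k', w j * if l k' = j k then w l else 0 :=
            Finset.single_le_sum (f := fun k' => w j * if l k' = j k then w l else 0)
              (fun k' _ => hnn k k') (Finset.mem_univ k')
          _ ≤ _ := Finset.single_le_sum (f := fun k => ∑ k', w j * if l k' = j k then w l else 0)
              (fun k _ => Finset.sum_nonneg fun k' _ => hnn k k') (Finset.mem_univ k)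
    refine (Finset.sum_le_sum hl).trans ?_
    rw [Finset.sum_comm]
    have hk : ∀ k, ∑ l ∈ D, ∑ k', (w j * if l k' = j k then w l else 0) ≤ w j * (n * ε) := by
      intro k
      rw [Finset.sum_comm]
      have : ∀ k', ∑ l ∈ D, (w j * if l k' = j k then w l else 0) ≤ w j * ε := fun k' => by
        rw [← Finset.mul_sum, ← Finset.sum_filter]
        exact mul_le_mul_of_nonneg_left (hε k' (j k)) (hw j)
      refine (Finset.sum_le_sum fun k' _ => this k').trans_eq ?_
      simp; ring
    refine (Finset.sum_le_sum fun k _ => hk k).trans_eq ?_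
    simp; ring
  refine (Finset.sum_le_sum hj).trans ?_
  rw [← Finset.sum_mul]
  exact mul_le_mul_of_nonneg_right hW (by positivity)

/-- The inequality `|S| ≤ η + S ^ 2 / η` turns the second moment bound into a first moment bound.
The state of server `i` is independent of all queues in the tuples, which avoid `i`, so by Fubini it
can be frozen at a value `a`. -/
theorem lintegral_abs_sum_deviation_le [IsProbabilityMeasure ν] (hY : ∀ v, Measurable (Y v))
    (hind : iIndepFun Y P) (hν : ∀ v, P.map (Y v) = ν) {i : Fin N}
    {w : (Fin n → Fin N) → ℝ} (hw : ∀ j, 0 ≤ w j) {W ε : ℝ} (hε0 : 0 ≤ ε)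
    (hW : ∑ j ∈ distinctTuples N n i, w j ≤ W)
    (hε : ∀ k v, ∑ j ∈ (distinctTuples N n i).filter (fun j => j k = v), w j ≤ ε)
    {η : ℝ} (hη : 0 < η) :
    ∫⁻ ω, ENNReal.ofReal |∑ j ∈ distinctTuples N n i, w j * deviation ν Y (Y i ω) j ω| ∂P ≤
      ENNReal.ofReal (η + W * (n ^ 2 * ε) / η) := by
  classical
  set D := distinctTuples N n i
  have hfix : ∀ a, ∫⁻ ω, ENNReal.ofReal |∑ j ∈ D, w j * deviation ν Y a j ω| ∂P ≤
      ENNReal.ofReal (η + W * (n ^ 2 * ε) / η) := by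
    intro a
    have hSm : Measurable fun ω => ∑ j ∈ D, w j * deviation ν Y a j ω :=
      Finset.measurable_sum _ fun j _ => (measurable_deviation hY a j).const_mul _
    have hSb : ∀ ω, |∑ j ∈ D, w j * deviation ν Y a j ω| ≤ ∑ j ∈ D, w j := fun ω =>
      (Finset.abs_sum_le_sum_abs _ _).trans (Finset.sum_le_sum fun j _ => by
        rw [abs_mul, abs_of_nonneg (hw j)]
        exact mul_le_of_le_one_right (hw j) (abs_deviation_le a j ω))
    have hi : Integrable (fun ω => (∑ j ∈ D, w j * deviation ν Y a j ω) ^ 2) P :=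
      Integrable.of_bound (hSm.pow_const 2).aestronglyMeasurable ((∑ j ∈ D, w j) ^ 2)
        (ae_of_all _ fun ω => by
          rw [norm_pow]
          exact pow_le_pow_left₀ (norm_nonneg _) (hSb ω) 2)
    calc ∫⁻ ω, ENNReal.ofReal |∑ j ∈ D, w j * deviation ν Y a j ω| ∂P
        ≤ ∫⁻ ω, ENNReal.ofReal (η + (∑ j ∈ D, w j * deviation ν Y a j ω) ^ 2 / η) ∂P := by
          refine lintegral_mono fun ω => ENNReal.ofReal_le_ofReal ?_
          set S := ∑ j ∈ D, w j * deviation ν Y a j ω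
          have h1 : η + S ^ 2 / η = (η ^ 2 + S ^ 2) / η := by field_simp
          rw [h1, le_div_iff₀ hη]
          nlinarith [sq_nonneg (|S| - η), sq_abs S, abs_nonneg S]
      _ = ENNReal.ofReal (∫ ω, (η + (∑ j ∈ D, w j * deviation ν Y a j ω) ^ 2 / η) ∂P) :=
          (ofReal_integral_eq_lintegral_ofReal ((integrable_const _).add (hi.div_const _))
            (ae_of_all _ fun ω =>
            add_nonneg hη.le (div_nonneg (sq_nonneg _) hη.le))).symm
      _ ≤ _ := by
          refine ENNReal.ofReal_le_ofReal ?_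
          rw [integral_add (integrable_const _) (hi.div_const _), integral_div, integral_const,
            probReal_univ, one_smul]
          gcongr
          exact integral_sq_sum_deviation_le hY hind hν a hw hε0 hW hε
  set R : Ω → ({v // v ∈ Finset.univ.erase i} → ℕ) := fun ω v => Y v ω
  have hR : Measurable R := measurable_pi_lambda _ fun v => hY v
  have hindR : IndepFun (Y i) R P :=
    (hind.indepFun_finset {i} (Finset.univ.erase i) (by simp) hY).comp
      (measurable_pi_apply (⟨i, by simp⟩ : ({i} : Finset (Fin N)))) measurable_id
  -- The default value `0` is never used for tuples in `D`, since they do not contain `i`.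
  set g : ℕ × ({v // v ∈ Finset.univ.erase i} → ℕ) → ℝ≥0∞ := fun p => ENNReal.ofReal |∑ j ∈ D,
    w j * (jsqProb (Matrix.vecCons p.1 fun k =>
      if h : j k = i then 0 else p.2 ⟨j k, by simp [h]⟩) - meanProb n p.1 ν)|
  have hg : Measurable g := measurable_of_countable g
  have hgeq : ∀ a ω, g (a, R ω) = ENNReal.ofReal |∑ j ∈ D, w j * deviation ν Y a j ω| := by
    intro a ω
    simp only [g, deviation]
    congr 2
    refine Finset.sum_congr rfl fun j hj => ?_
    congr 4
    funext k
    rw [dif_neg ((mem_distinctTuples.1 hj).2 k)]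
  have hmapR : IsProbabilityMeasure (P.map R) := Measure.isProbabilityMeasure_map hR.aemeasurable
  have hmapY : IsProbabilityMeasure (P.map (Y i)) :=
    Measure.isProbabilityMeasure_map (hY i).aemeasurable
  calc _ = ∫⁻ ω, g (Y i ω, R ω) ∂P := by simp only [hgeq]
    _ = ∫⁻ p, g p ∂(P.map fun ω => (Y i ω, R ω)) := (lintegral_map hg ((hY i).prodMk hR)).symm
    _ = ∫⁻ a, ∫⁻ r, g (a, r) ∂(P.map R) ∂(P.map (Y i)) := by
        rw [(indepFun_iff_map_prod_eq_prod_map_map (hY i).aemeasurable hR.aemeasurable).1 hindR,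
          lintegral_prod _ hg.aemeasurable]
    _ ≤ ∫⁻ _a, ENNReal.ofReal (η + W * (n ^ 2 * ε) / η) ∂(P.map (Y i)) := by
        refine lintegral_mono fun a => ?_
        rw [lintegral_map (measurable_of_countable _) hR]
        simp only [hgeq]
        exact hfix a
    _ = _ := by simp

end LLN

/-! ### Comparison of the graph dynamics with the limit -/

section Comparison
variable {Ω : Type*} [MeasurableSpace Ω] {P : Measure Ω} [IsProbabilityMeasure P] {N : ℕ}

/-- A term changes by at most one, and only if server `i` or one of the `n` servers of the tuple
differs; this gives the factor `n + 1`. -/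
theorem lintegral_abs_tuples_sub_le {n : ℕ} {x y : Fin N → Ω → ℕ} (hx : ∀ v, Measurable (x v))
    (hy : ∀ v, Measurable (y v)) {i : Fin N} {w : (Fin n → Fin N) → ℝ} (hw : ∀ j, 0 ≤ w j) {W p : ℝ}
    (hW : ∑ j ∈ distinctTuples N n i, w j ≤ W) (hp0 : 0 ≤ p)
    (hp : ∀ v, P.real {ω | x v ω ≠ y v ω} ≤ p) :
    ∫⁻ ω, ENNReal.ofReal |∑ j ∈ distinctTuples N n i, w j *
        jsqProb (Matrix.vecCons (x i ω) fun k => x (j k) ω) -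
      ∑ j ∈ distinctTuples N n i, w j *
        jsqProb (Matrix.vecCons (y i ω) fun k => y (j k) ω)| ∂P ≤
      ENNReal.ofReal (W * ((n + 1) * p)) := by
  classical
  set D := distinctTuples N n i
  set I : Fin N → Ω → ℝ := fun v => {ω | x v ω ≠ y v ω}.indicator fun _ => (1 : ℝ)
  have hE : ∀ v, MeasurableSet {ω | x v ω ≠ y v ω} := fun v =>
    (measurableSet_eq_fun (hx v) (hy v)).compl
  have hI0 : ∀ v ω, 0 ≤ I v ω := fun v ω => indicator_nonneg (fun _ _ => zero_le_one) _
  have hIi : ∀ v, Integrable (I v) P := fun v => (integrable_const 1).indicator (hE v)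
  have hIv : ∀ v, ∫ ω, I v ω ∂P ≤ p := fun v => by
    exact (integral_indicator_one (hE v)).trans_le (hp v)
  have hpt : ∀ (j : Fin n → Fin N) ω, |jsqProb (Matrix.vecCons (x i ω) fun k => x (j k) ω) -
      jsqProb (Matrix.vecCons (y i ω) fun k => y (j k) ω)| ≤ I i ω + ∑ k, I (j k) ω := by
    intro j ω
    by_cases h : x i ω = y i ω ∧ ∀ k : Fin n, x (j k) ω = y (j k) ω
    · rw [h.1, funext h.2, sub_self, abs_zero]
      exact add_nonneg (hI0 _ _) (Finset.sum_nonneg fun k _ => hI0 _ _)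
    · refine (abs_jsqProb_sub_le _ _).trans ?_
      rw [not_and_or, not_forall] at h
      rcases h with h | ⟨k, hk⟩
      · refine le_add_of_le_of_nonneg (le_of_eq ?_) (Finset.sum_nonneg fun k _ => hI0 _ _)
        simp [I, h]
      · refine le_add_of_nonneg_of_le (hI0 _ _) (le_trans (le_of_eq ?_)
          (Finset.single_le_sum (f := fun k => I (j k) ω) (fun k _ => hI0 _ _) (Finset.mem_univ k)))
        simp [I, hk]
  have hJi : ∀ j : Fin n → Fin N, Integrable (fun ω => w j * (I i ω + ∑ k, I (j k) ω)) P := fun j =>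
    ((hIi i).add (integrable_finsetSum _ fun k _ => hIi (j k))).const_mul _
  calc _ ≤ ∫⁻ ω, ENNReal.ofReal (∑ j ∈ D, w j * (I i ω + ∑ k, I (j k) ω)) ∂P := by
        refine lintegral_mono fun ω => ENNReal.ofReal_le_ofReal ?_
        rw [← Finset.sum_sub_distrib]
        refine (Finset.abs_sum_le_sum_abs _ _).trans (Finset.sum_le_sum fun j _ => ?_)
        rw [← mul_sub, abs_mul, abs_of_nonneg (hw j)]
        exact mul_le_mul_of_nonneg_left (hpt j ω) (hw j)
    _ = ENNReal.ofReal (∫ ω, ∑ j ∈ D, w j * (I i ω + ∑ k, I (j k) ω) ∂P) :=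
        (ofReal_integral_eq_lintegral_ofReal (integrable_finsetSum _ fun j _ => hJi j)
          (ae_of_all _ fun ω => Finset.sum_nonneg fun j _ => mul_nonneg (hw j)
            (add_nonneg (hI0 _ _) (Finset.sum_nonneg fun k _ => hI0 _ _)))).symm
    _ ≤ _ := by
        refine ENNReal.ofReal_le_ofReal ?_
        rw [integral_finsetSum _ fun j _ => hJi j]
        have hj : ∀ j ∈ D, ∫ ω, w j * (I i ω + ∑ k, I (j k) ω) ∂P ≤ w j * ((n + 1) * p) := by
          intro j _
          rw [integral_const_mul, integral_add (hIi i) (integrable_finsetSum _ fun k _ => hIi (j k)),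
            integral_finsetSum _ fun k _ => hIi (j k)]
          refine mul_le_mul_of_nonneg_left ?_ (hw j)
          refine (add_le_add (hIv i) (Finset.sum_le_sum fun k _ => hIv (j k))).trans_eq ?_
          simp; ring
        refine (Finset.sum_le_sum hj).trans ?_
        rw [← Finset.sum_mul]
        exact mul_le_mul_of_nonneg_right hW (by positivity)

end Comparison


/-! ### The Gronwall estimate for the graph dynamics -/

section GraphDecoupling
variable {Ω : Type*} [MeasurableSpace Ω] {P : Measure Ω} [IsProbabilityMeasure P] {N : ℕ}
  {lam : ℝ≥0} {d m : ℕ} {G : SimpleGraph (Fin N)} {e : ℝ}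

theorem IsRate.mono {ι : Type*} {c : ℝ≥0 → ι → (ι → ℕ) → ℝ} {K K' : ℝ≥0} (h : IsRate c K)
    (hK : K ≤ K') : IsRate c K' :=
  ⟨h.continuous, fun t i u => (h.le t i u).trans (by exact_mod_cast hK)⟩

/-- The total weight of the tuples is close to `d`. -/
theorem abs_sum_tupleWeight_sub_le (hd : 2 ≤ d) (hdeg : ∀ u, d - 1 ≤ deg G u)
    (i : Fin N) (hin : |inflow G i - 1| ≤ e) (z : Fin (d - 1)) :
    |∑ j ∈ distinctTuples N (d - 1) i, tupleWeight G i z j - d| ≤ d * e := by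
  have hd1 : ((d - 1 : ℕ) : ℝ) = (d : ℝ) - 1 := by
    rw [Nat.cast_sub (by omega)]; simp
  have hd2 : (2 : ℝ) ≤ d := by exact_mod_cast hd
  rw [sum_tupleWeight G hdeg, hd1]
  have : 1 + ((d : ℝ) - 1) * inflow G i - d = ((d : ℝ) - 1) * (inflow G i - 1) := by ring
  rw [this, abs_mul, abs_of_nonneg (by linarith)]
  gcongr
  linarith

theorem sum_tupleWeight_le (hd : 2 ≤ d) (hdeg : ∀ u, d - 1 ≤ deg G u) (he : e ≤ 1)
    (i : Fin N) (hin : |inflow G i - 1| ≤ e) (z : Fin (d - 1)) :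
    ∑ j ∈ distinctTuples N (d - 1) i, tupleWeight G i z j ≤ 2 * d := by
  have h := (abs_le.1 (abs_sum_tupleWeight_sub_le hd hdeg i hin z)).2
  have : (d : ℝ) * e ≤ d := mul_le_of_le_one_right (Nat.cast_nonneg d) he
  linarith

theorem arrivalRate_isRate (hd : 2 ≤ d) (hdeg : ∀ u, d - 1 ≤ deg G u) (he : e ≤ 1)
    (hin : ∀ i, |inflow G i - 1| ≤ e) (bself : Fin N → (Fin N → ℕ) → ℝ)
    (bnbr : Fin N → Fin N → (Fin N → ℕ) → ℝ) :
    IsRate (fun _ i u => arrivalRate G d hd bself bnbr i u) (2 * d) where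
  continuous i u := continuous_const
  le t i u := by
    rw [arrivalRate_eq G hd hdeg]
    push_cast
    refine (Finset.sum_le_sum fun j _ => ?_).trans
      (sum_tupleWeight_le hd hdeg he i (hin i) ⟨0, by omega⟩)
    exact mul_le_of_le_one_right (tupleWeight_nonneg _ _ _ _) (jsqProb_le_one _)

/-- The rate of growth in the comparison of the graph dynamics with the limit. -/
def graphRate (lam : ℝ≥0) (d : ℕ) : ℝ := lam * (2 * (d : ℝ) ^ 2) + 1

/-- The error of one step in the comparison of the graph dynamics with the limit, for a graph of
minimal degree `m` and inflows in `[1 - e, 1 + e]`. -/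
def graphError (d m : ℕ) (e η : ℝ) : ℝ :=
  η + 2 * d * ((d : ℝ) ^ 2 * (2 * d / ((m : ℝ) - 1))) / η + d * e

/-- Three errors add up: replacing `x` by `y` in all tuples, with total weight at most `2 * d` and
`d` servers per term; the fluctuation of the weighted sum for the independent queues `y`; and the
deviation of the total weight from `d`. -/
theorem lintegral_graph_rate_sub_le (hd : 2 ≤ d) (hm : 2 ≤ m) (hdm : d - 1 ≤ m)
    (hdeg : ∀ u, m ≤ deg G u) (he : e ≤ 1) (hin : ∀ i, |inflow G i - 1| ≤ e)
    (bself : Fin N → (Fin N → ℕ) → ℝ) (bnbr : Fin N → Fin N → (Fin N → ℕ) → ℝ)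
    {x y : Fin N → Ω → ℕ} (hx : ∀ v, Measurable (x v)) (hy : ∀ v, Measurable (y v))
    (hind : iIndepFun y P) {ν : Measure ℕ} (hν : ∀ v, P.map (y v) = ν) {p : ℝ} (hp0 : 0 ≤ p)
    (hp : ∀ v, P.real {ω | x v ω ≠ y v ω} ≤ p) {η : ℝ} (hη : 0 < η) (i : Fin N) :
    ∫⁻ ω, ENNReal.ofReal |arrivalRate G d hd bself bnbr i (fun v => x v ω) -
      limitRate d (y i ω) ν| ∂P ≤ ENNReal.ofReal (2 * (d : ℝ) ^ 2 * p + graphError d m e η) := by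
  have hdeg' : ∀ u, d - 1 ≤ deg G u := fun u => hdm.trans (hdeg u)
  set z : Fin (d - 1) := ⟨0, by omega⟩
  set w := tupleWeight G i z
  have hw : ∀ j, 0 ≤ w j := tupleWeight_nonneg G i z
  set D := distinctTuples N (d - 1) i
  have he0 : 0 ≤ e := (abs_nonneg _).trans (hin i)
  have hW : ∑ j ∈ D, w j ≤ 2 * d := sum_tupleWeight_le hd hdeg' he i (hin i) z
  have hWd : |∑ j ∈ D, w j - d| ≤ d * e := abs_sum_tupleWeight_sub_le hd hdeg' i (hin i) z
  have hd1 : ((d - 1 : ℕ) : ℝ) + 1 = d := by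
    rw [Nat.cast_sub (by omega)]; simp
  have hm1 : (0 : ℝ) < (m : ℝ) - 1 := by
    have : (2 : ℝ) ≤ m := by exact_mod_cast hm
    linarith
  have hε : ∀ k v, ∑ j ∈ D.filter (fun j => j k = v), w j ≤ 2 * d / ((m : ℝ) - 1) := fun k v => by
    have := sum_tupleWeight_apply_le G hdeg' hm hdeg (i := i)
      (by linarith [(abs_le.1 (hin i)).2]) z k v
    rwa [hd1] at this
  have hνp : IsProbabilityMeasure ν := by
    rw [← hν i]
    exact Measure.isProbabilityMeasure_map (hy i).aemeasurable
  have h1 := lintegral_abs_tuples_sub_le (P := P) hx hy hw hW hp0 hp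
  have h2 := lintegral_abs_sum_deviation_le hy hind hν (i := i) hw (W := 2 * d)
    (ε := 2 * d / ((m : ℝ) - 1)) (by positivity) hW hε hη
  have hpt : ∀ ω, ENNReal.ofReal |arrivalRate G d hd bself bnbr i (fun v => x v ω) -
      limitRate d (y i ω) ν| ≤
      ENNReal.ofReal |∑ j ∈ D, w j * jsqProb (Matrix.vecCons (x i ω) fun k => x (j k) ω) -
        ∑ j ∈ D, w j * jsqProb (Matrix.vecCons (y i ω) fun k => y (j k) ω)| +
      (ENNReal.ofReal |∑ j ∈ D, w j * deviation ν y (y i ω) j ω| + ENNReal.ofReal (d * e)) := by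
    intro ω
    rw [← ENNReal.ofReal_add (abs_nonneg _) (by positivity),
      ← ENNReal.ofReal_add (abs_nonneg _) (by positivity)]
    refine ENNReal.ofReal_le_ofReal ?_
    rw [arrivalRate_eq G hd hdeg', limitRate_eq]
    have hdev : ∑ j ∈ D, w j * deviation ν y (y i ω) j ω =
        ∑ j ∈ D, w j * jsqProb (Matrix.vecCons (y i ω) fun k => y (j k) ω) -
          (∑ j ∈ D, w j) * meanProb (d - 1) (y i ω) ν := by
      simp only [deviation, mul_sub, Finset.sum_sub_distrib, Finset.sum_mul]
    have hM : |(∑ j ∈ D, w j - d) * meanProb (d - 1) (y i ω) ν| ≤ d * e := by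
      rw [abs_mul, abs_of_nonneg (meanProb_nonneg _ _ _)]
      exact (mul_le_of_le_one_right (abs_nonneg _) meanProb_le_one).trans hWd
    have hsplit : ∑ j ∈ D, w j * jsqProb (Matrix.vecCons (x i ω) fun k => x (j k) ω) -
        d * meanProb (d - 1) (y i ω) ν =
        (∑ j ∈ D, w j * jsqProb (Matrix.vecCons (x i ω) fun k => x (j k) ω) -
          ∑ j ∈ D, w j * jsqProb (Matrix.vecCons (y i ω) fun k => y (j k) ω)) +
        (∑ j ∈ D, w j * deviation ν y (y i ω) j ω +
          (∑ j ∈ D, w j - d) * meanProb (d - 1) (y i ω) ν) := by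
      rw [hdev]; ring
    rw [hsplit]
    exact (abs_add_le _ _).trans (add_le_add le_rfl ((abs_add_le _ _).trans
      (add_le_add le_rfl hM)))
  have hm2 : Measurable fun ω =>
      ENNReal.ofReal |∑ j ∈ D, w j * deviation ν y (y i ω) j ω| := by
    have h3 : ∀ j, Measurable fun ω => deviation ν y (y i ω) j ω := fun j =>
      ((measurable_of_countable fun p : ℕ × (Fin (d - 1) → ℕ) => jsqProb (Matrix.vecCons p.1 p.2)).comp
        ((hy i).prodMk (measurable_comp_tuple hy j))).sub
        ((measurable_of_countable fun a => meanProb (d - 1) a ν).comp (hy i))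
    exact (measurable_norm.comp (Finset.measurable_sum _ fun j _ =>
      (h3 j).const_mul _)).ennreal_ofReal
  refine (lintegral_mono hpt).trans ?_
  rw [lintegral_add_right _ (hm2.add_const _), lintegral_add_right _ measurable_const,
    lintegral_const, measure_univ, mul_one]
  refine (add_le_add h1 (add_le_add h2 le_rfl)).trans ?_
  rw [← ENNReal.ofReal_add (by positivity) (by positivity),
    ← ENNReal.ofReal_add (by positivity) (by positivity), hd1]
  refine ENNReal.ofReal_le_ofReal ?_
  have hn : ((d - 1 : ℕ) : ℝ) ≤ d := by linarith
  have : (2 * d : ℝ) * (((d - 1 : ℕ) : ℝ) ^ 2 * (2 * d / ((m : ℝ) - 1))) / η ≤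
      2 * d * ((d : ℝ) ^ 2 * (2 * d / ((m : ℝ) - 1))) / η := by gcongr
  rw [graphError]
  linarith

/-- The rate of one server involves the decoupling of all others, so Gronwall is applied to the
maximum over the servers. The growth rate exceeds the Lipschitz constant by one, so the error is
multiplied by `lam` and the exponential only; the constant `C`, which depends on the number of
servers, does not enter. -/
theorem graph_decoupling_le (hd : 2 ≤ d) (hm : 2 ≤ m) (hdm : d - 1 ≤ m)
    (hdeg : ∀ u, m ≤ deg G u) (he : e ≤ 1) (hin : ∀ i, |inflow G i - 1| ≤ e)
    (bself : Fin N → (Fin N → ℕ) → ℝ) (bnbr : Fin N → Fin N → (Fin N → ℕ) → ℝ)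
    {M : Ω → Fin N → Noise} (hM : IsNoiseFamily P lam M) {U : Ω → Fin N → ℕ} (hU : Measurable U)
    (hUM : IndepFun U M P) {x y : Ω → Fin N → ℝ≥0 → ℕ} {ν : ℝ≥0 → Measure ℕ}
    (hx : IsSystemSolution P M (fun _ i u => arrivalRate G d hd bself bnbr i u) U x)
    (hy : IsSystemSolution P M (flowRate d ν) U y) {A : ℝ} (hA : 0 ≤ A)
    (hflow : ∀ i, IsFlow P A fun ω => y ω i) (hν : ∀ i, flow P (fun ω => y ω i) = ν)
    (hind : ∀ t, iIndepFun (fun i ω => y ω i t) P) {η : ℝ} (hη : 0 < η) (i : Fin N) (t : ℝ≥0) :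
    decoupling P x y i t ≤ lam * graphError d m e η * Real.exp (graphRate lam d * t) := by
  have hdeg' : ∀ u, d - 1 ≤ deg G u := fun u => hdm.trans (hdeg u)
  have he0 : 0 ≤ e := (abs_nonneg _).trans (hin i)
  have hm1 : (0 : ℝ) < (m : ℝ) - 1 := by
    have : (2 : ℝ) ≤ m := by exact_mod_cast hm
    linarith
  have hr0 : 0 ≤ graphError d m e η := by rw [graphError]; positivity
  have hc := arrivalRate_isRate hd hdeg' he hin bself bnbr
  have hc' : IsRate (flowRate (ι := Fin N) d ν) (2 * d) := by
    rw [← hν i]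
    exact ((hflow i).isRate d).mono (by
      rw [two_mul]; exact le_self_add)
  have hκ' : ∀ (j : Fin N) (u : Fin N → ℕ) (s t : ℝ≥0),
      |flowRate d ν s j u - flowRate d ν t j u| ≤ (d : ℝ) ^ 2 * A * dist s t := by
    rw [← hν i]
    exact (hflow i).abs_flowRate_sub_le d
  set C : ℝ := 2 * lam * ((d : ℝ) ^ 2 * A) +
    (2 * Fintype.card (Fin N)) ^ 2 * (1 + lam * (2 * d : ℝ≥0)) ^ 2
  have hC : 0 ≤ C := by positivity
  set p : ℝ≥0 → ℝ := fun t => ⨆ j, decoupling P x y j t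
  have hp0 : ∀ t, 0 ≤ p t := fun t => Real.iSup_nonneg fun j => measureReal_nonneg
  have hple : ∀ j t, decoupling P x y j t ≤ p t := fun j t =>
    le_ciSup (f := fun j => decoupling P x y j t) (Set.finite_range _).bddAbove j
  refine (hple i t).trans ?_
  have key := gronwall_exp (p := p) (L := lam * (2 * (d : ℝ) ^ 2)) (M := lam * graphError d m e η)
    (θ := graphRate lam d) (C := C) (by positivity) (by positivity)
    (by rw [graphRate]; linarith) hC ?_ ?_ t
  · refine key.trans_eq ?_
    rw [graphRate]
    simp
  · refine Real.iSup_le (fun j => ?_) le_rfl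
    refine le_of_eq ?_
    rw [decoupling, measureReal_eq_zero_iff]
    have h0 : ∀ᵐ ω ∂P, ¬ ∃ s ≤ (0 : ℝ≥0), x ω j s ≠ y ω j s := by
      filter_upwards [hx.initial, hy.initial] with ω h1 h2
      rintro ⟨s, hs, hne⟩
      have : s = 0 := le_antisymm hs zero_le
      subst this
      exact hne ((h1 j).trans (h2 j).symm)
    exact measure_eq_zero_iff_ae_notMem.2 h0
  · intro t s
    have hs : (0 : ℝ) ≤ s := s.2
    refine Real.iSup_le (fun j => ?_) (by have := hp0 t; positivity)
    have hint := lintegral_graph_rate_sub_le hd hm hdm hdeg he hin bself bnbr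
      (fun v => hx.measurable v t) (fun v => hy.measurable v t) (hind t) (ν := ν t)
      (fun v => congrFun (hν v) t) (hp0 t)
      (fun v => (measureReal_mono (show {ω | x ω v t ≠ y ω v t} ⊆ {ω | ∃ s ≤ t, x ω v s ≠ y ω v s}
        from fun ω hω => ⟨t, le_rfl, hω⟩)).trans (hple v t)) hη j
    have hstep := decoupling_add_le hM hU hUM hc hc' (κ := (d : ℝ) ^ 2 * A) (by positivity)
      (fun _ _ s t => by simpa using mul_nonneg (by positivity) dist_nonneg) hκ' hx hy j t s
      (r := 2 * (d : ℝ) ^ 2 * p t + graphError d m e η)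
      (by have := hp0 t; positivity) hint
    have hj := hple j t
    calc _ ≤ _ := hstep
      _ ≤ p t + lam * s * (2 * (d : ℝ) ^ 2 * p t + graphError d m e η) + C * s ^ 2 := by
        gcongr
      _ ≤ p t + lam * s * (2 * (d : ℝ) ^ 2 * p t +
          graphError d m e η * Real.exp (graphRate lam d * t)) + C * s ^ 2 := by
        gcongr
        refine le_mul_of_one_le_right hr0 (Real.one_le_exp ?_)
        rw [graphRate]
        positivity
      _ = _ := by ring

end GraphDecoupling


/-! ### Independent copies of the limit -/

/-- The joint law is a product over `i` of the laws of `A i` times a product of the laws of `B i`;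
pairing the coordinates gives a product of pair laws. -/
theorem iIndepFun_prodMk {Ω γ α β : Type*} [MeasurableSpace Ω] [Fintype γ] [MeasurableSpace α]
    [MeasurableSpace β] {P : Measure Ω} [IsProbabilityMeasure P] {A : γ → Ω → α} {B : γ → Ω → β}
    (hA : ∀ i, Measurable (A i)) (hB : ∀ i, Measurable (B i)) (hAi : iIndepFun A P)
    (hBi : iIndepFun B P) (hAB : IndepFun (fun ω i => A i ω) (fun ω i => B i ω) P) :
    iIndepFun (fun i ω => (A i ω, B i ω)) P := by
  have := fun i => Measure.isProbabilityMeasure_map (μ := P) (hA i).aemeasurable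
  have := fun i => Measure.isProbabilityMeasure_map (μ := P) (hB i).aemeasurable
  have mA : Measurable fun ω i => A i ω := measurable_pi_lambda _ hA
  have mB : Measurable fun ω i => B i ω := measurable_pi_lambda _ hB
  have hpair : ∀ i, P.map (fun ω => (A i ω, B i ω)) = (P.map (A i)).prod (P.map (B i)) := fun i =>
    (indepFun_iff_map_prod_eq_prod_map_map (hA i).aemeasurable (hB i).aemeasurable).1
      (hAB.comp (measurable_pi_apply i) (measurable_pi_apply i))
  rw [iIndepFun_iff_map_fun_eq_pi_map fun i => ((hA i).prodMk (hB i)).aemeasurable]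
  simp only [hpair]
  refine (MeasurableEquiv.arrowProdEquivProdArrow α β γ).map_measurableEquiv_injective ?_
  rw [(measurePreserving_arrowProdEquivProdArrow α β γ _ _).map_eq, Measure.map_map
    (MeasurableEquiv.measurable _) (measurable_pi_lambda _ fun i => (hA i).prodMk (hB i))]
  have e1 := (indepFun_iff_map_prod_eq_prod_map_map mA.aemeasurable mB.aemeasurable).1 hAB
  rw [hAi.map_fun_eq_pi_map fun i => (hA i).aemeasurable,
    hBi.map_fun_eq_pi_map fun i => (hB i).aemeasurable] at e1
  exact e1

/-- A measurable map which sends an initial queue length and a noise to a solution of the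
McKean–Vlasov equation. -/
structure IsSolutionMap {Ω : Type*} [MeasurableSpace Ω] (P : Measure Ω) (lam : ℝ≥0) (d : ℕ)
    (q : ℕ → ℝ) (Φ : ℕ × Noise → CadlagPath ℕ) : Prop where
  measurable : Measurable Φ
  solution : ∀ (M : Ω → Noise) (U : Ω → ℕ), IsNoiseFamily P lam (single M) → Measurable U →
    HasTail P q U → IndepFun U M P →
    IsMcKeanVlasov P d q (fun ω => (M ω).1) (fun ω => (M ω).2) (fun ω => Φ (U ω, M ω)) ∧
    ∀ᵐ ω ∂P, Φ (U ω, M ω) 0 = U ω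

section Copies
variable {Ω : Type*} [MeasurableSpace Ω] {P : Measure Ω} [IsProbabilityMeasure P] {lam : ℝ≥0}
  {d : ℕ} {q : ℕ → ℝ} {Svc : ℕ → Ω → Measure ℝ≥0} {Arr : ℕ → Ω → Measure (ℝ≥0 × ℝ≥0)}
  {Φ : ℕ × Noise → CadlagPath ℕ}

/-- The noise of server `i`. -/
def serverNoise (Svc : ℕ → Ω → Measure ℝ≥0) (Arr : ℕ → Ω → Measure (ℝ≥0 × ℝ≥0)) (i : ℕ) (ω : Ω) :
    Noise := (Svc i ω, Arr i ω)

omit [IsProbabilityMeasure P] in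
theorem IsDrivingNoise.single (h : IsDrivingNoise P lam Svc Arr) (i : ℕ) :
    IsNoiseFamily P lam (single (serverNoise Svc Arr i)) :=
  h.isNoiseFamily (e := fun _ : Unit => i) (Function.injective_of_subsingleton _)

omit [IsProbabilityMeasure P] in
theorem IsDrivingNoise.family (h : IsDrivingNoise P lam Svc Arr) (N : ℕ) :
    IsNoiseFamily P lam fun ω (i : Fin N) => serverNoise Svc Arr i ω :=
  h.isNoiseFamily (e := fun i : Fin N => (i : ℕ)) Fin.val_injective

omit [IsProbabilityMeasure P] in
theorem IsDrivingNoise.measurable_serverNoise (h : IsDrivingNoise P lam Svc Arr) (i : ℕ) :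
    Measurable (serverNoise Svc Arr i) :=
  measurable_single (h.single i)

/-- Every McKean–Vlasov process is given by the solution map. -/
theorem IsSolutionMap.ae_eq (hΦ : IsSolutionMap P lam d q Φ) (h : IsDrivingNoise P lam Svc Arr)
    {i : ℕ} {Y : Ω → CadlagPath ℕ} (hY : IsMcKeanVlasov P d q (Svc i) (Arr i) Y) {U : Ω → ℕ}
    (hU : Measurable U) (hYU : ∀ᵐ ω ∂P, Y ω 0 = U ω) :
    ∀ᵐ ω ∂P, Y ω = Φ (U ω, serverNoise Svc Arr i ω) := by
  have hUq : HasTail P q U := fun j => by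
    rw [← hY.initial_law j]
    refine measure_congr ?_
    filter_upwards [hYU] with ω hω
    exact propext (by change j ≤ U ω ↔ j ≤ Y ω 0; rw [hω])
  have hUN : IndepFun U (serverNoise Svc Arr i) P :=
    hY.indep_noise.congr hYU (ae_of_all _ fun _ => rfl)
  have h2 := hΦ.solution _ _ (h.single i) hU hUq hUN
  have hYn : IsMcKeanVlasov P d q (fun ω => (serverNoise Svc Arr i ω).1)
    (fun ω => (serverNoise Svc Arr i ω).2) Y := hY
  refine hYn.ae_eq (h.single i) h2.1 ?_
  filter_upwards [hYU, h2.2] with ω e1 e2 using e1.trans e2.symm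

/-- The law of the solutions of the McKean–Vlasov equation. -/
theorem IsSolutionMap.map_eq (hΦ : IsSolutionMap P lam d q Φ) (h : IsDrivingNoise P lam Svc Arr)
    {i j : ℕ} {U V : Ω → ℕ} (hU : Measurable U) (hV : Measurable V) (hUq : HasTail P q U)
    (hVq : HasTail P q V) (hUN : IndepFun U (serverNoise Svc Arr i) P)
    (hVN : IndepFun V (serverNoise Svc Arr j) P) :
    P.map (fun ω => Φ (U ω, serverNoise Svc Arr i ω)) =
      P.map (fun ω => Φ (V ω, serverNoise Svc Arr j ω)) := by
  have h1 := map_noise_eq (h.single i) (h.single j) hU hV hUq hVq hUN hVN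
  have h2 := Measure.map_map hΦ.measurable (μ := P) (hU.prodMk (h.measurable_serverNoise i))
  have h3 := Measure.map_map hΦ.measurable (μ := P) (hV.prodMk (h.measurable_serverNoise j))
  rw [h1, h3] at h2
  exact h2.symm

variable {hd : 2 ≤ d} {N : ℕ} {G : SimpleGraph (Fin N)} {bself : Fin N → (Fin N → ℕ) → ℝ}
  {bnbr : Fin N → Fin N → (Fin N → ℕ) → ℝ} {X : Fin N → Ω → CadlagPath ℕ}

omit [IsProbabilityMeasure P] in
theorem IsQueueSystem.measurable_path (hX : IsQueueSystem P d hd q Svc Arr G bself bnbr X)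
    (i : Fin N) : Measurable (X i) :=
  CadlagPath.measurable_of_eval CadlagPath.nat_eq_of_dist_lt_one (hX.measurable i)

omit [IsProbabilityMeasure P] in
theorem IsQueueSystem.indepFun_initial (hX : IsQueueSystem P d hd q Svc Arr G bself bnbr X)
    (i : Fin N) (j : ℕ) : IndepFun (fun ω => X i ω 0) (serverNoise Svc Arr j) P :=
  hX.indep_noise.comp (measurable_pi_apply i) (measurable_pi_apply j)

/-- The limiting process with the initial value and the noise of server `i`. -/
def coupledLimit (Svc : ℕ → Ω → Measure ℝ≥0) (Arr : ℕ → Ω → Measure (ℝ≥0 × ℝ≥0))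
    (Φ : ℕ × Noise → CadlagPath ℕ) (X : Fin N → Ω → CadlagPath ℕ) (i : Fin N) (ω : Ω) :
    CadlagPath ℕ := Φ (X i ω 0, serverNoise Svc Arr i ω)

omit [IsProbabilityMeasure P] in
theorem measurable_coupledLimit (hΦ : IsSolutionMap P lam d q Φ)
    (h : IsDrivingNoise P lam Svc Arr) (hX : IsQueueSystem P d hd q Svc Arr G bself bnbr X)
    (i : Fin N) : Measurable (coupledLimit Svc Arr Φ X i) :=
  hΦ.measurable.comp ((hX.measurable i 0).prodMk (h.measurable_serverNoise i))

omit [IsProbabilityMeasure P] in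
theorem isMcKeanVlasov_coupledLimit (hΦ : IsSolutionMap P lam d q Φ)
    (h : IsDrivingNoise P lam Svc Arr) (hX : IsQueueSystem P d hd q Svc Arr G bself bnbr X)
    (i : Fin N) :
    IsMcKeanVlasov P d q (fun ω => (serverNoise Svc Arr i ω).1)
      (fun ω => (serverNoise Svc Arr i ω).2) (coupledLimit Svc Arr Φ X i) ∧
    ∀ᵐ ω ∂P, coupledLimit Svc Arr Φ X i ω 0 = X i ω 0 :=
  hΦ.solution _ _ (h.single i) (hX.measurable i 0) (hX.initial_law i) (hX.indepFun_initial i i)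

theorem iIndepFun_initial_noise (h : IsDrivingNoise P lam Svc Arr)
    (hX : IsQueueSystem P d hd q Svc Arr G bself bnbr X) :
    iIndepFun (fun i ω => (X i ω 0, serverNoise Svc Arr i ω)) P :=
  iIndepFun_prodMk (fun i => hX.measurable i 0) (fun i => h.measurable_serverNoise i)
    hX.initial_indep (h.family N).indep (hX.indep_noise.comp measurable_id
      (measurable_pi_lambda (fun (n : ℕ → Noise) (i : Fin N) => n i)
        fun i => measurable_pi_apply (i : ℕ)))

theorem iIndepFun_coupledLimit (hΦ : IsSolutionMap P lam d q Φ)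
    (h : IsDrivingNoise P lam Svc Arr) (hX : IsQueueSystem P d hd q Svc Arr G bself bnbr X) :
    iIndepFun (coupledLimit Svc Arr Φ X) P :=
  (iIndepFun_initial_noise h hX).comp (fun _ => Φ) fun _ => hΦ.measurable

theorem map_coupledLimit_eq (hΦ : IsSolutionMap P lam d q Φ)
    (h : IsDrivingNoise P lam Svc Arr) (hX : IsQueueSystem P d hd q Svc Arr G bself bnbr X)
    {N' : ℕ} {G' : SimpleGraph (Fin N')} {bself' : Fin N' → (Fin N' → ℕ) → ℝ}
    {bnbr' : Fin N' → Fin N' → (Fin N' → ℕ) → ℝ} {X' : Fin N' → Ω → CadlagPath ℕ}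
    (hX' : IsQueueSystem P d hd q Svc Arr G' bself' bnbr' X') (i : Fin N) (j : Fin N') :
    P.map (coupledLimit Svc Arr Φ X i) = P.map (coupledLimit Svc Arr Φ X' j) :=
  hΦ.map_eq h (hX.measurable i 0) (hX'.measurable j 0) (hX.initial_law i) (hX'.initial_law j)
    (hX.indepFun_initial i i) (hX'.indepFun_initial j j)

theorem coupledLimit_decoupling_le (hΦ : IsSolutionMap P lam d q Φ)
    (h : IsDrivingNoise P lam Svc Arr) (hX : IsQueueSystem P d hd q Svc Arr G bself bnbr X)
    {m : ℕ} {e : ℝ} (hm : 2 ≤ m) (hdm : d - 1 ≤ m) (hdeg : ∀ u, m ≤ deg G u) (he : e ≤ 1)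
    (hin : ∀ i, |inflow G i - 1| ≤ e) {η : ℝ} (hη : 0 < η) (i : Fin N) (t : ℝ≥0) :
    P.real {ω | ∃ s ≤ t, X i ω s ≠ coupledLimit Svc Arr Φ X i ω s} ≤
      lam * graphError d m e η * Real.exp (graphRate lam d * t) := by
  have hdeg' : ∀ u, d - 1 ≤ deg G u := fun u => hdm.trans (hdeg u)
  set Y := coupledLimit Svc Arr Φ X
  have hflow : ∀ j, IsFlow P (1 + lam * d) fun ω => Y j ω := fun j =>
    (isMcKeanVlasov_coupledLimit hΦ h hX j).1.isFlow (h.single j)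
  have hνj : ∀ j, flow P (fun ω => Y j ω) = flow P (fun ω => Y i ω) := fun j => by
    funext t
    have := congrArg (fun m : Measure (CadlagPath ℕ) => m.map fun x => x t)
      (map_coupledLimit_eq hΦ h hX hX j i)
    simp only [Measure.map_map (CadlagPath.measurable_eval CadlagPath.nat_eq_of_dist_lt_one t)
      (measurable_coupledLimit hΦ h hX _)] at this
    exact this
  have hM := h.family N
  refine graph_decoupling_le (x := fun ω i => X i ω) (y := fun ω i => Y i ω)
    (U := fun ω i => X i ω 0) (A := 1 + lam * d) (ν := flow P fun ω => Y i ω)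
    hd hm hdm hdeg he hin bself bnbr hM (measurable_pi_lambda _ fun i => hX.measurable i 0)
    (hX.indep_noise.comp measurable_id (measurable_pi_lambda
      (fun (n : ℕ → Noise) (i : Fin N) => n i) fun i => measurable_pi_apply (i : ℕ)))
    ?_ ?_ (by positivity) hflow hνj (fun t => ?_) hη i t
  · exact hM.isSystemSolution (arrivalRate_isRate hd hdeg' he hin bself bnbr)
      (y := fun ω i => X i ω) hX.measurable (ae_of_all _ fun _ _ => rfl) hX.evolution
  · refine hM.isSystemSolution ((hflow i).isRate d) (y := fun ω i => Y i ω)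
      (fun j t => (hflow j).measurable t) ?_ ?_
    · exact ae_all_iff.2 fun j => (isMcKeanVlasov_coupledLimit hΦ h hX j).2
    · refine ae_all_iff.2 fun j => ?_
      have := (isMcKeanVlasov_coupledLimit hΦ h hX j).1.evolution
      rw [← hνj j]
      exact this
  · exact (iIndepFun_coupledLimit hΦ h hX).comp (fun _ x => x t)
      fun _ => CadlagPath.measurable_eval CadlagPath.nat_eq_of_dist_lt_one t

end Copies

/-! ### Convergence to the limit, uniformly over the servers -/

theorem minDeg_le_deg {N : ℕ} (G : SimpleGraph (Fin N)) (i : Fin N) : minDeg G ≤ deg G i := by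
  classical
  rw [minDeg, deg]
  exact G.minDegree_le_degree i

theorem exists_isSolutionMap {Ω : Type*} [MeasurableSpace Ω] {P : Measure Ω}
    [IsProbabilityMeasure P] {lam : ℝ≥0} {d : ℕ} {q : ℕ → ℝ} {Svc : ℕ → Ω → Measure ℝ≥0}
    {Arr : ℕ → Ω → Measure (ℝ≥0 × ℝ≥0)} {hd : 2 ≤ d} {N : ℕ} {G : SimpleGraph (Fin N)}
    {bself : Fin N → (Fin N → ℕ) → ℝ} {bnbr : Fin N → Fin N → (Fin N → ℕ) → ℝ}
    {X : Fin N → Ω → CadlagPath ℕ} (h : IsDrivingNoise P lam Svc Arr)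
    (hX : IsQueueSystem P d hd q Svc Arr G bself bnbr X) (i : Fin N) :
    ∃ Φ, IsSolutionMap P lam d q Φ := by
  obtain ⟨Φ, h1, h3⟩ := exists_solutionMap (d := d) (h.single i) (hX.measurable i 0)
    (hX.initial_law i) (hX.indepFun_initial i i)
  exact ⟨Φ, h1, fun M U => h3 P M U⟩

/-- The truncation parameter `η` is fixed first, small in terms of `ε` and `T`; the remaining terms
of the error vanish as the minimal degree grows and the imbalance tends to zero. -/
theorem DegreeRegular.eventually_decoupling_le {Ω : Type*} [MeasurableSpace Ω] {P : Measure Ω}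
    [IsProbabilityMeasure P] {lam : ℝ≥0} {d : ℕ} {hd : 2 ≤ d} {q : ℕ → ℝ}
    {Svc : ℕ → Ω → Measure ℝ≥0} {Arr : ℕ → Ω → Measure (ℝ≥0 × ℝ≥0)}
    {Φ : ℕ × Noise → CadlagPath ℕ} {G : ∀ N, SimpleGraph (Fin N)} (hG : DegreeRegular G)
    {bself : ∀ N : ℕ, Fin N → (Fin N → ℕ) → ℝ} {bnbr : ∀ N : ℕ, Fin N → Fin N → (Fin N → ℕ) → ℝ}
    {X : ∀ N : ℕ, Fin N → Ω → CadlagPath ℕ} (hΦ : IsSolutionMap P lam d q Φ)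
    (h : IsDrivingNoise P lam Svc Arr)
    (hX : ∀ N, IsQueueSystem P d hd q Svc Arr (G N) (bself N) (bnbr N) (X N))
    (T : ℝ≥0) {ε : ℝ} (hε : 0 < ε) :
    ∀ᶠ N in atTop, ∀ i : Fin N,
      P.real {ω | ∃ s ≤ T, X N i ω s ≠ coupledLimit Svc Arr Φ (X N) i ω s} ≤ ε := by
  set F := lam * Real.exp (graphRate lam d * T) with hF
  have hF0 : 0 ≤ F := by positivity
  -- This choice makes `F * η` less than `ε`, and `F * η` is the limit of the bound as `N → ∞`.
  set η : ℝ := ε / (2 * (F + 1))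
  have hη : 0 < η := by positivity
  set e : ℕ → ℝ := fun N => ⨆ i : Fin N, |inflow (G N) i - 1|
  have he : Tendsto e atTop (𝓝 0) := hG.balanced
  have hinv : Tendsto (fun N => (2 * d / ((minDeg (G N) : ℝ) - 1))) atTop (𝓝 0) := by
    have h1 : Tendsto (fun N => (minDeg (G N) : ℝ) - 1) atTop atTop :=
      tendsto_atTop_add_const_right _ _ (tendsto_natCast_atTop_atTop.comp hG.minDeg_tendsto)
    exact h1.const_div_atTop _
  have hlim : Tendsto (fun N => lam * graphError d (minDeg (G N)) (e N) η *
      Real.exp (graphRate lam d * T)) atTop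
      (𝓝 (lam * (η + 2 * d * ((d : ℝ) ^ 2 * 0) / η + d * 0) *
        Real.exp (graphRate lam d * T))) := by
    unfold graphError
    exact (((((hinv.const_mul _).const_mul _).div_const _).const_add _).add
      (he.const_mul _)).const_mul _ |>.mul_const _
  have hlt : lam * (η + 2 * d * ((d : ℝ) ^ 2 * 0) / η + d * 0) *
      Real.exp (graphRate lam d * T) < ε := by
    have h1 : lam * (η + 2 * d * ((d : ℝ) ^ 2 * 0) / η + d * 0) *
      Real.exp (graphRate lam d * T) = F * η := by rw [hF]; ring
    have h2 : (F + 1) * η = ε / 2 := by simp only [η]; field_simp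
    rw [h1]
    linarith
  filter_upwards [hlim.eventually (gt_mem_nhds hlt), he.eventually (gt_mem_nhds one_pos),
    hG.minDeg_tendsto.eventually_ge_atTop (max 2 (d - 1))] with N h1 h2 h3 i
  refine (coupledLimit_decoupling_le hΦ h (hX N) ((le_max_left _ _).trans h3)
    ((le_max_right _ _).trans h3) (minDeg_le_deg (G N)) h2.le (fun j => ?_) hη i T).trans h1.le
  exact le_ciSup (f := fun j => |inflow (G N) j - 1|) (Set.finite_range _).bddAbove j


/-! ### Convergence in distribution of tagged queues -/

/-- With the identity as time change, agreement on a long interval gives closeness in `J₁`, so the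
probability of decoupling controls convergence in distribution. -/
theorem CadlagPath.exists_forall_eq_mem {E : Type*} [PseudoMetricSpace E]
    {V : Set (CadlagPath E × CadlagPath E)} (hV : V ∈ uniformity (CadlagPath E)) :
    ∃ T : ℝ≥0, ∀ x y : CadlagPath E, (∀ t ≤ T, x t = y t) → (x, y) ∈ V := by
  obtain ⟨⟨T, ε⟩, hε, h⟩ := CadlagPath.hasBasis_uniformity.mem_iff.1 hV
  exact ⟨T, fun x y hxy => h (CadlagPath.mem_close_of_dist_lt hε fun t ht => by
    rw [hxy t ht, dist_self]; exact hε)⟩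

theorem CadlagPath.measurable_tuple {ι : Type*} [Fintype ι] :
    Measurable fun x : ι → CadlagPath ℕ => CadlagPath.tuple x :=
  CadlagPath.measurable_of_eval CadlagPath.pi_nat_eq_of_dist_lt_one fun t =>
    measurable_pi_lambda _ fun i =>
      (CadlagPath.measurable_eval CadlagPath.nat_eq_of_dist_lt_one t).comp (measurable_pi_apply i)

section Limit
variable {Ω : Type*} [MeasurableSpace Ω] {P : Measure Ω} [IsProbabilityMeasure P] {lam : ℝ≥0}
  {d : ℕ} {hd : 2 ≤ d} {q : ℕ → ℝ} {Svc : ℕ → Ω → Measure ℝ≥0}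
  {Arr : ℕ → Ω → Measure (ℝ≥0 × ℝ≥0)} {Φ : ℕ × Noise → CadlagPath ℕ}
  {G : ∀ N, SimpleGraph (Fin N)} {bself : ∀ N : ℕ, Fin N → (Fin N → ℕ) → ℝ}
  {bnbr : ∀ N : ℕ, Fin N → Fin N → (Fin N → ℕ) → ℝ} {X : ∀ N : ℕ, Fin N → Ω → CadlagPath ℕ}

omit [IsProbabilityMeasure P] in
theorem IsSolutionMap.exists_isMcKeanVlasov (hΦ : IsSolutionMap P lam d q Φ)
    (h : IsDrivingNoise P lam Svc Arr) (i : ℕ) {ξ : Ω → ℕ} (hξ : Measurable ξ)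
    (hξq : HasTail P q ξ) (hξN : IndepFun ξ (fun ω => (Svc i ω, Arr i ω)) P) :
    ∃ Y : Ω → CadlagPath ℕ,
      IsMcKeanVlasov P d q (Svc i) (Arr i) Y ∧ ∀ᵐ ω ∂P, Y ω 0 = ξ ω :=
  ⟨_, hΦ.solution _ _ (h.single i) hξ hξq hξN⟩

theorem IsSolutionMap.hasLaw (hΦ : IsSolutionMap P lam d q Φ)
    (h : IsDrivingNoise P lam Svc Arr) {N : ℕ}
    (hX : IsQueueSystem P d hd q Svc Arr (G N) (bself N) (bnbr N) (X N)) (j : Fin N) (i : ℕ)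
    {Y : Ω → CadlagPath ℕ} (hY : IsMcKeanVlasov P d q (Svc i) (Arr i) Y) :
    HasLaw Y (P.map (coupledLimit Svc Arr Φ (X N) j)) P where
  aemeasurable := (CadlagPath.measurable_of_eval CadlagPath.nat_eq_of_dist_lt_one
    hY.measurable).aemeasurable
  map_eq := by
    rw [Measure.map_congr (hΦ.ae_eq h hY (hY.measurable 0) (ae_of_all _ fun _ => rfl))]
    exact hΦ.map_eq h (hY.measurable 0) (hX.measurable j 0) hY.initial_law (hX.initial_law j)
      hY.indep_noise (hX.indepFun_initial j j)

theorem DegreeRegular.tendsto_decoupling (hG : DegreeRegular G) (hΦ : IsSolutionMap P lam d q Φ)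
    (h : IsDrivingNoise P lam Svc Arr)
    (hX : ∀ N, IsQueueSystem P d hd q Svc Arr (G N) (bself N) (bnbr N) (X N)) (T : ℝ≥0)
    {s : ℕ → ℕ} (hs : Tendsto s atTop atTop) (i : ∀ n, Fin (s n)) :
    Tendsto (fun n => P {ω | ∃ t ≤ T, X (s n) (i n) ω t ≠
      coupledLimit Svc Arr Φ (X (s n)) (i n) ω t}) atTop (𝓝 0) := by
  rw [← ENNReal.tendsto_toReal_zero_iff fun n => measure_ne_top _ _, Metric.tendsto_nhds]
  intro ε hε
  filter_upwards [hs.eventually (hG.eventually_decoupling_le hΦ h hX T (half_pos hε))] with n hn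
  rw [Real.dist_0_eq_abs, abs_of_nonneg ENNReal.toReal_nonneg]
  exact (hn (i n)).trans_lt (half_lt_self hε)

theorem DegreeRegular.tendsto_tagged (hG : DegreeRegular G) (hΦ : IsSolutionMap P lam d q Φ)
    (h : IsDrivingNoise P lam Svc Arr)
    (hX : ∀ N, IsQueueSystem P d hd q Svc Arr (G N) (bself N) (bnbr N) (X N)) {N : ℕ} (j : Fin N)
    {μ : Measure (CadlagPath ℕ)} [IsProbabilityMeasure μ]
    (hμ : μ = P.map (coupledLimit Svc Arr Φ (X N) j)) {s : ℕ → ℕ} (hs : Tendsto s atTop atTop) (i : ∀ n, Fin (s n)) :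
    TendstoInDistribution (fun n => X (s n) (i n)) atTop (fun x : CadlagPath ℕ => x) (fun _ => P) μ := by
  refine tendsto_map_of_uniformity P _ (fun n => coupledLimit Svc Arr Φ (X (s n)) (i n))
    (fun n => ((hX _).measurable_path _).aemeasurable) aemeasurable_id
    (.of_forall fun n => ⟨(measurable_coupledLimit hΦ h (hX _) _).aemeasurable, ?_⟩) ?_
  · rw [Measure.map_id', hμ]
    exact map_coupledLimit_eq hΦ h (hX _) (hX _) _ _
  · intro V hV
    obtain ⟨T, hT⟩ := CadlagPath.exists_forall_eq_mem hV
    refine tendsto_of_tendsto_of_tendsto_of_le_of_le tendsto_const_nhds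
      (hG.tendsto_decoupling hΦ h hX T hs i) (fun n => zero_le) fun n => measure_mono ?_
    intro ω hω
    by_contra hc
    refine hω (hT _ _ fun t ht => ?_)
    by_contra hne
    exact hc ⟨t, ht, hne⟩

theorem DegreeRegular.tendsto_tuple (hG : DegreeRegular G) (hΦ : IsSolutionMap P lam d q Φ)
    (h : IsDrivingNoise P lam Svc Arr)
    (hX : ∀ N, IsQueueSystem P d hd q Svc Arr (G N) (bself N) (bnbr N) (X N)) {N : ℕ} (j : Fin N)
    {μ : Measure (CadlagPath ℕ)} [IsProbabilityMeasure μ]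
    (hμ : μ = P.map (coupledLimit Svc Arr Φ (X N) j)) {s : ℕ → ℕ} (hs : Tendsto s atTop atTop) {m : ℕ} (i : ∀ n, Fin m → Fin (s n))
    (hi : ∀ n, Function.Injective (i n)) :
    TendstoInDistribution (fun n ω => CadlagPath.tuple fun k => X (s n) (i n k) ω) atTop
      (fun x : Fin m → CadlagPath ℕ => CadlagPath.tuple x) (fun _ => P)
      (Measure.pi fun _ => μ) := by
  have hm : ∀ n, Measurable fun ω k => coupledLimit Svc Arr Φ (X (s n)) (i n k) ω := fun n =>
    measurable_pi_lambda _ fun k => measurable_coupledLimit hΦ h (hX _) _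
  refine tendsto_map_of_uniformity P _
    (fun n ω => CadlagPath.tuple fun k => coupledLimit Svc Arr Φ (X (s n)) (i n k) ω)
    (fun n => (CadlagPath.measurable_tuple.comp (measurable_pi_lambda _ fun k =>
      (hX _).measurable_path (i n k))).aemeasurable) CadlagPath.measurable_tuple.aemeasurable
    (.of_forall fun n => ⟨(CadlagPath.measurable_tuple.comp (hm n)).aemeasurable, ?_⟩) ?_
  · have h1 := ((iIndepFun_coupledLimit hΦ h (hX (s n))).precomp (hi n)).map_fun_eq_pi_map
      fun k => (measurable_coupledLimit hΦ h (hX _) _).aemeasurable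
    have h2 : ∀ k, P.map (coupledLimit Svc Arr Φ (X (s n)) (i n k)) =
        P.map (coupledLimit Svc Arr Φ (X N) j) := fun k =>
      map_coupledLimit_eq hΦ h (hX _) (hX _) _ _
    simp only [h2, ← hμ] at h1
    rw [← h1, Measure.map_map CadlagPath.measurable_tuple (hm n)]
    rfl
  · intro V hV
    obtain ⟨T, hT⟩ := CadlagPath.exists_forall_eq_mem hV
    have hsum : Tendsto (fun n => ∑ k, P {ω | ∃ t ≤ T, X (s n) (i n k) ω t ≠
        coupledLimit Svc Arr Φ (X (s n)) (i n k) ω t}) atTop (𝓝 0) := by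
      have := tendsto_finsetSum Finset.univ fun k _ =>
        hG.tendsto_decoupling hΦ h hX T hs fun n => i n k
      rwa [Finset.sum_const_zero] at this
    refine tendsto_of_tendsto_of_tendsto_of_le_of_le tendsto_const_nhds hsum (fun n => zero_le)
      fun n => (measure_mono ?_).trans (measure_iUnion_fintype_le _ _)
    intro ω hω
    by_contra hc
    refine hω (hT _ _ fun t ht => funext fun k => ?_)
    by_contra hne
    exact hc (mem_iUnion.2 ⟨k, t, ht, hne⟩)

end Limit

/-! ### Mean square convergence -/

/-- A crude comparison that reduces third moments of the Poisson law to an exponential series. -/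
theorem natCast_pow_three_le (n : ℕ) : n ^ 3 ≤ 4 * 2 ^ n := by
  induction n with
  | zero => norm_num
  | succ n ih =>
    rcases Nat.lt_or_ge n 4 with h | h
    · interval_cases n <;> norm_num
    · have : 3 * n ^ 2 + 3 * n + 1 ≤ n ^ 3 := by nlinarith
      calc (n + 1) ^ 3 = n ^ 3 + (3 * n ^ 2 + 3 * n + 1) := by ring
        _ ≤ 4 * 2 ^ n + 4 * 2 ^ n := by omega
        _ = 4 * 2 ^ (n + 1) := by ring

theorem lintegral_pow_three_poissonMeasure_ne_top (r : ℝ≥0) :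
    ∫⁻ n : ℕ, (n : ℝ≥0∞) ^ 3 ∂poissonMeasure r ≠ ∞ := by
  rw [poissonMeasure, lintegral_sum_measure]
  simp only [lintegral_smul_measure, lintegral_dirac, smul_eq_mul]
  have hs : Summable fun n : ℕ => Real.exp (-r) * 4 * ((2 * r : ℝ) ^ n / n.factorial) :=
    (Real.summable_pow_div_factorial _).mul_left _
  refine ((ENNReal.tsum_le_tsum fun n => ?_).trans_lt
    (lt_top_iff_ne_top.2 hs.tsum_ofReal_ne_top)).ne
  have h1 : ((n : ℝ≥0∞)) ^ 3 ≤ ENNReal.ofReal (4 * 2 ^ n) := by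
    rw [← ENNReal.ofReal_natCast, ← ENNReal.ofReal_pow (Nat.cast_nonneg n)]
    exact ENNReal.ofReal_le_ofReal (by exact_mod_cast natCast_pow_three_le n)
  calc _ ≤ ENNReal.ofReal (Real.exp (-r) * r ^ n / n.factorial) * ENNReal.ofReal (4 * 2 ^ n) := by
        gcongr
    _ = _ := by
        rw [← ENNReal.ofReal_mul (by positivity)]
        congr 1
        rw [mul_pow]
        ring

theorem IsPoissonRandomMeasure.lintegral_pow_three {Ω S : Type*} [MeasurableSpace Ω]
    [MeasurableSpace S] {P : Measure Ω} {ν : Measure S} {η : Ω → Measure S}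
    (h : IsPoissonRandomMeasure P ν η) {s : Set S} (hs : MeasurableSet s) (hν : ν s ≠ ∞) :
    ∫⁻ ω, η ω s ^ 3 ∂P = ∫⁻ n : ℕ, (n : ℝ≥0∞) ^ 3 ∂poissonMeasure (ν s).toNNReal := by
  have h1 := lintegral_map (μ := P) (f := fun x : ℝ≥0∞ => x ^ 3) (by fun_prop)
    (h.measurable_apply hs)
  rw [← h1, h.poisson s hs hν, lintegral_map (by fun_prop) .of_discrete]

theorem ofReal_abs_natCast_sub_le {a b : ℕ} {z : ℝ≥0∞} (h1 : (a : ℝ≥0∞) ≤ b + z)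
    (h2 : (b : ℝ≥0∞) ≤ a + z) : ENNReal.ofReal |(a : ℝ) - b| ≤ z := by
  rcases eq_or_ne z ∞ with rfl | hz
  · exact le_top
  lift z to ℝ≥0 using hz
  rw [ENNReal.ofReal_le_iff_le_toReal ENNReal.coe_ne_top, ENNReal.coe_toReal, abs_sub_le_iff]
  have h1' : (a : ℝ≥0) ≤ b + z := by exact_mod_cast h1
  have h2' : (b : ℝ≥0) ≤ a + z := by exact_mod_cast h2
  have h1'' : (a : ℝ) ≤ b + z := by exact_mod_cast h1'
  have h2'' : (b : ℝ) ≤ a + z := by exact_mod_cast h2'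
  constructor <;> linarith

/-- Two queues with the same initial value and the same noise differ by at most the number of
noise points. -/
theorem iSup_abs_sub_le {x y : CadlagPath ℕ} {C D : ℝ≥0 → ℝ} {η : Measure ℝ≥0}
    {ζ : Measure (ℝ≥0 × ℝ≥0)} {K : ℝ≥0} (hC : ∀ t, C t ≤ K) (hD : ∀ t, D t ≤ K)
    (hn : IsLocallyFiniteNoise η ζ K) (hx : SolvesQueueEquation x C η ζ)
    (hy : SolvesQueueEquation y D η ζ) (h0 : x 0 = y 0) (T : ℝ≥0) :
    ⨆ s ∈ Iic T, ENNReal.ofReal |(x s : ℝ) - (y s : ℝ)| ≤ η (Ioc 0 T) + ζ (Ioc 0 T ×ˢ Iic K) := by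
  refine iSup₂_le fun s hs => ?_
  have hmono : η (Ioc 0 s) + ζ (Ioc 0 s ×ˢ Iic K) ≤ η (Ioc 0 T) + ζ (Ioc 0 T ×ˢ Iic K) := by
    have : Ioc 0 s ⊆ Ioc 0 T := Ioc_subset_Ioc_right hs
    exact add_le_add (measure_mono this) (measure_mono (prod_mono this le_rfl))
  refine le_trans ?_ hmono
  have key : ∀ {x y : CadlagPath ℕ} {C D : ℝ≥0 → ℝ}, (∀ t, C t ≤ K) → (∀ t, D t ≤ K) →
      SolvesQueueEquation x C η ζ → SolvesQueueEquation y D η ζ → x 0 = y 0 →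
      (x s : ℝ≥0∞) ≤ y s + (η (Ioc 0 s) + ζ (Ioc 0 s ×ˢ Iic K)) := by
    intro x y C D hC hD hx hy h0
    have h1 : (x s : ℝ≥0∞) + _ = _ + _ := (solvesQueueEquation_iff hC hn).1 hx s
    have h2 : (y s : ℝ≥0∞) + _ = _ + _ := (solvesQueueEquation_iff hD hn).1 hy s
    calc (x s : ℝ≥0∞) ≤ x 0 + arrivals C ζ 0 s := le_self_add.trans h1.le
      _ ≤ (y 0 + arrivals D ζ 0 s) + ζ (Ioc 0 s ×ˢ Iic K) := by
        rw [h0]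
        gcongr
        · exact le_self_add
        · exact arrivals_le hC ζ 0 s
      _ = (y s + departures y η 0 s) + ζ (Ioc 0 s ×ˢ Iic K) := by rw [h2]
      _ ≤ (y s + η (Ioc 0 s)) + ζ (Ioc 0 s ×ˢ Iic K) := by
        gcongr; exact departures_le _ _ _ _
      _ = _ := add_assoc _ _ _
  exact ofReal_abs_natCast_sub_le (key hC hD hx hy h0) (key hD hC hy hx h0.symm)

/-- Truncation at `M`: large values are paid for by the third moment. This takes the place of
uniform integrability. -/
theorem sq_le_sq_add_pow_three_div (z : ℝ≥0∞) {M : ℝ≥0} (hM : 0 < M) :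
    z ^ 2 ≤ (M : ℝ≥0∞) ^ 2 + z ^ 3 / M := by
  rcases le_total z M with h | h
  · exact (pow_le_pow_left₀ zero_le h 2).trans le_self_add
  · refine le_trans ?_ le_add_self
    rw [ENNReal.le_div_iff_mul_le (.inl (by exact_mod_cast hM.ne')) (.inl ENNReal.coe_ne_top)]
    calc z ^ 2 * M ≤ z ^ 2 * z := by gcongr
      _ = z ^ 3 := by ring

theorem setLIntegral_sq_le {Ω : Type*} [MeasurableSpace Ω] {P : Measure Ω} {Z : Ω → ℝ≥0∞}
    (hZ : Measurable Z) (A : Set Ω) {M : ℝ≥0} (hM : 0 < M) :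
    ∫⁻ ω in A, Z ω ^ 2 ∂P ≤ (M : ℝ≥0∞) ^ 2 * P A + (∫⁻ ω, Z ω ^ 3 ∂P) / M := by
  calc ∫⁻ ω in A, Z ω ^ 2 ∂P ≤ ∫⁻ ω in A, ((M : ℝ≥0∞) ^ 2 + Z ω ^ 3 / M) ∂P :=
        lintegral_mono fun ω => sq_le_sq_add_pow_three_div _ hM
    _ = (M : ℝ≥0∞) ^ 2 * P A + ∫⁻ ω in A, Z ω ^ 3 / M ∂P := by
        rw [lintegral_add_left measurable_const, setLIntegral_const]
    _ ≤ (M : ℝ≥0∞) ^ 2 * P A + ∫⁻ ω, Z ω ^ 3 / M ∂P := by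
        gcongr; exact Measure.restrict_le_self
    _ = _ := by
        simp only [div_eq_mul_inv]
        rw [lintegral_mul_const _ (by fun_prop)]

theorem lintegral_add_pow_three_le {Ω : Type*} [MeasurableSpace Ω] {P : Measure Ω}
    {a b : Ω → ℝ≥0∞} (ha : Measurable a) :
    ∫⁻ ω, (a ω + b ω) ^ 3 ∂P ≤ 8 * (∫⁻ ω, a ω ^ 3 ∂P) + 8 * ∫⁻ ω, b ω ^ 3 ∂P := by
  have h : ∀ x y : ℝ≥0∞, (x + y) ^ 3 ≤ 8 * x ^ 3 + 8 * y ^ 3 := by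
    intro x y
    wlog hxy : x ≤ y generalizing x y
    · rw [add_comm x, add_comm (8 * x ^ 3)]
      exact this y x (le_of_not_ge hxy)
    calc (x + y) ^ 3 ≤ (y + y) ^ 3 := by gcongr
      _ = 8 * y ^ 3 := by ring
      _ ≤ _ := le_add_self
  refine (lintegral_mono fun ω => h _ _).trans ?_
  rw [lintegral_add_left (by fun_prop), lintegral_const_mul' _ _ (by simp),
    lintegral_const_mul' _ _ (by simp)]


section MeanSquare
variable {Ω : Type*} [MeasurableSpace Ω] {P : Measure Ω} [IsProbabilityMeasure P] {lam : ℝ≥0}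
  {d : ℕ} {hd : 2 ≤ d} {q : ℕ → ℝ} {Svc : ℕ → Ω → Measure ℝ≥0}
  {Arr : ℕ → Ω → Measure (ℝ≥0 × ℝ≥0)} {Φ : ℕ × Noise → CadlagPath ℕ}
  {G : ∀ N, SimpleGraph (Fin N)} {bself : ∀ N : ℕ, Fin N → (Fin N → ℕ) → ℝ}
  {bnbr : ∀ N : ℕ, Fin N → Fin N → (Fin N → ℕ) → ℝ} {X : ∀ N : ℕ, Fin N → Ω → CadlagPath ℕ}

omit [IsProbabilityMeasure P] in
/-- The number of noise points of a server has third moments, uniformly over the servers. -/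
theorem IsDrivingNoise.exists_lintegral_pow_three_le (h : IsDrivingNoise P lam Svc Arr)
    (T K : ℝ≥0) : ∃ m : ℝ≥0, ∀ i,
      ∫⁻ ω, (Svc i ω (Ioc 0 T) + Arr i ω (Ioc 0 T ×ˢ Iic K)) ^ 3 ∂P ≤ m := by
  have h1 : lebesgue (Ioc 0 T) ≠ ∞ :=
    ((lebesgue_Ioc_le 0 T).trans_lt ENNReal.ofReal_lt_top).ne
  have h2 : (lam • lebesgue.prod lebesgue) (Ioc 0 T ×ˢ Iic K) ≠ ∞ :=
    ((IsNoiseFamily.arrivalIntensity_cell_le lam K 0 T).trans_lt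
      (ENNReal.mul_lt_top (ENNReal.mul_lt_top ENNReal.coe_lt_top ENNReal.coe_lt_top)
        ENNReal.ofReal_lt_top)).ne
  have h3 : MeasurableSet (Ioc 0 T ×ˢ Iic K) := measurableSet_Ioc.prod measurableSet_Iic
  refine ⟨(8 * (∫⁻ n : ℕ, (n : ℝ≥0∞) ^ 3 ∂poissonMeasure (lebesgue (Ioc 0 T)).toNNReal) +
    8 * ∫⁻ n : ℕ, (n : ℝ≥0∞) ^ 3 ∂poissonMeasure
      ((lam • lebesgue.prod lebesgue) (Ioc 0 T ×ˢ Iic K)).toNNReal).toNNReal, fun i => ?_⟩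
  rw [ENNReal.coe_toNNReal (ENNReal.add_ne_top.2
    ⟨ENNReal.mul_ne_top (by simp) (lintegral_pow_three_poissonMeasure_ne_top _),
      ENNReal.mul_ne_top (by simp) (lintegral_pow_three_poissonMeasure_ne_top _)⟩)]
  refine (lintegral_add_pow_three_le ((h.service i).measurable_apply measurableSet_Ioc)).trans_eq ?_
  rw [(h.service i).lintegral_pow_three measurableSet_Ioc h1,
    (h.arrival i).lintegral_pow_three h3 h2]

/-- Without decoupling the two paths agree up to `T`. With it, they differ by at most the number of
noise points, whose square is truncated at `M`. -/
theorem lintegral_iSup_abs_sub_sq_le {N : ℕ} {Gn : SimpleGraph (Fin N)}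
    {bs : Fin N → (Fin N → ℕ) → ℝ} {bn : Fin N → Fin N → (Fin N → ℕ) → ℝ}
    {x : Fin N → Ω → CadlagPath ℕ} {e : ℝ} (hdeg : ∀ u, d - 1 ≤ deg Gn u) (he : e ≤ 1)
    (hin : ∀ i, |inflow Gn i - 1| ≤ e) (hΦ : IsSolutionMap P lam d q Φ)
    (h : IsDrivingNoise P lam Svc Arr) (hX : IsQueueSystem P d hd q Svc Arr Gn bs bn x)
    (i : Fin N) {Y : Ω → CadlagPath ℕ} (hY : IsMcKeanVlasov P d q (Svc i) (Arr i) Y)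
    (h0 : ∀ᵐ ω ∂P, x i ω 0 = Y ω 0) (T : ℝ≥0) {M m : ℝ≥0} (hM : 0 < M)
    (hm : ∫⁻ ω, (Svc i ω (Ioc 0 T) + Arr i ω (Ioc 0 T ×ˢ Iic (2 * d : ℝ≥0))) ^ 3 ∂P ≤ m) :
    ∫⁻ ω, (⨆ s ∈ Iic T, ENNReal.ofReal |(x i ω s : ℝ) - (Y ω s : ℝ)|) ^ 2 ∂P ≤
      (M : ℝ≥0∞) ^ 2 * P {ω | ∃ s ≤ T, x i ω s ≠ coupledLimit Svc Arr Φ x i ω s} + m / M := by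
  set D := {ω | ∃ s ≤ T, x i ω s ≠ coupledLimit Svc Arr Φ x i ω s} with hD
  set Z : Ω → ℝ≥0∞ := fun ω => Svc i ω (Ioc 0 T) + Arr i ω (Ioc 0 T ×ˢ Iic (2 * d : ℝ≥0))
  have hZ : Measurable Z := ((h.service i).measurable_apply measurableSet_Ioc).add
    ((h.arrival i).measurable_apply (measurableSet_Ioc.prod measurableSet_Iic))
  have hle : ∀ᵐ ω ∂P, (⨆ s ∈ Iic T, ENNReal.ofReal |(x i ω s : ℝ) - (Y ω s : ℝ)|) ^ 2 ≤
      (toMeasurable P D).indicator (fun ω => Z ω ^ 2) ω := by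
    filter_upwards [hX.evolution, hY.evolution, h0,
      hΦ.ae_eq h hY (hX.measurable i 0) (h0.mono fun ω hω => hω.symm),
      (h.single i).ae_isRegularNoise (2 * d)] with ω e1 e2 e3 e4 e5
    by_cases hω : ω ∈ toMeasurable P D
    · rw [indicator_of_mem hω]
      refine pow_le_pow_left₀ zero_le (iSup_abs_sub_le ?_ ?_
        (e5 ()).toIsLocallyFiniteNoise (e1 i) e2 e3 T) 2
      · exact fun t => (arrivalRate_isRate hd hdeg he hin bs bn).le t i _
      · intro t
        have : IsProbabilityMeasure (P.map fun ω' => Y ω' t) :=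
          Measure.isProbabilityMeasure_map (hY.measurable t).aemeasurable
        refine (limitRate_le d).trans ?_
        push_cast
        have : (0 : ℝ) ≤ d := Nat.cast_nonneg d
        linarith
    · rw [indicator_of_notMem hω]
      have h1 : ω ∉ D := fun h => hω (subset_toMeasurable P D h)
      have h2 : ∀ s ≤ T, x i ω s = Y ω s := fun s hs => by
        by_contra hne
        refine h1 ⟨s, hs, ?_⟩
        rwa [coupledLimit, ← e4]
      simp only [nonpos_iff_eq_zero]
      rw [pow_eq_zero_iff two_ne_zero]
      simp only [ENNReal.iSup_eq_zero]
      intro s hs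
      rw [h2 s hs]
      simp
  calc _ ≤ ∫⁻ ω, (toMeasurable P D).indicator (fun ω => Z ω ^ 2) ω ∂P := lintegral_mono_ae hle
    _ = ∫⁻ ω in toMeasurable P D, Z ω ^ 2 ∂P :=
        lintegral_indicator (measurableSet_toMeasurable P D) _
    _ ≤ (M : ℝ≥0∞) ^ 2 * P (toMeasurable P D) + (∫⁻ ω, Z ω ^ 3 ∂P) / M :=
        setLIntegral_sq_le hZ _ hM
    _ ≤ _ := by rw [measure_toMeasurable]; gcongr

theorem DegreeRegular.tendsto_iSup_lintegral_sq (hG : DegreeRegular G)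
    (hΦ : IsSolutionMap P lam d q Φ) (h : IsDrivingNoise P lam Svc Arr)
    (hX : ∀ N, IsQueueSystem P d hd q Svc Arr (G N) (bself N) (bnbr N) (X N))
    {Y : ℕ → Ω → CadlagPath ℕ} (hY : ∀ i, IsMcKeanVlasov P d q (Svc i) (Arr i) (Y i))
    (h0 : ∀ (N : ℕ) (i : Fin N), ∀ᵐ ω ∂P, X N i ω 0 = Y i ω 0) (T : ℝ≥0) :
    Tendsto (fun N => ⨆ i : Fin N, ∫⁻ ω,
      (⨆ s ∈ Iic T, ENNReal.ofReal |(X N i ω s : ℝ) - (Y i ω s : ℝ)|) ^ 2 ∂P) atTop (𝓝 0) := by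
  obtain ⟨m, hm⟩ := h.exists_lintegral_pow_three_le T (2 * d)
  rw [ENNReal.tendsto_nhds_zero]
  intro ε' hε'
  obtain ⟨ε, hε, hεε'⟩ := ENNReal.lt_iff_exists_nnreal_btwn.1 hε'
  have hε : 0 < ε := by exact_mod_cast hε
  -- First `M` makes the third moment term at most `ε / 2`; then `δ`, the admissible decoupling
  -- probability, makes `M ^ 2 * δ` equal to `ε / 2`.
  set M : ℝ≥0 := 2 * m / ε + 1
  have hM : 0 < M := by positivity
  set δ : ℝ≥0 := ε / (2 * M ^ 2)
  have hδ : 0 < δ := by positivity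
  have hsum : M ^ 2 * δ + m / M ≤ ε := by
    have h1 : M ^ 2 * δ = ε / 2 := by simp only [δ]; field_simp
    have h2 : m / M ≤ ε / 2 := by
      rw [div_le_iff₀ hM]
      have : ε / 2 * (2 * m / ε) = m := by field_simp
      calc m = ε / 2 * (2 * m / ε) := this.symm
        _ ≤ ε / 2 * M := by gcongr; exact le_self_add
    calc _ ≤ ε / 2 + ε / 2 := by rw [h1]; gcongr
      _ = ε := add_halves ε
  clear_value δ M
  filter_upwards [hG.eventually_decoupling_le hΦ h hX T (NNReal.coe_pos.2 hδ),
    hG.balanced.eventually (gt_mem_nhds one_pos),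
    hG.minDeg_tendsto.eventually_ge_atTop (d - 1)] with N h1 h2 h3
  refine iSup_le fun i => le_trans ?_ hεε'.le
  have hin : ∀ j, |inflow (G N) j - 1| ≤ _ := fun j =>
    le_ciSup (f := fun j => |inflow (G N) j - 1|) (Set.finite_range _).bddAbove j
  refine (lintegral_iSup_abs_sub_sq_le (fun u => h3.trans (minDeg_le_deg _ u)) h2.le hin hΦ h
    (hX N) i (hY i) (h0 N i) T hM (hm i)).trans ?_
  have hP : P {ω | ∃ s ≤ T, X N i ω s ≠ coupledLimit Svc Arr Φ (X N) i ω s} ≤ δ := by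
    rw [← ofReal_measureReal, ← ENNReal.ofReal_coe_nnreal]
    exact ENNReal.ofReal_le_ofReal (h1 i)
  calc _ ≤ (M : ℝ≥0∞) ^ 2 * δ + m / M := by gcongr
    _ = ((M ^ 2 * δ + m / M : ℝ≥0) : ℝ≥0∞) := by
        rw [ENNReal.coe_add, ENNReal.coe_mul, ENNReal.coe_pow, ENNReal.coe_div hM.ne']
    _ ≤ ε := by exact_mod_cast hsum

end MeanSquare


/-! ### Fractions of a finite set -/

section Fraction
variable {γ : Type*}

/-- The fraction of the points of `S` which lie in `A`. -/
def fraction (S : Finset γ) (A : Set γ) : ℝ := (∑ j ∈ S, A.indicator 1 j) / (S.card : ℝ)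

theorem indicator_one_real_nonneg (A : Set γ) (j : γ) : 0 ≤ A.indicator (1 : γ → ℝ) j :=
  indicator_nonneg (fun _ _ => zero_le_one) j

theorem fraction_nonneg (S : Finset γ) (A : Set γ) : 0 ≤ fraction S A :=
  div_nonneg (Finset.sum_nonneg fun _ _ => indicator_one_real_nonneg _ _)
    (Nat.cast_nonneg _)

theorem fraction_le_one (S : Finset γ) (A : Set γ) : fraction S A ≤ 1 := by
  refine div_le_one_of_le₀ ?_ (Nat.cast_nonneg _)
  refine (Finset.sum_le_card_nsmul S _ 1 fun j _ => ?_).trans_eq (by simp)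
  exact indicator_le_self' (fun _ _ => zero_le_one) j

theorem fraction_mono (S : Finset γ) {A B : Set γ} (h : A ⊆ B) : fraction S A ≤ fraction S B := by
  unfold fraction
  exact div_le_div_of_nonneg_right (Finset.sum_le_sum fun j _ =>
    indicator_le_indicator_of_subset h (fun _ => zero_le_one) j) (Nat.cast_nonneg _)

theorem fraction_union_le (S : Finset γ) (A B : Set γ) :
    fraction S (A ∪ B) ≤ fraction S A + fraction S B := by
  unfold fraction
  rw [← add_div, ← Finset.sum_add_distrib]
  gcongr with j
  by_cases hA : j ∈ A <;> by_cases hB : j ∈ B <;> simp [hA, hB]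

variable {Ω E : Type*} [MeasurableSpace Ω] {P : Measure Ω} [IsProbabilityMeasure P]
  [MeasurableSpace E]

/-- Weak law of large numbers. -/
theorem measure_le_abs_fraction_sub_le (S : Finset γ) (hS : S.Nonempty) {Z : γ → Ω → E}
    (hZ : ∀ j, Measurable (Z j)) (hind : iIndepFun Z P) {A : Set E} (hA : MeasurableSet A)
    {ε : ℝ} (hε : 0 < ε) :
    P {ω | ε ≤ |fraction S {j | Z j ω ∈ A} - (∑ j ∈ S, P.real {ω | Z j ω ∈ A}) / S.card|} ≤
      ENNReal.ofReal (1 / (S.card * ε ^ 2)) := by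
  have hM : (0 : ℝ) < S.card := by exact_mod_cast hS.card_pos
  set f : γ → Ω → ℝ := fun j ω => A.indicator 1 (Z j ω) with hf
  have hfm : ∀ j, Measurable (f j) := fun j =>
    (measurable_one.indicator hA).comp (hZ j)
  have hfb : ∀ j, ∀ᵐ ω ∂P, f j ω ∈ Icc (0 : ℝ) 1 := fun j => ae_of_all _ fun ω =>
    ⟨indicator_nonneg (fun _ _ => zero_le_one) _, indicator_le_self' (fun _ _ => zero_le_one) _⟩
  have hfL : ∀ j, MemLp (f j) 2 P := fun j => memLp_of_bounded (hfb j)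
    (hfm j).aestronglyMeasurable 2
  have hfi : ∀ j, ∫ ω, f j ω ∂P = P.real {ω | Z j ω ∈ A} := fun j =>
    integral_indicator_one (hZ j hA)
  have hsumL : MemLp (∑ j ∈ S, f j) 2 P := memLp_finsetSum' _ fun j _ => hfL j
  have hE : ∫ ω, (∑ j ∈ S, f j) ω ∂P = ∑ j ∈ S, P.real {ω | Z j ω ∈ A} := by
    simp only [Finset.sum_apply]
    rw [integral_finsetSum _ fun j _ => (hfL j).integrable one_le_two]
    simp only [hfi]
  have hV : variance (∑ j ∈ S, f j) P ≤ S.card := by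
    rw [IndepFun.variance_sum (fun j _ => hfL j) fun j _ k _ hjk =>
      (hind.indepFun hjk).comp (measurable_one.indicator hA) (measurable_one.indicator hA)]
    refine (Finset.sum_le_card_nsmul S _ 1 fun j _ => ?_).trans_eq (by simp)
    refine (variance_le_sq_of_bounded (hfb j) (hfm j).aemeasurable).trans ?_
    norm_num
  have h := meas_ge_le_variance_div_sq hsumL (c := ε * S.card) (by positivity)
  refine (measure_mono ?_).trans (h.trans (ENNReal.ofReal_le_ofReal ?_))
  · intro ω (hω : ε ≤ _)
    change ε * S.card ≤ |(∑ j ∈ S, f j) ω - _|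
    rw [hE]
    have e : fraction S {j | Z j ω ∈ A} = (∑ j ∈ S, f j) ω / S.card := by
      rw [fraction, Finset.sum_apply]
      rfl
    rw [e, ← sub_div, abs_div, abs_of_pos hM, le_div_iff₀ hM] at hω
    exact hω
  · calc _ ≤ S.card / (ε * S.card) ^ 2 := by gcongr
      _ = _ := by field_simp

/-- Markov's inequality. -/
theorem measure_le_fraction_le (S : Finset γ) {D : γ → Set Ω} {ε c : ℝ} (hc : 0 ≤ c) (hε : 0 < ε)
    (hD : ∀ j, P.real (D j) ≤ c) :
    P {ω | ε ≤ fraction S {j | ω ∈ D j}} ≤ ENNReal.ofReal (c / ε) := by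
  -- The sets `D j` need not be measurable; their measurable hulls have the same probability and
  -- only enlarge the fraction.
  set f : Ω → ℝ := fun ω => fraction S {j | ω ∈ toMeasurable P (D j)} with hf
  have hm : ∀ j, Measurable fun ω => (toMeasurable P (D j)).indicator (1 : Ω → ℝ) ω := fun j =>
    measurable_one.indicator (measurableSet_toMeasurable _ _)
  have hfe : ∀ ω, f ω = (∑ j ∈ S, (toMeasurable P (D j)).indicator (1 : Ω → ℝ) ω) / S.card :=
    fun ω => rfl
  have hint : ∀ j, Integrable (fun ω => (toMeasurable P (D j)).indicator (1 : Ω → ℝ) ω) P :=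
    fun j => (integrable_const (1 : ℝ)).indicator (measurableSet_toMeasurable _ _)
  have hfint : Integrable f P := (integrable_finsetSum _ fun j _ => hint j).div_const _
  have hI : ∫ ω, f ω ∂P ≤ c := by
    simp only [hfe]
    rw [integral_div, integral_finsetSum _ fun j _ => hint j]
    rcases S.eq_empty_or_nonempty with rfl | hS
    · simpa using hc
    rw [div_le_iff₀ (by exact_mod_cast hS.card_pos), mul_comm, ← nsmul_eq_mul]
    refine Finset.sum_le_card_nsmul S _ c fun j _ => ?_
    rw [integral_indicator_one (measurableSet_toMeasurable _ _), measureReal_def,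
      measure_toMeasurable]
    exact hD j
  have h1 := mul_meas_ge_le_integral_of_nonneg (μ := P) (f := f)
    (ae_of_all _ fun ω => fraction_nonneg _ _) hfint ε
  have h2 : P.real {ω | ε ≤ f ω} ≤ c / ε := by
    rw [le_div_iff₀ hε, mul_comm]
    exact h1.trans hI
  rw [← ofReal_measureReal]
  refine ENNReal.ofReal_le_ofReal (le_trans (measureReal_mono ?_) h2)
  intro ω (hω : ε ≤ _)
  exact hω.trans (fraction_mono S fun j hj => subset_toMeasurable P (D j) hj)

end Fraction

/-! ### The Lévy–Prokhorov distance of queue laws -/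

/-- Every set is contained in its thickenings, so a uniform bound over all sets bounds the
Lévy–Prokhorov distance. -/
theorem QueueLaws.dist_le {μ ν : QueueLaws} {r : ℝ} (hr : 0 ≤ r)
    (h : ∀ B : Set ℕ, (μ.toMeasure : Measure ℕ) B ≤
      (ν.toMeasure : Measure ℕ) B + ENNReal.ofReal r) : dist μ ν ≤ r := by
  rw [LevyProkhorov.dist_probabilityMeasure_def]
  refine levyProkhorovDist_le_of_forall_le _ _ hr fun ε B hε _ => (h B).trans ?_
  gcongr
  exact Metric.self_subset_thickening (hr.trans_lt hε) B

theorem QueueLaws.dist_le_of_real {μ ν : QueueLaws} {r : ℝ} (hr : 0 ≤ r)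
    (h : ∀ B : Set ℕ, (μ.toMeasure : Measure ℕ).real B ≤ (ν.toMeasure : Measure ℕ).real B + r) :
    dist μ ν ≤ r := by
  refine QueueLaws.dist_le hr fun B => ?_
  rw [← ofReal_measureReal, ← ofReal_measureReal, ← ENNReal.ofReal_add measureReal_nonneg hr]
  exact ENNReal.ofReal_le_ofReal (h B)

/-- Two queue laws are close if they are close on single points and one of them is tight. -/
theorem QueueLaws.dist_le_of_singleton {μ ν : QueueLaws} {r e : ℝ} (hr : 0 ≤ r) (he : 0 ≤ e)
    (J : ℕ) (h : ∀ a < J, |(ν.toMeasure : Measure ℕ).real {a} -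
      (μ.toMeasure : Measure ℕ).real {a}| ≤ e)
    (hJ : (μ.toMeasure : Measure ℕ).real (Ici J) ≤ r) : dist μ ν ≤ r + J * e := by
  classical
  refine QueueLaws.dist_le_of_real (by positivity) fun B => ?_
  set F : Finset ℕ := (Finset.range J).filter (· ∈ B)
  have hsub : B ⊆ ↑F ∪ Ici J := fun b hb => by
    rcases lt_or_ge b J with h | h
    · left; simp [F, h, hb]
    · right; exact h
  have hF : (F : Set ℕ) ⊆ B := fun b hb => by
    simp only [F, Finset.coe_filter, Finset.mem_range] at hb
    exact hb.2
  calc (μ.toMeasure : Measure ℕ).real B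
      ≤ (μ.toMeasure : Measure ℕ).real F + (μ.toMeasure : Measure ℕ).real (Ici J) :=
        (measureReal_mono hsub).trans (measureReal_union_le _ _)
    _ ≤ ((ν.toMeasure : Measure ℕ).real F + J * e) + r := by
        gcongr
        rw [← sum_measureReal_singleton, ← sum_measureReal_singleton]
        have : ∑ a ∈ F, (μ.toMeasure : Measure ℕ).real {a} ≤
            ∑ a ∈ F, ((ν.toMeasure : Measure ℕ).real {a} + e) := by
          refine Finset.sum_le_sum fun a ha => ?_
          have ha' : a < J := Finset.mem_range.1 (Finset.mem_filter.1 ha).1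
          have := (abs_le.1 (h a ha')).1
          linarith
        rw [Finset.sum_add_distrib, Finset.sum_const, nsmul_eq_mul] at this
        refine this.trans ?_
        gcongr
        exact (Finset.card_filter_le _ _).trans_eq (Finset.card_range J)
    _ ≤ _ := by
        have := measureReal_mono (μ := (ν.toMeasure : Measure ℕ)) hF
        linarith

/-! ### Occupancy measures -/

section Occupancy
variable {N : ℕ} (G : SimpleGraph (Fin N))

open Classical in
/-- A server and its neighbors. -/
def closedNbhd (i : Fin N) : Finset (Fin N) := insert i (G.neighborFinset i)

theorem card_closedNbhd (i : Fin N) : (closedNbhd G i).card = deg G i + 1 := by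
  classical
  rw [closedNbhd, Finset.card_insert_of_notMem (by simp), SimpleGraph.card_neighborFinset_eq_degree]
  rfl

theorem nbhdMeasure_real (i : Fin N) (x : Fin N → ℕ) (B : Set ℕ) :
    (nbhdMeasure G i x).real B = fraction (closedNbhd G i) {j | x j ∈ B} := by
  classical
  have hB : ∀ j, Measure.dirac (x j) B = ENNReal.ofReal ({j | x j ∈ B}.indicator 1 j) := fun j => by
    rw [Measure.dirac_apply]
    by_cases h : x j ∈ B <;> simp [h]
  have hsum : ∑ j ∈ Finset.univ.filter (fun j => j ≠ i),
      ENNReal.ofReal (edge G i j) * Measure.dirac (x j) B =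
      ∑ j ∈ G.neighborFinset i, Measure.dirac (x j) B := by
    have h1 : ∀ j, ENNReal.ofReal (edge G i j) * Measure.dirac (x j) B =
        if G.Adj i j then Measure.dirac (x j) B else 0 := by
      intro j; unfold edge; split_ifs <;> simp
    simp only [h1]
    rw [← Finset.sum_filter]
    refine Finset.sum_congr ?_ fun _ _ => rfl
    ext j
    simp only [Finset.mem_filter, Finset.mem_univ, true_and, SimpleGraph.mem_neighborFinset]
    exact ⟨fun h => h.2, fun h => ⟨h.ne', h⟩⟩
  have h0 : nbhdMeasure G i x B = ((deg G i : ℝ≥0∞) + 1)⁻¹ *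
      ENNReal.ofReal (∑ j ∈ closedNbhd G i, {j | x j ∈ B}.indicator 1 j) := by
    rw [nbhdMeasure, Measure.smul_apply, Measure.add_apply, Measure.finsetSum_apply, smul_eq_mul,
      ENNReal.ofReal_sum_of_nonneg fun _ _ => indicator_one_real_nonneg _ _]
    simp only [Measure.smul_apply, smul_eq_mul]
    rw [hsum, closedNbhd, Finset.sum_insert (by simp)]
    simp only [hB]
    rw [add_comm (ENNReal.ofReal _)]
  rw [measureReal_def, h0, ENNReal.toReal_mul, ENNReal.toReal_inv, fraction, card_closedNbhd,
    ENNReal.toReal_ofReal (Finset.sum_nonneg fun _ _ => indicator_one_real_nonneg _ _),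
    ENNReal.toReal_add (by simp) (by simp)]
  simp only [ENNReal.toReal_natCast, ENNReal.toReal_one]
  push_cast
  rw [div_eq_inv_mul]

theorem dist_nbhdOccupancy_le (i : Fin N) (x y : Fin N → ℕ) :
    dist (nbhdOccupancy G i x) (nbhdOccupancy G i y) ≤
      fraction (closedNbhd G i) {j | x j ≠ y j} := by
  refine QueueLaws.dist_le_of_real (fraction_nonneg _ _) fun B => ?_
  change (nbhdMeasure G i x).real B ≤ (nbhdMeasure G i y).real B + _
  rw [nbhdMeasure_real, nbhdMeasure_real]
  refine (fraction_mono _ fun j (hj : x j ∈ B) => ?_).trans (fraction_union_le _ _ _)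
  by_cases h : x j = y j
  · left; change y j ∈ B; rwa [← h]
  · right; exact h

/-- Distinct integer configurations are at distance at least one, while a fraction never exceeds
one. The occupancy map is thus 1-Lipschitz. -/
theorem dist_nbhdOccupancy_le_dist (i : Fin N) (x y : Fin N → ℕ) :
    dist (nbhdOccupancy G i x) (nbhdOccupancy G i y) ≤ dist x y := by
  rcases eq_or_ne x y with rfl | h
  · simp
  · refine (dist_nbhdOccupancy_le G i x y).trans ((fraction_le_one _ _).trans ?_)
    by_contra hlt
    exact h (CadlagPath.pi_nat_eq_of_dist_lt_one x y (not_le.1 hlt))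

/-- The same time change serves for the image paths. This gives measurability of the occupancy
paths, whose state space is not discrete, so that the criterion by evaluations does not apply. -/
theorem CadlagPath.continuous_map {E F : Type*} [PseudoMetricSpace E] [PseudoMetricSpace F]
    {f : E → F} (hf : Continuous f) (h : ∀ a b, dist (f a) (f b) ≤ dist a b) :
    Continuous (CadlagPath.map f hf) := by
  refine UniformContinuous.continuous ?_
  refine (CadlagPath.hasBasis_uniformity.uniformContinuous_iff
    CadlagPath.hasBasis_uniformity).2 fun p hp => ⟨p, hp, fun x y ⟨τ, hτ⟩ => ⟨τ, fun t ht => ?_⟩⟩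
  exact ⟨(hτ t ht).1, (h _ _).trans_lt (hτ t ht).2⟩

theorem measurable_nbhdOccupancyPath (i : Fin N) :
    Measurable fun x : Fin N → CadlagPath ℕ => nbhdOccupancyPath G i x :=
  (CadlagPath.continuous_map continuous_of_discreteTopology
    (dist_nbhdOccupancy_le_dist G i)).measurable.comp CadlagPath.measurable_tuple

end Occupancy


/-! ### Convergence of the occupancy processes -/

/-- A path is close to `ρ` on `[0, T]` if it is close to a path which is close to `ρ` on a grid and
which moves little between grid times. -/
theorem dist_nbhdOccupancy_le_of_grid {N : ℕ} (G : SimpleGraph (Fin N)) (i : Fin N)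
    {x y : Fin N → ℝ≥0 → ℕ} {ρ : ℝ≥0 → QueueLaws} {A : ℝ} (hA : 0 ≤ A)
    (hρ : ∀ s t, dist (ρ s) (ρ t) ≤ A * dist s t) {T δ : ℝ≥0} (hδ : 0 < δ) {n J : ℕ}
    (hn : T < n * δ) {r r' e : ℝ} (hr : 0 ≤ r) (he : 0 ≤ e)
    (h1 : fraction (closedNbhd G i) {j | ∃ s ≤ T, x j s ≠ y j s} ≤ r)
    (h2 : ∀ k < n, fraction (closedNbhd G i)
      {j | ∃ s ∈ Icc (k * δ) ((k + 1) * δ), y j s ≠ y j (k * δ)} ≤ r')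
    (h3 : ∀ k < n, ∀ a < J, |fraction (closedNbhd G i) {j | y j (k * δ) = a} -
      ((ρ (k * δ)).toMeasure : Measure ℕ).real {a}| ≤ e)
    (h4 : ∀ k < n, ((ρ (k * δ)).toMeasure : Measure ℕ).real (Ici J) ≤ r) {t : ℝ≥0} (ht : t ≤ T) :
    dist (nbhdOccupancy G i fun j => x j t) (ρ t) ≤ r + r' + (r + J * e) + A * δ := by
  -- The last grid time before `t`. The four errors are the decoupled servers, the servers that move
  -- after `k * δ`, the law of large numbers at `k * δ`, and the movement of `ρ`.
  set k := ⌊t / δ⌋₊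
  have hk1 : k * δ ≤ t := by
    rw [← le_div_iff₀ hδ]; exact Nat.floor_le zero_le
  have hk2 : t ≤ (k + 1) * δ := by
    rw [← div_le_iff₀ hδ]; exact (Nat.lt_floor_add_one _).le
  have hk : k < n := by
    have : (k : ℝ≥0) * δ < n * δ := hk1.trans_lt (ht.trans_lt hn)
    exact_mod_cast lt_of_mul_lt_mul_right this zero_le
  have e1 : dist (nbhdOccupancy G i fun j => x j t) (nbhdOccupancy G i fun j => y j t) ≤ r :=
    (dist_nbhdOccupancy_le G i _ _).trans
      ((fraction_mono _ (show _ ⊆ {j | ∃ s ≤ T, x j s ≠ y j s} from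
        fun j hj => ⟨t, ht, hj⟩)).trans h1)
  have e2 : dist (nbhdOccupancy G i fun j => y j t) (nbhdOccupancy G i fun j => y j (k * δ)) ≤
      r' := (dist_nbhdOccupancy_le G i _ _).trans
      ((fraction_mono _ (show _ ⊆ {j | ∃ s ∈ Icc (k * δ) ((k + 1) * δ),
        y j s ≠ y j (k * δ)} from fun j hj => ⟨t, ⟨hk1, hk2⟩, hj⟩)).trans (h2 k hk))
  have e3 : dist (ρ (k * δ)) (nbhdOccupancy G i fun j => y j (k * δ)) ≤ r + J * e := by
    refine QueueLaws.dist_le_of_singleton hr he J (fun a ha => ?_) (h4 k hk)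
    change |(nbhdMeasure G i fun j => y j (k * δ)).real {a} - _| ≤ e
    rw [nbhdMeasure_real]
    exact h3 k hk a ha
  have e4 : dist (ρ (k * δ)) (ρ t) ≤ A * δ := by
    refine (hρ _ _).trans (mul_le_mul_of_nonneg_left ?_ hA)
    have h1 : ((k : ℝ) * δ : ℝ) ≤ t := by exact_mod_cast hk1
    have h2 : (t : ℝ) ≤ (k + 1) * δ := by exact_mod_cast hk2
    rw [NNReal.dist_eq, abs_sub_comm, abs_of_nonneg (by push_cast; linarith)]
    push_cast
    linarith
  have t1 := dist_triangle (nbhdOccupancy G i fun j => x j t) (nbhdOccupancy G i fun j => y j t)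
    (ρ t)
  have t2 := dist_triangle (nbhdOccupancy G i fun j => y j t)
    (nbhdOccupancy G i fun j => y j (k * δ)) (ρ t)
  have t3 := dist_triangle (nbhdOccupancy G i fun j => y j (k * δ)) (ρ (k * δ)) (ρ t)
  rw [dist_comm (nbhdOccupancy G i fun j => y j (k * δ)) (ρ (k * δ))] at t3
  linarith

theorem tendsto_measureReal_Ici (ν : Measure ℕ) [IsFiniteMeasure ν] :
    Tendsto (fun J => ν.real (Ici J)) atTop (𝓝 0) := by
  have h := tendsto_measure_iInter_atTop (μ := ν) (s := fun J : ℕ => Ici J)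
    (fun J => measurableSet_Ici.nullMeasurableSet) (fun a b hab => Ici_subset_Ici.2 hab)
    ⟨0, measure_ne_top _ _⟩
  have h0 : ⋂ J : ℕ, Ici J = ∅ := eq_empty_of_forall_notMem fun x hx =>
    absurd (mem_iInter.1 hx (x + 1)) (by simp)
  rw [h0, measure_empty] at h
  exact (ENNReal.tendsto_toReal_zero_iff fun n => measure_ne_top _ _).2 h

theorem measurableSet_isQuiet (K a b : ℝ≥0) :
    MeasurableSet {n : Noise | IsQuiet n.1 n.2 K a b} :=
  ((((Measure.measurable_coe measurableSet_Ioc).comp measurable_fst) (measurableSet_singleton 0))).inter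
    (((Measure.measurable_coe (measurableSet_Ioc.prod measurableSet_Iic)).comp measurable_snd)
      (measurableSet_singleton 0))

section Occupancy
variable {Ω : Type*} [MeasurableSpace Ω] {P : Measure Ω} [IsProbabilityMeasure P] {lam : ℝ≥0}
  {d : ℕ} {hd : 2 ≤ d} {q : ℕ → ℝ} {Svc : ℕ → Ω → Measure ℝ≥0}
  {Arr : ℕ → Ω → Measure (ℝ≥0 × ℝ≥0)} {Φ : ℕ × Noise → CadlagPath ℕ}
  {G : ∀ N, SimpleGraph (Fin N)} {bself : ∀ N : ℕ, Fin N → (Fin N → ℕ) → ℝ}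
  {bnbr : ∀ N : ℕ, Fin N → Fin N → (Fin N → ℕ) → ℝ} {X : ∀ N : ℕ, Fin N → Ω → CadlagPath ℕ}

theorem IsFlow.dist_le {A : ℝ} {Z : Ω → ℝ≥0 → ℕ} (h : IsFlow P A Z) {ρ : ℝ≥0 → QueueLaws}
    (hρ : ∀ t, ((ρ t).toMeasure : Measure ℕ) = flow P Z t) (hA : 0 ≤ A) (s t : ℝ≥0) :
    dist (ρ s) (ρ t) ≤ A * dist s t := by
  refine QueueLaws.dist_le_of_real (by positivity) fun B => ?_
  rw [hρ, hρ, flow, flow, map_measureReal_apply (h.measurable _) .of_discrete,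
    map_measureReal_apply (h.measurable _) .of_discrete]
  refine le_trans ?_ (add_le_add_right (h.lipschitz s t) _)
  refine (measureReal_mono ?_).trans (measureReal_union_le _ _)
  intro ω (hω : Z ω s ∈ B)
  by_cases he : Z ω s = Z ω t
  · left; change Z ω t ∈ B; rwa [← he]
  · right; exact he

theorem DegreeRegular.tendsto_card_closedNbhd (hG : DegreeRegular G) {s : ℕ → ℕ}
    (hs : Tendsto s atTop atTop) (i : ∀ n, Fin (s n)) :
    Tendsto (fun n => ((closedNbhd (G (s n)) (i n)).card : ℝ)) atTop atTop := by
  refine tendsto_natCast_atTop_atTop.comp (tendsto_atTop_mono (fun n => ?_)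
    (hG.minDeg_tendsto.comp hs))
  rw [card_closedNbhd]
  exact (minDeg_le_deg _ _).trans (Nat.le_succ _)

/-- The law of large numbers in growing neighborhoods. -/
theorem DegreeRegular.tendsto_measure_abs_fraction_sub (hG : DegreeRegular G) {s : ℕ → ℕ}
    (hs : Tendsto s atTop atTop) (i : ∀ n, Fin (s n)) {E : Type*} [MeasurableSpace E]
    {Z : ∀ n, Fin (s n) → Ω → E} (hZ : ∀ n j, Measurable (Z n j))
    (hind : ∀ n, iIndepFun (Z n) P) {A : Set E} (hA : MeasurableSet A) {p ε : ℝ} (hε : 0 < ε)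
    (hp : ∀ n j, P.real {ω | Z n j ω ∈ A} = p) :
    Tendsto (fun n => P {ω | ε ≤
      |fraction (closedNbhd (G (s n)) (i n)) {j | Z n j ω ∈ A} - p|}) atTop (𝓝 0) := by
  have hlim : Tendsto (fun n => ENNReal.ofReal
      (1 / ((closedNbhd (G (s n)) (i n)).card * ε ^ 2))) atTop (𝓝 0) := by
    rw [← ENNReal.ofReal_zero]
    exact ENNReal.tendsto_ofReal (((hG.tendsto_card_closedNbhd hs i).atTop_mul_const
      (by positivity)).const_div_atTop 1)
  refine tendsto_of_tendsto_of_tendsto_of_le_of_le tendsto_const_nhds hlim (fun n => zero_le)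
    fun n => ?_
  have hne : (closedNbhd (G (s n)) (i n)).Nonempty := by
    rw [← Finset.card_pos, card_closedNbhd]; omega
  have h := measure_le_abs_fraction_sub_le (closedNbhd (G (s n)) (i n)) hne (hZ n) (hind n) hA hε
  simp only [hp, Finset.sum_const, nsmul_eq_mul] at h
  have hc : ((closedNbhd (G (s n)) (i n)).card : ℝ) ≠ 0 := by exact_mod_cast hne.card_pos.ne'
  rwa [mul_div_cancel_left₀ _ hc] at h

theorem DegreeRegular.tendsto_measure_le_fraction_decoupling (hG : DegreeRegular G)
    (hΦ : IsSolutionMap P lam d q Φ) (h : IsDrivingNoise P lam Svc Arr)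
    (hX : ∀ N, IsQueueSystem P d hd q Svc Arr (G N) (bself N) (bnbr N) (X N)) (T : ℝ≥0)
    {s : ℕ → ℕ} (hs : Tendsto s atTop atTop) (i : ∀ n, Fin (s n)) {r : ℝ} (hr : 0 < r) :
    Tendsto (fun n => P {ω | r ≤ fraction (closedNbhd (G (s n)) (i n))
      {j | ∃ t ≤ T, X (s n) j ω t ≠ coupledLimit Svc Arr Φ (X (s n)) j ω t}}) atTop (𝓝 0) := by
  rw [ENNReal.tendsto_nhds_zero]
  intro ε hε
  obtain ⟨c, hc, hcε⟩ := ENNReal.lt_iff_exists_nnreal_btwn.1 hε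
  have hc : 0 < (c : ℝ) := by exact_mod_cast hc
  filter_upwards [hs.eventually (hG.eventually_decoupling_le hΦ h hX T (mul_pos hc hr))] with n hn
  refine (measure_le_fraction_le (closedNbhd (G (s n)) (i n)) (by positivity) hr hn).trans ?_
  rw [mul_div_cancel_right₀ _ hr.ne', ENNReal.ofReal_coe_nnreal]
  exact hcε.le

omit [IsProbabilityMeasure P] in
theorem IsDrivingNoise.measureReal_serverNoise_eq [IsProbabilityMeasure P]
    (h : IsDrivingNoise P lam Svc Arr) (i j : ℕ) {A : Set Noise} (hA : MeasurableSet A) :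
    P.real {ω | serverNoise Svc Arr i ω ∈ A} = P.real {ω | serverNoise Svc Arr j ω ∈ A} := by
  have key : ∀ i, P.map (serverNoise Svc Arr i) = (P.map (Svc i)).prod (P.map (Arr i)) := fun i =>
    (indepFun_iff_map_prod_eq_prod_map_map (h.service i).measurable.aemeasurable
      (h.arrival i).measurable.aemeasurable).1 (h.indep_pair i)
  have h1 : P.map (serverNoise Svc Arr i) = P.map (serverNoise Svc Arr j) := by
    have : SigmaFinite (lam • lebesgue.prod lebesgue) :=
      inferInstanceAs (SigmaFinite (arrivalIntensity lam))
    rw [key, key, (h.service i).map_eq (h.service j), (h.arrival i).map_eq (h.arrival j)]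
  have h2 := map_measureReal_apply (μ := P) (h.measurable_serverNoise i) hA
  rw [h1, map_measureReal_apply (h.measurable_serverNoise j) hA] at h2
  exact h2.symm

/-- Finitely many grid times suffice, since `ρ` is Lipschitz and few servers move between grid
times. The bad events are a large decoupled fraction, too many servers with a noise point in a grid
cell, and a wrong empirical frequency of a state at a grid time; each has vanishing probability. -/
theorem DegreeRegular.tendsto_measure_le_dist_occupancy (hG : DegreeRegular G)
    (hΦ : IsSolutionMap P lam d q Φ) (h : IsDrivingNoise P lam Svc Arr)
    (hX : ∀ N, IsQueueSystem P d hd q Svc Arr (G N) (bself N) (bnbr N) (X N))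
    {N : ℕ} (j₀ : Fin N) {ρ : ℝ≥0 → QueueLaws}
    (hρ : ∀ t, ((ρ t).toMeasure : Measure ℕ) =
      flow P (fun ω => coupledLimit Svc Arr Φ (X N) j₀ ω) t) (T : ℝ≥0)
    {s : ℕ → ℕ} (hs : Tendsto s atTop atTop) (i : ∀ n, Fin (s n)) {ε : ℝ} (hε : 0 < ε) :
    Tendsto (fun n => P {ω | ∃ t ≤ T, ε ≤
      dist (nbhdOccupancy (G (s n)) (i n) fun j => X (s n) j ω t) (ρ t)}) atTop (𝓝 0) := by
  set A : ℝ := 1 + lam * d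
  have hA : 0 < A := by positivity
  have hLip := ((isMcKeanVlasov_coupledLimit hΦ h (hX N) j₀).1.isFlow (h.single j₀)).dist_le hρ
    hA.le
  -- The errors add up to at most `6 * r`: one `r` for decoupling, two for movement, two for the
  -- frequencies with the tail, and one for `ρ`.
  set r : ℝ := ε / 8
  have hr : 0 < r := by positivity
  set δ : ℝ≥0 := ⟨r / A, by positivity⟩
  have hδ : 0 < δ := show (0 : ℝ) < r / A by positivity
  have hAδ : A * δ = r := mul_div_cancel₀ _ hA.ne'
  set n₀ := ⌊T / δ⌋₊ + 1
  have hn₀ : T < n₀ * δ := by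
    rw [← div_lt_iff₀ hδ]
    exact_mod_cast Nat.lt_floor_add_one (T / δ)
  obtain ⟨J, hJ⟩ : ∃ J : ℕ, ∀ k ∈ Finset.range n₀,
      ((ρ (k * δ)).toMeasure : Measure ℕ).real (Ici J) ≤ r := by
    refine Eventually.exists (f := atTop) ((Finset.eventually_all _).2 fun k _ => ?_)
    filter_upwards [(tendsto_measureReal_Ici
      ((ρ (k * δ)).toMeasure : Measure ℕ)).eventually (gt_mem_nhds hr)] with J hJ using hJ.le
  set e : ℝ := r / (J + 1)
  have he : 0 < e := by positivity
  have hJe : J * e ≤ r := by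
    have : (J + 1 : ℝ) * e = r := by simp only [e]; field_simp
    linarith
  -- Movement in a grid cell is replaced by the presence of a noise point. This event is measurable,
  -- independent over the servers, and has probability at most `A * δ = r`.
  set W : ℕ → Set Noise := fun k => {m | ¬IsQuiet m.1 m.2 d (k * δ) ((k + 1) * δ)}
  have hW : ∀ k, MeasurableSet (W k) := fun k => (measurableSet_isQuiet _ _ _).compl
  have hWp : ∀ k, P.real {ω | serverNoise Svc Arr 0 ω ∈ W k} ≤ r := fun k => by
    refine ((h.single 0).measure_not_isQuiet_le () d (s := k * δ) (t := (k + 1) * δ)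
      (by gcongr; exact le_self_add)).trans_eq ?_
    rw [NNReal.dist_eq]
    push_cast
    rw [show (k : ℝ) * δ - (k + 1) * δ = -δ by ring, abs_neg, NNReal.abs_eq]
    exact hAδ
  set Z := fun n => coupledLimit Svc Arr Φ (X (s n))
  have hZm : ∀ n j t, Measurable fun ω => Z n j ω t := fun n j t =>
    (CadlagPath.measurable_eval CadlagPath.nat_eq_of_dist_lt_one t).comp
      (measurable_coupledLimit hΦ h (hX _) j)
  have hZp : ∀ n j t a, P.real {ω | Z n j ω t ∈ ({a} : Set ℕ)} =
      ((ρ t).toMeasure : Measure ℕ).real {a} := fun n j t a => by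
    have hev := CadlagPath.measurable_eval CadlagPath.nat_eq_of_dist_lt_one t
    have h1 := congrArg (fun m : Measure (CadlagPath ℕ) => m.map fun x => x t)
      (map_coupledLimit_eq hΦ h (hX (s n)) (hX N) j j₀)
    simp only [Measure.map_map hev (measurable_coupledLimit hΦ h (hX _) _)] at h1
    rw [hρ, flow]
    refine (map_measureReal_apply (hZm n j t) (measurableSet_singleton a)).symm.trans ?_
    exact congrArg (fun m : Measure ℕ => m.real {a}) h1
  set B₁ := fun n => {ω | r ≤ fraction (closedNbhd (G (s n)) (i n))
      {j | ∃ t ≤ T, X (s n) j ω t ≠ Z n j ω t}}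
  set B₂ := fun k n => {ω | r ≤ |fraction (closedNbhd (G (s n)) (i n))
      {j | serverNoise Svc Arr j ω ∈ W k} - P.real {ω | serverNoise Svc Arr 0 ω ∈ W k}|}
  set B₃ := fun k a n => {ω | e ≤ |fraction (closedNbhd (G (s n)) (i n))
      {j | Z n j ω (k * δ) ∈ ({a} : Set ℕ)} - ((ρ (k * δ)).toMeasure : Measure ℕ).real {a}|}
  have l₁ : Tendsto (fun n => P (B₁ n)) atTop (𝓝 0) :=
    hG.tendsto_measure_le_fraction_decoupling hΦ h hX T hs i hr
  have l₂ : ∀ k, Tendsto (fun n => P (B₂ k n)) atTop (𝓝 0) := fun k =>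
    hG.tendsto_measure_abs_fraction_sub hs i (Z := fun n j => serverNoise Svc Arr j)
      (fun n j => h.measurable_serverNoise j) (fun n => (h.family (s n)).indep) (hW k) hr
      fun n j => h.measureReal_serverNoise_eq j 0 (hW k)
  have l₃ : ∀ k a, Tendsto (fun n => P (B₃ k a n)) atTop (𝓝 0) := fun k a =>
    hG.tendsto_measure_abs_fraction_sub hs i (Z := fun n j ω => Z n j ω (k * δ))
      (fun n j => hZm n j _) (fun n => (iIndepFun_coupledLimit hΦ h (hX (s n))).comp
        (fun _ x => x (k * δ)) fun _ =>
        CadlagPath.measurable_eval CadlagPath.nat_eq_of_dist_lt_one _)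
      (measurableSet_singleton a) he fun n j => hZp n j _ a
  have hlim : Tendsto (fun n => P (B₁ n) + ∑ k ∈ Finset.range n₀, (P (B₂ k n) +
      ∑ a ∈ Finset.range J, P (B₃ k a n))) atTop (𝓝 0) := by
    have := l₁.add (tendsto_finsetSum (Finset.range n₀) fun k _ =>
      (l₂ k).add (tendsto_finsetSum (Finset.range J) fun a _ => l₃ k a))
    simpa only [Finset.sum_const_zero, add_zero] using this
  refine tendsto_of_tendsto_of_tendsto_of_le_of_le tendsto_const_nhds hlim (fun n => zero_le)
    fun n => ?_
  have hquiet : ∀ᵐ ω ∂P, ∀ j u v, u ≤ v → serverNoise Svc Arr (j : Fin (s n)) ω ∈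
      {m : Noise | IsQuiet m.1 m.2 d u v} → Z n j ω v = Z n j ω u := by
    rw [ae_all_iff]
    intro j
    have hmk := (isMcKeanVlasov_coupledLimit hΦ h (hX (s n)) j).1
    have hK : ∀ ω t, limitRate d (Z n j ω t) (P.map fun ω' => Z n j ω' t) ≤ (d : ℝ≥0) :=
      fun ω t => by
        have := Measure.isProbabilityMeasure_map (μ := P) (hZm n j t).aemeasurable
        rw [NNReal.coe_natCast]
        exact limitRate_le d
    refine (h.single j).ae_eq_of_isQuiet () (K := d) (x := fun ω => Z n j ω)
      (C := fun ω t => limitRate d (Z n j ω t) (P.map fun ω' => Z n j ω' t)) hK ?_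
    filter_upwards [hmk.evolution, (h.single j).ae_isRegularNoise d] with ω e1 e2
    exact (solvesQueueEquation_iff (hK ω) (e2 ()).toIsLocallyFiniteNoise).1 e1
  have hsub : ({ω | ∃ t ≤ T, ε ≤ dist (nbhdOccupancy (G (s n)) (i n) fun j => X (s n) j ω t)
      (ρ t)} : Set Ω) ≤ᵐ[P] (B₁ n ∪ ⋃ k ∈ Finset.range n₀, (B₂ k n ∪
        ⋃ a ∈ Finset.range J, B₃ k a n) : Set Ω) := by
    filter_upwards [hquiet] with ω hq
    rintro ⟨t, ht, hle⟩
    by_contra hcon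
    have hcon' : ω ∉ B₁ n ∪ ⋃ k ∈ Finset.range n₀, (B₂ k n ∪ ⋃ a ∈ Finset.range J, B₃ k a n) :=
      hcon
    simp only [mem_union, mem_iUnion, not_or, not_exists] at hcon'
    obtain ⟨c1, c2⟩ := hcon'
    have key := dist_nbhdOccupancy_le_of_grid (G (s n)) (i n) (x := fun j t => X (s n) j ω t)
      (y := fun j t => Z n j ω t) hA.le hLip hδ hn₀ (r' := r + r) hr.le he.le (not_le.1 c1).le
      (fun k hk => ?_) (fun k hk a ha => (not_le.1 ((c2 k (Finset.mem_range.2 hk)).2 a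
        (Finset.mem_range.2 ha))).le) (fun k hk => hJ k (Finset.mem_range.2 hk)) ht
    · rw [hAδ] at key
      have : ε = 8 * r := by simp only [r]; ring
      linarith
    · have h1 : |_ - _| < r := not_le.1 (c2 k (Finset.mem_range.2 hk)).1
      have h2 := hWp k
      have h3 := (abs_lt.1 h1).2
      refine (fraction_mono _ ?_).trans (by linarith :
        fraction (closedNbhd (G (s n)) (i n)) {j | serverNoise Svc Arr j ω ∈ W k} ≤ r + r)
      rintro j ⟨v, hv, hne⟩
      exact fun hquiet => hne (hq j _ v hv.1 (hquiet.mono hv.2))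
  refine (measure_mono_ae hsub).trans ((measure_union_le _ _).trans ?_)
  gcongr
  refine (measure_biUnion_finset_le _ _).trans (Finset.sum_le_sum fun k _ => ?_)
  refine (measure_union_le _ _).trans ?_
  gcongr
  exact measure_biUnion_finset_le _ _

/-- The occupancy processes converge to a deterministic path. -/
theorem DegreeRegular.tendsto_occupancy (hG : DegreeRegular G)
    (hΦ : IsSolutionMap P lam d q Φ) (h : IsDrivingNoise P lam Svc Arr)
    (hX : ∀ N, IsQueueSystem P d hd q Svc Arr (G N) (bself N) (bnbr N) (X N))
    {N : ℕ} (j₀ : Fin N) {ρ : CadlagPath QueueLaws}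
    (hρ : ∀ t, ((ρ t).toMeasure : Measure ℕ) =
      flow P (fun ω => coupledLimit Svc Arr Φ (X N) j₀ ω) t)
    {s : ℕ → ℕ} (hs : Tendsto s atTop atTop) (i : ∀ n, Fin (s n)) :
    TendstoInDistribution (fun n ω => nbhdOccupancyPath (G (s n)) (i n) fun j => X (s n) j ω) atTop
      (fun _ : Ω => ρ) (fun _ => P) P := by
  refine tendsto_map_of_uniformity P _ (fun _ _ => ρ)
    (fun n => ((measurable_nbhdOccupancyPath _ _).comp (measurable_pi_lambda _ fun j =>
      (hX _).measurable_path j)).aemeasurable) aemeasurable_const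
    (.of_forall fun n => ⟨aemeasurable_const, rfl⟩) fun V hV => ?_
  obtain ⟨⟨T, ε⟩, hε, hsub⟩ := CadlagPath.hasBasis_uniformity.mem_iff.1 hV
  refine tendsto_of_tendsto_of_tendsto_of_le_of_le tendsto_const_nhds
    (hG.tendsto_measure_le_dist_occupancy hΦ h hX j₀ hρ T hs i (ε := ε) (NNReal.coe_pos.2 hε))
    (fun n => zero_le) fun n => measure_mono fun ω hω => ?_
  by_contra hc
  refine hω (hsub (CadlagPath.mem_close_of_dist_lt hε fun t ht => ?_))
  by_contra hlt
  exact hc ⟨t, ht, not_lt.1 hlt⟩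

/-- The flow of laws is Lipschitz in the Lévy–Prokhorov distance, so it is a continuous path. -/
theorem exists_occupancy_limit (hΦ : IsSolutionMap P lam d q Φ) (h : IsDrivingNoise P lam Svc Arr)
    {N : ℕ} (hX : IsQueueSystem P d hd q Svc Arr (G N) (bself N) (bnbr N) (X N)) (j₀ : Fin N) :
    ∃ ρ : CadlagPath QueueLaws, ∀ t, ((ρ t).toMeasure : Measure ℕ) =
      flow P (fun ω => coupledLimit Svc Arr Φ (X N) j₀ ω) t := by
  have hflow := (isMcKeanVlasov_coupledLimit hΦ h hX j₀).1.isFlow (h.single j₀)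
  set ρ : ℝ≥0 → QueueLaws := fun t =>
    .ofMeasure ⟨flow P (fun ω => coupledLimit Svc Arr Φ (X N) j₀ ω) t,
      Measure.isProbabilityMeasure_map (hflow.measurable t).aemeasurable⟩
  have hlip : LipschitzWith (1 + lam * d) ρ := LipschitzWith.of_dist_le_mul fun s t => by
    have := hflow.dist_le (ρ := ρ) (fun _ => rfl) (by positivity) s t
    simpa using this
  exact ⟨⟨ρ, fun t => hlip.continuous.continuousWithinAt,
    fun t => ⟨ρ t, hlip.continuous.continuousAt.mono_left nhdsWithin_le_nhds⟩⟩, fun t => rfl⟩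

end Occupancy

end JSQ

end

/-! ### Assembly of the theorem -/

open JSQ
theorem theorem2
    {Ω : Type*} [MeasurableSpace Ω] (P : Measure Ω) [IsProbabilityMeasure P]
    (d : ℕ) (hd : 2 ≤ d) (lam : ℝ≥0) (hlam : 0 < lam)
    (q : ℕ → ℝ) (hq : IsTailSequence q)
    -- the graphs, and the assignment rules at servers with less than `d - 1` neighbors
    (G : ∀ N : ℕ, SimpleGraph (Fin N)) (hG : DegreeRegular G)
    (bself : ∀ N : ℕ, Fin N → (Fin N → ℕ) → ℝ)
    (bnbr : ∀ N : ℕ, Fin N → Fin N → (Fin N → ℕ) → ℝ)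
    (hbself : ∀ N i x, bself N i x ∈ Icc (0 : ℝ) (deg (G N) i + 1))
    (hbnbr : ∀ N i j x, bnbr N i j x ∈ Icc (0 : ℝ) (deg (G N) i + 1))
    -- the driving noises and the queue length processes
    (Svc : ℕ → Ω → Measure ℝ≥0) (Arr : ℕ → Ω → Measure (ℝ≥0 × ℝ≥0))
    (hnoise : IsDrivingNoise P lam Svc Arr)
    (X : ∀ N : ℕ, Fin N → Ω → CadlagPath ℕ)
    (hX : ∀ N, IsQueueSystem P d hd q Svc Arr (G N) (bself N) (bnbr N) (X N)) :
    ∃ μ : ProbabilityMeasure (CadlagPath ℕ),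
      -- the McKean–Vlasov equation has a solution for every admissible initial value,
      (∀ (i : ℕ) (ξ : Ω → ℕ), Measurable ξ → HasTail P q ξ →
        IndepFun ξ (fun ω => (Svc i ω, Arr i ω)) P →
        ∃ Y : Ω → CadlagPath ℕ,
          IsMcKeanVlasov P d q (Svc i) (Arr i) Y ∧ ∀ᵐ ω ∂P, Y ω 0 = ξ ω) ∧
      -- and `μ` is the law of every solution
      (∀ (i : ℕ) (Y : Ω → CadlagPath ℕ), IsMcKeanVlasov P d q (Svc i) (Arr i) Y →
        HasLaw Y (μ : Measure (CadlagPath ℕ)) P) ∧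
      -- (i) convergence in distribution of every tagged queue
      (∀ i : ℕ, TendstoInDistribution
        (fun (n : ℕ) ω => X (i + 1 + n) ⟨i, by omega⟩ ω) atTop
        (fun x : CadlagPath ℕ => x) (fun _ => P) (μ : Measure (CadlagPath ℕ))) ∧
      -- and mean square convergence, uniformly over the servers, for coupled initial values
      (∀ Y : ℕ → Ω → CadlagPath ℕ,
        (∀ i, IsMcKeanVlasov P d q (Svc i) (Arr i) (Y i)) →
        (∀ (N : ℕ) (i : Fin N), ∀ᵐ ω ∂P, X N i ω 0 = Y i ω 0) →
        ∀ T : ℝ≥0, Tendsto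
          (fun N => ⨆ i : Fin N, ∫⁻ ω,
            (⨆ s ∈ Iic T, ENNReal.ofReal |(X N i ω s : ℝ) - (Y i ω s : ℝ)|) ^ 2 ∂P)
          atTop (𝓝 0)) ∧
      -- (ii) propagation of chaos
      (∀ (m M : ℕ) (i : Fin m → ℕ), Function.Injective i → ∀ hM : ∀ k, i k < M,
        TendstoInDistribution
          (fun (n : ℕ) ω => CadlagPath.tuple fun k : Fin m =>
            X (M + n) ⟨i k, Nat.lt_add_right n (hM k)⟩ ω) atTop
          (fun x : Fin m → CadlagPath ℕ => CadlagPath.tuple x) (fun _ => P)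
          (Measure.pi fun _ : Fin m => (μ : Measure (CadlagPath ℕ)))) ∧
      -- (iii) convergence of the neighborhood occupancy measure processes
      (∃ ρ : CadlagPath QueueLaws,
        (∀ t, ((ρ t).toMeasure : Measure ℕ) =
          (μ : Measure (CadlagPath ℕ)).map fun x => x t) ∧
        ∀ i : ℕ, TendstoInDistribution
          (fun (n : ℕ) ω => nbhdOccupancyPath (G (i + 1 + n)) ⟨i, by omega⟩
            fun j => X (i + 1 + n) j ω) atTop
          (fun _ : Ω => ρ) (fun _ => P) P) := by
  -- The only server of the system with `N = 1` provides an initial value with tail `q` that is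
  -- independent of the noise; the law of its coupled limit serves as `μ`.
  obtain ⟨Φ, hΦ⟩ := exists_isSolutionMap hnoise (hX 1) 0
  have hs : ∀ M : ℕ, Tendsto (fun n => M + n) atTop atTop := fun M =>
    tendsto_atTop_mono (fun n => Nat.le_add_left n M) tendsto_id
  have hm := measurable_coupledLimit hΦ hnoise (hX 1) 0
  obtain ⟨ρ, hρ⟩ := exists_occupancy_limit hΦ hnoise (hX 1) 0
  have hprob : IsProbabilityMeasure (P.map (coupledLimit Svc Arr Φ (X 1) 0)) :=
    Measure.isProbabilityMeasure_map hm.aemeasurable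
  refine ⟨⟨P.map (coupledLimit Svc Arr Φ (X 1) 0), hprob⟩,
    fun i ξ => hΦ.exists_isMcKeanVlasov hnoise i, fun i Y => hΦ.hasLaw hnoise (hX 1) 0 i,
    fun i => hG.tendsto_tagged hΦ hnoise hX 0 rfl (hs _) _,
    fun Y hY h0 T => hG.tendsto_iSup_lintegral_sq hΦ hnoise hX hY h0 T,
    fun m M i hi hM => hG.tendsto_tuple hΦ hnoise hX 0 rfl (hs _) _
      fun n k l hkl => hi (Fin.mk.inj hkl),
    ρ, fun t => ?_, fun i => hG.tendsto_occupancy hΦ hnoise hX 0 hρ (hs _) _⟩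
  rw [hρ]
  exact (Measure.map_map
    (CadlagPath.measurable_eval CadlagPath.nat_eq_of_dist_lt_one t) hm).symm
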